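/- **Input.** Let $\Gamma$ be a finite abelian group and $Q\colon\Gamma\to\mathbb{C}^\times$ a nondegenerate quadratic form, i.e. $Q(na)=Q(a)^{n^2}$ and $B_Q(a,b)=Q(a+b)Q(a)^{-1}Q(b)^{-1}$ is bimultiplicative and nondegenerate. Let $(\sigma,\omega)$ be an abelian $3$-cocycle on $\Gamma$ with values in $\mathbb{C}^\times$ representing $Q$, i.e. $\sigma(a,a)=Q(a)$, such that $\sigma$ is normalised ($\sigma(a,0)=\sigma(0,a)=1$) and symmetric, $\omega(\cdot,b,c)$ is a homomorphism for all $b,c$, and $\sigma(a,b+c)\sigma(a,b)^{-1}\sigma(a,c)^{-1}=\omega(a,b,c)$. (Then $\omega$ takes values in $\{\pm1\}$, and $\omega(\bar x,b,c)$ is defined for $\bar x\in\Gamma/2\Gamma$.) Let $\delta\in\Gamma$ with $2\delta=0$ and $q\colon\Gamma\to\mathbb{C}^\times$ satisfy $$q(a)^2=Q(a),\qquad q(a+b)q(a)^{-1}q(b)^{-1}=\sigma(a,b)\,\omega(a+b,a,b)\,\omega(\delta,a,b)\qquad(a,b\in\Gamma).$$ Let $\varepsilon\in\{\pm1\}$,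 let $\alpha\in\mathbb{C}$ satisfy $\alpha^2=\varepsilon\,|2\Gamma|^{-1/2}\sum_{a\in\delta+2\Gamma}q(a)^{-1}$, and let $\beta=\alpha^{-1}$ or $\beta=-\alpha^{-1}$. **Structure maps.** Consider the category $\mathcal{C}=\mathrm{Vect}_\Gamma\oplus\mathrm{Vect}_{\Gamma/2\Gamma}$ of finite-dimensional complex vector spaces graded by $\Gamma\sqcup\Gamma/2\Gamma$, with simple objects $\mathbb{C}_a$ ($a\in\Gamma$) and $\mathsf{X}^{\bar x}$ ($\bar x\in\Gamma/2\Gamma$), with unit $\mathbb{C}_0$ (trivial unit isomorphisms) and tensor product $$\mathbb{C}_a\otimes\mathbb{C}_b=\mathbb{C}_{a+b},\quad \mathbb{C}_a\otimes\mathsf{X}^{\bar x}=\mathsf{X}^{\bar a+\bar x}=\mathsf{X}^{\bar x}\otimes\mathbb{C}_a,\quad \mathsf{X}^{\bar x}\otimes\mathsf{X}^{\bar y}=\bigoplus_{t\in\delta+\bar x+\bar y}\mathbb{C}_t .$$ Below, $t$ (in $(\mathsf{X}\otimes\mathsf{X})\otimes\mathsf{X}$ and $\mathsf X\otimes\mathsf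 X$) and $r$ (in $\mathsf{X}\otimes(\mathsf{X}\otimes\mathsf{X})$) label the summands of the inner or only product $\mathsf X\otimes\mathsf X$, respectively, and the scalars act on the corresponding summands; in $(\mathsf X\otimes \mathbb{C}_a)\otimes \mathsf X$, $t$ labels the summands of the total product. The associators are $$\begin{aligned} (\mathbb{C}_a\otimes\mathbb{C}_b)\otimes\mathbb{C}_c&:\ \omega(a,b,c), & (\mathsf{X}^{\bar x}\otimes\mathbb{C}_a)\otimes\mathbb{C}_b&:\ \omega(\bar x+\delta,a,b),\\ (\mathbb{C}_a\otimes\mathsf{X}^{\bar x})\otimes\mathbb{C}_b&:\ \sigma(a,b), & (\mathbb{C}_a\otimes\mathbb{C}_b)\otimes\mathsf{X}^{\bar x}&:\ \omega(a+b+\bar x,a,b),\\ (\mathbb{C}_a\otimes\mathsf{X}^{\bar x})\otimes\mathsf{X}^{\bar y}&:\ \omega(a+\bar x,a,t)\ \ (\mathbb{C}_{a+t}\to\mathbb{C}_a\otimes\mathbb{C}_t), & (\mathsf{X}^{\bar x}\otimes\mathsf{X}^{\bar y})\otimes\mathbb{C}_a&:\ \omega(\bar x,t,a)\ \ (\mathbb{C}_t\otimes\mathbb{C}_a\to\mathbb{C}_{t+a}),\\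 (\mathsf{X}^{\bar x}\otimes\mathbb{C}_a)\otimes\mathsf{X}^{\bar y}&:\ \sigma(a,t), & (\mathsf{X}^{\bar x}\otimes\mathsf{X}^{\bar y})\otimes\mathsf{X}^{\bar z}&:\ \varepsilon|2\Gamma|^{-1/2}\sigma(t,r)^{-1}. \end{aligned}$$ The group $\mathbb{Z}_2=\langle g\rangle$ acts by $g_*\mathbb{C}_a=\mathbb{C}_{-a}$, $g_*\mathsf{X}^{\bar x}=\mathsf{X}^{\bar x}$, with strict composition and tensor structure $g_*(Y\otimes Z)\to g_*Y\otimes g_*Z$ given, for $Y\otimes Z$ equal to $\mathbb{C}_a\otimes\mathbb{C}_b$, $\mathbb{C}_a\otimes\mathsf{X}^{\bar x}$, $\mathsf{X}^{\bar x}\otimes\mathbb{C}_a$, $\mathsf{X}^{\bar x}\otimes\mathsf{X}^{\bar y}$, by $$\omega(a,b,-b),\quad \omega(a+\bar x,a,-a),\quad \omega(\bar x+\delta,a,-a),\quad \omega(\bar x,t,-t).$$ The grading puts $\mathbb{C}_a$ in degree $1$ and $\mathsf{X}^{\bar x}$ in degree $g$. The $\mathbb{Z}_2$-braiding is $$\mathbb{C}_a\otimes\mathbb{C}_b\xrightarrow{\sigma(a,b)}\mathbb{C}_b\otimes\mathbb{C}_a,\quad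 \mathbb{C}_a\otimes\mathsf{X}^{\bar x}\xrightarrow{q(a)^{-1}}\mathsf{X}^{\bar x}\otimes\mathbb{C}_a,\quad \mathsf{X}^{\bar x}\otimes\mathbb{C}_a\xrightarrow{q(a)^{-1}\omega(\bar x+a,a,-a)}\mathbb{C}_{-a}\otimes\mathsf{X}^{\bar x},\quad \mathsf{X}^{\bar x}\otimes\mathsf{X}^{\bar y}\xrightarrow{\alpha q(t)}\mathsf{X}^{\bar y}\otimes\mathsf{X}^{\bar x},$$ and the twist is $\sigma(a,a)$ on $\mathbb{C}_a$ and $\beta\colon\mathsf{X}^{\bar x}\to g_*\mathsf{X}^{\bar x}$ on $\mathsf{X}^{\bar x}$. **Theorem.** 1. These data make $\mathcal{C}$ a braided $\mathbb{Z}_2$-crossed ribbon fusion category $\mathcal{GLM}(\Gamma,\sigma,\omega,\delta,\varepsilon\,|\,q,\alpha,\beta)$: a fusion category over $\mathbb{C}$ with an action of $\mathbb{Z}_2$, a faithful $\mathbb{Z}_2$-grading, a $\mathbb{Z}_2$-braiding $Y\otimes Z\to h_*Z\otimes Y$ ($Y\in\mathcal{C}_h$) that is natural, invertible, compatible with the action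 and satisfies both crossed hexagon identities, and a $\mathbb{Z}_2$-ribbon twist. Duals are $\mathbb{C}_a^*=\mathbb{C}_{-a}$, and $(\mathsf{X}^{\bar x})^*=\mathsf{X}^{-\bar x-\delta}$; in both cases the coevaluation $\mathbf 1\to Y\otimes Y^*$ may be taken to be the inclusion of $\mathbb{C}_0$, and for $\mathsf X^{\bar x}$ the evaluation is then $\varepsilon|2\Gamma|^{1/2}$ times the projection to $\mathbb{C}_0$. 2. $\mathcal{C}$ is a braided $\mathbb{Z}_2$-crossed extension of $\mathrm{Vect}_\Gamma^Q$, represented by the braided monoidal category $\mathrm{Vect}_\Gamma^{\sigma,\omega}$ (associator $\omega$, braiding $\sigma$) with the action of $\mathbb{Z}_2$ by braided autoequivalences $g_*\mathbb{C}_a=\mathbb{C}_{-a}$ with strict composition and tensor structure $\omega(a,b,-b)$: the embedding of $\mathrm{Vect}_\Gamma$ identifies it, with its braiding and action, with the neutral component $\mathcal{C}_1$. 3. All simple objects of $\mathcal{C}$ have positive quantum dimension with respect to this twist if and only if $\alpha\beta=\varepsilon$. -/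

import Mathlib

open CategoryTheory MonoidalCategory

universe u v

/-! ## Monoidal categories from explicit structure maps -/

/-- The axioms of a monoidal category, for given structure maps. -/
structure IsMonoidal (C : Type u) [Category.{v} C] [MonoidalCategoryStruct C] : Prop where
  tensorHom_def : ∀ {X₁ Y₁ X₂ Y₂ : C} (f : X₁ ⟶ Y₁) (g : X₂ ⟶ Y₂),
    f ⊗ₘ g = (f ▷ X₂) ≫ (Y₁ ◁ g)
  id_tensorHom_id : ∀ X₁ X₂ : C, 𝟙 X₁ ⊗ₘ 𝟙 X₂ = 𝟙 (X₁ ⊗ X₂)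
  tensorHom_comp_tensorHom : ∀ {X₁ Y₁ Z₁ X₂ Y₂ Z₂ : C} (f₁ : X₁ ⟶ Y₁) (f₂ : X₂ ⟶ Y₂)
    (g₁ : Y₁ ⟶ Z₁) (g₂ : Y₂ ⟶ Z₂), (f₁ ⊗ₘ f₂) ≫ (g₁ ⊗ₘ g₂) = (f₁ ≫ g₁) ⊗ₘ (f₂ ≫ g₂)
  whiskerLeft_id : ∀ X Y : C, X ◁ 𝟙 Y = 𝟙 (X ⊗ Y)
  id_whiskerRight : ∀ X Y : C, 𝟙 X ▷ Y = 𝟙 (X ⊗ Y)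
  associator_naturality : ∀ {X₁ X₂ X₃ Y₁ Y₂ Y₃ : C} (f₁ : X₁ ⟶ Y₁) (f₂ : X₂ ⟶ Y₂) (f₃ : X₃ ⟶ Y₃),
    ((f₁ ⊗ₘ f₂) ⊗ₘ f₃) ≫ (α_ Y₁ Y₂ Y₃).hom = (α_ X₁ X₂ X₃).hom ≫ (f₁ ⊗ₘ (f₂ ⊗ₘ f₃))
  leftUnitor_naturality : ∀ {X Y : C} (f : X ⟶ Y), 𝟙_ C ◁ f ≫ (λ_ Y).hom = (λ_ X).hom ≫ f
  rightUnitor_naturality : ∀ {X Y : C} (f : X ⟶ Y), f ▷ 𝟙_ C ≫ (ρ_ Y).hom = (ρ_ X).hom ≫ f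
  pentagon : ∀ W X Y Z : C, (α_ W X Y).hom ▷ Z ≫ (α_ W (X ⊗ Y) Z).hom ≫ W ◁ (α_ X Y Z).hom =
    (α_ (W ⊗ X) Y Z).hom ≫ (α_ W X (Y ⊗ Z)).hom
  triangle : ∀ X Y : C, (α_ X (𝟙_ C) Y).hom ≫ X ◁ (λ_ Y).hom = (ρ_ X).hom ▷ Y

/-- Structure maps that satisfy the axioms make up a monoidal category. -/
abbrev IsMonoidal.toMonoidalCategory {C : Type u} [Category.{v} C] [S : MonoidalCategoryStruct C]
    (h : IsMonoidal C) : MonoidalCategory C :=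
  { S with
    tensorHom_def := h.tensorHom_def
    id_tensorHom_id := h.id_tensorHom_id
    tensorHom_comp_tensorHom := h.tensorHom_comp_tensorHom
    whiskerLeft_id := h.whiskerLeft_id
    id_whiskerRight := h.id_whiskerRight
    associator_naturality := h.associator_naturality
    leftUnitor_naturality := h.leftUnitor_naturality
    rightUnitor_naturality := h.rightUnitor_naturality
    pentagon := h.pentagon
    triangle := h.triangle }

/-! ## Fusion categories, group actions, crossed braidings, twists -/

section General

/-- A fusion category over `ℂ`: a `ℂ`-linear abelian monoidal category with bilinear tensor
product, finite-dimensional morphism spaces, finitely many simple objects up to isomorphism, all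
objects being finite direct sums of simple ones, with duals and simple tensor unit. -/
structure IsFusion (C : Type u) [Category.{v} C] [Preadditive C] [Linear ℂ C]
    [MonoidalCategory C] : Prop where
  abelian : ∃ A : Abelian C, A.toPreadditive = ‹Preadditive C›
  bilinear : ∃ _ : MonoidalPreadditive C, MonoidalLinear ℂ C
  finite_hom : ∀ X Y : C, Module.Finite ℂ (X ⟶ Y)
  finite_simple : ∃ (n : ℕ) (S : Fin n → C), ∀ X : C, Simple X → ∃ i, Nonempty (X ≅ S i)
  semisimple : ∀ X : C, ∃ (n : ℕ) (S : Fin n → C) (b : Limits.Bicone S),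
    (∀ i, Simple (S i)) ∧ Nonempty b.IsBilimit ∧ Nonempty (b.pt ≅ X)
  rigid : Nonempty (RigidCategory C)
  unit_simple : Simple (𝟙_ C)

variable (G : Type) [Group G]

/-- The data of an action of `G` on a monoidal category: functors `g_*`, composition isomorphisms
`(gh)_* ≅ g_* h_*` and `1_* ≅ id`, and tensor structures `g_*(X ⊗ Y) ⟶ g_* X ⊗ g_* Y`,
`g_* 𝟙 ⟶ 𝟙`. -/
structure ActionData (C : Type u) [Category.{v} C] [MonoidalCategory C] where
  act : G → C ⥤ C
  T₂ : ∀ (g h : G) (X : C), (act (g * h)).obj X ≅ (act g).obj ((act h).obj X)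
  T₀ : ∀ X : C, (act 1).obj X ≅ X
  τ : ∀ (g : G) (X Y : C), (act g).obj (X ⊗ Y) ⟶ (act g).obj X ⊗ (act g).obj Y
  τ₀ : ∀ g : G, (act g).obj (𝟙_ C) ⟶ 𝟙_ C

variable {G} {C : Type u} [Category.{v} C] [MonoidalCategory C]

/-- The composition isomorphism `k_* ≅ g_* h_*` where `k` equals `gh`. -/
def ActionData.T₂Of (A : ActionData G C) {k g h : G} (e : k = g * h) (X : C) :
    (A.act k).obj X ≅ (A.act g).obj ((A.act h).obj X) :=
  eqToIso (congrArg (fun l => (A.act l).obj X) e) ≪≫ A.T₂ g h X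

/-- The data form an action of `G` by `ℂ`-linear monoidal functors. -/
structure ActionData.IsAction [Preadditive C] [Linear ℂ C] (A : ActionData G C) : Prop where
  additive : ∀ g, (A.act g).Additive
  linear : ∀ g, (A.act g).Linear ℂ
  T₂_natural : ∀ (g h : G) {X Y : C} (f : X ⟶ Y),
    (A.act (g * h)).map f ≫ (A.T₂ g h Y).hom = (A.T₂ g h X).hom ≫ (A.act g).map ((A.act h).map f)
  T₀_natural : ∀ {X Y : C} (f : X ⟶ Y), (A.act 1).map f ≫ (A.T₀ Y).hom = (A.T₀ X).hom ≫ f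
  T₂_assoc : ∀ (g h l : G) (X : C),
    (A.T₂ (g * h) l X).hom ≫ (A.T₂ g h ((A.act l).obj X)).hom =
      (A.T₂Of (mul_assoc g h l) X).hom ≫ (A.act g).map (A.T₂ h l X).hom
  T₂_one_left : ∀ (g : G) (X : C),
    (A.T₂Of (one_mul g).symm X).hom ≫ (A.T₀ ((A.act g).obj X)).hom = 𝟙 _
  T₂_one_right : ∀ (g : G) (X : C),
    (A.T₂Of (mul_one g).symm X).hom ≫ (A.act g).map (A.T₀ X).hom = 𝟙 _
  τ_iso : ∀ (g : G) (X Y : C), IsIso (A.τ g X Y)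
  τ₀_iso : ∀ g : G, IsIso (A.τ₀ g)
  τ_natural : ∀ (g : G) {X X₁ Y Y₁ : C} (f : X ⟶ X₁) (k : Y ⟶ Y₁),
    (A.act g).map (f ⊗ₘ k) ≫ A.τ g X₁ Y₁ = A.τ g X Y ≫ ((A.act g).map f ⊗ₘ (A.act g).map k)
  τ_assoc : ∀ (g : G) (X Y Z : C),
    A.τ g (X ⊗ Y) Z ≫ (A.τ g X Y ▷ (A.act g).obj Z) ≫ (α_ _ _ _).hom =
      (A.act g).map (α_ X Y Z).hom ≫ A.τ g X (Y ⊗ Z) ≫ ((A.act g).obj X ◁ A.τ g Y Z)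
  τ_left_unit : ∀ (g : G) (X : C),
    (A.act g).map (λ_ X).hom = A.τ g (𝟙_ C) X ≫ (A.τ₀ g ▷ (A.act g).obj X) ≫ (λ_ _).hom
  τ_right_unit : ∀ (g : G) (X : C),
    (A.act g).map (ρ_ X).hom = A.τ g X (𝟙_ C) ≫ ((A.act g).obj X ◁ A.τ₀ g) ≫ (ρ_ _).hom
  τ_T₂ : ∀ (g h : G) (X Y : C),
    A.τ (g * h) X Y ≫ ((A.T₂ g h X).hom ⊗ₘ (A.T₂ g h Y).hom) =
      (A.T₂ g h (X ⊗ Y)).hom ≫ (A.act g).map (A.τ h X Y) ≫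
        A.τ g ((A.act h).obj X) ((A.act h).obj Y)
  τ₀_T₂ : ∀ g h : G,
    A.τ₀ (g * h) = (A.T₂ g h (𝟙_ C)).hom ≫ (A.act g).map (A.τ₀ h) ≫ A.τ₀ g
  τ_T₀ : ∀ X Y : C, A.τ 1 X Y ≫ ((A.T₀ X).hom ⊗ₘ (A.T₀ Y).hom) = (A.T₀ (X ⊗ Y)).hom
  τ₀_T₀ : A.τ₀ 1 = (A.T₀ (𝟙_ C)).hom

/-- The action on a braided monoidal category is by braided functors. -/
def ActionData.IsBraidedAction [BraidedCategory C] (A : ActionData G C) : Prop :=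
  ∀ (g : G) (X Y : C), (A.act g).map (β_ X Y).hom ≫ A.τ g Y X =
    A.τ g X Y ≫ (β_ ((A.act g).obj X) ((A.act g).obj Y)).hom

variable (G C) in
/-- The data of a braided `G`-crossed category: an action, the homogeneous components
`C_g` (`comp g X` says that `X` lies in `C_g`) and the `G`-braiding
`X ⊗ Y ⟶ g_* Y ⊗ X` for `X` in `C_g`. -/
structure CrossedData extends ActionData G C where
  comp : G → ObjectProperty C
  braid : ∀ {g : G} {X : C}, comp g X → ∀ Y : C, X ⊗ Y ⟶ (act g).obj Y ⊗ X

/-- The components form a faithful grading `C = ⨁ C_g` of the monoidal category. -/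
structure CrossedData.IsGrading [Preadditive C] (D : CrossedData G C) : Prop where
  closed_iso : ∀ (g : G) {X Y : C}, (X ≅ Y) → D.comp g X → D.comp g Y
  hom_zero : ∀ {g h : G} {X Y : C}, D.comp g X → D.comp h Y → g ≠ h → ∀ f : X ⟶ Y, f = 0
  decomposition : ∀ X : C, ∃ (Y : G → C) (b : Limits.Bicone Y),
    (∀ g, D.comp g (Y g)) ∧ Nonempty b.IsBilimit ∧ Nonempty (b.pt ≅ X)
  tensor : ∀ {g h : G} {X Y : C}, D.comp g X → D.comp h Y → D.comp (g * h) (X ⊗ Y)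
  unit : D.comp 1 (𝟙_ C)
  faithful : ∀ g : G, ∃ X : C, D.comp g X ∧ ¬ Limits.IsZero X

/-- The axioms of a braided `G`-crossed tensor category. -/
structure CrossedData.IsBraidedCrossed [Preadditive C] [Linear ℂ C] (D : CrossedData G C) :
    Prop where
  isAction : D.IsAction
  isGrading : D.IsGrading
  conj : ∀ (g h : G) {X : C}, D.comp h X → D.comp (g * h * g⁻¹) ((D.act g).obj X)
  braid_iso : ∀ {g : G} {X : C} (hX : D.comp g X) (Y : C), IsIso (D.braid hX Y)
  braid_natural : ∀ {g : G} {X X₁ Y Y₁ : C} (hX : D.comp g X) (hX₁ : D.comp g X₁)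
    (f : X ⟶ X₁) (k : Y ⟶ Y₁),
    (f ⊗ₘ k) ≫ D.braid hX₁ Y₁ = D.braid hX Y ≫ ((D.act g).map k ⊗ₘ f)
  /-- The braiding is equivariant under the action. -/
  braid_act : ∀ (g h : G) {X : C} (hX : D.comp h X) (Y : C),
    (D.act g).map (D.braid hX Y) ≫ D.τ g ((D.act h).obj Y) X ≫
        (((D.T₂ g h Y).inv ≫
          (D.T₂Of (show g * h = g * h * g⁻¹ * g by group) Y).hom) ▷ (D.act g).obj X) =
      D.τ g X Y ≫ D.braid (conj g h hX) ((D.act g).obj Y)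
  /-- First hexagon. -/
  hexagon : ∀ {g : G} {X : C} (hX : D.comp g X) (Y Z : C),
    (α_ X Y Z).hom ≫ D.braid hX (Y ⊗ Z) ≫ (D.τ g Y Z ▷ X) ≫ (α_ _ _ _).hom =
      (D.braid hX Y ▷ Z) ≫ (α_ _ _ _).hom ≫ ((D.act g).obj Y ◁ D.braid hX Z)
  /-- Second hexagon. -/
  hexagon_inv : ∀ {g h : G} {X Y : C} (hX : D.comp g X) (hY : D.comp h Y) (Z : C),
    D.braid (isGrading.tensor hX hY) Z ≫ ((D.T₂ g h Z).hom ▷ (X ⊗ Y)) ≫ (α_ _ _ _).inv =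
      (α_ X Y Z).hom ≫ (X ◁ D.braid hY Z) ≫ (α_ _ _ _).inv ≫
        (D.braid hX ((D.act h).obj Z) ▷ Y)

/-- Data of a `G`-twist: morphisms `X ⟶ g_* X` for `X` in `C_g`. -/
abbrev CrossedData.TwistData (D : CrossedData G C) : Type _ :=
  ∀ {g : G} {X : C}, D.comp g X → (X ⟶ (D.act g).obj X)

/-- The axioms of a `G`-twist on a braided `G`-crossed tensor category. -/
structure CrossedData.IsTwist [Preadditive C] [Linear ℂ C] (D : CrossedData G C)
    (hD : D.IsBraidedCrossed) (θ : D.TwistData) : Prop where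
  iso : ∀ {g : G} {X : C} (hX : D.comp g X), IsIso (θ hX)
  natural : ∀ {g : G} {X Y : C} (hX : D.comp g X) (hY : D.comp g Y) (f : X ⟶ Y),
    f ≫ θ hY = θ hX ≫ (D.act g).map f
  unit : θ hD.isGrading.unit ≫ (D.T₀ (𝟙_ C)).hom = 𝟙 (𝟙_ C)
  tensor : ∀ {g h : G} {X Y : C} (hX : D.comp g X) (hY : D.comp h Y),
    θ (hD.isGrading.tensor hX hY) ≫ D.τ (g * h) X Y ≫
        ((D.T₂Of (show g * h = g * h * g⁻¹ * g by group) X).hom ⊗ₘ (D.T₂ g h Y).hom) =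
      D.braid hX Y ≫ D.braid (hD.conj g h hY) X ≫
        ((D.act (g * h * g⁻¹)).map (θ hX) ⊗ₘ (D.act g).map (θ hY))
  invariant : ∀ (g : G) {h : G} {Y : C} (hY : D.comp h Y),
    θ (hD.conj g h hY) ≫ (D.T₂Of (show g * h = g * h * g⁻¹ * g by group) Y).inv =
      (D.act g).map (θ hY) ≫ (D.T₂ g h Y).inv

/-- A `G`-twist is a `G`-ribbon if it is compatible with duals: for `X` in `C_g` with dual `Y`,
the two composites from `𝟙 ≅ (g⁻¹)_* 𝟙` to `(g⁻¹)_* g_* X ⊗ (g⁻¹)_* Y` agree. -/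
structure CrossedData.IsRibbon [Preadditive C] [Linear ℂ C] (D : CrossedData G C)
    (hD : D.IsBraidedCrossed) (θ : D.TwistData) : Prop where
  isTwist : D.IsTwist hD θ
  dual : ∀ {g : G} {X Y : C} (hX : D.comp g X) (hY : D.comp g⁻¹ Y) [ExactPairing X Y],
    (D.act g⁻¹).map (η_ X Y ≫ (θ hX ▷ Y)) ≫ D.τ g⁻¹ ((D.act g).obj X) Y =
      D.τ₀ g⁻¹ ≫ η_ X Y ≫ (X ◁ θ hY) ≫
        (((D.T₀ X).inv ≫ (D.T₂Of (inv_mul_cancel g).symm X).hom) ▷ (D.act g⁻¹).obj Y)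

/-- The quantum dimension of `X` in `C_g` with dual `Y`, as an endomorphism of the unit:
`𝟙 ⟶ X ⊗ Y ⟶ g_* Y ⊗ X ⟶ g_* Y ⊗ g_* X ≅ g_* (Y ⊗ X) ⟶ g_* 𝟙 ⟶ 𝟙`, where the maps are the
coevaluation, the braiding, the twist of `X`, the tensor structure, the evaluation and the unit
structure. -/
noncomputable def CrossedData.quantumDim [Preadditive C] [Linear ℂ C] (D : CrossedData G C)
    (hD : D.IsBraidedCrossed) (θ : D.TwistData) {g : G} {X : C} (hX : D.comp g X) (Y : C)
    [ExactPairing X Y] : 𝟙_ C ⟶ 𝟙_ C :=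
  haveI := hD.isAction.τ_iso g Y X
  η_ X Y ≫ D.braid hX Y ≫ ((D.act g).obj Y ◁ θ hX) ≫ inv (D.τ g Y X) ≫
    (D.act g).map (ε_ X Y) ≫ D.τ₀ g

/-- All simple objects have positive quantum dimension. -/
def CrossedData.HasPositiveDims [Preadditive C] [Linear ℂ C] (D : CrossedData G C)
    (hD : D.IsBraidedCrossed) (θ : D.TwistData) : Prop :=
  ∀ {g : G} {X : C} (hX : D.comp g X) (Y : C) [ExactPairing X Y], Simple X →
    ∃ d : ℝ, 0 < d ∧ D.quantumDim hD θ hX Y = (d : ℂ) • 𝟙 (𝟙_ C)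

/-- The braided `G`-crossed category `C` is an extension, via `F`, of the braided category `B` with
`G`-action: `F` identifies `B` with the neutral component of `C`, as a braided monoidal category
with an action of `G`. -/
def CrossedData.IsExtension [Preadditive C] [Linear ℂ C] {B : Type u} [Category.{v} B]
    [Preadditive B] [Linear ℂ B] [MonoidalCategory B] [BraidedCategory B]
    (D : CrossedData G C) (A : ActionData G B) (F : B ⥤ C) : Prop :=
  F.Full ∧ F.Faithful ∧ F.Additive ∧ F.Linear ℂ ∧
  (∀ Y : C, D.comp 1 Y ↔ F.essImage Y) ∧
  ∃ (_ : F.Monoidal)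
    (κ : ∀ (g : G) (X : B), F.obj ((A.act g).obj X) ≅ (D.act g).obj (F.obj X)),
    (∀ (X Y : B) (hX : D.comp 1 (F.obj X)),
      D.braid hX (F.obj Y) ≫ ((D.T₀ (F.obj Y)).hom ▷ F.obj X) ≫ Functor.LaxMonoidal.μ F Y X =
        Functor.LaxMonoidal.μ F X Y ≫ F.map (β_ X Y).hom) ∧
    (∀ (g : G) {X Y : B} (f : X ⟶ Y),
      F.map ((A.act g).map f) ≫ (κ g Y).hom = (κ g X).hom ≫ (D.act g).map (F.map f)) ∧
    (∀ X : B, F.map (A.T₀ X).hom = (κ 1 X).hom ≫ (D.T₀ (F.obj X)).hom) ∧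
    (∀ (g h : G) (X : B),
      F.map (A.T₂ g h X).hom ≫ (κ g ((A.act h).obj X)).hom ≫ (D.act g).map (κ h X).hom =
        (κ (g * h) X).hom ≫ (D.T₂ g h (F.obj X)).hom) ∧
    (∀ (g : G) (X Y : B),
      F.map (A.τ g X Y) ≫ Functor.OplaxMonoidal.δ F _ _ ≫ ((κ g X).hom ⊗ₘ (κ g Y).hom) =
        (κ g (X ⊗ Y)).hom ≫ (D.act g).map (Functor.OplaxMonoidal.δ F X Y) ≫
          D.τ g (F.obj X) (F.obj Y))

end General

/-! ## Graded vector spaces -/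

/-- A finite-dimensional `I`-graded complex vector space, given by a finite homogeneous basis. -/
structure GradedVect (I : Type u) where
  ι : Type u
  [fin : Fintype ι]
  deg : ι → I

attribute [instance] GradedVect.fin

namespace GradedVect

variable {I : Type u}

/-- Degree-preserving linear maps, as matrices: `M i j` is the coefficient of the `j`-th basis
vector of `Y` in the image of the `i`-th basis vector of `X`. -/
def homs (X Y : GradedVect I) : Submodule ℂ (Matrix X.ι Y.ι ℂ) where
  carrier := {M | ∀ i j, X.deg i ≠ Y.deg j → M i j = 0}
  add_mem' := by
    intro a b ha hb i j hij
    simp [ha i j hij, hb i j hij]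
  zero_mem' := by intro i j _; rfl
  smul_mem' := by
    intro c a ha i j hij
    simp [ha i j hij]

open Classical in
noncomputable instance : Category.{u} (GradedVect I) where
  Hom X Y := homs X Y
  id X := ⟨1, fun _ _ h => Matrix.one_apply_ne (fun e => h (e ▸ rfl))⟩
  comp {X Y Z} f g := ⟨f.1 * g.1, fun i k h => by
    rw [Matrix.mul_apply]
    refine Finset.sum_eq_zero fun j _ => ?_
    by_cases hj : X.deg i = Y.deg j
    · rw [g.2 j k (fun e => h (hj.trans e)), mul_zero]
    · rw [f.2 i j hj, zero_mul]⟩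
  id_comp f := Subtype.ext (Matrix.one_mul _)
  comp_id f := Subtype.ext (Matrix.mul_one _)
  assoc f g h := Subtype.ext (Matrix.mul_assoc _ _ _)

noncomputable instance : Preadditive (GradedVect I) where
  homGroup X Y := inferInstanceAs (AddCommGroup (homs X Y))
  add_comp _ _ _ f f₁ g := Subtype.ext (Matrix.add_mul f.1 f₁.1 g.1)
  comp_add _ _ _ f g g₁ := Subtype.ext (Matrix.mul_add f.1 g.1 g₁.1)

noncomputable instance : Linear ℂ (GradedVect I) where
  homModule X Y := inferInstanceAs (Module ℂ (homs X Y))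
  smul_comp _ _ _ r f g := Subtype.ext (Matrix.smul_mul r f.1 g.1)
  comp_smul _ _ _ f r g := Subtype.ext (Matrix.mul_smul f.1 r g.1)

open Classical in
/-- The degree-preserving part of a matrix. -/
noncomputable def ofMat {X Y : GradedVect I} (M : X.ι → Y.ι → ℂ) : X ⟶ Y :=
  ⟨fun i j => if X.deg i = Y.deg j then M i j else 0, fun _ _ h => if_neg h⟩

/-- The one-dimensional space in degree `s`. -/
def single (s : I) : GradedVect I := ⟨PUnit, fun _ => s⟩

/-- Change of degrees along a map. -/
def relabel {J : Type u} (f : I → J) : GradedVect I ⥤ GradedVect J where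
  obj X := ⟨X.ι, fun i => f (X.deg i)⟩
  map {X Y} M := ⟨M.1, fun i j h => M.2 i j (fun e => h (congrArg f e))⟩

open Classical in
/-- Two gradings of a basis that agree give isomorphic spaces, through the identity matrix. -/
noncomputable def isoOfDeg (X : GradedVect I) {f f₁ : X.ι → I} (h : ∀ i, f i = f₁ i) :
    (⟨X.ι, f⟩ : GradedVect I) ≅ ⟨X.ι, f₁⟩ where
  hom := ⟨1, fun i _ hij => Matrix.one_apply_ne (fun e => hij (e ▸ h i))⟩
  inv := ⟨1, fun i _ hij => Matrix.one_apply_ne (fun e => hij (e ▸ (h i).symm))⟩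
  hom_inv_id := Subtype.ext (Matrix.one_mul _)
  inv_hom_id := Subtype.ext (Matrix.one_mul _)

end GradedVect

/-- Multiplicity-free fusion rules on a set `I` of simple objects with explicit associators.
`N i j` is the set of constituents of `i ⊗ j`, and `F i j k s r w` is the coefficient of the
associator from the summand `w` of `s ⊗ k ⊆ (i ⊗ j) ⊗ k` (with `s` in `i ⊗ j`) to the summand `w`
of `i ⊗ r ⊆ i ⊗ (j ⊗ k)` (with `r` in `j ⊗ k`). -/
structure FusionDatum (I : Type u) where
  one : I
  N : I → I → Set I
  F : I → I → I → I → I → I → ℂ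

namespace FusionDatum

open GradedVect

variable {I : Type u} [Finite I] (D : FusionDatum I)

/-- The tensor product: a basis vector `(i, j, s)` for each pair of basis vectors and each
constituent `s` of the tensor product of their degrees. -/
noncomputable def tensorObj (X Y : GradedVect I) : GradedVect I where
  ι := {p : X.ι × Y.ι × I // p.2.2 ∈ D.N (X.deg p.1) (Y.deg p.2.1)}
  fin := Fintype.ofFinite _
  deg p := p.1.2.2

noncomputable def tensorHom {X X₁ Y Y₁ : GradedVect I} (f : X ⟶ X₁) (g : Y ⟶ Y₁) :
    D.tensorObj X Y ⟶ D.tensorObj X₁ Y₁ :=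
  ofMat fun p q => f.1 p.1.1 q.1.1 * g.1 p.1.2.1 q.1.2.1

open Classical in
noncomputable def assocHom (X Y Z : GradedVect I) :
    D.tensorObj (D.tensorObj X Y) Z ⟶ D.tensorObj X (D.tensorObj Y Z) :=
  ofMat fun p q =>
    if p.1.1.1.1 = q.1.1 ∧ p.1.1.1.2.1 = q.1.2.1.1.1 ∧ p.1.2.1 = q.1.2.1.1.2.1 then
      D.F (X.deg q.1.1) (Y.deg q.1.2.1.1.1) (Z.deg q.1.2.1.1.2.1)
        p.1.1.1.2.2 q.1.2.1.1.2.2 p.1.2.2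
    else 0

open Classical in
noncomputable def leftHom (X : GradedVect I) : D.tensorObj (single D.one) X ⟶ X :=
  ofMat fun p i => if p.1.2.1 = i then 1 else 0

open Classical in
noncomputable def rightHom (X : GradedVect I) : D.tensorObj X (single D.one) ⟶ X :=
  ofMat fun p i => if p.1.1 = i then 1 else 0

/-- Associators and unit maps are isomorphisms. -/
structure Invertible : Prop where
  assoc : ∀ X Y Z : GradedVect I, IsIso (D.assocHom X Y Z)
  left : ∀ X : GradedVect I, IsIso (D.leftHom X)
  right : ∀ X : GradedVect I, IsIso (D.rightHom X)

variable {D} in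
/-- The structure maps defined by the datum. -/
noncomputable abbrev Invertible.toStruct (h : D.Invertible) :
    MonoidalCategoryStruct (GradedVect I) where
  tensorObj := D.tensorObj
  whiskerLeft X _ _ g := D.tensorHom (𝟙 X) g
  whiskerRight f Y := D.tensorHom f (𝟙 Y)
  tensorHom f g := D.tensorHom f g
  tensorUnit := single D.one
  associator X Y Z := haveI := h.assoc X Y Z; asIso (D.assocHom X Y Z)
  leftUnitor X := haveI := h.left X; asIso (D.leftHom X)
  rightUnitor X := haveI := h.right X; asIso (D.rightHom X)

/-- The datum defines a monoidal category. -/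
def IsTensor : Prop := ∃ h : D.Invertible, @IsMonoidal (GradedVect I) _ h.toStruct

/-- The category of graded vector spaces with the monoidal structure defined by the datum. -/
def Cat {D : FusionDatum I} (_h : D.IsTensor) : Type (u + 1) := GradedVect I

variable {D} (hD : D.IsTensor)

noncomputable instance : Category.{u} (Cat hD) := inferInstanceAs (Category (GradedVect I))

noncomputable instance : Preadditive (Cat hD) := inferInstanceAs (Preadditive (GradedVect I))

noncomputable instance : Linear ℂ (Cat hD) := inferInstanceAs (Linear ℂ (GradedVect I))

noncomputable instance : MonoidalCategory (Cat hD) :=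
  @IsMonoidal.toMonoidalCategory (GradedVect I) _ hD.choose.toStruct hD.choose_spec

/-- The simple object with label `s`. -/
def simple (s : I) : Cat hD := single s

variable {G : Type} [Group G]

open Classical in
/-- The action data with `g_*` given on labels by `ρ`, strict composition, and tensor structure
`g_*(i ⊗ j) ⟶ g_* i ⊗ g_* j` given on the constituent `s` of `i ⊗ j` by the scalar `t g i j s`. -/
noncomputable def actionData (ρ : G →* Function.End I) (t : G → I → I → I → ℂ) :
    ActionData G (Cat hD) where
  act g := relabel (ρ g)
  T₂ g h X := isoOfDeg X fun i => by
    show ρ (g * h) _ = ρ g (ρ h _)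
    rw [map_mul]
    rfl
  T₀ X := isoOfDeg X fun i => by
    show ρ 1 _ = _
    rw [map_one]
    rfl
  τ g X Y := ofMat (X := (relabel (ρ g)).obj (D.tensorObj X Y))
    (Y := D.tensorObj ((relabel (ρ g)).obj X) ((relabel (ρ g)).obj Y)) fun p q =>
    if p.1.1 = q.1.1 ∧ p.1.2.1 = q.1.2.1 then
      t g (GradedVect.deg X p.1.1) (GradedVect.deg Y p.1.2.1) p.1.2.2
    else 0
  τ₀ g := ofMat (X := (relabel (ρ g)).obj (single D.one)) (Y := single D.one) fun _ _ => 1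

open Classical in
/-- The crossed data with the action above, grading `gr` of the labels, and braiding
`i ⊗ j ⟶ g_* j ⊗ i` given on the constituent `s` by the scalar `R i j s`. -/
noncomputable def crossedData (ρ : G →* Function.End I) (t : G → I → I → I → ℂ) (gr : I → G)
    (R : I → I → I → ℂ) : CrossedData G (Cat hD) where
  toActionData := actionData hD ρ t
  comp g X := ∀ i, gr (GradedVect.deg X i) = g
  braid {g X} _ Y := ofMat (X := D.tensorObj X Y)
    (Y := D.tensorObj ((relabel (ρ g)).obj Y) X) fun p q =>
    if p.1.1 = q.1.2.1 ∧ p.1.2.1 = q.1.1 then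
      R (GradedVect.deg X p.1.1) (GradedVect.deg Y p.1.2.1) p.1.2.2
    else 0

open Classical in
/-- The twist that is the scalar `θ i` on the simple object `i`. -/
noncomputable def twistData (ρ : G →* Function.End I) (t : G → I → I → I → ℂ) (gr : I → G)
    (R : I → I → I → ℂ) (θ : I → ℂ) : (crossedData hD ρ t gr R).TwistData :=
  fun {g X} _ => ofMat (X := X) (Y := (relabel (ρ g)).obj X) fun i j =>
    if i = j then θ (GradedVect.deg X i) else 0

open Classical in
/-- The braiding `i ⊗ j ⟶ j ⊗ i` given on the constituent `s` by the scalar `R i j s`. -/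
noncomputable def braidHom (R : I → I → I → ℂ) (X Y : Cat hD) : X ⊗ Y ⟶ Y ⊗ X :=
  ofMat (X := D.tensorObj X Y) (Y := D.tensorObj Y X) fun p q =>
    if p.1.1 = q.1.2.1 ∧ p.1.2.1 = q.1.1 then
      R (GradedVect.deg X p.1.1) (GradedVect.deg Y p.1.2.1) p.1.2.2
    else 0

end FusionDatum

/-! ## Discriminant forms and the input data -/

section Input

variable {Γ : Type u} [AddCommGroup Γ]

/-- The bimultiplicative form of a quadratic form. -/
def assocForm (Q : Γ → ℂˣ) (a b : Γ) : ℂˣ := Q (a + b) * (Q a)⁻¹ * (Q b)⁻¹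

/-- `Q` is a nondegenerate quadratic form, i.e. `(Γ, Q)` is a discriminant form if `Γ` is finite. -/
structure IsDiscriminantForm (Q : Γ → ℂˣ) : Prop where
  zsmul : ∀ (n : ℤ) (a : Γ), Q (n • a) = Q a ^ (n ^ 2)
  mul_left : ∀ a b c, assocForm Q (a + b) c = assocForm Q a c * assocForm Q b c
  mul_right : ∀ a b c, assocForm Q a (b + c) = assocForm Q a b * assocForm Q a c
  nondegenerate : ∀ a, (∀ b, assocForm Q a b = 1) → a = 0

/-- `(σ, ω)` is an abelian 3-cocycle that represents `Q` and is special: `σ` is normalised and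
symmetric, `ω` is multiplicative in the first argument and is the deviation of `σ` from being
bimultiplicative. -/
structure IsSpecialCocycle (Q : Γ → ℂˣ) (σ : Γ → Γ → ℂˣ) (ω : Γ → Γ → Γ → ℂˣ) : Prop where
  cocycle : ∀ a b c d,
    ω b c d * ω a (b + c) d * ω a b c = ω (a + b) c d * ω a b (c + d)
  hexagon₁ : ∀ a b c,
    ω b a c * (ω a b c * ω b c a)⁻¹ = σ a (b + c) * (σ a b * σ a c)⁻¹
  hexagon₂ : ∀ a b c,
    ω a b c * ω c a b * (ω a c b)⁻¹ = σ (a + b) c * (σ a c * σ b c)⁻¹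
  represents : ∀ a, σ a a = Q a
  normalised_right : ∀ a, σ a 0 = 1
  normalised_left : ∀ a, σ 0 a = 1
  symmetric : ∀ a b, σ a b = σ b a
  multiplicative : ∀ a b c d, ω (a + b) c d = ω a c d * ω b c d
  deviation : ∀ a b c, σ a (b + c) * (σ a b)⁻¹ * (σ a c)⁻¹ = ω a b c

variable (Γ) in
/-- The subgroup `2Γ`. -/
abbrev twoMul : AddSubgroup Γ := (zsmulAddGroupHom (2 : ℤ) : Γ →+ Γ).range

variable (Γ) in
/-- The number `|2Γ|^{1/2}`. -/
noncomputable def sqrtCard : ℂ := (Real.sqrt (Nat.card (twoMul Γ)) : ℂ)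

/-- The partial Gauss sum `|2Γ|^{-1/2} ∑ q(a)⁻¹` over `a` in the class of `δ` modulo `2Γ`. -/
noncomputable def partialGaussSum (q : Γ → ℂˣ) (δ : Γ) : ℂ :=
  (sqrtCard Γ)⁻¹ * ∑ᶠ m : twoMul Γ, (((q (δ + m))⁻¹ : ℂˣ) : ℂ)

/-- The value `ω(x, a, b)` for a class `x` in `Γ/2Γ`; for special cocycles it does not depend on the
representative of `x`. -/
noncomputable def omegaBar (ω : Γ → Γ → Γ → ℂˣ) (x : Γ ⧸ twoMul Γ) (a b : Γ) : ℂ :=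
  ω (Quotient.out x) a b

/-! ## The pointed category -/

/-- The group with two elements, written multiplicatively. -/
abbrev C₂ : Type := Multiplicative (ZMod 2)

open Classical in
/-- The action of the group of order two through an involution. -/
noncomputable def involutionAction {I : Type u} (n : I → I) (hn : ∀ i, n (n i) = i) :
    C₂ →* Function.End I where
  toFun g := fun i => if g = 1 then i else n i
  map_one' := funext fun _ => if_pos rfl
  map_mul' g h := by
    have key : ∀ k : C₂, k = 1 ∨ k = Multiplicative.ofAdd 1 := by decide
    have h1 : (Multiplicative.ofAdd 1 : C₂) ≠ 1 := by decide
    have h2 : (Multiplicative.ofAdd 1 : C₂) * Multiplicative.ofAdd 1 = 1 := by decide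
    funext i
    change _ = if g = 1 then (if h = 1 then i else n i) else n (if h = 1 then i else n i)
    rcases key g with rfl | rfl <;> rcases key h with rfl | rfl <;> simp [h1, h2, hn]

/-- `Vect_Γ` with simple objects `ℂ_a`, `ℂ_a ⊗ ℂ_b = ℂ_{a+b}` and associator `ω`. -/
def pointedDatum (ω : Γ → Γ → Γ → ℂˣ) : FusionDatum Γ where
  one := 0
  N a b := {a + b}
  F a b c _ _ _ := ω a b c

open Classical in
/-- The action of the group of order two on `Vect_Γ` by `ℂ_a ↦ ℂ_{-a}` with tensor structure
`ω(a, b, -b)`. -/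
noncomputable def pointedAction [Finite Γ] {ω : Γ → Γ → Γ → ℂˣ} (h : (pointedDatum ω).IsTensor) :
    ActionData C₂ (FusionDatum.Cat h) :=
  FusionDatum.actionData h (involutionAction (fun a => -a) neg_neg)
    fun g a b _ => if g = 1 then 1 else (ω a b (-b) : ℂ)

/-! ## The category `Vect_Γ ⊕ Vect_{Γ/2Γ}` -/

variable (Γ) in
/-- The simple objects: `inl a` is `ℂ_a` for `a` in `Γ`, and `inr x` is `X^x` for `x` in `Γ/2Γ`. -/
abbrev Label : Type u := Γ ⊕ (Γ ⧸ twoMul Γ)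

variable (σ : Γ → Γ → ℂˣ) (ω : Γ → Γ → Γ → ℂˣ) (δ : Γ) (ε : ℤˣ) (q : Γ → ℂˣ) (α β : ℂ)

/-- The fusion rules. -/
def glmN : Label Γ → Label Γ → Set (Label Γ)
  | .inl a, .inl b => {.inl (a + b)}
  | .inl a, .inr x => {.inr (a + x)}
  | .inr x, .inl a => {.inr (x + a)}
  | .inr x, .inr y => {s | ∃ t : Γ, (t : Γ ⧸ twoMul Γ) = δ + x + y ∧ s = .inl t}

/-- The associators. -/
noncomputable def glmF : Label Γ → Label Γ → Label Γ → Label Γ → Label Γ → Label Γ → ℂ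
  | .inl a, .inl b, .inl c, _, _, _ => ω a b c
  | .inr x, .inl a, .inl b, _, _, _ => omegaBar ω (x + δ) a b
  | .inl a, .inr _, .inl b, _, _, _ => σ a b
  | .inl a, .inl b, .inr x, _, _, _ => omegaBar ω (a + b + x) a b
  | .inl a, .inr x, .inr _, _, .inl t, _ => omegaBar ω (a + x) a t
  | .inr x, .inr _, .inl a, .inl t, _, _ => omegaBar ω x t a
  | .inr _, .inl a, .inr _, _, _, .inl t => σ a t
  | .inr _, .inr _, .inr _, .inl t, .inl r, _ =>
      ((ε : ℤ) : ℂ) * (sqrtCard Γ)⁻¹ * ((σ t r)⁻¹ : ℂˣ)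
  | _, _, _, _, _, _ => 0

/-- The graded tensor category. -/
noncomputable def glmDatum : FusionDatum (Label Γ) where
  one := .inl 0
  N := glmN δ
  F := glmF σ ω δ ε

/-- The involution `ℂ_a ↦ ℂ_{-a}`, `X^x ↦ X^x` on simple objects. -/
def glmNeg : Label Γ → Label Γ
  | .inl a => .inl (-a)
  | .inr x => .inr x

theorem glmNeg_glmNeg (s : Label Γ) : glmNeg (glmNeg s) = s := by
  cases s with
  | inl a => exact congrArg Sum.inl (neg_neg a)
  | inr x => rfl

/-- The tensor structure of the nontrivial group element, on the constituent of `i ⊗ j` in the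
last argument. -/
noncomputable def glmTau : Label Γ → Label Γ → Label Γ → ℂ
  | .inl a, .inl b, _ => ω a b (-b)
  | .inl a, .inr x, _ => omegaBar ω (a + x) a (-a)
  | .inr x, .inl a, _ => omegaBar ω (x + δ) a (-a)
  | .inr x, .inr _, .inl t => omegaBar ω x t (-t)
  | .inr _, .inr _, .inr _ => 0

/-- The braiding, on the constituent of `i ⊗ j` in the last argument. -/
noncomputable def glmR : Label Γ → Label Γ → Label Γ → ℂ
  | .inl a, .inl b, _ => σ a b
  | .inl a, .inr _, _ => ((q a)⁻¹ : ℂˣ)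
  | .inr x, .inl a, _ => ((q a)⁻¹ : ℂˣ) * omegaBar ω (x + a) a (-a)
  | .inr _, .inr _, .inl t => α * q t
  | .inr _, .inr _, .inr _ => 0

/-- The degree: `ℂ_a` in degree `1`, `X^x` in degree `g`. -/
def glmDegree : Label Γ → C₂
  | .inl _ => 1
  | .inr _ => Multiplicative.ofAdd 1

/-- The twist. -/
noncomputable def glmTheta : Label Γ → ℂ
  | .inl a => σ a a
  | .inr _ => β

variable [Finite Γ] {σ ω δ ε} (h : (glmDatum σ ω δ ε).IsTensor)

open Classical in
/-- The action, grading and braiding on `Vect_Γ ⊕ Vect_{Γ/2Γ}`. -/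
noncomputable def glmCrossed : CrossedData C₂ (FusionDatum.Cat h) :=
  FusionDatum.crossedData h (involutionAction glmNeg glmNeg_glmNeg)
    (fun g i j s => if g = 1 then 1 else glmTau ω δ i j s) glmDegree (glmR σ ω q α)

open Classical in
/-- The ribbon twist on `Vect_Γ ⊕ Vect_{Γ/2Γ}`. -/
noncomputable def glmTwist : (glmCrossed q α h).TwistData :=
  FusionDatum.twistData h (involutionAction glmNeg glmNeg_glmNeg)
    (fun g i j s => if g = 1 then 1 else glmTau ω δ i j s) glmDegree (glmR σ ω q α)
    (glmTheta σ β)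

/-- The embedding of `Vect_Γ` as the degree-one part. -/
def glmIncl (h₀ : (pointedDatum ω).IsTensor) : FusionDatum.Cat h₀ ⥤ FusionDatum.Cat h :=
  GradedVect.relabel Sum.inl

/-- The coevaluation `𝟙 ⟶ i ⊗ j` given by the inclusion of the summand `ℂ_0`, for simple objects
`i`, `j`. -/
noncomputable def glmCoev (i j : Label Γ) :
    𝟙_ (FusionDatum.Cat h) ⟶ FusionDatum.simple h i ⊗ FusionDatum.simple h j :=
  GradedVect.ofMat (X := GradedVect.single (.inl 0)) (Y := (glmDatum σ ω δ ε).tensorObj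
    (GradedVect.single i) (GradedVect.single j)) fun _ _ => 1

/-- The evaluation `i ⊗ j ⟶ 𝟙` given by `c` times the projection to the summand `ℂ_0`, for simple
objects `i`, `j`. -/
noncomputable def glmEv (c : ℂ) (i j : Label Γ) :
    FusionDatum.simple h i ⊗ FusionDatum.simple h j ⟶ 𝟙_ (FusionDatum.Cat h) :=
  GradedVect.ofMat (X := (glmDatum σ ω δ ε).tensorObj (GradedVect.single i) (GradedVect.single j))
    (Y := GradedVect.single (.inl 0)) fun _ _ => c

end Input

/-! The whole theorem is reduced to identities between scalars, and these are then deduced from the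
cocycle, from the addition law of `q` and from two facts about finite sums.

Reduction. A morphism of graded spaces is a matrix, and `push` pulls functionals back along it
(`push_comp`, `ext_push`). On basis vectors every structure map is monomial, except for the
associators, which sum over the label of the inner tensor product. Hence, for any multiplicity-free
`FusionDatum`, the categorical axioms follow from equations between coefficients: `IsCoherent`
(associators), `IsActionCoherent`, `IsCrossedCoherent` (braiding and hexagons), `IsTwistCoherent`,
`IsDual` and `IsNeutralEmbedding`. Ordinary braidings are the crossed ones for the trivial group,
and the embedding of the neutral component uses the same comparison maps as the tensor structure of
an action. The underlying category is equivalent to families of finite-dimensional vector spaces,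
hence abelian and semisimple.

Arithmetic. A special `ω` is symmetric in its last two arguments, takes values of square one, and
for a fixed first argument is a 2-cocycle that depends only on the class of that argument modulo
`2Γ`. If only one intermediate channel is possible, each equation is a consequence of these rules,
of the deviation formula for `σ`, of `q(a)² = σ(a, a)` and of the addition law of `q`. The cochain
`ω(·, b, -b)` measures the effect of negation on `ω` and `σ` (`omega_neg_neg`, `sigma_neg_neg`),
which is why it appears in the action and in the braiding.

Several channels occur only when enough factors are of type `X`, and then two inputs are needed. (1)
For `n` in `2Γ`, `σ(2b, n) = σ(b, n)²` is the bimultiplicative form of `Q`. So `σ` restricts to a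
nondegenerate bicharacter on `2Γ`, and the functions `σ(t, ·)` on a coset are orthogonal
(`sum_sigma_coset`). This inverts the associator of three `X` and proves the pentagon of four `X`.
(2) Completing the square (`q_mul_sigma`) turns the hexagons of three `X` into Gauss sums over `δ +
2Γ`. The first hexagon is the defining equation of `α²`; the second involves the sum of `q` in place
of `q⁻¹`, and the product of the two sums is `|2Γ|` (`gauss_mul_gauss`), which also gives `α ≠ 0`.

For two `X`, the twist equation comes down to `α²β² = 1` and `q(t)² = Q(t)`. The zigzag identity
makes the quantum dimension independent of the chosen duality (`push_quantumDim`); it is `1` for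
`ℂ_a` and `αβε|2Γ|^{1/2}` for `X`. Since `αβ = ±1`, positivity means `αβ = ε`. -/

/-! ## Morphisms of graded vector spaces as matrices -/

namespace GradedVect

variable {I : Type u}

/-- The matrix coefficients of a morphism. -/
def coeff {X Y : GradedVect I} (f : X ⟶ Y) (i : X.ι) (j : Y.ι) : ℂ := f.1 i j

theorem coeff_of_ne {X Y : GradedVect I} (f : X ⟶ Y) {i : X.ι} {j : Y.ι}
    (h : X.deg i ≠ Y.deg j) : coeff f i j = 0 := f.2 i j h

theorem hom_ext {X Y : GradedVect I} {f g : X ⟶ Y} (h : ∀ i j, coeff f i j = coeff g i j) : f = g :=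
  Subtype.ext (Matrix.ext h)

theorem comp_apply {X Y Z : GradedVect I} (f : X ⟶ Y) (g : Y ⟶ Z) (i : X.ι) (k : Z.ι) :
    coeff (f ≫ g) i k = ∑ j, coeff f i j * coeff g j k := by
  change (f.1 * g.1 : Matrix X.ι Z.ι ℂ) i k = _
  rw [Matrix.mul_apply]
  rfl

open Classical in
theorem id_apply (X : GradedVect I) (i j : X.ι) :
    coeff (𝟙 X) i j = if i = j then 1 else 0 := by
  change (1 : Matrix X.ι X.ι ℂ) i j = _
  rw [Matrix.one_apply]

open Classical in
theorem ofMat_apply {X Y : GradedVect I} (M : X.ι → Y.ι → ℂ) (i : X.ι) (j : Y.ι) :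
    coeff (ofMat M) i j = if X.deg i = Y.deg j then M i j else 0 := rfl

theorem ofMat_of_eq {X Y : GradedVect I} {M : X.ι → Y.ι → ℂ} {i : X.ι} {j : Y.ι}
    (h : X.deg i = Y.deg j) : coeff (ofMat M) i j = M i j := if_pos h

theorem ofMat_of_ne {X Y : GradedVect I} {M : X.ι → Y.ι → ℂ} {i : X.ι} {j : Y.ι}
    (h : X.deg i ≠ Y.deg j) : coeff (ofMat M) i j = 0 := if_neg h

theorem ofMat_eq_zero {X Y : GradedVect I} {M : X.ι → Y.ι → ℂ} {i : X.ι} {j : Y.ι}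
    (h : M i j = 0) : coeff (ofMat M) i j = 0 := by
  rw [ofMat_apply, h, ite_self]

theorem add_apply {X Y : GradedVect I} (f g : X ⟶ Y) (i : X.ι) (j : Y.ι) :
    coeff (f + g) i j = coeff f i j + coeff g i j := rfl

theorem smul_apply {X Y : GradedVect I} (c : ℂ) (f : X ⟶ Y) (i : X.ι) (j : Y.ι) :
    coeff (c • f) i j = c * coeff f i j := rfl

theorem zero_apply {X Y : GradedVect I} (i : X.ι) (j : Y.ι) :
    coeff (0 : X ⟶ Y) i j = 0 := rfl

open Classical in
theorem isoOfDeg_hom_apply (X : GradedVect I) {f f₁ : X.ι → I} (h : ∀ i, f i = f₁ i) (i j : X.ι) :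
    coeff (isoOfDeg X h).hom i j = if i = j then 1 else 0 := by
  change (1 : Matrix X.ι X.ι ℂ) i j = _
  rw [Matrix.one_apply]

open Classical in
theorem isoOfDeg_inv_apply (X : GradedVect I) {f f₁ : X.ι → I} (h : ∀ i, f i = f₁ i) (i j : X.ι) :
    coeff (isoOfDeg X h).inv i j = if i = j then 1 else 0 := by
  change (1 : Matrix X.ι X.ι ℂ) i j = _
  rw [Matrix.one_apply]

/-- The value of a functional on the target of `f` at the image of a basis vector. -/
def push {X Y : GradedVect I} (f : X ⟶ Y) (p : X.ι) (γ : Y.ι → ℂ) : ℂ := ∑ q, coeff f p q * γ q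

open Classical in
theorem push_single {X Y : GradedVect I} (f : X ⟶ Y) (p : X.ι) (q : Y.ι) :
    push f p (fun q' => if q' = q then 1 else 0) = coeff f p q := by
  simp [push]

/-- Coordinate functionals separate matrices. Identities between composites are checked with an
arbitrary functional, which is carried along unevaluated while each map contributes its scalar. -/
theorem ext_push {X Y : GradedVect I} {f g : X ⟶ Y} (h : ∀ p γ, push f p γ = push g p γ) :
    f = g := by
  classical
  refine hom_ext fun i j => ?_
  rw [← push_single f, ← push_single g, h]

/-- Because functionals pull back one map at a time, a composite is computed by one rewriting rule
per factor, and no sum over an intermediate basis appears unless a factor really has several terms.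
-/
theorem push_comp {X Y Z : GradedVect I} (f : X ⟶ Y) (g : Y ⟶ Z) (p : X.ι) (γ : Z.ι → ℂ) :
    push (f ≫ g) p γ = push f p fun q => push g q γ := by
  simp only [push, comp_apply, Finset.sum_mul, Finset.mul_sum]
  rw [Finset.sum_comm]
  exact Finset.sum_congr rfl fun _ _ => Finset.sum_congr rfl fun _ _ => by ring

theorem push_id (X : GradedVect I) (p : X.ι) (γ : X.ι → ℂ) : push (𝟙 X) p γ = γ p := by
  classical
  simp [push, id_apply]

theorem push_isoOfDeg_hom (X : GradedVect I) {f f₁ : X.ι → I} (h : ∀ i, f i = f₁ i) (p : X.ι)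
    (γ : X.ι → ℂ) : push (isoOfDeg X h).hom p γ = γ p := by
  classical
  simp [push, isoOfDeg_hom_apply]

theorem push_isoOfDeg_inv (X : GradedVect I) {f f₁ : X.ι → I} (h : ∀ i, f i = f₁ i) (p : X.ι)
    (γ : X.ι → ℂ) : push (isoOfDeg X h).inv p γ = γ p := by
  classical
  simp [push, isoOfDeg_inv_apply]

/-- This is how preservation of degrees is used: along a morphism only basis vectors of the same
degree contribute, so membership of a constituent can be transported from source to target. -/
theorem push_congr {X Y : GradedVect I} (f : X ⟶ Y) (p : X.ι) {γ γ₁ : Y.ι → ℂ}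
    (h : ∀ q, X.deg p = Y.deg q → γ q = γ₁ q) : push f p γ = push f p γ₁ := by
  refine Finset.sum_congr rfl fun q _ => ?_
  by_cases e : X.deg p = Y.deg q
  · rw [h q e]
  · rw [coeff_of_ne f e, zero_mul, zero_mul]

theorem push_mul_left {X Y : GradedVect I} (f : X ⟶ Y) (p : X.ι) (c : ℂ) (γ : Y.ι → ℂ) :
    push f p (fun q => c * γ q) = c * push f p γ := by
  simp only [push, Finset.mul_sum]
  exact Finset.sum_congr rfl fun _ _ => by ring

theorem push_sum {X Y : GradedVect I} (f : X ⟶ Y) (p : X.ι) {K : Type*} (s : Finset K)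
    (γ : K → Y.ι → ℂ) :
    push f p (fun q => ∑ k ∈ s, γ k q) = ∑ k ∈ s, push f p (γ k) := by
  simp only [push, Finset.mul_sum]
  rw [Finset.sum_comm]

theorem push_zero {X Y : GradedVect I} (f : X ⟶ Y) (p : X.ι) :
    push f p (fun _ => 0) = 0 := by
  simp [push]

/-- A map that sends basis vectors to multiples of basis vectors. -/
theorem push_of_apply {X Y : GradedVect I} {f : X ⟶ Y} {p : X.ι} {q₀ : Y.ι} {c : ℂ}
    (h : coeff f p q₀ = c) (h₀ : ∀ q, q ≠ q₀ → coeff f p q = 0) (γ : Y.ι → ℂ) : push f p γ = c * γ q₀ := by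
  rw [push, Finset.sum_eq_single q₀ (fun q _ hq => by rw [h₀ q hq, zero_mul]) (by simp), h]

/-- The basis vector of a one-dimensional space. -/
def pt (s : I) : (single s).ι := PUnit.unit

@[simp] theorem deg_pt (s : I) : (single s).deg (pt s) = s := rfl

theorem eq_pt {s : I} (i : (single s).ι) : i = pt s := rfl

/-- The variant for maps that send a basis vector to several channels, enumerated by `ψ`; this is
the shape of an associator, of its inverse and of a coevaluation. -/
theorem push_of_support {X Y : GradedVect I} {f : X ⟶ Y} {p : X.ι} {K : Type*} [Fintype K]
    {ψ : K → Y.ι} {c : K → ℂ} (inj : Function.Injective ψ) (h : ∀ k, coeff f p (ψ k) = c k)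
    (h₀ : ∀ q, X.deg p = Y.deg q → (∀ k, ψ k ≠ q) → coeff f p q = 0) (γ : Y.ι → ℂ) :
    push f p γ = ∑ k, c k * γ (ψ k) := by
  symm
  refine Fintype.sum_of_injective ψ inj _ _ (fun q hq => ?_) fun k => by rw [h]
  by_cases e : X.deg p = Y.deg q
  · rw [h₀ q e fun k hk => hq ⟨k, hk⟩, zero_mul]
  · rw [coeff_of_ne f e, zero_mul]

end GradedVect

namespace GradedVect

variable {I : Type u}

/-- Two independent finite sums may be exchanged. This is what the interchange law and the
naturality of the braiding amount to. -/
theorem push_comm {X Y X₁ Y₁ : GradedVect I} (f : X ⟶ Y) (g : X₁ ⟶ Y₁) (p : X.ι) (q : X₁.ι)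
    (γ : Y.ι → Y₁.ι → ℂ) :
    push f p (fun a => push g q (γ a)) = push g q fun b => push f p fun a => γ a b := by
  simp only [push, Finset.mul_sum]
  rw [Finset.sum_comm]
  exact Finset.sum_congr rfl fun _ _ => Finset.sum_congr rfl fun _ _ => by ring

theorem sum_dite_eq_sum_subtype {K : Type*} [Fintype K] (P : K → Prop) [DecidablePred P]
    [Fintype {k // P k}] (φ : ∀ k, P k → ℂ) :
    (∑ k, if h : P k then φ k h else 0) = ∑ k : {k // P k}, φ k.1 k.2 := by
  symm
  refine Fintype.sum_of_injective (fun k : {k // P k} => k.1) Subtype.val_injective _ _ ?_ ?_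
  · intro k hk
    exact dif_neg fun h => hk ⟨⟨k, h⟩, rfl⟩
  · intro k
    rw [dif_pos k.2]

end GradedVect

/-! ## The tensor product on coefficients -/

namespace FusionDatum

open GradedVect

section Index

variable {I : Type u} [Finite I] (D : FusionDatum I) {X Y : GradedVect I}

/-- The basis vector of a tensor product with given factors and constituent. -/
def idx (i : X.ι) (j : Y.ι) (s : I) (h : s ∈ D.N (X.deg i) (Y.deg j)) : (D.tensorObj X Y).ι :=
  ⟨(i, j, s), h⟩

variable {D}

theorem exists_idx (p : (D.tensorObj X Y).ι) : ∃ i j s hs, p = D.idx i j s hs :=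
  ⟨p.1.1, p.1.2.1, p.1.2.2, p.2, rfl⟩

@[simp] theorem deg_idx (i : X.ι) (j : Y.ι) (s : I) (h : s ∈ D.N (X.deg i) (Y.deg j)) :
    (D.tensorObj X Y).deg (D.idx i j s h) = s := rfl

@[simp] theorem idx_inj {i i₁ : X.ι} {j j₁ : Y.ι} {s s₁ : I} {h : s ∈ D.N (X.deg i) (Y.deg j)}
    {h₁ : s₁ ∈ D.N (X.deg i₁) (Y.deg j₁)} :
    D.idx i j s h = D.idx i₁ j₁ s₁ h₁ ↔ i = i₁ ∧ j = j₁ ∧ s = s₁ := by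
  rw [idx, idx]
  constructor
  · intro e
    have := congrArg Subtype.val e
    simpa using this
  · rintro ⟨rfl, rfl, rfl⟩
    rfl

theorem mem_left {Z : GradedVect I} {i : X.ι} {j : Y.ι} {s : I} {h : s ∈ D.N (X.deg i) (Y.deg j)}
    {k : Z.ι} {w : I} (e : w ∈ D.N s (Z.deg k)) :
    w ∈ D.N ((D.tensorObj X Y).deg (D.idx i j s h)) (Z.deg k) := e

theorem mem_right {Z : GradedVect I} {i : X.ι} {j : Y.ι} {s : I} {h : s ∈ D.N (X.deg i) (Y.deg j)}
    {k : Z.ι} {w : I} (e : w ∈ D.N (Z.deg k) s) :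
    w ∈ D.N (Z.deg k) ((D.tensorObj X Y).deg (D.idx i j s h)) := e

end Index

section Push

variable {I : Type u} [Fintype I] (D : FusionDatum I)

open Classical in
theorem sum_tensorObj {X Y : GradedVect I} (φ : (D.tensorObj X Y).ι → ℂ) :
    ∑ p, φ p = ∑ i, ∑ j, ∑ s,
      if h : s ∈ D.N (X.deg i) (Y.deg j) then φ (D.idx i j s h) else 0 := by
  rw [← Fintype.sum_prod_type']
  rw [← Fintype.sum_prod_type' (f := fun (x : X.ι × Y.ι) (s : I) =>
    if h : s ∈ D.N (X.deg x.1) (Y.deg x.2) then φ (D.idx x.1 x.2 s h) else 0)]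
  rw [sum_dite_eq_sum_subtype
    (P := fun x : (X.ι × Y.ι) × I => x.2 ∈ D.N (X.deg x.1.1) (Y.deg x.1.2))]
  refine Fintype.sum_equiv
    { toFun := fun p => ⟨((p.1.1, p.1.2.1), p.1.2.2), p.2⟩
      invFun := fun p => ⟨(p.1.1.1, p.1.1.2, p.1.2), p.2⟩
      left_inv := fun _ => rfl
      right_inv := fun _ => rfl } _ _ fun _ => rfl

theorem coeff_tensorHom [DecidableEq I] {X X₁ Y Y₁ : GradedVect I}
    (f : X ⟶ X₁) (g : Y ⟶ Y₁) (i : X.ι) (j : Y.ι) (s : I) (h) (i₁ : X₁.ι) (j₁ : Y₁.ι) (s₁ : I)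
    (h₁) : coeff (D.tensorHom f g) (D.idx i j s h) (D.idx i₁ j₁ s₁ h₁) =
      if s = s₁ then coeff f i i₁ * coeff g j j₁ else 0 := by
  split_ifs with e
  · exact ofMat_of_eq e
  · exact ofMat_of_ne e

-- The guard asks whether the constituent `s` is still allowed for the new pair of factors. Whenever
-- both coefficients are nonzero it is, since morphisms preserve degrees; users discharge it after
-- `push_congr`.
open Classical in
theorem push_tensorHom {X X₁ Y Y₁ : GradedVect I}
    (f : X ⟶ X₁) (g : Y ⟶ Y₁) (i : X.ι) (j : Y.ι) (s : I) (h) (γ : (D.tensorObj X₁ Y₁).ι → ℂ) :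
    push (D.tensorHom f g) (D.idx i j s h) γ = push f i fun a => push g j fun b =>
      if e : s ∈ D.N (X₁.deg a) (Y₁.deg b) then γ (D.idx a b s e) else 0 := by
  rw [push, sum_tensorObj]
  simp only [push, Finset.mul_sum]
  refine Finset.sum_congr rfl fun a _ => Finset.sum_congr rfl fun b _ => ?_
  rw [Finset.sum_eq_single s]
  · split_ifs with e
    · rw [coeff_tensorHom, if_pos rfl]; ring
    · ring
  · intro s₁ _ hs
    split_ifs with e
    · rw [coeff_tensorHom, if_neg (fun h => hs h.symm), zero_mul]
    · rfl
  · simp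

-- An associator fixes the three factors and the total constituent `w`, and only trades the inner
-- label `s` for labels `r`. This is the one structure map that leaves a sum.
open Classical in
theorem push_assocHom {X Y Z : GradedVect I} (i : X.ι) (j : Y.ι) (k : Z.ι) (s w : I) (h h₁)
    (γ : (D.tensorObj X (D.tensorObj Y Z)).ι → ℂ) :
    push (D.assocHom X Y Z) (D.idx (D.idx i j s h) k w h₁) γ = ∑ r,
      if e : r ∈ D.N (Y.deg j) (Z.deg k) ∧ w ∈ D.N (X.deg i) r then
        D.F (X.deg i) (Y.deg j) (Z.deg k) s r w * γ (D.idx i (D.idx j k r e.1) w (mem_right e.2))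
      else 0 := by
  rw [sum_dite_eq_sum_subtype]
  refine push_of_support (K := {r // r ∈ D.N (Y.deg j) (Z.deg k) ∧ w ∈ D.N (X.deg i) r})
    (ψ := fun r => D.idx i (D.idx j k r.1 r.2.1) w r.2.2) ?_ ?_ ?_ γ
  · intro r r₁ hr
    exact Subtype.ext (idx_inj.1 (idx_inj.1 hr).2.1).2.2
  · exact fun r => (ofMat_of_eq (by rfl)).trans (if_pos ⟨rfl, rfl, rfl⟩)
  · intro q hw hq
    obtain ⟨i₁, q, w₁, h₃, rfl⟩ := exists_idx q
    obtain ⟨j₁, k₁, r, h₂, rfl⟩ := exists_idx q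
    obtain rfl : w = w₁ := hw
    refine ofMat_eq_zero (if_neg ?_)
    rintro ⟨h₄, h₅, h₆⟩
    obtain rfl : i = i₁ := h₄
    obtain rfl : j = j₁ := h₅
    obtain rfl : k = k₁ := h₆
    exact hq ⟨r, h₂, h₃⟩ rfl

open Classical in
/-- The candidate for the inverse associator with coefficients `G`. -/
noncomputable def assocInv (G : I → I → I → I → I → I → ℂ) (X Y Z : GradedVect I) :
    D.tensorObj X (D.tensorObj Y Z) ⟶ D.tensorObj (D.tensorObj X Y) Z :=
  ofMat fun q p =>
    if q.1.1 = p.1.1.1.1 ∧ q.1.2.1.1.1 = p.1.1.1.2.1 ∧ q.1.2.1.1.2.1 = p.1.2.1 then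
      G (X.deg q.1.1) (Y.deg q.1.2.1.1.1) (Z.deg q.1.2.1.1.2.1)
        p.1.1.1.2.2 q.1.2.1.1.2.2 q.1.2.2
    else 0

open Classical in
theorem push_assocInv (G : I → I → I → I → I → I → ℂ) {X Y Z : GradedVect I} (i : X.ι) (j : Y.ι)
    (k : Z.ι) (r w : I) (h h₁) (γ : (D.tensorObj (D.tensorObj X Y) Z).ι → ℂ) :
    push (D.assocInv G X Y Z) (D.idx i (D.idx j k r h) w h₁) γ = ∑ s,
      if e : s ∈ D.N (X.deg i) (Y.deg j) ∧ w ∈ D.N s (Z.deg k) then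
        G (X.deg i) (Y.deg j) (Z.deg k) s r w * γ (D.idx (D.idx i j s e.1) k w (mem_left e.2))
      else 0 := by
  rw [sum_dite_eq_sum_subtype]
  refine push_of_support (K := {s // s ∈ D.N (X.deg i) (Y.deg j) ∧ w ∈ D.N s (Z.deg k)})
    (ψ := fun s => D.idx (D.idx i j s.1 s.2.1) k w s.2.2) ?_ ?_ ?_ γ
  · intro s s₁ hs
    exact Subtype.ext (idx_inj.1 (idx_inj.1 hs).1).2.2
  · exact fun s => (ofMat_of_eq (by rfl)).trans (if_pos ⟨rfl, rfl, rfl⟩)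
  · intro q hw hq
    obtain ⟨q, k₁, w₁, h₃, rfl⟩ := exists_idx q
    obtain ⟨i₁, j₁, s, h₂, rfl⟩ := exists_idx q
    obtain rfl : w = w₁ := hw
    refine ofMat_eq_zero (if_neg ?_)
    rintro ⟨h₄, h₅, h₆⟩
    obtain rfl : i = i₁ := h₄
    obtain rfl : j = j₁ := h₅
    obtain rfl : k = k₁ := h₆
    exact hq ⟨s, h₂, h₃⟩ rfl

open Classical in
theorem push_leftHom {X : GradedVect I} (u : (single D.one).ι) (i : X.ι) (s : I)
    (h) (hs : s = X.deg i) (γ : X.ι → ℂ) :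
    push (D.leftHom X) (D.idx u i s h) γ = γ i := by
  rw [← one_mul (γ i)]
  refine push_of_apply ?_ (fun k hk => ?_) γ
  · exact (ofMat_of_eq hs).trans (if_pos rfl)
  · exact ofMat_eq_zero (if_neg fun e => hk (Eq.symm e))

open Classical in
theorem push_rightHom {X : GradedVect I} (i : X.ι) (u : (single D.one).ι) (s : I)
    (h) (hs : s = X.deg i) (γ : X.ι → ℂ) :
    push (D.rightHom X) (D.idx i u s h) γ = γ i := by
  rw [← one_mul (γ i)]
  refine push_of_apply ?_ (fun k hk => ?_) γ
  · exact (ofMat_of_eq hs).trans (if_pos rfl)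
  · exact ofMat_eq_zero (if_neg fun e => hk (Eq.symm e))

end Push

end FusionDatum

/-! ### Scalar coherence equations and the monoidal category they define -/

namespace FusionDatum

open GradedVect

/-- The entrywise form of extensionality, for identities such as the pentagon where one has to
distinguish whether source and target basis vectors have the same factors. -/
theorem ext_coeff {I : Type u} {X Y : GradedVect I} {f g : X ⟶ Y}
    (h : ∀ p q, push f p (fun q' => open Classical in if q' = q then 1 else 0) =
      push g p (fun q' => open Classical in if q' = q then 1 else 0)) : f = g := by
  classical
  refine hom_ext fun p q => ?_
  have := h p q
  rwa [push_single, push_single] at this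

variable {I : Type u} [Fintype I] {D : FusionDatum I}

open Classical in
theorem tensorHom_comp {X₁ Y₁ Z₁ X₂ Y₂ Z₂ : GradedVect I} (f₁ : X₁ ⟶ Y₁) (f₂ : X₂ ⟶ Y₂)
    (g₁ : Y₁ ⟶ Z₁) (g₂ : Y₂ ⟶ Z₂) :
    D.tensorHom f₁ f₂ ≫ D.tensorHom g₁ g₂ = D.tensorHom (f₁ ≫ g₁) (f₂ ≫ g₂) := by
  refine ext_push fun p γ => ?_
  obtain ⟨i, j, s, h, rfl⟩ := exists_idx p
  simp only [push_comp, push_tensorHom]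
  refine push_congr _ _ fun a ha => ?_
  rw [push_comm]
  refine push_congr _ _ fun b hb => ?_
  have : s ∈ D.N (Y₁.deg a) (Y₂.deg b) := ha ▸ hb ▸ h
  rw [dif_pos this]

theorem tensorHom_id (X Y : GradedVect I) : D.tensorHom (𝟙 X) (𝟙 Y) = 𝟙 _ := by
  refine ext_push fun p γ => ?_
  obtain ⟨i, j, s, h, rfl⟩ := exists_idx p
  simp only [push_id, push_tensorHom, dif_pos h]

-- Both sides are brought to the form in which the three morphisms act outside and the sum over `r`
-- stands inside. The coefficient `F` depends only on degrees, which the morphisms preserve, so it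
-- may be read off at the source or at the target.
open Classical in
theorem assocHom_natural {X₁ X₂ X₃ Y₁ Y₂ Y₃ : GradedVect I} (f₁ : X₁ ⟶ Y₁) (f₂ : X₂ ⟶ Y₂)
    (f₃ : X₃ ⟶ Y₃) :
    D.tensorHom (D.tensorHom f₁ f₂) f₃ ≫ D.assocHom Y₁ Y₂ Y₃ =
      D.assocHom X₁ X₂ X₃ ≫ D.tensorHom f₁ (D.tensorHom f₂ f₃) := by
  refine ext_push fun p γ => ?_
  obtain ⟨p, k, w, h₁, rfl⟩ := exists_idx p
  obtain ⟨i, j, s, h, rfl⟩ := exists_idx p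
  simp only [push_comp, push_tensorHom, push_assocHom]
  trans push f₁ i fun a => push f₂ j fun b => push f₃ k fun c => ∑ r,
    if e : r ∈ D.N (Y₂.deg b) (Y₃.deg c) ∧ w ∈ D.N (Y₁.deg a) r then
        D.F (X₁.deg i) (X₂.deg j) (X₃.deg k) s r w *
          γ (D.idx a (D.idx b c r e.1) w (mem_right e.2))
      else 0
  · refine push_congr _ _ fun a ha => push_congr _ _ fun b hb => ?_
    have hs : s ∈ D.N (Y₁.deg a) (Y₂.deg b) := ha ▸ hb ▸ h
    rw [dif_pos hs]
    refine push_congr _ _ fun c hc => ?_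
    have hw : w ∈ D.N s (Y₃.deg c) := hc ▸ h₁
    rw [deg_idx, dif_pos hw, ha, hb, hc]
  · simp only [push_sum]
    refine Finset.sum_congr rfl fun r _ => ?_
    by_cases e : r ∈ D.N (X₂.deg j) (X₃.deg k) ∧ w ∈ D.N (X₁.deg i) r
    · rw [dif_pos e, ← push_mul_left]
      refine push_congr _ _ fun a ha => ?_
      rw [← push_mul_left]
      refine push_congr _ _ fun b hb => ?_
      rw [← push_mul_left]
      refine push_congr _ _ fun c hc => ?_
      have e₁ : r ∈ D.N (Y₂.deg b) (Y₃.deg c) := hb ▸ hc ▸ e.1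
      have e₂ : w ∈ D.N (Y₁.deg a) r := ha ▸ e.2
      rw [dif_pos ⟨e₁, e₂⟩, dif_pos e₁, dif_pos (mem_right e₂)]
    · rw [dif_neg e]
      refine (push_congr _ _ (γ₁ := fun _ => 0) fun a ha => ?_).trans (push_zero _ _)
      refine (push_congr _ _ (γ₁ := fun _ => 0) fun b hb => ?_).trans (push_zero _ _)
      refine (push_congr _ _ (γ₁ := fun _ => 0) fun c hc => ?_).trans (push_zero _ _)
      rw [dif_neg]
      rwa [← ha, ← hb, ← hc]

variable (D) in
open Classical in
/-- The equations that make a fusion datum define a monoidal category; `G` are the coefficients of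
the inverse associators. -/
structure IsCoherent (G : I → I → I → I → I → I → ℂ) : Prop where
  one_left : ∀ i s, s ∈ D.N D.one i ↔ s = i
  one_right : ∀ i s, s ∈ D.N i D.one ↔ s = i
  inv_right : ∀ i j k s s₁ w, s ∈ D.N i j → w ∈ D.N s k → s₁ ∈ D.N i j → w ∈ D.N s₁ k →
    (∑ r, if r ∈ D.N j k ∧ w ∈ D.N i r then D.F i j k s r w * G i j k s₁ r w else 0) =
      if s = s₁ then 1 else 0
  inv_left : ∀ i j k r r₁ w, r ∈ D.N j k → w ∈ D.N i r → r₁ ∈ D.N j k → w ∈ D.N i r₁ →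
    (∑ s, if s ∈ D.N i j ∧ w ∈ D.N s k then G i j k s r w * D.F i j k s r₁ w else 0) =
      if r = r₁ then 1 else 0
  pentagon : ∀ i j k l s w u r v, s ∈ D.N i j → w ∈ D.N s k → u ∈ D.N w l → r ∈ D.N k l →
    v ∈ D.N j r → u ∈ D.N i v →
    (∑ m, if (m ∈ D.N j k ∧ w ∈ D.N i m) ∧ v ∈ D.N m l then
      D.F i j k s m w * (D.F i m l w v u * D.F j k l m r v) else 0) =
      if u ∈ D.N s r then D.F s k l w r u * D.F i j r s v u else 0
  triangle : ∀ i j w, w ∈ D.N i j → D.F i D.one j i j w = 1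

variable {G : I → I → I → I → I → I → ℂ}

theorem sum_ite_ite_eq {K : Type*} [Fintype K] (P : K → Prop) [DecidablePred P] (a : K)
    [∀ x, Decidable (x = a)] (f : K → ℂ) :
    (∑ x, if P x then (if x = a then f x else 0) else 0) = if P a then f a else 0 := by
  rw [Finset.sum_eq_single a]
  · rw [if_pos rfl]
  · intro b _ hb
    rw [if_neg hb, ite_self]
  · simp

-- An entry vanishes unless the three factors and the total constituent agree. Where they agree,
-- what remains is one entry of a product of two matrices indexed by inner labels.
open Classical in
theorem IsCoherent.assoc_hom_inv (hD : D.IsCoherent G) (X Y Z : GradedVect I) :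
    D.assocHom X Y Z ≫ D.assocInv G X Y Z = 𝟙 _ := by
  refine ext_coeff fun p q => ?_
  obtain ⟨p, k, w, h₁, rfl⟩ := exists_idx p
  obtain ⟨i, j, s, h, rfl⟩ := exists_idx p
  obtain ⟨q, k', w', h₁', rfl⟩ := exists_idx q
  obtain ⟨i', j', s', h', rfl⟩ := exists_idx q
  simp only [push_comp, push_id, push_assocHom, push_assocInv, idx_inj]
  by_cases e : i = i' ∧ j = j' ∧ k = k' ∧ w = w'
  · obtain ⟨rfl, rfl, rfl, rfl⟩ := e
    rw [deg_idx] at h₁ h₁'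
    simp only [true_and, and_true, mul_ite, mul_one, mul_zero, sum_ite_ite_eq, h', h₁', dite_eq_ite,
      if_true]
    exact hD.inv_right _ _ _ _ _ _ h h₁ h' h₁'
  · have key : ∀ x, ¬ ((i = i' ∧ j = j' ∧ x = s') ∧ k = k' ∧ w = w') := by tauto
    simp [key]

open Classical in
theorem IsCoherent.assoc_inv_hom (hD : D.IsCoherent G) (X Y Z : GradedVect I) :
    D.assocInv G X Y Z ≫ D.assocHom X Y Z = 𝟙 _ := by
  refine ext_coeff fun p q => ?_
  obtain ⟨i, p, w, h₁, rfl⟩ := exists_idx p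
  obtain ⟨j, k, s, h, rfl⟩ := exists_idx p
  obtain ⟨i', q, w', h₁', rfl⟩ := exists_idx q
  obtain ⟨j', k', s', h', rfl⟩ := exists_idx q
  simp only [push_comp, push_id, push_assocHom, push_assocInv, idx_inj]
  by_cases e : i = i' ∧ j = j' ∧ k = k' ∧ w = w'
  · obtain ⟨rfl, rfl, rfl, rfl⟩ := e
    rw [deg_idx] at h₁ h₁'
    simp only [true_and, and_true, mul_ite, mul_one, mul_zero, sum_ite_ite_eq, h', h₁', dite_eq_ite,
      if_true]
    exact hD.inv_left _ _ _ _ _ _ h h₁ h' h₁'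
  · have key : ∀ x, ¬ (i = i' ∧ (j = j' ∧ k = k' ∧ x = s') ∧ w = w') := by tauto
    simp [key]

-- Fixing a source and a target basis vector fixes the labels `s`, `w` of the left-most bracketing
-- and `r`, `v` of the right-most one. The three-step path then has one free label `m`, while the
-- two-step path has none and exists only if `u` is a constituent of `s ⊗ r`.
open Classical in
theorem IsCoherent.pentagon_assocHom (hD : D.IsCoherent G) (W X Y Z : GradedVect I) :
    D.tensorHom (D.assocHom W X Y) (𝟙 Z) ≫ D.assocHom W (D.tensorObj X Y) Z ≫
        D.tensorHom (𝟙 W) (D.assocHom X Y Z) =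
      D.assocHom (D.tensorObj W X) Y Z ≫ D.assocHom W X (D.tensorObj Y Z) := by
  refine ext_coeff fun p q => ?_
  obtain ⟨p, l, u, h₂, rfl⟩ := exists_idx p
  obtain ⟨p, k, w, h₁, rfl⟩ := exists_idx p
  obtain ⟨i, j, s, h, rfl⟩ := exists_idx p
  obtain ⟨i', q, u', h₂', rfl⟩ := exists_idx q
  obtain ⟨j', q, v, h₁', rfl⟩ := exists_idx q
  obtain ⟨k', l', r, h', rfl⟩ := exists_idx q
  simp only [push_comp, push_id, push_assocHom, push_tensorHom, idx_inj]
  rw [deg_idx] at h₁ h₁' h₂ h₂'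
  by_cases e : i = i' ∧ j = j' ∧ k = k' ∧ l = l' ∧ u = u'
  · obtain ⟨rfl, rfl, rfl, rfl, rfl⟩ := e
    refine Eq.trans (Finset.sum_congr rfl fun m _ => ?_) ((hD.pentagon _ _ _ _ _ _ _ _ _ h h₁ h₂ h'
      h₁' h₂').trans ?_)
    · by_cases hm : m ∈ D.N (X.deg j) (Y.deg k) ∧ w ∈ D.N (W.deg i) m
      -- The sums over the labels produced by the second and third associators collapse, because the
      -- target basis vector prescribes `v` and `r`.
      · rw [dif_pos hm, dif_pos (mem_left h₂), Finset.sum_eq_single v, Finset.sum_eq_single r]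
        · by_cases hv : v ∈ D.N m (Z.deg l)
          · have hr : r ∈ D.N (Y.deg k) (Z.deg l) ∧ v ∈ D.N (X.deg j) r := ⟨h', h₁'⟩
            have hu : v ∈ D.N m (Z.deg l) ∧ u ∈ D.N (W.deg i) v := ⟨hv, h₂'⟩
            simp [hm, hr, hu]
          · simp [hv]
        · intro x _ hx
          simp [hx]
        · simp
        · intro x _ hx
          simp [hx]
        · simp
      · rw [dif_neg hm, if_neg (fun h => hm h.1)]
    · rw [Finset.sum_eq_single r]
      · by_cases hu : u ∈ D.N s r
        · rw [if_pos hu, dif_pos ⟨h', hu⟩, Finset.sum_eq_single v, dif_pos ⟨h₁', h₂'⟩]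
          · simp
          · intro x _ hx
            simp [hx]
          · simp
        · rw [if_neg hu, dif_neg (fun h => hu h.2)]
      · intro x _ hx
        simp [hx]
      · simp
  · have key : ∀ x y, ¬ (i = i' ∧ (j = j' ∧ (k = k' ∧ l = l' ∧ x = r) ∧ y = v) ∧ u = u') := by tauto
    simp [key]

theorem IsCoherent.exists_right (hD : D.IsCoherent G) {X : GradedVect I}
    (p : (D.tensorObj X (single D.one)).ι) : ∃ i h, p = D.idx i (pt D.one) (X.deg i) h := by
  obtain ⟨i, j, s, h, rfl⟩ := exists_idx p
  obtain rfl : s = X.deg i := (hD.one_right _ _).1 h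
  exact ⟨i, h, rfl⟩

theorem IsCoherent.exists_left (hD : D.IsCoherent G) {X : GradedVect I}
    (p : (D.tensorObj (single D.one) X).ι) :
    ∃ i h, p = D.idx (pt D.one) i (X.deg i) h := by
  obtain ⟨j, i, s, h, rfl⟩ := exists_idx p
  obtain rfl : s = X.deg i := (hD.one_left _ _).1 h
  exact ⟨i, h, rfl⟩

theorem IsCoherent.mem_one_right (hD : D.IsCoherent G) (X : GradedVect I) (i : X.ι)
    (u : (single D.one).ι) : X.deg i ∈ D.N (X.deg i) ((single D.one).deg u) :=
  (hD.one_right _ _).2 rfl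

theorem IsCoherent.mem_one_left (hD : D.IsCoherent G) (X : GradedVect I) (i : X.ι)
    (u : (single D.one).ι) : X.deg i ∈ D.N ((single D.one).deg u) (X.deg i) :=
  (hD.one_left _ _).2 rfl

open Classical in
theorem IsCoherent.leftHom_natural (hD : D.IsCoherent G) {X Y : GradedVect I} (f : X ⟶ Y) :
    D.tensorHom (𝟙 (single D.one)) f ≫ D.leftHom Y = D.leftHom X ≫ f := by
  refine ext_push fun p γ => ?_
  obtain ⟨i, h, rfl⟩ := hD.exists_left p
  simp only [push_comp, push_tensorHom, push_id]
  rw [push_leftHom _ _ _ _ _ rfl]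
  refine push_congr _ _ fun a ha => ?_
  have : X.deg i ∈ D.N ((single D.one).deg (pt D.one)) (Y.deg a) := (hD.one_left _ _).2 ha
  rw [dif_pos this, push_leftHom _ _ _ _ _ ha]

open Classical in
theorem IsCoherent.rightHom_natural (hD : D.IsCoherent G) {X Y : GradedVect I} (f : X ⟶ Y) :
    D.tensorHom f (𝟙 (single D.one)) ≫ D.rightHom Y = D.rightHom X ≫ f := by
  refine ext_push fun p γ => ?_
  obtain ⟨i, h, rfl⟩ := hD.exists_right p
  simp only [push_comp, push_tensorHom, push_id]
  rw [push_rightHom _ _ _ _ _ rfl]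
  refine push_congr _ _ fun a ha => ?_
  have : X.deg i ∈ D.N (Y.deg a) ((single D.one).deg (pt D.one)) := (hD.one_right _ _).2 ha
  rw [dif_pos this, push_rightHom _ _ _ _ _ ha]

/-- The inverse of the left unit map. -/
noncomputable def IsCoherent.leftInv (hD : D.IsCoherent G) (X : GradedVect I) :
    X ⟶ D.tensorObj (single D.one) X :=
  open Classical in
  ofMat fun i p => if p = D.idx (pt D.one) i _ (hD.mem_one_left X i _) then 1
    else 0

theorem IsCoherent.push_leftInv (hD : D.IsCoherent G) (X : GradedVect I) (i : X.ι)
    (γ : (D.tensorObj (single D.one) X).ι → ℂ) : push (hD.leftInv X) i γ =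
      γ (D.idx (pt D.one) i _ (hD.mem_one_left X i _)) := by
  rw [← one_mul (γ _)]
  refine push_of_apply ?_ (fun k hk => ?_) γ
  · exact (ofMat_of_eq (by rfl)).trans (if_pos rfl)
  · exact ofMat_eq_zero (if_neg hk)

/-- The inverse of the right unit map. -/
noncomputable def IsCoherent.rightInv (hD : D.IsCoherent G) (X : GradedVect I) :
    X ⟶ D.tensorObj X (single D.one) :=
  open Classical in
  ofMat fun i p => if p = D.idx i (pt D.one) _ (hD.mem_one_right X i _) then 1
    else 0

theorem IsCoherent.push_rightInv (hD : D.IsCoherent G) (X : GradedVect I) (i : X.ι)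
    (γ : (D.tensorObj X (single D.one)).ι → ℂ) : push (hD.rightInv X) i γ =
      γ (D.idx i (pt D.one) _ (hD.mem_one_right X i _)) := by
  rw [← one_mul (γ _)]
  refine push_of_apply ?_ (fun k hk => ?_) γ
  · exact (ofMat_of_eq (by rfl)).trans (if_pos rfl)
  · exact ofMat_eq_zero (if_neg hk)

theorem IsCoherent.left_hom_inv (hD : D.IsCoherent G) (X : GradedVect I) :
    D.leftHom X ≫ hD.leftInv X = 𝟙 _ := by
  refine ext_push fun p γ => ?_
  obtain ⟨i, h, rfl⟩ := hD.exists_left p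
  rw [push_comp, push_leftHom _ _ _ _ _ rfl, hD.push_leftInv, push_id]

theorem IsCoherent.left_inv_hom (hD : D.IsCoherent G) (X : GradedVect I) :
    hD.leftInv X ≫ D.leftHom X = 𝟙 _ := by
  refine ext_push fun p γ => ?_
  rw [push_comp, hD.push_leftInv, push_leftHom _ _ _ _ _ rfl, push_id]

theorem IsCoherent.right_hom_inv (hD : D.IsCoherent G) (X : GradedVect I) :
    D.rightHom X ≫ hD.rightInv X = 𝟙 _ := by
  refine ext_push fun p γ => ?_
  obtain ⟨i, h, rfl⟩ := hD.exists_right p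
  rw [push_comp, push_rightHom _ _ _ _ _ rfl, hD.push_rightInv, push_id]

theorem IsCoherent.right_inv_hom (hD : D.IsCoherent G) (X : GradedVect I) :
    hD.rightInv X ≫ D.rightHom X = 𝟙 _ := by
  refine ext_push fun p γ => ?_
  rw [push_comp, hD.push_rightInv, push_rightHom _ _ _ _ _ rfl, push_id]

theorem IsCoherent.triangle_assocHom (hD : D.IsCoherent G) (X Y : GradedVect I) :
    D.assocHom X (single D.one) Y ≫ D.tensorHom (𝟙 X) (D.leftHom Y) =
      D.tensorHom (D.rightHom X) (𝟙 Y) := by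
  classical
  refine ext_push fun p γ => ?_
  obtain ⟨p, j, w, h, rfl⟩ := exists_idx p
  obtain ⟨i, h₁, rfl⟩ := hD.exists_right p
  simp only [push_comp, push_tensorHom, push_id, push_assocHom]
  rw [Finset.sum_eq_single (Y.deg j)]
  · have hr : Y.deg j ∈ D.N ((single D.one).deg (pt D.one)) (Y.deg j) ∧
        w ∈ D.N (X.deg i) (Y.deg j) := ⟨hD.mem_one_left Y j _, h⟩
    rw [dif_pos hr, push_leftHom _ _ _ _ _ rfl, push_rightHom _ _ _ _ _ rfl]
    rw [show D.F (X.deg i) ((single D.one).deg (pt D.one)) (Y.deg j) (X.deg i) (Y.deg j) w = 1 from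
      hD.triangle _ _ _ h, one_mul]
  · intro r _ hr
    rw [dif_neg]
    exact fun e => hr ((hD.one_left _ _).1 e.1)
  · simp

theorem IsCoherent.isTensor (hD : D.IsCoherent G) : D.IsTensor := by
  have inv : D.Invertible :=
    { assoc := fun X Y Z => ⟨D.assocInv G X Y Z, hD.assoc_hom_inv X Y Z, hD.assoc_inv_hom X Y Z⟩
      left := fun X => ⟨hD.leftInv X, hD.left_hom_inv X, hD.left_inv_hom X⟩
      right := fun X => ⟨hD.rightInv X, hD.right_hom_inv X, hD.right_inv_hom X⟩ }
  let _ := inv.toStruct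
  refine ⟨inv, ?_⟩
  exact
    { tensorHom_def := fun {X₁ Y₁ X₂ Y₂} f g => by
        change D.tensorHom f g = D.tensorHom f (𝟙 X₂) ≫ D.tensorHom (𝟙 Y₁) g
        rw [tensorHom_comp, Category.comp_id, Category.id_comp]
      id_tensorHom_id := fun X Y => tensorHom_id X Y
      tensorHom_comp_tensorHom := fun f₁ f₂ g₁ g₂ => tensorHom_comp f₁ f₂ g₁ g₂
      whiskerLeft_id := fun X Y => tensorHom_id X Y
      id_whiskerRight := fun X Y => tensorHom_id X Y
      associator_naturality := fun f₁ f₂ f₃ => assocHom_natural f₁ f₂ f₃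
      leftUnitor_naturality := fun f => hD.leftHom_natural f
      rightUnitor_naturality := fun f => hD.rightHom_natural f
      pentagon := fun W X Y Z => hD.pentagon_assocHom W X Y Z
      triangle := fun X Y => hD.triangle_assocHom X Y }

end FusionDatum

/-! ### Relabelling functors and monomial isomorphisms -/

namespace GradedVect

variable {I : Type u}

/-- The basis vector of a relabelled space. -/
def up {J : Type u} (f : I → J) {X : GradedVect I} (i : X.ι) : ((relabel f).obj X).ι := i

@[simp] theorem deg_up {J : Type u} (f : I → J) {X : GradedVect I} (i : X.ι) :
    ((relabel f).obj X).deg (up f i) = f (X.deg i) := rfl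

theorem exists_up {J : Type u} (f : I → J) {X : GradedVect I} (p : ((relabel f).obj X).ι) :
    ∃ i, p = up f i := ⟨p, rfl⟩

theorem up_inj {J : Type u} (f : I → J) {X : GradedVect I} {i j : X.ι} :
    up f i = up f j ↔ i = j := Iff.rfl

theorem push_relabel_up {J : Type u} (f : I → J) {X Y : GradedVect I} (g : X ⟶ Y) (p : X.ι)
    (γ : ((relabel f).obj Y).ι → ℂ) :
    push ((relabel f).map g) (up f p) γ = push g p fun q => γ (up f q) := rfl

/-- A monomial matrix is inverted by inverting its entries and the underlying bijection. The inverse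
preserves degrees because a nonzero entry of `f` already forces the two degrees to agree. -/
theorem isIso_of_push {X Y : GradedVect I} {f : X ⟶ Y} {φ : X.ι → Y.ι}
    (hφ : Function.Bijective φ) {c : X.ι → ℂ} (hc : ∀ p, c p ≠ 0)
    (h : ∀ p γ, push f p γ = c p * γ (φ p)) : IsIso f := by
  classical
  have hf : ∀ p q, coeff f p q = if φ p = q then c p else 0 := by
    intro p q
    rw [← push_single, h, mul_ite, mul_one, mul_zero]
  have deg : ∀ p, X.deg p = Y.deg (φ p) := by
    intro p
    by_contra e
    have := hf p (φ p)
    rw [coeff_of_ne f e, if_pos rfl] at this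
    exact hc p this.symm
  let g : Y ⟶ X := ofMat fun q p => if φ p = q then (c p)⁻¹ else 0
  have hg : ∀ p γ, push g (φ p) γ = (c p)⁻¹ * γ p := by
    intro p γ
    refine push_of_apply ?_ (fun p₁ hp => ?_) γ
    · exact (ofMat_of_eq (deg p).symm).trans (if_pos rfl)
    · exact ofMat_eq_zero (if_neg fun e => hp (hφ.1 e))
  refine ⟨g, ext_push fun p γ => ?_, ext_push fun q γ => ?_⟩
  · rw [push_comp, h, hg, push_id, mul_inv_cancel_left₀ (hc p)]
  · obtain ⟨p, rfl⟩ := hφ.2 q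
    rw [push_comp, hg, h, push_id, inv_mul_cancel_left₀ (hc p)]

/-- For an inverse that is only known through `IsIso`, such as the inverse tensor structure in the
definition of the quantum dimension. -/
theorem push_inv {X Y : GradedVect I} {f : X ⟶ Y} [IsIso f] {p : X.ι} {q : Y.ι} {c : ℂ}
    (hc : c ≠ 0) (h : ∀ γ, push f p γ = c * γ q) (γ : X.ι → ℂ) :
    push (inv f) q γ = c⁻¹ * γ p := by
  have : push (f ≫ inv f) p γ = γ p := by rw [IsIso.hom_inv_id, push_id]
  rw [push_comp, h] at this
  rw [← this, inv_mul_cancel_left₀ hc]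

end GradedVect

/-! ### Comparison maps between `f(X ⊗ Y)` and `f X ⊗ f Y` -/

namespace FusionDatum

open GradedVect

section Unit

variable {I J : Type u} (D : FusionDatum I) (E : FusionDatum J)

/-- The map `f(𝟙) ⟶ 𝟙`. -/
noncomputable def tauOne (f : I → J) : (relabel f).obj (single D.one) ⟶ single E.one :=
  ofMat fun _ _ => 1

variable {D E}

theorem mem_up {f : I → J} {X Y : GradedVect I} {i : X.ι} {j : Y.ι} {s : I}
    (h : f s ∈ E.N (f (X.deg i)) (f (Y.deg j))) :
    f s ∈ E.N (((relabel f).obj X).deg (up f i)) (((relabel f).obj Y).deg (up f j)) := h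

theorem push_tauOne {f : I → J} (h : f D.one = E.one) (γ : (single E.one).ι → ℂ) :
    push (D.tauOne E f) (up f (pt D.one)) γ = γ (pt E.one) := by
  rw [← one_mul (γ _)]
  refine push_of_apply ?_ (fun q hq => ?_) γ
  · exact ofMat_of_eq h
  · exact absurd (eq_pt q) hq

theorem isIso_tauOne {f : I → J} (h : f D.one = E.one) : IsIso (D.tauOne E f) := by
  refine isIso_of_push (φ := fun _ => pt E.one) ⟨fun _ _ _ => rfl, fun q => ⟨pt D.one, rfl⟩⟩
    (c := fun _ => 1) (fun _ => one_ne_zero) fun p γ => ?_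
  rw [show p = up f (pt D.one) from rfl, push_tauOne h, one_mul]

end Unit

section Maps

variable {I J : Type u} [Finite I] [Finite J] (D : FusionDatum I) (E : FusionDatum J)

open Classical in
/-- The map `f(X ⊗ Y) ⟶ f X ⊗ f Y` with coefficients `t`. -/
noncomputable def tauHom (f : I → J) (t : I → I → I → ℂ) (X Y : GradedVect I) :
    (relabel f).obj (D.tensorObj X Y) ⟶
      E.tensorObj ((relabel f).obj X) ((relabel f).obj Y) :=
  ofMat (X := (relabel f).obj (D.tensorObj X Y))
    (Y := E.tensorObj ((relabel f).obj X) ((relabel f).obj Y)) fun p q =>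
    if p.1.1 = q.1.1 ∧ p.1.2.1 = q.1.2.1 then
      t (X.deg p.1.1) (Y.deg p.1.2.1) p.1.2.2
    else 0

variable {D E}

theorem push_tauHom {f : I → J} {t : I → I → I → ℂ} {X Y : GradedVect I}
    (i : X.ι) (j : Y.ι) (s : I) (h) (h₁)
    (γ : (E.tensorObj ((relabel f).obj X) ((relabel f).obj Y)).ι → ℂ) :
    push (D.tauHom E f t X Y) (up f (D.idx i j s h)) γ =
      t (X.deg i) (Y.deg j) s * γ (E.idx (up f i) (up f j) (f s) h₁) := by
  refine push_of_apply ?_ (fun q hq => ?_) γ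
  · exact (ofMat_of_eq (by rfl)).trans (if_pos ⟨rfl, rfl⟩)
  · obtain ⟨i₁, j₁, s₁, h₂, rfl⟩ := exists_idx q
    by_cases hs : f s = s₁
    · refine ofMat_eq_zero (if_neg ?_)
      rintro ⟨h₃, h₄⟩
      obtain rfl : i = i₁ := h₃
      obtain rfl : j = j₁ := h₄
      subst hs
      exact hq rfl
    · exact ofMat_of_ne hs

/-- The map on basis vectors is injective since `f` is, and surjective since by `hs` a product of
labels in the image of `f` has no constituents outside that image. -/
theorem isIso_tauHom {f : I → J} {t : I → I → I → ℂ} (hf : Function.Injective f)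
    (hN : ∀ i j s, s ∈ D.N i j ↔ f s ∈ E.N (f i) (f j))
    (hs : ∀ i j w, w ∈ E.N (f i) (f j) → ∃ s, f s = w)
    (ht : ∀ i j s, s ∈ D.N i j → t i j s ≠ 0) (X Y : GradedVect I) :
    IsIso (D.tauHom E f t X Y) := by
  refine isIso_of_push (φ := fun p => E.idx (up f p.1.1) (up f p.1.2.1) (f p.1.2.2)
    ((hN _ _ _).1 p.2)) ⟨?_, ?_⟩ (c := fun p => t (X.deg p.1.1) (Y.deg p.1.2.1) p.1.2.2) ?_ ?_
  · intro p q e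
    obtain ⟨p, hp⟩ := exists_up f p
    obtain ⟨q, hq⟩ := exists_up f q
    obtain ⟨i, j, s, h, rfl⟩ := exists_idx p
    obtain ⟨i₁, j₁, s₁, h₁, rfl⟩ := exists_idx q
    subst hp hq
    obtain ⟨e₁, e₂, e₃⟩ := idx_inj.1 e
    obtain rfl : i = i₁ := e₁
    obtain rfl : j = j₁ := e₂
    obtain rfl : s = s₁ := hf e₃
    rfl
  · intro q
    obtain ⟨i, j, s, h, rfl⟩ := exists_idx q
    obtain ⟨s, rfl⟩ := hs _ _ _ h
    exact ⟨up f (D.idx (X := X) (Y := Y) i j s ((hN _ _ _).2 h)), rfl⟩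
  · exact fun p => ht _ _ _ p.2
  · intro p γ
    obtain ⟨p, hp⟩ := exists_up f p
    obtain ⟨i, j, s, h, rfl⟩ := exists_idx p
    subst hp
    exact push_tauHom i j s h _ γ

end Maps

section Equations

variable {I J : Type u} [Fintype I] [Fintype J] {D : FusionDatum I} {E : FusionDatum J}
  {f : I → J} {t : I → I → I → ℂ}

open Classical in
theorem tauHom_natural
    (hN : ∀ i j s, s ∈ D.N i j ↔ f s ∈ E.N (f i) (f j)) {X X₁ Y Y₁ : GradedVect I}
    (a : X ⟶ X₁) (b : Y ⟶ Y₁) :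
    (relabel f).map (D.tensorHom a b) ≫ D.tauHom E f t X₁ Y₁ =
      D.tauHom E f t X Y ≫ E.tensorHom ((relabel f).map a) ((relabel f).map b) := by
  refine ext_push fun p γ => ?_
  obtain ⟨p, hp⟩ := exists_up f p
  obtain ⟨i, j, s, h, rfl⟩ := exists_idx p
  subst hp
  rw [push_comp, push_comp, push_relabel_up, push_tensorHom,
    push_tauHom _ _ _ _ (mem_up ((hN _ _ _).1 h)), push_tensorHom, push_relabel_up, ← push_mul_left]
  refine push_congr _ _ fun i₁ hi => ?_
  rw [push_relabel_up, ← push_mul_left]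
  refine push_congr _ _ fun j₁ hj => ?_
  have h₁ : s ∈ D.N (X₁.deg i₁) (Y₁.deg j₁) := hi ▸ hj ▸ h
  have h₂ := mem_up ((hN _ _ _).1 h₁)
  rw [dif_pos h₁, push_tauHom _ _ _ _ h₂, dif_pos h₂, hi, hj]

-- Stated for an arbitrary map of labels, so that it serves both a group element acting on one
-- category and the embedding of the neutral component with `t = 1`.
open Classical in
theorem tauHom_assoc
    (hN : ∀ i j s, s ∈ D.N i j ↔ f s ∈ E.N (f i) (f j)) (hf : Function.Injective f)
    (hs : ∀ i j w, w ∈ E.N (f i) (f j) → ∃ s, f s = w)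
    (ht : ∀ i j k s r w, s ∈ D.N i j → w ∈ D.N s k → r ∈ D.N j k → w ∈ D.N i r →
      t s k w * t i j s * E.F (f i) (f j) (f k) (f s) (f r) (f w) =
        D.F i j k s r w * t i r w * t j k r) (X Y Z : GradedVect I) :
    D.tauHom E f t (D.tensorObj X Y) Z ≫
      E.tensorHom (D.tauHom E f t X Y) (𝟙 ((relabel f).obj Z)) ≫ E.assocHom _ _ _ =
    (relabel f).map (D.assocHom X Y Z) ≫ D.tauHom E f t X (D.tensorObj Y Z) ≫
      E.tensorHom (𝟙 ((relabel f).obj X)) (D.tauHom E f t Y Z) := by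
  refine ext_push fun p γ => ?_
  obtain ⟨p, hp⟩ := exists_up f p
  obtain ⟨p, k, w, h₁, rfl⟩ := exists_idx p
  obtain ⟨i, j, s, h, rfl⟩ := exists_idx p
  subst hp
  have h₂ := mem_up ((hN _ _ _).1 h)
  have h₃ := mem_up ((hN _ _ _).1 h₁)
  rw [push_comp, push_tauHom _ _ _ _ h₃, push_comp, push_tensorHom, push_tauHom _ _ _ _ h₂,
    push_id]
  have h₄ : f w ∈ E.N ((E.tensorObj ((relabel f).obj X) ((relabel f).obj Y)).deg
      (E.idx (up f i) (up f j) (f s) h₂)) (((relabel f).obj Z).deg (up f k)) := h₃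
  rw [dif_pos h₄, push_assocHom, push_comp, push_relabel_up, push_assocHom, Finset.mul_sum,
    Finset.mul_sum]
  symm
  -- The inner label runs over `J` on one side and over `I` on the other. Constituents of `f j ⊗ f
  -- k` come from `I`, so the sums match term by term.
  refine Fintype.sum_of_injective f hf _ _ (fun r hr => ?_) fun r => ?_
  · rw [dif_neg, mul_zero, mul_zero]
    exact fun e => hr (hs _ _ _ e.1)
  by_cases e : r ∈ D.N (Y.deg j) (Z.deg k) ∧ w ∈ D.N (X.deg i) r
  · have e₁ := mem_up ((hN _ _ _).1 e.1)
    have e₂ : f w ∈ E.N (((relabel f).obj X).deg (up f i)) (f r) := (hN _ _ _).1 e.2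
    have e₃ : f w ∈ E.N (((relabel f).obj X).deg (up f i))
        (((relabel f).obj (D.tensorObj Y Z)).deg (up f (D.idx j k r e.1))) := e₂
    rw [dif_pos e, push_comp, push_tauHom _ _ _ _ e₃, push_tensorHom, push_id,
      push_tauHom _ _ _ _ e₁, dif_pos (mem_right e₂), dif_pos ⟨e₁, e₂⟩]
    have := ht _ _ _ _ _ _ h h₁ e.1 e.2
    simp only [deg_up, deg_idx] at this ⊢
    linear_combination - γ (E.idx (up f i) (E.idx (up f j) (up f k) (f r) e₁) (f w)
      (mem_right e₂)) * this
  · rw [dif_neg e, dif_neg (fun e₁ => e ⟨(hN _ _ _).2 e₁.1, (hN _ _ _).2 e₁.2⟩)]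
    ring

variable {F' : I → I → I → I → I → I → ℂ} {F'' : J → J → J → J → J → J → ℂ}

open Classical in
theorem tauHom_left (hD : D.IsCoherent F') (hE : E.IsCoherent F'')
    (h₁ : f D.one = E.one) (ht : ∀ i, t D.one i i = 1) (X : GradedVect I) :
    (relabel f).map (D.leftHom X) = D.tauHom E f t (single D.one) X ≫
      E.tensorHom (D.tauOne E f) (𝟙 ((relabel f).obj X)) ≫ E.leftHom _ := by
  refine ext_push fun p γ => ?_
  obtain ⟨p, hp⟩ := exists_up f p
  obtain ⟨i, h, rfl⟩ := hD.exists_left p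
  subst hp
  have e : f (X.deg i) ∈ E.N (f ((single D.one).deg (pt D.one))) (f (X.deg i)) := by
    rw [deg_pt, h₁, hE.one_left]
  replace e := mem_up e
  have e₁ : f (X.deg i) ∈ E.N ((single E.one).deg (pt E.one))
    (((relabel f).obj X).deg (up f i)) := by
    rw [deg_pt, hE.one_left, deg_up]
  rw [push_relabel_up, push_leftHom _ _ _ _ _ rfl, push_comp, push_tauHom _ _ _ _ e, push_comp,
    push_tensorHom, push_tauOne h₁, push_id, dif_pos e₁,
    push_leftHom _ _ _ _ _ (deg_up f i).symm, deg_pt, ht, one_mul]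

open Classical in
theorem tauHom_right (hD : D.IsCoherent F') (hE : E.IsCoherent F'')
    (h₁ : f D.one = E.one) (ht : ∀ i, t i D.one i = 1) (X : GradedVect I) :
    (relabel f).map (D.rightHom X) = D.tauHom E f t X (single D.one) ≫
      E.tensorHom (𝟙 ((relabel f).obj X)) (D.tauOne E f) ≫ E.rightHom _ := by
  refine ext_push fun p γ => ?_
  obtain ⟨p, hp⟩ := exists_up f p
  obtain ⟨i, h, rfl⟩ := hD.exists_right p
  subst hp
  have e : f (X.deg i) ∈ E.N (f (X.deg i)) (f ((single D.one).deg (pt D.one))) := by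
    rw [deg_pt, h₁, hE.one_right]
  replace e := mem_up e
  have e₁ : f (X.deg i) ∈ E.N (((relabel f).obj X).deg (up f i))
    ((single E.one).deg (pt E.one)) := by
    rw [deg_pt, hE.one_right, deg_up]
  rw [push_relabel_up, push_rightHom _ _ _ _ _ rfl, push_comp, push_tauHom _ _ _ _ e, push_comp,
    push_tensorHom, push_id, push_tauOne h₁, dif_pos e₁,
    push_rightHom _ _ _ _ _ (deg_up f i).symm, deg_pt, ht, one_mul]

end Equations

end FusionDatum

/-! ### Group actions from scalar data -/

namespace FusionDatum

open GradedVect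

section Action

variable {I : Type u} {G : Type} [Group G]

/-- The map on labels given by a group element. -/
def act (ρ : G →* Function.End I) (g : G) : I → I := ρ g

theorem act_one (ρ : G →* Function.End I) (i : I) : act ρ 1 i = i := by
  rw [act, map_one]
  rfl

theorem act_mul (ρ : G →* Function.End I) (g h : G) (i : I) :
    act ρ (g * h) i = act ρ g (act ρ h i) := by
  rw [act, map_mul]
  rfl

theorem bijective_act (ρ : G →* Function.End I) (g : G) : Function.Bijective (act ρ g) := by
  refine Function.bijective_iff_has_inverse.2 ⟨act ρ g⁻¹, fun i => ?_, fun i => ?_⟩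
  · rw [← act_mul, inv_mul_cancel, act_one]
  · rw [← act_mul, mul_inv_cancel, act_one]

/-- The isomorphism `(gh)_* X ≅ g_* h_* X` given by the identity matrix. -/
noncomputable def compIso (ρ : G →* Function.End I) (g h : G) (X : GradedVect I) :
    (relabel (act ρ (g * h))).obj X ≅ (relabel (act ρ g)).obj ((relabel (act ρ h)).obj X) :=
  isoOfDeg X fun i => act_mul ρ g h (X.deg i)

/-- The isomorphism `1_* X ≅ X` given by the identity matrix. -/
noncomputable def unitIso (ρ : G →* Function.End I) (X : GradedVect I) :
    (relabel (act ρ 1)).obj X ≅ X :=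
  isoOfDeg X fun i => act_one ρ (X.deg i)

/-- The composition isomorphism `k_* ≅ g_* h_*` where `k` equals `gh`. -/
noncomputable def compIsoOf (ρ : G →* Function.End I) {k g h : G} (e : k = g * h)
    (X : GradedVect I) :
    (relabel (act ρ k)).obj X ≅ (relabel (act ρ g)).obj ((relabel (act ρ h)).obj X) :=
  isoOfDeg X fun i => by
    subst e
    exact act_mul ρ g h (X.deg i)

theorem push_compIsoOf_hom (ρ : G →* Function.End I) {k g h : G} (e : k = g * h)
    (X : GradedVect I) (i : X.ι) (γ) :
    push (compIsoOf ρ e X).hom (up (act ρ k) i) γ = γ (up (act ρ g) (up (act ρ h) i)) :=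
  push_isoOfDeg_hom X _ i γ

theorem push_compIsoOf_inv (ρ : G →* Function.End I) {k g h : G} (e : k = g * h)
    (X : GradedVect I) (i : X.ι) (γ) :
    push (compIsoOf ρ e X).inv (up (act ρ g) (up (act ρ h) i)) γ = γ (up (act ρ k) i) :=
  push_isoOfDeg_inv X _ i γ

theorem push_compIso_hom (ρ : G →* Function.End I) (g h : G) (X : GradedVect I) (i : X.ι) (γ) :
    push (compIso ρ g h X).hom (up (act ρ (g * h)) i) γ = γ (up (act ρ g) (up (act ρ h) i)) :=
  push_isoOfDeg_hom X _ i γ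

theorem push_compIso_inv (ρ : G →* Function.End I) (g h : G) (X : GradedVect I) (i : X.ι) (γ) :
    push (compIso ρ g h X).inv (up (act ρ g) (up (act ρ h) i)) γ = γ (up (act ρ (g * h)) i) :=
  push_isoOfDeg_inv X _ i γ

theorem push_unitIso_hom (ρ : G →* Function.End I) (X : GradedVect I) (i : X.ι) (γ) :
    push (unitIso ρ X).hom (up (act ρ 1) i) γ = γ i :=
  push_isoOfDeg_hom X _ i γ

theorem push_unitIso_inv (ρ : G →* Function.End I) (X : GradedVect I) (i : X.ι) (γ) :
    push (unitIso ρ X).inv i γ = γ (up (act ρ 1) i) :=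
  push_isoOfDeg_inv X _ i γ

/-- Transport along an equality of group elements is the identity matrix after substitution.
Afterwards no `eqToIso` has to be handled. -/
theorem T₂Of_eq [Finite I] {D : FusionDatum I} (hD : D.IsTensor) (ρ : G →* Function.End I)
    (t : G → I → I → I → ℂ) {k g h : G} (e : k = g * h) (X : Cat hD) :
    (actionData hD ρ t).T₂Of e X = compIsoOf ρ e X := by
  subst e
  exact Iso.ext (@Category.id_comp (GradedVect I) _ _ _ _)

end Action

section Coherence

variable {I : Type u} {G : Type} [Group G]

/-- The equations that make `t` the tensor structure of an action. -/
structure IsActionCoherent (D : FusionDatum I) (ρ : G →* Function.End I)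
    (t : G → I → I → I → ℂ) : Prop where
  mem : ∀ g i j s, s ∈ D.N i j ↔ act ρ g s ∈ D.N (act ρ g i) (act ρ g j)
  one : ∀ g, act ρ g D.one = D.one
  ne_zero : ∀ g i j s, s ∈ D.N i j → t g i j s ≠ 0
  assoc : ∀ g i j k s r w, s ∈ D.N i j → w ∈ D.N s k → r ∈ D.N j k → w ∈ D.N i r →
    t g s k w * t g i j s * D.F (act ρ g i) (act ρ g j) (act ρ g k) (act ρ g s) (act ρ g r) (act ρ g w) =
      D.F i j k s r w * t g i r w * t g j k r
  left : ∀ g i, t g D.one i i = 1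
  right : ∀ g i, t g i D.one i = 1
  mul : ∀ g h i j s, s ∈ D.N i j →
    t (g * h) i j s = t h i j s * t g (act ρ h i) (act ρ h j) (act ρ h s)
  t_one : ∀ i j s, s ∈ D.N i j → t 1 i j s = 1

variable {D : FusionDatum I} {ρ : G →* Function.End I} {t : G → I → I → I → ℂ}

theorem compIso_natural (g h : G) {X Y : GradedVect I} (f : X ⟶ Y) :
    (relabel (act ρ (g * h))).map f ≫ (compIso ρ g h Y).hom =
      (compIso ρ g h X).hom ≫ (relabel (act ρ g)).map ((relabel (act ρ h)).map f) := by
  refine ext_push fun p γ => ?_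
  obtain ⟨p, hp⟩ := exists_up _ p
  rw [hp]
  simp only [push_comp, push_relabel_up, push_compIso_hom]

theorem unitIso_natural {X Y : GradedVect I} (f : X ⟶ Y) :
    (relabel (act ρ 1)).map f ≫ (unitIso ρ Y).hom = (unitIso ρ X).hom ≫ f := by
  refine ext_push fun p γ => ?_
  obtain ⟨p, hp⟩ := exists_up _ p
  rw [hp]
  simp only [push_comp, push_relabel_up, push_unitIso_hom]

theorem compIso_assoc (g h l : G) (X : GradedVect I) :
    (compIso ρ (g * h) l X).hom ≫ (compIso ρ g h ((relabel (act ρ l)).obj X)).hom =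
      (compIsoOf ρ (mul_assoc g h l) X).hom ≫ (relabel (act ρ g)).map (compIso ρ h l X).hom := by
  refine ext_push fun p γ => ?_
  obtain ⟨p, hp⟩ := exists_up _ p
  rw [hp, push_comp, push_compIso_hom, push_compIso_hom, push_comp, push_compIsoOf_hom,
    push_relabel_up, push_compIso_hom]

theorem compIso_one_left (g : G) (X : GradedVect I) :
    (compIsoOf ρ (one_mul g).symm X).hom ≫ (unitIso ρ ((relabel (act ρ g)).obj X)).hom = 𝟙 _ := by
  refine ext_push fun p γ => ?_
  obtain ⟨p, hp⟩ := exists_up _ p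
  rw [hp, push_comp, push_compIsoOf_hom, push_unitIso_hom, push_id]

theorem compIso_one_right (g : G) (X : GradedVect I) :
    (compIsoOf ρ (mul_one g).symm X).hom ≫ (relabel (act ρ g)).map (unitIso ρ X).hom = 𝟙 _ := by
  refine ext_push fun p γ => ?_
  obtain ⟨p, hp⟩ := exists_up _ p
  rw [hp, push_comp, push_compIsoOf_hom, push_relabel_up, push_unitIso_hom, push_id]

theorem IsActionCoherent.tauOne_one (h : IsActionCoherent D ρ t) :
    D.tauOne D (act ρ 1) = (unitIso ρ (single D.one)).hom := by
  refine ext_push fun p γ => ?_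
  rw [show p = up (act ρ 1) (pt D.one) from rfl, push_tauOne (h.one _), push_unitIso_hom]

variable [Fintype I]

open Classical in
theorem IsActionCoherent.tauHom_mul (h : IsActionCoherent D ρ t) (g k : G) (X Y : GradedVect I) :
    D.tauHom D (act ρ (g * k)) (t (g * k)) X Y ≫
        D.tensorHom (compIso ρ g k X).hom (compIso ρ g k Y).hom =
      (compIso ρ g k (D.tensorObj X Y)).hom ≫ (relabel (act ρ g)).map (D.tauHom D (act ρ k) (t k) X Y) ≫
        D.tauHom D (act ρ g) (t g) ((relabel (act ρ k)).obj X) ((relabel (act ρ k)).obj Y) := by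
  refine ext_push fun p γ => ?_
  obtain ⟨p, hp⟩ := exists_up _ p
  obtain ⟨i, j, s, hs, rfl⟩ := exists_idx p
  subst hp
  have e₁ := mem_up ((h.mem (g * k) _ _ _).1 hs)
  have e₂ := mem_up ((h.mem k _ _ _).1 hs)
  have e₃ := mem_up ((h.mem g _ _ _).1 e₂)
  have e₄ : act ρ (g * k) s ∈ D.N (((relabel (act ρ g)).obj ((relabel (act ρ k)).obj X)).deg
      (up (act ρ g) (up (act ρ k) i))) (((relabel (act ρ g)).obj ((relabel (act ρ k)).obj Y)).deg
      (up (act ρ g) (up (act ρ k) j))) := by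
    rw [act_mul]
    exact e₃
  rw [push_comp, push_tauHom _ _ _ _ e₁, push_tensorHom, push_compIso_hom, push_compIso_hom,
    dif_pos e₄, push_comp, push_compIso_hom, push_comp, push_relabel_up, push_tauHom _ _ _ _ e₂,
    push_tauHom _ _ _ _ e₃, h.mul _ _ _ _ _ hs, mul_assoc]
  simp only [deg_up, act_mul]

theorem IsActionCoherent.tauOne_mul (h : IsActionCoherent D ρ t) (g k : G) :
    D.tauOne D (act ρ (g * k)) = (compIso ρ g k (single D.one)).hom ≫
      (relabel (act ρ g)).map (D.tauOne D (act ρ k)) ≫ D.tauOne D (act ρ g) := by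
  refine ext_push fun p γ => ?_
  rw [show p = up (act ρ (g * k)) (pt D.one) from rfl, push_tauOne (h.one _), push_comp,
    push_compIso_hom, push_comp, push_relabel_up, push_tauOne (h.one _), push_tauOne (h.one _)]

open Classical in
theorem IsActionCoherent.tauHom_one (h : IsActionCoherent D ρ t) (X Y : GradedVect I) :
    D.tauHom D (act ρ 1) (t 1) X Y ≫ D.tensorHom (unitIso ρ X).hom (unitIso ρ Y).hom =
      (unitIso ρ (D.tensorObj X Y)).hom := by
  refine ext_push fun p γ => ?_
  obtain ⟨p, hp⟩ := exists_up _ p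
  obtain ⟨i, j, s, hs, rfl⟩ := exists_idx p
  subst hp
  have e₁ := mem_up ((h.mem 1 _ _ _).1 hs)
  have e₂ : act ρ 1 s ∈ D.N (X.deg i) (Y.deg j) := by rwa [act_one]
  rw [push_comp, push_tauHom _ _ _ _ e₁, push_tensorHom, push_unitIso_hom, push_unitIso_hom,
    push_unitIso_hom, dif_pos e₂, h.t_one _ _ _ hs, one_mul]
  simp only [act_one]

instance relabel_additive {J : Type u} (f : I → J) : (relabel f).Additive where
  map_add := rfl

instance relabel_linear {J : Type u} (f : I → J) : (relabel f).Linear ℂ where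
  map_smul _ _ := rfl

theorem IsActionCoherent.isAction {F' : I → I → I → I → I → I → ℂ} (hC : D.IsCoherent F')
    (h : IsActionCoherent D ρ t) (hD : D.IsTensor) : (actionData hD ρ t).IsAction where
  additive g := relabel_additive (act ρ g)
  linear g := relabel_linear (act ρ g)
  T₂_natural g h _ _ f := compIso_natural g h f
  T₀_natural f := unitIso_natural f
  T₂_assoc g h l X := by
    rw [T₂Of_eq]
    exact compIso_assoc g h l X
  T₂_one_left g X := by
    rw [T₂Of_eq]
    exact compIso_one_left g X
  T₂_one_right g X := by
    rw [T₂Of_eq]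
    exact compIso_one_right g X
  τ_iso g X Y := isIso_tauHom (bijective_act ρ g).1 (h.mem g) (fun _ _ w _ => (bijective_act ρ g).2 w) (h.ne_zero g) X Y
  τ₀_iso g := isIso_tauOne (h.one g)
  τ_natural g _ _ _ _ f k := tauHom_natural (h.mem g) f k
  τ_assoc g X Y Z := tauHom_assoc (h.mem g) (bijective_act ρ g).1 (fun _ _ w _ => (bijective_act ρ g).2 w) (h.assoc g) X Y Z
  τ_left_unit g X := tauHom_left hC hC (h.one g) (h.left g) X
  τ_right_unit g X := tauHom_right hC hC (h.one g) (h.right g) X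
  τ_T₂ g k X Y := h.tauHom_mul g k X Y
  τ₀_T₂ g k := h.tauOne_mul g k
  τ_T₀ X Y := h.tauHom_one X Y
  τ₀_T₀ := h.tauOne_one

end Coherence

end FusionDatum

/-! ### Crossed braidings from scalar data -/

namespace FusionDatum

open GradedVect

section Maps

variable {I : Type u} [Finite I] (D : FusionDatum I)

open Classical in
/-- The map `X ⊗ Y ⟶ f Y ⊗ X` with coefficients `R`. -/
noncomputable def crossHom (f : I → I) (R : I → I → I → ℂ) (X Y : GradedVect I) :
    D.tensorObj X Y ⟶ D.tensorObj ((relabel f).obj Y) X :=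
  ofMat (X := D.tensorObj X Y) (Y := D.tensorObj ((relabel f).obj Y) X) fun p q =>
    if p.1.1 = q.1.2.1 ∧ p.1.2.1 = q.1.1 then
      R (X.deg p.1.1) (Y.deg p.1.2.1) p.1.2.2
    else 0

variable {D}

theorem push_crossHom {f : I → I} {R : I → I → I → ℂ} {X Y : GradedVect I}
    (i : X.ι) (j : Y.ι) (s : I) (h) (h₁)
    (γ : (D.tensorObj ((relabel f).obj Y) X).ι → ℂ) :
    push (D.crossHom f R X Y) (D.idx i j s h) γ =
      R (X.deg i) (Y.deg j) s * γ (D.idx (up f j) i s h₁) := by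
  refine push_of_apply ?_ (fun q hq => ?_) γ
  · exact (ofMat_of_eq (by rfl)).trans (if_pos ⟨rfl, rfl⟩)
  · obtain ⟨j₁, i₁, s₁, h₂, rfl⟩ := exists_idx q
    by_cases hs : s = s₁
    · refine ofMat_eq_zero (if_neg ?_)
      rintro ⟨h₃, h₄⟩
      obtain rfl : i = i₁ := h₃
      obtain rfl : j = j₁ := h₄
      subst hs
      exact hq rfl
    · exact ofMat_of_ne hs

theorem isIso_crossHom {f : I → I} {R : I → I → I → ℂ} {X Y : GradedVect I}
    (hN : ∀ (i : X.ι) j s, s ∈ D.N (X.deg i) j ↔ s ∈ D.N (f j) (X.deg i))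
    (hR : ∀ i j s, s ∈ D.N i j → R i j s ≠ 0) :
    IsIso (D.crossHom f R X Y) := by
  refine isIso_of_push (φ := fun p => D.idx (up f p.1.2.1) p.1.1 p.1.2.2
    ((hN _ _ _).1 p.2)) ⟨?_, ?_⟩ (c := fun p => R (X.deg p.1.1) (Y.deg p.1.2.1) p.1.2.2) ?_ ?_
  · intro p q e
    obtain ⟨i, j, s, h, rfl⟩ := exists_idx p
    obtain ⟨i₁, j₁, s₁, h₁, rfl⟩ := exists_idx q
    obtain ⟨e₁, e₂, e₃⟩ := idx_inj.1 e
    obtain rfl : i = i₁ := e₂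
    obtain rfl : j = j₁ := e₁
    obtain rfl : s = s₁ := e₃
    rfl
  · intro q
    obtain ⟨j, i, s, h, rfl⟩ := exists_idx q
    exact ⟨D.idx (X := X) (Y := Y) i j s ((hN _ _ _).2 h), rfl⟩
  · exact fun p => hR _ _ _ p.2
  · intro p γ
    obtain ⟨i, j, s, h, rfl⟩ := exists_idx p
    exact push_crossHom i j s h _ γ

end Maps

section Cases

variable {I : Type u} [Finite I] {D : FusionDatum I}

theorem exists_idx_up {f : I → I} {X Y : GradedVect I}
    (p : (D.tensorObj ((relabel f).obj X) Y).ι) : ∃ i j s hs, p = D.idx (up f i) j s hs :=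
  exists_idx p

theorem exists_idx_up_up {f k : I → I} {X Y : GradedVect I}
    (p : (D.tensorObj ((relabel f).obj ((relabel k).obj X)) Y).ι) :
    ∃ i j s hs, p = D.idx (up f (up k i)) j s hs :=
  exists_idx p

open Classical in
theorem dite_idx_eq_zero {X Y : GradedVect I} {i i' : X.ι} {j j' : Y.ι} {s s' : I}
    {hs : s' ∈ D.N (X.deg i') (Y.deg j')} (h : ¬ (i = i' ∧ j = j' ∧ s = s')) :
    (if e : s ∈ D.N (X.deg i) (Y.deg j) then
      if D.idx i j s e = D.idx i' j' s' hs then (1 : ℂ) else 0 else 0) = 0 := by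
  split_ifs with e he
  · exact absurd (idx_inj.1 he) h
  · rfl
  · rfl

end Cases

section Natural

variable {I : Type u} [Fintype I] {D : FusionDatum I}

open Classical in
theorem crossHom_natural {f : I → I} {R : I → I → I → ℂ} {X X₁ Y Y₁ : GradedVect I}
    (hN : ∀ (i : X.ι) j s, s ∈ D.N (X.deg i) j ↔ s ∈ D.N (f j) (X.deg i))
    (a : X ⟶ X₁) (b : Y ⟶ Y₁) :
    D.tensorHom a b ≫ D.crossHom f R X₁ Y₁ =
      D.crossHom f R X Y ≫ D.tensorHom ((relabel f).map b) a := by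
  refine ext_push fun p γ => ?_
  obtain ⟨i, j, s, h, rfl⟩ := exists_idx p
  have e₁ : s ∈ D.N (((relabel f).obj Y).deg (up f j)) (X.deg i) := (hN _ _ _).1 h
  rw [push_comp, push_tensorHom, push_comp, push_crossHom _ _ _ _ e₁, push_tensorHom,
    push_relabel_up, push_comm, ← push_mul_left]
  refine push_congr _ _ fun j₁ hj => ?_
  rw [← push_mul_left]
  refine push_congr _ _ fun i₁ hi => ?_
  have h₁ : s ∈ D.N (X₁.deg i₁) (Y₁.deg j₁) := hi ▸ hj ▸ h
  have h₂ : s ∈ D.N (((relabel f).obj Y₁).deg (up f j₁)) (X₁.deg i₁) := by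
    rw [deg_up, ← hi, ← hN, hi]
    exact h₁
  rw [dif_pos h₁, dif_pos h₂, push_crossHom _ _ _ _ h₂, hi, hj]

end Natural

section Coherence

variable {I : Type u} {G : Type} [Group G]

open Classical in
/-- The equations that make `R` a crossed braiding. -/
structure IsCrossedCoherent [Fintype I] (D : FusionDatum I) (G' : I → I → I → I → I → I → ℂ)
    (ρ : G →* Function.End I) (t : G → I → I → I → ℂ) (gr : I → G) (R : I → I → I → ℂ) : Prop where
  isActionCoherent : IsActionCoherent D ρ t
  gr_mem : ∀ i j s, s ∈ D.N i j → gr s = gr i * gr j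
  gr_one : gr D.one = 1
  gr_act : ∀ g i, gr (act ρ g i) = g * gr i * g⁻¹
  gr_surj : ∀ g, ∃ i, gr i = g
  cross : ∀ i j s, s ∈ D.N i j ↔ s ∈ D.N (act ρ (gr i) j) i
  ne_zero : ∀ i j s, s ∈ D.N i j → R i j s ≠ 0
  braid_act : ∀ g i j s, s ∈ D.N i j →
    R i j s * t g (act ρ (gr i) j) i s = t g i j s * R (act ρ g i) (act ρ g j) (act ρ g s)
  hexagon : ∀ i j k s w v, s ∈ D.N i j → w ∈ D.N s k → v ∈ D.N i k →
    w ∈ D.N (act ρ (gr i) j) v →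
    (∑ r, if r ∈ D.N j k ∧ w ∈ D.N i r then
      D.F i j k s r w * (R i r w * (t (gr i) j k r *
        D.F (act ρ (gr i) j) (act ρ (gr i) k) i (act ρ (gr i) r) v w)) else 0) =
      R i j s * (D.F (act ρ (gr i) j) i k s v w * R i k v)
  hexagon_inv : ∀ i j k s w v, s ∈ D.N i j → w ∈ D.N s k → v ∈ D.N i (act ρ (gr j) k) →
    w ∈ D.N v j →
    R s k w * G' (act ρ (gr i) (act ρ (gr j) k)) i j v s w =
      ∑ r, if r ∈ D.N j k ∧ w ∈ D.N i r then
        D.F i j k s r w * (R j k r * (G' i (act ρ (gr j) k) j v r w * R i (act ρ (gr j) k) v))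
        else 0

variable [Fintype I] {D : FusionDatum I} {G' : I → I → I → I → I → I → ℂ}
  {ρ : G →* Function.End I} {t : G → I → I → I → ℂ} {gr : I → G} {R : I → I → I → ℂ}

theorem IsCrossedCoherent.cross_of (h : IsCrossedCoherent D G' ρ t gr R) {g : G} {X : GradedVect I}
    (hX : ∀ i, gr (X.deg i) = g) (i : X.ι) (j s : I) :
    s ∈ D.N (X.deg i) j ↔ s ∈ D.N (act ρ g j) (X.deg i) := by
  rw [h.cross, hX]

theorem IsCrossedCoherent.mem_cross (h : IsCrossedCoherent D G' ρ t gr R) {g : G}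
    {X Y : GradedVect I} (hX : ∀ i, gr (X.deg i) = g) {i : X.ι} {j : Y.ι} {s : I}
    (hs : s ∈ D.N (X.deg i) (Y.deg j)) :
    s ∈ D.N (((relabel (act ρ g)).obj Y).deg (up (act ρ g) j)) (X.deg i) :=
  (h.cross_of hX i _ s).1 hs

open Classical in
theorem IsCrossedCoherent.crossHom_act (h : IsCrossedCoherent D G' ρ t gr R) (g k : G)
    {X : GradedVect I} (hX : ∀ i, gr (X.deg i) = k) (Y : GradedVect I) :
    (relabel (act ρ g)).map (D.crossHom (act ρ k) R X Y) ≫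
        D.tauHom D (act ρ g) (t g) ((relabel (act ρ k)).obj Y) X ≫
        D.tensorHom ((compIso ρ g k Y).inv ≫
          (compIsoOf ρ (show g * k = g * k * g⁻¹ * g by group) Y).hom)
          (𝟙 ((relabel (act ρ g)).obj X)) =
      D.tauHom D (act ρ g) (t g) X Y ≫ D.crossHom (act ρ (g * k * g⁻¹)) R
        ((relabel (act ρ g)).obj X) ((relabel (act ρ g)).obj Y) := by
  have hA := h.isActionCoherent
  have hX₁ : ∀ i, gr (((relabel (act ρ g)).obj X).deg i) = g * k * g⁻¹ := by
    exact fun i => (h.gr_act g _).trans (congrArg (fun x => g * x * g⁻¹) (hX i))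
  refine ext_push fun p γ => ?_
  obtain ⟨p, hp⟩ := exists_up _ p
  obtain ⟨i, j, s, hs, rfl⟩ := exists_idx p
  subst hp
  have e₁ := mem_up ((hA.mem g _ _ _).1 hs)
  have e₂ := h.mem_cross hX hs
  have e₃ := mem_up ((hA.mem g _ _ _).1 e₂)
  have e₄ := h.mem_cross hX₁ e₁
  rw [push_comp, push_relabel_up, push_crossHom _ _ _ _ e₂, push_comp, push_tauHom _ _ _ _ e₃,
    push_tensorHom, push_comp, push_compIso_inv, push_compIsoOf_hom, push_id, dif_pos e₄,
    push_comp, push_tauHom _ _ _ _ e₁, push_crossHom _ _ _ _ e₄]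
  have := h.braid_act g _ _ _ hs
  rw [hX] at this
  simp only [deg_up] at this ⊢
  linear_combination γ (D.idx _ _ _ e₄) * this

-- As for the pentagon, entries with different factors vanish on both sides. In the remaining
-- entries the first path sums over the constituents `r` of `j ⊗ k`, while on the second path the
-- label `s` of `i ⊗ j` survives the braiding and `v` is prescribed by the target.
open Classical in
theorem IsCrossedCoherent.hexagon_crossHom (h : IsCrossedCoherent D G' ρ t gr R) {g : G}
    {X : GradedVect I} (hX : ∀ i, gr (X.deg i) = g) (Y Z : GradedVect I) :
    D.assocHom X Y Z ≫ D.crossHom (act ρ g) R X (D.tensorObj Y Z) ≫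
        D.tensorHom (D.tauHom D (act ρ g) (t g) Y Z) (𝟙 X) ≫ D.assocHom _ _ _ =
      D.tensorHom (D.crossHom (act ρ g) R X Y) (𝟙 Z) ≫ D.assocHom _ _ _ ≫
        D.tensorHom (𝟙 ((relabel (act ρ g)).obj Y)) (D.crossHom (act ρ g) R X Z) := by
  have hA := h.isActionCoherent
  refine ext_coeff fun p q => ?_
  obtain ⟨p, k, w, hw, rfl⟩ := exists_idx p
  obtain ⟨i, j, s, hs, rfl⟩ := exists_idx p
  obtain ⟨j', q, w', hw', rfl⟩ := exists_idx_up q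
  obtain ⟨k', i', v, hv', rfl⟩ := exists_idx_up q
  have e₁ := h.mem_cross hX hs
  have e₂ : w ∈ D.N ((D.tensorObj ((relabel (act ρ g)).obj Y) X).deg
    (D.idx (up (act ρ g) j) i s e₁)) (Z.deg k) := hw
  rw [push_comp, push_assocHom, push_comp, push_tensorHom, push_crossHom _ _ _ _ e₁, push_id,
    dif_pos e₂, push_comp, push_assocHom]
  by_cases e : i = i' ∧ j = j' ∧ k = k' ∧ w = w'
  · obtain ⟨rfl, rfl, rfl, rfl⟩ := e
    have hv : v ∈ D.N (X.deg i) (Z.deg k) := (h.cross_of hX _ _ _).2 hv'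
    have key := h.hexagon _ _ _ _ _ _ hs hw hv (by rw [hX]; exact hw')
    rw [hX] at key
    refine Eq.trans (Finset.sum_congr rfl fun r _ => ?_)
      (key.trans (congrArg (R (X.deg i) (Y.deg j) s * ·) (Eq.symm ?_)))
    · by_cases hr : r ∈ D.N (Y.deg j) (Z.deg k) ∧ w ∈ D.N (X.deg i) r
      · have e₃ := h.mem_cross hX (mem_right (h := hr.1) hr.2)
        have e₄ := mem_up ((hA.mem g _ _ _).1 hr.1)
        have e₅ : w ∈ D.N ((D.tensorObj ((relabel (act ρ g)).obj Y)
          ((relabel (act ρ g)).obj Z)).deg (D.idx _ _ _ e₄)) (X.deg i) := e₃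
        rw [dif_pos hr, if_pos hr, push_comp, push_crossHom _ _ _ _ e₃, push_comp, push_tensorHom,
          push_tauHom _ _ _ _ e₄, push_id, dif_pos e₅, push_assocHom, Finset.sum_eq_single v]
        · rw [dif_pos ⟨hv', hw'⟩, if_pos rfl, mul_one]
          simp only [deg_up, deg_idx]
        · intro x _ hx
          simp [hx]
        · simp
      · rw [dif_neg hr, if_neg hr]
    · rw [Finset.sum_eq_single v]
      · rw [dif_pos ⟨hv, hw'⟩, push_tensorHom, push_id, push_crossHom _ _ _ _ hv',
          dif_pos hw', if_pos rfl, mul_one]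
        simp only [deg_up]
      · intro x _ hx
        split_ifs with e₃
        · have e₄ := h.mem_cross hX e₃.1
          rw [push_tensorHom, push_id, push_crossHom _ _ _ _ e₄, dite_idx_eq_zero, mul_zero,
            mul_zero]
          exact fun e => hx (idx_inj.1 e.2.1).2.2
        · rfl
      · simp
  · trans 0
    · refine Finset.sum_eq_zero fun r _ => ?_
      split_ifs with hr
      · have e₃ := h.mem_cross hX (mem_right (h := hr.1) hr.2)
        have e₄ := mem_up ((hA.mem g _ _ _).1 hr.1)
        have e₅ : w ∈ D.N ((D.tensorObj ((relabel (act ρ g)).obj Y)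
          ((relabel (act ρ g)).obj Z)).deg (D.idx _ _ _ e₄)) (X.deg i) := e₃
        rw [push_comp, push_crossHom _ _ _ _ e₃, push_comp, push_tensorHom,
          push_tauHom _ _ _ _ e₄, push_id, dif_pos e₅, push_assocHom]
        have : ∀ x, ¬ (j = j' ∧ (k = k' ∧ i = i' ∧ x = v) ∧ w = w') := by tauto
        simp [up_inj, this]
      · rfl
    · symm
      rw [mul_eq_zero]
      right
      refine Finset.sum_eq_zero fun r _ => ?_
      split_ifs with hr
      · have e₄ := h.mem_cross hX hr.1
        rw [push_tensorHom, push_id, push_crossHom _ _ _ _ e₄, dite_idx_eq_zero, mul_zero,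
          mul_zero]
        rw [idx_inj, up_inj, up_inj]
        tauto
      · rfl

-- The inverse associators enter through the explicit coefficients `G'`, so that this hexagon is
-- again an equation between finite sums; `associator_inv` later identifies them with the
-- categorical inverses.
open Classical in
theorem IsCrossedCoherent.hexagon_inv_crossHom (h : IsCrossedCoherent D G' ρ t gr R) {g k : G}
    {X Y : GradedVect I} (hX : ∀ i, gr (X.deg i) = g) (hY : ∀ i, gr (Y.deg i) = k)
    (Z : GradedVect I) :
    D.crossHom (act ρ (g * k)) R (D.tensorObj X Y) Z ≫
        D.tensorHom (compIso ρ g k Z).hom (𝟙 (D.tensorObj X Y)) ≫ D.assocInv G' _ _ _ =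
      D.assocHom X Y Z ≫ D.tensorHom (𝟙 X) (D.crossHom (act ρ k) R Y Z) ≫
        D.assocInv G' _ _ _ ≫
        D.tensorHom (D.crossHom (act ρ g) R X ((relabel (act ρ k)).obj Z)) (𝟙 Y) := by
  have hXY : ∀ p, gr ((D.tensorObj X Y).deg p) = g * k := by
    intro p
    obtain ⟨i, j, s, hs, rfl⟩ := exists_idx p
    rw [deg_idx, h.gr_mem _ _ _ hs, hX, hY]
  refine ext_coeff fun p q => ?_
  obtain ⟨p, c, w, hw, rfl⟩ := exists_idx p
  obtain ⟨i, j, s, hs, rfl⟩ := exists_idx p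
  obtain ⟨q, j', w', hw', rfl⟩ := exists_idx q
  obtain ⟨c', i', v, hv', rfl⟩ := exists_idx_up_up q
  have e₁ := h.mem_cross hXY hw
  have e₂ : w ∈ D.N (((relabel (act ρ g)).obj ((relabel (act ρ k)).obj Z)).deg
      (up (act ρ g) (up (act ρ k) c))) ((D.tensorObj X Y).deg (D.idx i j s hs)) := by
    have := e₁
    rwa [deg_up, act_mul] at this
  rw [push_comp, push_crossHom _ _ _ _ e₁, push_comp, push_tensorHom, push_compIso_hom, push_id,
    dif_pos e₂, push_assocInv, push_comp, push_assocHom]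
  by_cases e : i = i' ∧ j = j' ∧ c = c' ∧ w = w'
  · obtain ⟨rfl, rfl, rfl, rfl⟩ := e
    have hv : v ∈ D.N (X.deg i) (act ρ k (Z.deg c)) := (h.cross_of hX _ _ _).2 hv'
    have key := h.hexagon_inv _ _ _ _ _ v hs hw (by rw [hY]; exact hv) hw'
    rw [hX, hY] at key
    rw [Finset.sum_eq_single v]
    · rw [dif_pos ⟨hv', hw'⟩, if_pos rfl, mul_one]
      refine key.trans (Finset.sum_congr rfl fun r _ => ?_)
      by_cases hr : r ∈ D.N (Y.deg j) (Z.deg c) ∧ w ∈ D.N (X.deg i) r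
      · have e₃ := h.mem_cross hY hr.1
        have e₄ : w ∈ D.N (X.deg i) ((D.tensorObj ((relabel (act ρ k)).obj Z) Y).deg
          (D.idx _ _ _ e₃)) := hr.2
        rw [dif_pos hr, if_pos hr, push_comp, push_tensorHom, push_id, push_crossHom _ _ _ _ e₃,
          dif_pos e₄, push_comp, push_assocInv, Finset.sum_eq_single v]
        · have e₅ : v ∈ D.N (X.deg i) (((relabel (act ρ k)).obj Z).deg (up (act ρ k) c)) := hv
          rw [dif_pos ⟨e₅, hw'⟩, push_tensorHom, push_crossHom _ _ _ _ hv', push_id,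
            dif_pos hw', if_pos rfl, mul_one]
          simp only [deg_up]
        · intro x _ hx
          split_ifs with e₅
          · have e₆ := h.mem_cross hX e₅.1
            rw [push_tensorHom, push_crossHom _ _ _ _ e₆, push_id, dite_idx_eq_zero, mul_zero,
              mul_zero]
            exact fun e => hx (idx_inj.1 e.1).2.2
          · rfl
        · simp
      · rw [dif_neg hr, if_neg hr]
    · intro x _ hx
      simp [hx]
    · simp
  · trans 0
    · rw [mul_eq_zero]
      right
      refine Finset.sum_eq_zero fun r _ => ?_
      have : ¬ ((c = c' ∧ i = i' ∧ r = v) ∧ j = j' ∧ w = w') := by tauto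
      simp [up_inj, this]
    · symm
      refine Finset.sum_eq_zero fun r _ => ?_
      split_ifs with hr
      · have e₃ := h.mem_cross hY hr.1
        have e₄ : w ∈ D.N (X.deg i) ((D.tensorObj ((relabel (act ρ k)).obj Z) Y).deg
          (D.idx _ _ _ e₃)) := hr.2
        rw [push_comp, push_tensorHom, push_id, push_crossHom _ _ _ _ e₃,
          dif_pos e₄, push_comp, push_assocInv]
        rw [mul_eq_zero]
        right
        rw [mul_eq_zero]
        right
        refine Finset.sum_eq_zero fun x _ => ?_
        split_ifs with e₅
        · have e₆ := h.mem_cross hX e₅.1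
          rw [push_tensorHom, push_crossHom _ _ _ _ e₆, push_id, dite_idx_eq_zero, mul_zero,
            mul_zero]
          rw [idx_inj, up_inj, up_inj]
          tauto
        · rfl
      · rfl

end Coherence

end FusionDatum

/-! ## Direct sums -/

namespace GradedVect

variable {I : Type u}

open Classical in
/-- The inclusion of the summand `j`. -/
noncomputable def inclusion {J : Type*} {S : J → GradedVect I} {X : GradedVect I}
    (e : (Σ j, (S j).ι) ≃ X.ι) (j : J) : S j ⟶ X :=
  ofMat fun i k => if e ⟨j, i⟩ = k then 1 else 0

open Classical in
/-- The projection to the summand `j`. -/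
noncomputable def projection {J : Type*} {S : J → GradedVect I} {X : GradedVect I}
    (e : (Σ j, (S j).ι) ≃ X.ι) (j : J) : X ⟶ S j :=
  ofMat fun k i => if e ⟨j, i⟩ = k then 1 else 0

section Sum

variable {J : Type*} {S : J → GradedVect I} {X : GradedVect I} {e : (Σ j, (S j).ι) ≃ X.ι}

theorem push_inclusion (he : ∀ j i, X.deg (e ⟨j, i⟩) = (S j).deg i) (j : J) (i : (S j).ι) (γ) :
    push (inclusion e j) i γ = γ (e ⟨j, i⟩) := by
  rw [← one_mul (γ _)]
  refine push_of_apply ?_ (fun k hk => ?_) γ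
  · exact (ofMat_of_eq (he j i).symm).trans (if_pos rfl)
  · exact ofMat_eq_zero (if_neg fun h => hk h.symm)

theorem push_projection (he : ∀ j i, X.deg (e ⟨j, i⟩) = (S j).deg i) (j : J) (i : (S j).ι) (γ) :
    push (projection e j) (e ⟨j, i⟩) γ = γ i := by
  rw [← one_mul (γ _)]
  refine push_of_apply ?_ (fun k hk => ?_) γ
  · exact (ofMat_of_eq (he j i)).trans (if_pos rfl)
  · refine ofMat_eq_zero (if_neg fun h => hk ?_)
    simpa using h

theorem push_projection_of_ne {j j₁ : J} (h : j₁ ≠ j) (i : (S j₁).ι) (γ) : push (projection e j) (e ⟨j₁, i⟩) γ = 0 := by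
  refine Finset.sum_eq_zero fun k _ => ?_
  rw [projection, ofMat_eq_zero, zero_mul]
  refine if_neg fun h₁ => h ?_
  simpa using (congrArg Sigma.fst (e.injective h₁)).symm

open Classical in
/-- A partition of the basis decomposes a graded vector space as a direct sum. -/
theorem exists_isBilimit [Fintype J] (he : ∀ j i, X.deg (e ⟨j, i⟩) = (S j).deg i) :
    ∃ b : Limits.Bicone S, Nonempty b.IsBilimit ∧ Nonempty (b.pt ≅ X) := by
  let b : Limits.Bicone S :=
    { pt := X
      π := projection e
      ι := inclusion e
      ι_π := fun j j₁ => by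
        split_ifs with h
        · subst h
          refine ext_push fun p γ => ?_
          rw [push_comp, push_inclusion he, push_projection he, eqToHom_refl, push_id]
        · refine ext_push fun p γ => ?_
          rw [push_comp, push_inclusion he, push_projection_of_ne h]
          exact (Finset.sum_eq_zero fun _ _ => zero_mul _).symm }
  refine ⟨b, ⟨Limits.isBilimitOfTotal b ?_⟩, ⟨Iso.refl X⟩⟩
  refine hom_ext fun p q => ?_
  have hs : ∀ (s : Finset J) (f : J → (X ⟶ X)), coeff (∑ j ∈ s, f j) p q =
      ∑ j ∈ s, coeff (f j) p q := by
    intro s f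
    induction s using Finset.induction_on with
    | empty => rfl
    | insert a s ha ih => rw [Finset.sum_insert ha, Finset.sum_insert ha, add_apply, ih]
  refine (hs _ _).trans ?_
  obtain ⟨⟨j, i⟩, rfl⟩ := e.surjective p
  rw [Finset.sum_eq_single j]
  · rw [← push_single, push_comp, push_projection he, push_inclusion he]
    exact (id_apply X _ _).symm
  · intro j₁ _ hj
    rw [← push_single, push_comp, push_projection_of_ne hj.symm]
  · simp

end Sum

theorem exists_deg_eq_of_iso {X Y : GradedVect I} (e : X ≅ Y) (j : Y.ι) :
    ∃ i, X.deg i = Y.deg j := by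
  classical
  by_contra! h
  have : push (e.inv ≫ e.hom) j (fun k => if k = j then 1 else 0) = 1 := by
    rw [e.inv_hom_id, push_id, if_pos rfl]
  rw [push_comp] at this
  refine one_ne_zero (this.symm.trans (Finset.sum_eq_zero fun i _ => ?_))
  rw [coeff_of_ne e.inv (h i).symm, zero_mul]

theorem hom_eq_zero_of_deg_ne {X Y : GradedVect I} (h : ∀ i j, X.deg i ≠ Y.deg j) (f : X ⟶ Y) :
    f = 0 :=
  hom_ext fun i j => coeff_of_ne f (h i j)

theorem not_isZero_single (s : I) : ¬ Limits.IsZero (single s) := by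
  intro h
  have := congrArg (fun f : single s ⟶ single s => coeff f (pt s) (pt s))
    (h.eq_of_src (𝟙 (single s)) 0)
  classical
  rw [id_apply, zero_apply, if_pos rfl] at this
  exact one_ne_zero this

end GradedVect

/-! ### The grading and the crossed axioms for the category -/

namespace FusionDatum

open GradedVect

section Crossed

variable {I : Type u} {G : Type} [Group G] [Fintype I] {D : FusionDatum I}
  {F' : I → I → I → I → I → I → ℂ}
  {ρ : G →* Function.End I} {t : G → I → I → I → ℂ} {gr : I → G} {R : I → I → I → ℂ}

theorem associator_inv (hC : D.IsCoherent F') (hD : D.IsTensor) (X Y Z : Cat hD) :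
    (α_ X Y Z).inv = D.assocInv F' X Y Z :=
  Iso.inv_ext (hC.assoc_hom_inv X Y Z)

theorem crossedData_T₂Of_eq (hD : D.IsTensor) {k g h : G} (e : k = g * h) (X : Cat hD) :
    (crossedData hD ρ t gr R).T₂Of e X = compIsoOf ρ e X :=
  T₂Of_eq hD ρ t e X

theorem IsCrossedCoherent.isGrading [Fintype G] (h : IsCrossedCoherent D F' ρ t gr R)
    (hD : D.IsTensor) : (crossedData hD ρ t gr R).IsGrading where
  closed_iso g X Y e hX := by
    intro j
    obtain ⟨i, hi⟩ := exists_deg_eq_of_iso (X := X) (Y := Y) e j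
    exact (congrArg gr hi).symm.trans (hX i)
  hom_zero {g k X Y} hX hY hgk f := by
    refine hom_eq_zero_of_deg_ne (X := X) (Y := Y) (fun i j e => hgk ?_) f
    exact (hX i).symm.trans ((congrArg gr e).trans (hY j))
  decomposition X := by
    classical
    let X' : GradedVect I := X
    let Y : G → GradedVect I := fun g =>
      { ι := {i : X'.ι // gr (X'.deg i) = g}, fin := inferInstance, deg := fun i => X'.deg i.1 }
    -- The fibres of the degree function partition the basis, and a partition of the basis is a
    -- direct sum decomposition.
    obtain ⟨b, h₁, h₂⟩ := exists_isBilimit (S := Y) (X := X')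
      (e := Equiv.sigmaFiberEquiv fun i => gr (X'.deg i)) fun _ _ => rfl
    exact ⟨Y, b, fun g i => i.2, h₁, h₂⟩
  tensor {g k X Y} hX hY := fun p => by
    obtain ⟨i, j, s, hs, rfl⟩ := exists_idx (D := D) (X := X) (Y := Y) p
    exact (h.gr_mem _ _ _ hs).trans (congrArg₂ (· * ·) (hX i) (hY j))
  unit := fun _ => h.gr_one
  faithful g := by
    obtain ⟨i, hi⟩ := h.gr_surj g
    exact ⟨single i, fun _ => hi, not_isZero_single i⟩

theorem IsCrossedCoherent.isBraidedCrossed [Fintype G] (h : IsCrossedCoherent D F' ρ t gr R)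
    (hC : D.IsCoherent F') (hD : D.IsTensor) :
    (crossedData hD ρ t gr R).IsBraidedCrossed where
  isAction := h.isActionCoherent.isAction hC hD
  isGrading := h.isGrading hD
  conj g k X hX := fun i => (h.gr_act g _).trans (congrArg (fun x => g * x * g⁻¹) (hX i))
  braid_iso {g X} hX Y := isIso_crossHom (X := X) (Y := Y) (h.cross_of hX) h.ne_zero
  braid_natural {g X X₁ Y Y₁} hX hX₁ f k :=
    crossHom_natural (X := X) (X₁ := X₁) (Y := Y) (Y₁ := Y₁) (h.cross_of hX) f k
  braid_act g k X hX Y := by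
    rw [crossedData_T₂Of_eq]
    exact h.crossHom_act g k hX Y
  hexagon {g X} hX Y Z := h.hexagon_crossHom hX Y Z
  hexagon_inv {g k X Y} hX hY Z := by
    rw [associator_inv hC, associator_inv hC]
    exact h.hexagon_inv_crossHom hX hY Z

end Crossed

end FusionDatum

/-! ## Twists -/

namespace FusionDatum

open GradedVect

open Classical in
/-- The map `X ⟶ f X` with coefficients `θ`. -/
noncomputable def twistHom {I : Type u} (f : I → I) (θ : I → ℂ) (X : GradedVect I) :
    X ⟶ (relabel f).obj X :=
  ofMat (X := X) (Y := (relabel f).obj X) fun i j => if i = j then θ (X.deg i) else 0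

/-- The hypothesis that `f` fixes the degree is essential: otherwise source and target degrees
differ and the degree-preserving part of the matrix is zero at this basis vector. -/
theorem push_twistHom {I : Type u} {f : I → I} {θ : I → ℂ} {X : GradedVect I} {i : X.ι}
    (h : f (X.deg i) = X.deg i) (γ) :
    push (twistHom f θ X) i γ = θ (X.deg i) * γ (up f i) := by
  refine push_of_apply ?_ (fun k hk => ?_) γ
  · exact (ofMat_of_eq h.symm).trans (if_pos rfl)
  · exact ofMat_eq_zero (if_neg fun e => hk e.symm)

section Twist

variable {I : Type u} {G : Type} [Group G]

/-- The equations that make `θ` a ribbon twist. -/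
structure IsTwistCoherent (D : FusionDatum I) (ρ : G →* Function.End I) (t : G → I → I → I → ℂ)
    (gr : I → G) (R : I → I → I → ℂ) (θ : I → ℂ) : Prop where
  act_self : ∀ i, act ρ (gr i) i = i
  ne_zero : ∀ i, θ i ≠ 0
  one : θ D.one = 1
  tensor : ∀ i j s, s ∈ D.N i j →
    θ s * t (gr i * gr j) i j s = R i j s * (R (act ρ (gr i) j) i s * (θ i * θ j))
  invariant : ∀ g i, θ (act ρ g i) = θ i
  dual : ∀ i j, D.one ∈ D.N i j → θ i * t (gr i)⁻¹ i j D.one = θ j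

variable {D : FusionDatum I} {F' : I → I → I → I → I → I → ℂ}
  {ρ : G →* Function.End I} {t : G → I → I → I → ℂ} {gr : I → G} {R : I → I → I → ℂ}
  {θ : I → ℂ}

theorem IsTwistCoherent.push_twistHom (h : IsTwistCoherent D ρ t gr R θ) {g : G} {X : GradedVect I}
    (hX : ∀ i, gr (X.deg i) = g) (i : X.ι) (γ) :
    push (twistHom (act ρ g) θ X) i γ = θ (X.deg i) * γ (up (act ρ g) i) :=
  FusionDatum.push_twistHom (by rw [← hX i, h.act_self]) γ

theorem IsTwistCoherent.isIso_twistHom (h : IsTwistCoherent D ρ t gr R θ) {g : G}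
    {X : GradedVect I} (hX : ∀ i, gr (X.deg i) = g) : IsIso (twistHom (act ρ g) θ X) :=
  isIso_of_push (φ := fun i => up (act ρ g) i) ⟨fun _ _ e => e, fun q => ⟨q, rfl⟩⟩
    (fun i => h.ne_zero (X.deg i)) (h.push_twistHom hX)

theorem IsTwistCoherent.twistHom_natural (h : IsTwistCoherent D ρ t gr R θ) {g : G}
    {X Y : GradedVect I} (hX : ∀ i, gr (X.deg i) = g) (hY : ∀ i, gr (Y.deg i) = g) (f : X ⟶ Y) :
    f ≫ twistHom (act ρ g) θ Y = twistHom (act ρ g) θ X ≫ (relabel (act ρ g)).map f := by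
  refine ext_push fun p γ => ?_
  rw [push_comp, push_comp, h.push_twistHom hX, push_relabel_up, ← push_mul_left]
  refine push_congr _ _ fun q hq => ?_
  rw [h.push_twistHom hY, hq]

theorem IsTwistCoherent.twistHom_unit (h : IsTwistCoherent D ρ t gr R θ) (h₁ : gr D.one = 1) :
    twistHom (act ρ 1) θ (single D.one) ≫ (unitIso ρ (single D.one)).hom = 𝟙 _ := by
  refine ext_push fun p γ => ?_
  rw [push_comp, h.push_twistHom (fun _ => h₁), push_unitIso_hom, push_id, eq_pt p, deg_pt, h.one,
    one_mul]

variable [Fintype I]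

-- A homogeneous label is fixed by the action of its own degree, so every relabelling that occurs
-- here fixes the labels involved. Both sides are then monomial with the same target, and only the
-- scalar equation `tensor` is left.
open Classical in
theorem IsTwistCoherent.twistHom_tensor (h : IsTwistCoherent D ρ t gr R θ)
    (hR : IsCrossedCoherent D F' ρ t gr R) {g k : G} {X Y : GradedVect I}
    (hX : ∀ i, gr (X.deg i) = g) (hY : ∀ i, gr (Y.deg i) = k) :
    twistHom (act ρ (g * k)) θ (D.tensorObj X Y) ≫ D.tauHom D (act ρ (g * k)) (t (g * k)) X Y ≫
        D.tensorHom (compIsoOf ρ (show g * k = g * k * g⁻¹ * g by group) X).hom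
          (compIso ρ g k Y).hom =
      D.crossHom (act ρ g) R X Y ≫
        D.crossHom (act ρ (g * k * g⁻¹)) R ((relabel (act ρ g)).obj Y) X ≫
        D.tensorHom ((relabel (act ρ (g * k * g⁻¹))).map (twistHom (act ρ g) θ X))
          ((relabel (act ρ g)).map (twistHom (act ρ k) θ Y)) := by
  have hA := hR.isActionCoherent
  have hXY : ∀ p, gr ((D.tensorObj X Y).deg p) = g * k := by
    intro p
    obtain ⟨i, j, s, hs, rfl⟩ := exists_idx p
    rw [deg_idx, hR.gr_mem _ _ _ hs, hX, hY]
  have hgY : ∀ i, gr (((relabel (act ρ g)).obj Y).deg i) = g * k * g⁻¹ := by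
    exact fun i => (hR.gr_act g _).trans (congrArg (fun x => g * x * g⁻¹) (hY i))
  refine ext_push fun p γ => ?_
  obtain ⟨i, j, s, hs, rfl⟩ := exists_idx p
  have e₁ := mem_up ((hA.mem (g * k) _ _ _).1 hs)
  have e₂ := hR.mem_cross hX hs
  have e₃ := hR.mem_cross hgY e₂
  have hsk : act ρ (g * k) s = s := by
    rw [← hX i, ← hY j, ← hR.gr_mem _ _ _ hs, h.act_self]
  have hXg : act ρ g (X.deg i) = X.deg i := by rw [← hX i, h.act_self]
  have hYk : act ρ k (Y.deg j) = Y.deg j := by rw [← hY j, h.act_self]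
  have e₄ : s ∈ D.N
      (((relabel (act ρ (g * k * g⁻¹))).obj ((relabel (act ρ g)).obj X)).deg
        (up (act ρ (g * k * g⁻¹)) (up (act ρ g) i)))
      (((relabel (act ρ g)).obj ((relabel (act ρ k)).obj Y)).deg
        (up (act ρ g) (up (act ρ k) j))) := by
    have := e₃
    simp only [deg_up] at this ⊢
    rwa [hXg, hYk]
  have e₅ : act ρ (g * k) s ∈ D.N
      (((relabel (act ρ (g * k * g⁻¹))).obj ((relabel (act ρ g)).obj X)).deg
        (up (act ρ (g * k * g⁻¹)) (up (act ρ g) i)))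
      (((relabel (act ρ g)).obj ((relabel (act ρ k)).obj Y)).deg
        (up (act ρ g) (up (act ρ k) j))) := by rwa [hsk]
  have key := h.tensor _ _ _ hs
  rw [hX, hY] at key
  rw [push_comp, h.push_twistHom hXY, push_comp, push_tauHom _ _ _ _ e₁, push_tensorHom,
    push_compIsoOf_hom, push_compIso_hom, dif_pos e₅, push_comp, push_crossHom _ _ _ _ e₂,
    push_comp, push_crossHom _ _ _ _ e₃, push_tensorHom, push_relabel_up, h.push_twistHom hX,
    push_relabel_up, h.push_twistHom hY, dif_pos e₄]
  have e₆ : D.idx _ _ _ e₅ = D.idx _ _ _ e₄ := idx_inj.2 ⟨rfl, rfl, hsk⟩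
  rw [e₆]
  simp only [deg_up, deg_idx] at key ⊢
  linear_combination γ (D.idx _ _ _ e₄) * key

theorem IsTwistCoherent.twistHom_act (h : IsTwistCoherent D ρ t gr R θ)
    (hR : IsCrossedCoherent D F' ρ t gr R) (g : G) {k : G} {Y : GradedVect I}
    (hY : ∀ i, gr (Y.deg i) = k) :
    twistHom (act ρ (g * k * g⁻¹)) θ ((relabel (act ρ g)).obj Y) ≫
        (compIsoOf ρ (show g * k = g * k * g⁻¹ * g by group) Y).inv =
      (relabel (act ρ g)).map (twistHom (act ρ k) θ Y) ≫ (compIso ρ g k Y).inv := by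
  have hgY : ∀ i, gr (((relabel (act ρ g)).obj Y).deg i) = g * k * g⁻¹ := by
    exact fun i => (hR.gr_act g _).trans (congrArg (fun x => g * x * g⁻¹) (hY i))
  refine ext_push fun p γ => ?_
  obtain ⟨p, hp⟩ := exists_up _ p
  rw [hp, push_comp, h.push_twistHom hgY, push_compIsoOf_inv, push_comp, push_relabel_up,
    h.push_twistHom hY, push_compIso_inv, deg_up, h.invariant]

-- No property of the coevaluation `η` is needed: both composites are `η` followed by a map that is
-- diagonal on matched basis vectors. Compatibility with duals therefore holds for every choice of
-- exact pairing at once.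
open Classical in
theorem IsTwistCoherent.twistHom_dual (h : IsTwistCoherent D ρ t gr R θ)
    (hR : IsCrossedCoherent D F' ρ t gr R) {g : G} {X Y : GradedVect I}
    (hX : ∀ i, gr (X.deg i) = g) (hY : ∀ i, gr (Y.deg i) = g⁻¹)
    (η : single D.one ⟶ D.tensorObj X Y) :
    (relabel (act ρ g⁻¹)).map (η ≫ D.tensorHom (twistHom (act ρ g) θ X) (𝟙 Y)) ≫
        D.tauHom D (act ρ g⁻¹) (t g⁻¹) ((relabel (act ρ g)).obj X) Y =
      D.tauOne D (act ρ g⁻¹) ≫ η ≫ D.tensorHom (𝟙 X) (twistHom (act ρ g⁻¹) θ Y) ≫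
        D.tensorHom ((unitIso ρ X).inv ≫ (compIsoOf ρ (inv_mul_cancel g).symm X).hom)
          (𝟙 ((relabel (act ρ g⁻¹)).obj Y)) := by
  have hA := hR.isActionCoherent
  refine ext_push fun p γ => ?_
  rw [show p = up (act ρ g⁻¹) (pt D.one) from rfl, push_comp, push_relabel_up, push_comp,
    push_comp, push_tauOne (hA.one _), push_comp]
  refine push_congr _ _ fun p hp => ?_
  obtain ⟨i, j, s, hs, rfl⟩ := exists_idx p
  -- `η` starts at the unit and preserves degrees, so only the constituent `D.one` is reached; this
  -- is why the scalar equation is required only where `D.one` is a constituent.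
  obtain rfl : D.one = s := hp
  have hXg : act ρ g (X.deg i) = X.deg i := by rw [← hX i, h.act_self]
  have hYg : act ρ g⁻¹ (Y.deg j) = Y.deg j := by rw [← hY j, h.act_self]
  have hXg' : act ρ g⁻¹ (X.deg i) = X.deg i := by
    conv_lhs => rw [← hXg]
    rw [← act_mul, inv_mul_cancel, act_one]
  have e₁ : D.one ∈ D.N (((relabel (act ρ g)).obj X).deg (up (act ρ g) i)) (Y.deg j) := by
    rwa [deg_up, hXg]
  have e₂ := mem_up ((hA.mem g⁻¹ _ _ _).1 e₁)
  have e₃ : D.one ∈ D.N (X.deg i) (((relabel (act ρ g⁻¹)).obj Y).deg (up (act ρ g⁻¹) j)) := by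
    rwa [deg_up, hYg]
  have e₄ : D.one ∈ D.N
      (((relabel (act ρ g⁻¹)).obj ((relabel (act ρ g)).obj X)).deg
        (up (act ρ g⁻¹) (up (act ρ g) i)))
      (((relabel (act ρ g⁻¹)).obj Y).deg (up (act ρ g⁻¹) j)) := by
    rwa [deg_up, deg_up, deg_up, hXg, hXg', hYg]
  have key := h.dual _ _ hs
  rw [hX] at key
  rw [push_tensorHom, h.push_twistHom hX, push_id, dif_pos e₁, push_tauHom _ _ _ _ e₂,
    push_comp, push_tensorHom, push_id, h.push_twistHom hY, dif_pos e₃, push_tensorHom, push_comp,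
    push_unitIso_inv, push_compIsoOf_hom, push_id, dif_pos e₄]
  rw [show D.idx _ _ _ e₂ = D.idx _ _ _ e₄ from idx_inj.2 ⟨rfl, rfl, hA.one _⟩, deg_up, hXg,
    ← key, mul_assoc]

theorem IsTwistCoherent.isRibbon [Fintype G] (h : IsTwistCoherent D ρ t gr R θ)
    (hR : IsCrossedCoherent D F' ρ t gr R) (hD : D.IsTensor) (hB : (crossedData hD ρ t gr R).IsBraidedCrossed) :
    (crossedData hD ρ t gr R).IsRibbon hB (twistData hD ρ t gr R θ) where
  isTwist :=
    { iso := fun {g X} hX => h.isIso_twistHom (X := X) hX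
      natural := fun {g X Y} hX hY f => h.twistHom_natural (X := X) (Y := Y) hX hY f
      unit := h.twistHom_unit hR.gr_one
      tensor := fun {g k X Y} hX hY => by
        rw [crossedData_T₂Of_eq]
        exact h.twistHom_tensor hR (X := X) (Y := Y) hX hY
      invariant := fun g {k Y} hY => by
        rw [crossedData_T₂Of_eq]
        exact h.twistHom_act hR g (Y := Y) hY }
  dual {g X Y} hX hY _ := by
    rw [crossedData_T₂Of_eq]
    exact h.twistHom_dual hR (X := X) (Y := Y) hX hY _

end Twist

end FusionDatum

/-! ## Simple objects -/

namespace GradedVect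

variable {I : Type u}

open Classical in
/-- The map from a one-dimensional space to the line spanned by a basis vector. -/
noncomputable def line {X : GradedVect I} (i : X.ι) : single (X.deg i) ⟶ X :=
  ofMat fun _ k => if i = k then 1 else 0

theorem push_line {X : GradedVect I} (i : X.ι) (u) (γ) : push (line i) u γ = γ i := by
  rw [← one_mul (γ i)]
  refine push_of_apply ?_ (fun k hk => ?_) γ
  · exact (ofMat_of_eq (by rfl)).trans (if_pos rfl)
  · exact ofMat_eq_zero (if_neg fun e => hk e.symm)

open Classical in
/-- The coordinate with respect to a basis vector. -/
noncomputable def coord {X : GradedVect I} (i : X.ι) : X ⟶ single (X.deg i) :=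
  ofMat fun k _ => if i = k then 1 else 0

theorem push_coord {X : GradedVect I} (i : X.ι) (γ) : push (coord i) i γ = γ (pt _) := by
  rw [← one_mul (γ _)]
  refine push_of_apply ?_ (fun k hk => ?_) γ
  · exact (ofMat_of_eq (by rfl)).trans (if_pos rfl)
  · exact absurd (eq_pt k) hk

theorem line_coord {X : GradedVect I} (i : X.ι) : line i ≫ coord i = 𝟙 _ := by
  refine ext_push fun p γ => ?_
  rw [push_comp, push_line, push_coord, push_id, eq_pt p]

/-- The inclusion of the line spanned by a basis vector is split, hence a nonzero monomorphism into
a simple object, hence an isomorphism. A second basis vector would contradict its surjectivity. -/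
theorem exists_basis_of_simple (X : GradedVect I) [Simple X] : ∃ i : X.ι, ∀ k, k = i := by
  classical
  have hne : Nonempty X.ι := by
    by_contra h
    rw [not_nonempty_iff] at h
    exact id_nonzero X (hom_ext fun i => h.elim i)
  obtain ⟨i⟩ := hne
  refine ⟨i, fun k => ?_⟩
  have : Mono (line i) := ⟨fun f g h => by
    simpa [line_coord] using congrArg (· ≫ coord i) h⟩
  have hl : line i ≠ 0 := by
    intro h
    have := push_line i (pt _) fun _ => 1
    rw [h] at this
    exact one_ne_zero (this.symm.trans (Finset.sum_eq_zero fun _ _ => zero_mul _))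
  have := isIso_of_mono_of_nonzero hl
  by_contra hk
  have : push (inv (line i) ≫ line i) k (fun j => if j = k then 1 else 0) = 1 := by
    rw [IsIso.inv_hom_id, push_id, if_pos rfl]
  rw [push_comp] at this
  refine one_ne_zero (this.symm.trans ((congrArg (push _ k) (funext fun u => ?_)).trans
    (push_zero _ k)))
  rw [push_line, if_neg (Ne.symm hk)]

theorem nonempty_iso_single {X : GradedVect I} {i : X.ι} (h : ∀ k, k = i) :
    Nonempty (X ≅ single (X.deg i)) := by
  refine ⟨⟨coord i, line i, ext_push fun p γ => ?_, line_coord i⟩⟩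
  rw [h p, push_comp, push_coord, push_line, push_id]

/-- A nonzero map to a line has a section, obtained by rescaling a basis vector on which it does not
vanish. A monomorphism with a section is invertible. -/
instance simple_single (s : I) : Simple (single s) where
  mono_isIso_iff_nonzero {Y} f _ := by
    classical
    constructor
    · intro _ h
      have h₁ : (0 : single s ⟶ single s) = 𝟙 _ := by
        rw [← IsIso.inv_hom_id f]
        simp only [h, Limits.comp_zero]
      have := congrArg (fun g : single s ⟶ single s => coeff g (pt s) (pt s)) h₁
      rw [id_apply, zero_apply, if_pos rfl] at this
      exact zero_ne_one this
    · intro h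
      obtain ⟨j, hj⟩ : ∃ j, coeff f j (pt s) ≠ 0 := by
        by_contra! h₁
        exact h (hom_ext fun j k => h₁ j)
      have hd : Y.deg j = s := by
        by_contra e
        exact hj (coeff_of_ne f e)
      let g : single s ⟶ Y := ofMat fun _ k => if k = j then (coeff f j (pt s))⁻¹ else 0
      have hg : ∀ γ, push g (pt s) γ = (coeff f j (pt s))⁻¹ * γ j := by
        refine push_of_apply ?_ (fun k hk => ?_)
        · exact (ofMat_of_eq hd.symm).trans (if_pos rfl)
        · exact ofMat_eq_zero (if_neg hk)
      have hgf : g ≫ f = 𝟙 _ := by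
        refine ext_push fun p γ => ?_
        rw [eq_pt p, push_comp, hg, push_id, push, Fintype.sum_eq_single (pt s)
          (fun x hx => absurd (eq_pt x) hx), inv_mul_cancel_left₀ hj]
      refine ⟨g, ?_, hgf⟩
      rw [← cancel_mono f, Category.assoc, hgf, Category.comp_id, Category.id_comp]

end GradedVect

/-! ## Quantum dimensions -/

namespace FusionDatum

open GradedVect

variable {I : Type u} {G : Type} [Group G] [Fintype I] {D : FusionDatum I}
  {F' : I → I → I → I → I → I → ℂ}
  {ρ : G →* Function.End I} {t : G → I → I → I → ℂ} {gr : I → G} {R : I → I → I → ℂ}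
  {θ : I → ℂ}

/-- The zigzag identity for an object with one basis vector. -/
theorem push_coev_ev {F' : I → I → I → I → I → I → ℂ} (hC : D.IsCoherent F')
    {X Y : GradedVect I} {i : X.ι} (hi : ∀ k, k = i)
    {η : single D.one ⟶ D.tensorObj X Y} {e : D.tensorObj Y X ⟶ single D.one}
    (h : D.tensorHom η (𝟙 X) ≫ D.assocHom X Y X ≫ D.tensorHom (𝟙 X) e ≫ D.rightHom X =
      D.leftHom X)
    {ψ : (D.tensorObj X Y).ι → ℂ}
    (hψ : ∀ (j : Y.ι) (h₁ : D.one ∈ D.N (X.deg i) (Y.deg j)),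
      ∃ h₂ : D.one ∈ D.N (Y.deg j) (X.deg i), ψ (D.idx i j D.one h₁) =
        D.F (X.deg i) (Y.deg j) (X.deg i) D.one D.one (X.deg i) *
          push e (D.idx j i D.one h₂) fun _ => 1) :
    push η (pt D.one) ψ = 1 := by
  have h₀ := hC.mem_one_left X i (pt D.one)
  have h₀' := hC.mem_one_right X i (pt D.one)
  have := congrArg (fun f : D.tensorObj (single D.one) X ⟶ X =>
    push f (D.idx (pt D.one) i (X.deg i) h₀) fun _ => 1) h
  rw [push_leftHom _ _ _ _ _ rfl, push_comp, push_tensorHom] at this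
  rw [← this]
  refine push_congr _ _ fun p hp => ?_
  obtain ⟨k, j, s, hs, rfl⟩ := exists_idx p
  obtain rfl : D.one = s := hp
  obtain rfl := hi k
  obtain ⟨h₂, h₃⟩ := hψ j hs
  have h₄ : X.deg k ∈ D.N ((D.tensorObj X Y).deg (D.idx k j D.one hs)) (X.deg k) := h₀
  rw [h₃, push_id, dif_pos h₄, push_comp, push_assocHom, Fintype.sum_eq_single D.one]
  · rw [dif_pos ⟨h₂, show X.deg k ∈ D.N (X.deg k) D.one from h₀'⟩, push_comp, push_tensorHom, push_id]
    congr 1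
    refine push_congr _ _ fun u _ => ?_
    rw [eq_pt u, dif_pos h₀', push_rightHom _ _ _ _ _ rfl]
  -- An inner channel other than the unit is annihilated by the evaluation, whose target has degree
  -- `D.one`.
  · intro r hr
    split_ifs with e₁
    · rw [push_comp, push_tensorHom, push_id]
      refine mul_eq_zero_of_right _ ((push_congr (γ₁ := fun _ => 0) _ _ fun u hu => ?_).trans
        (push_zero _ _))
      exact absurd hu hr
    · rfl

-- The dual object and the pairing are arbitrary. The composite is a sum over basis vectors of `Y`
-- of coevaluation times evaluation coefficients, weighted by braiding times twist divided by the
-- tensor structure. By `hd` each weight is `d` times the associator coefficient from the zigzag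
-- identity, and with those coefficients the sum is `1`.
open Classical in
theorem push_quantumDim (hC : D.IsCoherent F') (hR : IsCrossedCoherent D F' ρ t gr R)
    (hθ : IsTwistCoherent D ρ t gr R θ) {g : G} {X Y : GradedVect I}
    (hX : ∀ i, gr (X.deg i) = g) {i : X.ι} (hi : ∀ k, k = i)
    {η : single D.one ⟶ D.tensorObj X Y} {e : D.tensorObj Y X ⟶ single D.one}
    (h : D.tensorHom η (𝟙 X) ≫ D.assocHom X Y X ≫ D.tensorHom (𝟙 X) e ≫ D.rightHom X =
      D.leftHom X)
    (hmem : ∀ k, D.one ∈ D.N (X.deg i) k → D.one ∈ D.N k (X.deg i)) {d : ℂ}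
    (hd : ∀ k, D.one ∈ D.N (X.deg i) k →
      R (X.deg i) k D.one * θ (X.deg i) =
        d * (t g k (X.deg i) D.one * D.F (X.deg i) k (X.deg i) D.one D.one (X.deg i)))
    [IsIso (D.tauHom D (act ρ g) (t g) Y X)] :
    η ≫ D.crossHom (act ρ g) R X Y ≫
        D.tensorHom (𝟙 ((relabel (act ρ g)).obj Y)) (twistHom (act ρ g) θ X) ≫
        inv (D.tauHom D (act ρ g) (t g) Y X) ≫ (relabel (act ρ g)).map e ≫ D.tauOne D (act ρ g) =
      d • 𝟙 (single D.one) := by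
  have hA := hR.isActionCoherent
  -- The functional whose value on the coevaluation is `1` by the zigzag identity; the default value
  -- `0` is never met, since `hmem` applies to every basis vector that the coevaluation reaches.
  have hψ := push_coev_ev hC hi h (ψ := fun p =>
    if h₂ : D.one ∈ D.N (Y.deg p.1.2.1) (X.deg i) then
      D.F (X.deg i) (Y.deg p.1.2.1) (X.deg i) D.one D.one (X.deg i) *
        push e (D.idx p.1.2.1 i D.one h₂) fun _ => 1 else 0)
    fun j h₁ => ⟨hmem _ h₁, dif_pos (hmem _ h₁)⟩
  refine ext_push fun p γ => ?_
  rw [eq_pt p]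
  have hsm : push (d • 𝟙 (single D.one)) (pt D.one) γ = d * γ (pt D.one) := by
    rw [← push_id (single D.one) (pt D.one) γ, push, push, Finset.mul_sum]
    exact Finset.sum_congr rfl fun _ _ => by rw [smul_apply, mul_assoc]
  rw [hsm, push_comp]
  trans d * γ (pt D.one) * 1
  · rw [← hψ, ← push_mul_left]
    refine push_congr _ _ fun p hp => ?_
    obtain ⟨k, j, s, hs, rfl⟩ := exists_idx p
    obtain rfl : D.one = s := hp
    obtain rfl := hi k
    have hs' := hmem _ hs
    have e₁ := hR.mem_cross hX hs
    have hXg : act ρ g (X.deg k) = X.deg k := by rw [← hX k, hθ.act_self]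
    have e₂ : D.one ∈ D.N (((relabel (act ρ g)).obj Y).deg (up (act ρ g) j))
        (((relabel (act ρ g)).obj X).deg (up (act ρ g) k)) := by
      have := e₁
      rwa [deg_up, deg_up, hXg] at *
    have e₃ := mem_up ((hA.mem g _ _ _).1 hs')
    have e₄ : D.idx _ _ _ e₂ = D.idx _ _ _ e₃ := idx_inj.2 ⟨rfl, rfl, (hA.one g).symm⟩
    have ht := hA.ne_zero g _ _ _ hs'
    rw [push_comp, push_crossHom _ _ _ _ e₁, push_comp, push_tensorHom, push_id,
      hθ.push_twistHom hX, dif_pos e₂, push_comp, e₄,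
      push_inv (p := up (act ρ g) (D.idx j k D.one hs')) ht fun γ => push_tauHom _ _ _ hs' e₃ γ,
      push_comp, push_relabel_up]
    have e₅ : ∀ u, push (D.tauOne D (act ρ g)) (up (act ρ g) u) γ = γ (pt D.one) * 1 := by
      intro u
      rw [eq_pt u, push_tauOne (hA.one g), mul_one]
    simp only [e₅]
    rw [push_mul_left]
    refine Eq.trans ?_ (congrArg (d * γ (pt D.one) * ·)
      (show D.F (X.deg k) (Y.deg j) (X.deg k) D.one D.one (X.deg k) *
        push e (D.idx j k D.one hs') (fun _ => 1) =
          if h₂ : D.one ∈ D.N (Y.deg j) (X.deg k) then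
            D.F (X.deg k) (Y.deg j) (X.deg k) D.one D.one (X.deg k) *
              push e (D.idx j k D.one h₂) fun _ => 1 else 0 by
        rw [dif_pos hs']))
    have := hd _ hs
    field_simp
    linear_combination γ (pt D.one) * (push e (D.idx j k D.one hs') fun _ => 1) * this
  · rw [mul_one]

end FusionDatum

/-! ## Duals -/

namespace FusionDatum

open GradedVect

section Raw

variable {I : Type u} [Finite I] (D : FusionDatum I)

open Classical in
/-- The sum of the inclusions of the unit into the products of basis vectors matched by `φ`. -/
noncomputable def coevHom {X Y : GradedVect I} (φ : X.ι ≃ Y.ι) :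
    single D.one ⟶ D.tensorObj X Y :=
  ofMat fun _ p => if φ p.1.1 = p.1.2.1 then 1 else 0

open Classical in
/-- The sum of the projections to the unit of the products of basis vectors matched by `φ`. -/
noncomputable def evHom {X Y : GradedVect I} (φ : X.ι ≃ Y.ι) (c : X.ι → ℂ) :
    D.tensorObj Y X ⟶ single D.one :=
  ofMat fun p _ => if φ p.1.2.1 = p.1.1 then c p.1.2.1 else 0

variable {D}

theorem push_coevHom {X Y : GradedVect I} {φ : X.ι ≃ Y.ι}
    (h : ∀ i, D.one ∈ D.N (X.deg i) (Y.deg (φ i))) (u) (γ) :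
    push (D.coevHom φ) u γ = ∑ i, γ (D.idx i (φ i) D.one (h i)) := by
  have : push (D.coevHom φ) u γ = ∑ i, 1 * γ (D.idx i (φ i) D.one (h i)) := by
    refine push_of_support (fun i j e => (idx_inj.1 e).1) (fun i => ?_) (fun p hp hn => ?_) γ
    · exact (ofMat_of_eq (by rfl)).trans (if_pos rfl)
    · obtain ⟨i, j, s, hs, rfl⟩ := exists_idx p
      obtain rfl : D.one = s := hp
      refine ofMat_eq_zero (if_neg fun e => ?_)
      obtain rfl : φ i = j := e
      exact hn i rfl
  simpa only [one_mul] using this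

theorem push_evHom {X Y : GradedVect I} {φ : X.ι ≃ Y.ι} {c : X.ι → ℂ} (i : X.ι) (h) (γ) :
    push (D.evHom φ c) (D.idx (φ i) i D.one h) γ = c i * γ (pt D.one) := by
  refine push_of_apply ?_ (fun q hq => absurd (eq_pt q) hq) γ
  exact (ofMat_of_eq (by rfl)).trans (if_pos rfl)

theorem push_evHom_of_ne {X Y : GradedVect I} {φ : X.ι ≃ Y.ι} {c : X.ι → ℂ} {j : Y.ι} {i : X.ι}
    {s : I} (hn : ¬ (φ i = j ∧ D.one = s)) (h) (γ) :
    push (D.evHom φ c) (D.idx j i s h) γ = 0 := by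
  refine (push_of_apply (q₀ := pt D.one) (c := 0) ?_ (fun q hq => absurd (eq_pt q) hq) γ).trans
    (zero_mul _)
  by_cases hs : D.one = s
  · exact ofMat_eq_zero (if_neg fun e => hn ⟨e, hs⟩)
  · exact ofMat_of_ne (Ne.symm hs)

end Raw

section Zigzag

variable {I : Type u} [Fintype I] {D : FusionDatum I} {F' : I → I → I → I → I → I → ℂ}

-- The coevaluation produces matched pairs, and the evaluation kills every pair that is not matched
-- and every inner channel other than the unit. One associator coefficient times `c` survives.
open Classical in
theorem zigzag_right (hC : D.IsCoherent F') {X Y : GradedVect I} {φ : X.ι ≃ Y.ι} {c : X.ι → ℂ}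
    (h : ∀ i, D.one ∈ D.N (X.deg i) (Y.deg (φ i))) (h' : ∀ i, D.one ∈ D.N (Y.deg (φ i)) (X.deg i))
    (hF : ∀ i, D.F (X.deg i) (Y.deg (φ i)) (X.deg i) D.one D.one (X.deg i) * c i = 1) :
    D.tensorHom (D.coevHom φ) (𝟙 X) ≫ D.assocHom X Y X ≫ D.tensorHom (𝟙 X) (D.evHom φ c) =
      D.leftHom X ≫ hC.rightInv X := by
  refine ext_push fun p γ => ?_
  obtain ⟨i, hi, rfl⟩ := hC.exists_left p
  have e₁ := hC.mem_one_right X i (pt D.one)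
  have e₂ : X.deg i ∈ D.N ((D.tensorObj X Y).deg (D.idx i (φ i) D.one (h i))) (X.deg i) :=
    hC.mem_one_left X i (pt D.one)
  rw [push_comp, push_tensorHom, push_coevHom h, push_comp, push_leftHom _ _ _ _ _ rfl,
    hC.push_rightInv, Fintype.sum_eq_single i]
  · rw [push_id, dif_pos e₂, push_comp, push_assocHom, Fintype.sum_eq_single D.one]
    · rw [dif_pos ⟨h' i, show X.deg i ∈ D.N (X.deg i) D.one from e₁⟩, push_tensorHom, push_id,
        push_evHom, dif_pos e₁, ← mul_assoc, hF, one_mul]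
    · intro r hr
      split_ifs with e₃
      · rw [push_tensorHom, push_id, push_evHom_of_ne (fun e => hr e.2.symm), mul_zero]
      · rfl
  · intro k hk
    rw [push_id]
    split_ifs with e₃
    · rw [push_comp, push_assocHom]
      refine Finset.sum_eq_zero fun r _ => ?_
      split_ifs with e₄
      · rw [push_tensorHom, push_id, push_evHom_of_ne (fun e => hk (φ.injective e.1).symm),
          mul_zero]
      · rfl
    · rfl

open Classical in
theorem zigzag_left (hC : D.IsCoherent F') {X Y : GradedVect I} {φ : X.ι ≃ Y.ι} {c : X.ι → ℂ}
    (h : ∀ i, D.one ∈ D.N (X.deg i) (Y.deg (φ i))) (h' : ∀ i, D.one ∈ D.N (Y.deg (φ i)) (X.deg i))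
    (hF : ∀ i, F' (Y.deg (φ i)) (X.deg i) (Y.deg (φ i)) D.one D.one (Y.deg (φ i)) * c i = 1) :
    D.tensorHom (𝟙 Y) (D.coevHom φ) ≫ D.assocInv F' Y X Y ≫ D.tensorHom (D.evHom φ c) (𝟙 Y) =
      D.rightHom Y ≫ hC.leftInv Y := by
  refine ext_push fun p γ => ?_
  obtain ⟨j, hj, rfl⟩ := hC.exists_right p
  obtain ⟨i, rfl⟩ := φ.surjective j
  have e₁ := hC.mem_one_left Y (φ i) (pt D.one)
  have e₂ : Y.deg (φ i) ∈ D.N (Y.deg (φ i)) ((D.tensorObj X Y).deg (D.idx i (φ i) D.one (h i))) :=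
    hC.mem_one_right Y (φ i) (pt D.one)
  rw [push_comp, push_tensorHom, push_id, push_coevHom h, push_comp, push_rightHom _ _ _ _ _ rfl,
    hC.push_leftInv, Fintype.sum_eq_single i]
  · rw [dif_pos e₂, push_comp, push_assocInv, Fintype.sum_eq_single D.one]
    · rw [dif_pos ⟨h' i, show Y.deg (φ i) ∈ D.N D.one (Y.deg (φ i)) from e₁⟩, push_tensorHom,
        push_evHom, push_id, dif_pos e₁, ← mul_assoc, hF, one_mul]
    · intro r hr
      split_ifs with e₃
      · rw [push_tensorHom, push_evHom_of_ne (fun e => hr e.2.symm), mul_zero]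
      · rfl
  · intro k hk
    split_ifs with e₃
    · rw [push_comp, push_assocInv]
      refine Finset.sum_eq_zero fun r _ => ?_
      split_ifs with e₄
      · rw [push_tensorHom, push_evHom_of_ne (fun e => hk (φ.injective e.1)), mul_zero]
      · rfl
    · rfl

/-- A matching of the bases of `X` and `Y` by dual labels makes `Y` a dual of `X`. -/
noncomputable abbrev exactPairing (hC : D.IsCoherent F') (hD : D.IsTensor) {X Y : Cat hD}
    (φ : GradedVect.ι X ≃ GradedVect.ι Y) (c : GradedVect.ι X → ℂ)
    (h : ∀ i, D.one ∈ D.N (GradedVect.deg X i) (GradedVect.deg Y (φ i)))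
    (h' : ∀ i, D.one ∈ D.N (GradedVect.deg Y (φ i)) (GradedVect.deg X i))
    (hF : ∀ i, D.F (GradedVect.deg X i) (GradedVect.deg Y (φ i)) (GradedVect.deg X i) D.one D.one
      (GradedVect.deg X i) * c i = 1)
    (hF' : ∀ i, F' (GradedVect.deg Y (φ i)) (GradedVect.deg X i) (GradedVect.deg Y (φ i))
      D.one D.one (GradedVect.deg Y (φ i)) * c i = 1) :
    ExactPairing X Y where
  coevaluation' := D.coevHom (X := X) (Y := Y) φ
  evaluation' := D.evHom (X := X) (Y := Y) φ c
  coevaluation_evaluation' := by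
    have e : (λ_ Y).inv = hC.leftInv Y := Iso.inv_ext (hC.left_hom_inv Y)
    rw [associator_inv hC, e]
    exact zigzag_left (X := X) (Y := Y) hC h h' hF'
  evaluation_coevaluation' := by
    have e : (ρ_ X).inv = hC.rightInv X := Iso.inv_ext (hC.right_hom_inv X)
    rw [e]
    exact zigzag_right (X := X) (Y := Y) hC h h' hF

/-- Scalars `c` that make `dual` an assignment of duals. -/
structure IsDual (D : FusionDatum I) (F' : I → I → I → I → I → I → ℂ) (dual : I → I) (c : I → ℂ) :
    Prop where
  invol : ∀ i, dual (dual i) = i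
  mem : ∀ i, D.one ∈ D.N i (dual i)
  zigzag : ∀ i, D.F i (dual i) i D.one D.one i * c i = 1
  zigzag' : ∀ i, F' (dual i) i (dual i) D.one D.one (dual i) * c i = 1

omit [Fintype I] in
theorem IsDual.mem' {dual : I → I} {c : I → ℂ} (h : IsDual D F' dual c) (i : I) :
    D.one ∈ D.N (dual i) i := by
  have := h.mem (dual i)
  rwa [h.invol] at this

theorem IsDual.rigid {dual : I → I} {c : I → ℂ} (h : IsDual D F' dual c) (hC : D.IsCoherent F')
    (hD : D.IsTensor) : Nonempty (RigidCategory (Cat hD)) := by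
  refine ⟨{ toRightRigidCategory := @RightRigidCategory.mk _ _ _ ?_
            toLeftRigidCategory := @LeftRigidCategory.mk _ _ _ ?_ }⟩
  · intro X
    let X' : GradedVect I := X
    let Y : GradedVect I := ⟨X'.ι, fun i => dual (X'.deg i)⟩
    exact @HasRightDual.mk (Cat hD) _ _ X Y
      (exactPairing hC hD (X := X') (Y := Y) (Equiv.refl _) (fun i => c (X'.deg i))
        (fun i => h.mem _) (fun i => h.mem' _) (fun i => h.zigzag _) fun i => h.zigzag' _)
  · intro X
    let X' : GradedVect I := X
    let Y : GradedVect I := ⟨X'.ι, fun i => dual (X'.deg i)⟩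
    -- The same matching read backwards: since `dual` is an involution, `X` is also a right dual of
    -- `Y`, with scalar `c` taken at the dual label.
    refine @HasLeftDual.mk (Cat hD) _ _ X Y
      (exactPairing hC hD (X := Y) (Y := X') (Equiv.refl _) (fun i => c (dual (X'.deg i)))
        (fun i => h.mem' _) (fun i => h.mem _) (fun i => ?_) fun i => ?_)
    · have := h.zigzag (dual (X'.deg i))
      rwa [h.invol] at this
    · have := h.zigzag' (dual (X'.deg i))
      rwa [h.invol] at this

end Zigzag

section Dimension

variable {I : Type u} {G : Type} [Group G] [Fintype I] {D : FusionDatum I}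
  {F' : I → I → I → I → I → I → ℂ}
  {ρ : G →* Function.End I} {t : G → I → I → I → ℂ} {gr : I → G} {R : I → I → I → ℂ}
  {θ : I → ℂ}

theorem quantumDim_eq (hC : D.IsCoherent F') (hR : IsCrossedCoherent D F' ρ t gr R)
    (hθ : IsTwistCoherent D ρ t gr R θ) (hD : D.IsTensor)
    (hB : (crossedData hD ρ t gr R).IsBraidedCrossed) {g : G} {X : Cat hD}
    (hX : (crossedData hD ρ t gr R).comp g X) (Y : Cat hD) [ExactPairing X Y]
    {i : GradedVect.ι X} (hi : ∀ k, k = i)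
    (hmem : ∀ k, D.one ∈ D.N (GradedVect.deg X i) k → D.one ∈ D.N k (GradedVect.deg X i)) {d : ℂ}
    (hd : ∀ k, D.one ∈ D.N (GradedVect.deg X i) k →
      R (GradedVect.deg X i) k D.one * θ (GradedVect.deg X i) =
        d * (t g k (GradedVect.deg X i) D.one *
          D.F (GradedVect.deg X i) k (GradedVect.deg X i) D.one D.one (GradedVect.deg X i))) :
    (crossedData hD ρ t gr R).quantumDim hB (twistData hD ρ t gr R θ) hX Y = d • 𝟙 _ := by
  have h : η_ X Y ▷ X ≫ (α_ X Y X).hom ≫ X ◁ ε_ X Y ≫ (ρ_ X).hom = (λ_ X).hom := by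
    have := ExactPairing.evaluation_coevaluation X Y
    rw [← Category.assoc, ← Category.assoc, Category.assoc (η_ X Y ▷ X), this, Category.assoc,
      Iso.inv_hom_id, Category.comp_id]
  have : IsIso (D.tauHom D (act ρ g) (t g) Y X) := hB.isAction.τ_iso g Y X
  exact push_quantumDim (X := X) (Y := Y) hC hR hθ hX hi (η := η_ X Y) (e := ε_ X Y) h hmem hd

end Dimension

end FusionDatum

/-! ## Graded vector spaces form a semisimple abelian category -/

namespace GradedVect

variable {I : Type u}

instance finite_hom (X Y : GradedVect I) : Module.Finite ℂ (X ⟶ Y) :=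
  inferInstanceAs (Module.Finite ℂ (homs X Y))

/-- The homogeneous components, as functor. -/
noncomputable def components : GradedVect I ⥤ (Discrete I ⥤ FGModuleCat.{u} ℂ) where
  obj X := Discrete.functor fun s => FGModuleCat.of ℂ (single s ⟶ X)
  map f := Discrete.natTrans fun s => FGModuleCat.ofHom (Linear.rightComp ℂ (single s.as) f)
  map_id X := by
    ext s g
    exact Category.comp_id (show single s.as ⟶ X from g)
  map_comp {X _ _} f k := by
    ext s g
    exact (Category.assoc (show single s.as ⟶ X from g) f k).symm

open Classical in
/-- The map from a one-dimensional space that hits a given basis vector, or is zero if the degrees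
differ. -/
noncomputable def toBasis (s : I) {X : GradedVect I} (i : X.ι) : single s ⟶ X :=
  ofMat fun _ k => if i = k then 1 else 0

theorem coeff_sum {K : Type*} (t : Finset K) {X Y : GradedVect I} (f : K → (X ⟶ Y)) (p q) :
    coeff (∑ k ∈ t, f k) p q = ∑ k ∈ t, coeff (f k) p q := by
  classical
  induction t using Finset.induction_on with
  | empty => rfl
  | insert a t ha ih => rw [Finset.sum_insert ha, Finset.sum_insert ha, add_apply, ih]

theorem eq_sum_toBasis {s : I} {X : GradedVect I} (g : single s ⟶ X) :
    g = ∑ i, coeff g (pt s) i • toBasis s i := by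
  classical
  refine hom_ext fun p k => ?_
  rw [eq_pt p, coeff_sum, Fintype.sum_eq_single k]
  · rw [smul_apply]
    by_cases h : s = X.deg k
    · rw [show coeff (toBasis s k) (pt s) k = 1 from (ofMat_of_eq (by exact h)).trans (if_pos rfl),
        mul_one]
    · rw [coeff_of_ne g (show (single s).deg (pt s) ≠ X.deg k from h), zero_mul]
  · intro i hi
    rw [smul_apply, show coeff (toBasis s i) (pt s) k = 0 from ofMat_eq_zero (if_neg hi), mul_zero]

instance : (components (I := I)).Faithful where
  map_injective {X Y f k} h := by
    classical
    have key : ∀ {s : I} (g : single s ⟶ X), g ≫ f = g ≫ k := by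
      intro s g
      have := congrArg (fun φ => (φ.app ⟨s⟩).hom.hom g) h
      exact this
    refine ext_push fun p γ => ?_
    have := congrArg (fun g => push g (pt _) γ) (key (line p))
    simpa only [push_comp, push_line] using this

/-- A family of linear maps between components is determined by the images of basis vectors, and
these images are the rows of the matrix sought. -/
instance : (components (I := I)).Full where
  map_surjective {X Y} φ := by
    refine ⟨ofMat fun i j => coeff ((φ.app ⟨X.deg i⟩).hom.hom (toBasis (X.deg i) i) :
      single (X.deg i) ⟶ Y) (pt _) j, ?_⟩
    ext ⟨s⟩ g
    refine hom_ext (X := single s) (Y := Y) fun p j => ?_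
    rw [eq_pt p]
    have h₁ : ((φ.app ⟨s⟩).hom.hom g : single s ⟶ Y) =
        ∑ i, coeff g (pt s) i • ((φ.app ⟨s⟩).hom.hom (toBasis s i) : single s ⟶ Y) := by
      refine (congrArg (φ.app ⟨s⟩).hom.hom (eq_sum_toBasis (X := X) g)).trans ?_
      refine (map_sum (φ.app ⟨s⟩).hom.hom _ _).trans (Finset.sum_congr rfl fun i _ => ?_)
      exact map_smul (φ.app ⟨s⟩).hom.hom _ _
    refine Eq.trans ?_ (congrArg (fun f : single s ⟶ Y => coeff f (pt s) j) h₁.symm)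
    refine ((comp_apply (X := single s) (Y := X) (Z := Y) g _ (pt s) j).trans
      (Finset.sum_congr rfl fun i _ => ?_)).trans (coeff_sum _ _ _ _).symm
    refine Eq.trans ?_ (smul_apply (X := single s) (Y := Y) _ _ (pt s) j).symm
    by_cases h : s = X.deg i
    · subst h
      congr 1
      by_cases hj : X.deg i = Y.deg j
      · exact ofMat_of_eq hj
      · exact (ofMat_of_ne hj).trans (coeff_of_ne _ (by exact hj)).symm
    · have h₂ : coeff (X := single s) (Y := X) g (pt s) i = 0 := coeff_of_ne _ h
      rw [h₂, zero_mul, zero_mul]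

open Classical in
/-- Maps from a one-dimensional space are families of coordinates. -/
noncomputable def homEquiv (s : I) (X : GradedVect I) :
    (single s ⟶ X) ≃ₗ[ℂ] ({i : X.ι // X.deg i = s} → ℂ) where
  toFun g i := coeff g (pt s) i.1
  map_add' _ _ := rfl
  map_smul' _ _ := rfl
  invFun v := ofMat fun _ k => if h : X.deg k = s then v ⟨k, h⟩ else 0
  left_inv g := by
    refine hom_ext fun p k => ?_
    by_cases h : X.deg k = s
    · exact (ofMat_of_eq (by exact h.symm)).trans (dif_pos h)
    · exact (ofMat_of_ne (by exact Ne.symm h)).trans (coeff_of_ne g (by exact Ne.symm h)).symm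
  right_inv v := by
    funext k
    exact (ofMat_of_eq (by exact k.2.symm)).trans (dif_pos k.2)

/-- Only dimensions matter: take as many basis vectors in degree `s` as the dimension of the space
at `s`. Finiteness of `I` keeps the total basis finite. -/
instance [Finite I] : (components (I := I)).EssSurj where
  mem_essImage V := by
    have := Fintype.ofFinite I
    let n : I → ℕ := fun s => Module.finrank ℂ (V.obj ⟨s⟩)
    let X : GradedVect I := ⟨Σ s, ULift.{u} (Fin (n s)), Sigma.fst⟩
    have h : ∀ s, Module.finrank ℂ (single s ⟶ X) = Module.finrank ℂ (V.obj ⟨s⟩) := by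
      classical
      intro s
      rw [(homEquiv s X).finrank_eq, Module.finrank_fintype_fun_eq_card]
      exact (Fintype.card_congr (Equiv.sigmaSubtype s)).trans
        ((Fintype.card_congr Equiv.ulift).trans (Fintype.card_fin _))
    exact ⟨X, ⟨Discrete.natIso fun s =>
      (LinearEquiv.ofFinrankEq (R := ℂ) (single s.as ⟶ X) (V.obj s) (h s.as)).toFGModuleCatIso⟩⟩

instance [Finite I] : (components (I := I)).IsEquivalence where

open Classical in
instance : Limits.HasFiniteProducts (GradedVect I) := by
  suffices Limits.HasFiniteBiproducts (GradedVect I) from inferInstance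
  refine ⟨fun n => ⟨fun S => ?_⟩⟩
  let X : GradedVect I := ⟨Σ j, (S j).ι, fun p => (S p.1).deg p.2⟩
  obtain ⟨b, ⟨hb⟩, -⟩ := exists_isBilimit (S := S) (X := X) (e := Equiv.refl _) fun _ _ => rfl
  exact ⟨⟨⟨b, hb⟩⟩⟩

/-- Graded vector spaces form an abelian category. -/
noncomputable abbrev abelian [Finite I] : Abelian (GradedVect I) := abelianOfEquivalence components

/-- Transfer along the equivalence keeps the given addition of morphisms, which is the compatibility
demanded of a fusion category. -/
theorem abelian_toPreadditive [Finite I] :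
    (abelian (I := I)).toPreadditive = (inferInstance : Preadditive (GradedVect I)) := rfl

theorem exists_simple_summands (X : GradedVect I) :
    ∃ (n : ℕ) (S : Fin n → GradedVect I) (b : Limits.Bicone S),
      (∀ i, Simple (S i)) ∧ Nonempty b.IsBilimit ∧ Nonempty (b.pt ≅ X) := by
  let e := (Fintype.equivFin X.ι).symm
  obtain ⟨b, h₁, h₂⟩ := exists_isBilimit (S := fun k => single (X.deg (e k))) (X := X)
    (e := (Equiv.sigmaPUnit _).trans e) fun _ _ => rfl
  exact ⟨_, _, b, fun _ => simple_single _, h₁, h₂⟩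

theorem exists_simple_representatives [Finite I] :
    ∃ (n : ℕ) (S : Fin n → GradedVect I), ∀ X : GradedVect I, Simple X →
      ∃ i, Nonempty (X ≅ S i) := by
  have := Fintype.ofFinite I
  refine ⟨Fintype.card I, fun k => single ((Fintype.equivFin I).symm k), fun X _ => ?_⟩
  obtain ⟨i, hi⟩ := exists_basis_of_simple X
  refine ⟨Fintype.equivFin I (X.deg i), ?_⟩
  dsimp only
  rw [Equiv.symm_apply_apply]
  exact nonempty_iso_single hi

end GradedVect

/-! ### Bilinearity of the tensor product and the fusion axioms -/

namespace FusionDatum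

open GradedVect

variable {I : Type u} [Fintype I] {D : FusionDatum I} {F' : I → I → I → I → I → I → ℂ}

theorem tensorHom_add_right {X X₁ Y Y₁ : GradedVect I} (f : X ⟶ X₁) (g g₁ : Y ⟶ Y₁) :
    D.tensorHom f (g + g₁) = D.tensorHom f g + D.tensorHom f g₁ := by
  classical
  refine hom_ext fun p q => ?_
  obtain ⟨i, j, s, h, rfl⟩ := exists_idx p
  obtain ⟨i, j, s, h, rfl⟩ := exists_idx q
  simp only [add_apply, coeff_tensorHom]
  split_ifs <;> ring

theorem tensorHom_add_left {X X₁ Y Y₁ : GradedVect I} (f f₁ : X ⟶ X₁) (g : Y ⟶ Y₁) :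
    D.tensorHom (f + f₁) g = D.tensorHom f g + D.tensorHom f₁ g := by
  classical
  refine hom_ext fun p q => ?_
  obtain ⟨i, j, s, h, rfl⟩ := exists_idx p
  obtain ⟨i, j, s, h, rfl⟩ := exists_idx q
  simp only [add_apply, coeff_tensorHom]
  split_ifs <;> ring

theorem tensorHom_smul_right {X X₁ Y Y₁ : GradedVect I} (f : X ⟶ X₁) (c : ℂ) (g : Y ⟶ Y₁) :
    D.tensorHom f (c • g) = c • D.tensorHom f g := by
  classical
  refine hom_ext fun p q => ?_
  obtain ⟨i, j, s, h, rfl⟩ := exists_idx p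
  obtain ⟨i, j, s, h, rfl⟩ := exists_idx q
  simp only [smul_apply, coeff_tensorHom]
  split_ifs <;> ring

theorem tensorHom_smul_left {X X₁ Y Y₁ : GradedVect I} (c : ℂ) (f : X ⟶ X₁) (g : Y ⟶ Y₁) :
    D.tensorHom (c • f) g = c • D.tensorHom f g := by
  classical
  refine hom_ext fun p q => ?_
  obtain ⟨i, j, s, h, rfl⟩ := exists_idx p
  obtain ⟨i, j, s, h, rfl⟩ := exists_idx q
  simp only [smul_apply, coeff_tensorHom]
  split_ifs <;> ring

theorem tensorHom_zero_right {X X₁ Y Y₁ : GradedVect I} (f : X ⟶ X₁) :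
    D.tensorHom f (0 : Y ⟶ Y₁) = 0 := by
  simpa using tensorHom_smul_right (D := D) f 0 (0 : Y ⟶ Y₁)

theorem tensorHom_zero_left {X X₁ Y Y₁ : GradedVect I} (g : Y ⟶ Y₁) :
    D.tensorHom (0 : X ⟶ X₁) g = 0 := by
  simpa using tensorHom_smul_left (D := D) 0 (0 : X ⟶ X₁) g

theorem IsDual.isFusion {dual : I → I} {c : I → ℂ} (h : IsDual D F' dual c)
    (hC : D.IsCoherent F') (hD : D.IsTensor) : IsFusion (Cat hD) where
  abelian := ⟨GradedVect.abelian (I := I), GradedVect.abelian_toPreadditive⟩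
  bilinear := by
    have h₁ : MonoidalPreadditive (Cat hD) :=
      { whiskerLeft_zero := tensorHom_zero_right _
        zero_whiskerRight := tensorHom_zero_left _
        whiskerLeft_add := tensorHom_add_right _
        add_whiskerRight := fun f g => tensorHom_add_left f g _ }
    exact ⟨h₁,
      { whiskerLeft_smul := fun _ _ _ r f => tensorHom_smul_right _ r f
        smul_whiskerRight := fun r _ _ f _ => tensorHom_smul_left r f _ }⟩
  finite_hom X Y := GradedVect.finite_hom (I := I) X Y
  finite_simple := GradedVect.exists_simple_representatives (I := I)
  semisimple X := GradedVect.exists_simple_summands (I := I) X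
  rigid := h.rigid hC hD
  unit_simple := GradedVect.simple_single D.one

end FusionDatum

/-! ## Braidings -/

namespace FusionDatum

open GradedVect

section Braided

variable {I : Type u} [Fintype I] {D : FusionDatum I} {F' : I → I → I → I → I → I → ℂ}
  {R : I → I → I → ℂ}

/-- The equations that make `R` a braiding. -/
abbrev IsBraidCoherent (D : FusionDatum I) (F' : I → I → I → I → I → I → ℂ)
    (R : I → I → I → ℂ) : Prop :=
  IsCrossedCoherent D F' (1 : Unit →* Function.End I) (fun _ _ _ _ => 1) (fun _ => 1) R

theorem tauHom_id (X Y : GradedVect I) :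
    D.tauHom D id (fun _ _ _ => 1) X Y = 𝟙 (D.tensorObj X Y) := by
  refine ext_push fun p γ => ?_
  obtain ⟨i, j, s, hs, rfl⟩ := exists_idx (D := D) (X := X) (Y := Y) p
  exact (push_tauHom i j s hs hs γ).trans ((one_mul _).trans (push_id _ _ γ).symm)

/-- The braided monoidal category defined by a solution of the hexagon equations. -/
noncomputable abbrev IsBraidCoherent.braidedCategory (h : IsBraidCoherent D F' R)
    (hC : D.IsCoherent F') (hD : D.IsTensor) : BraidedCategory (Cat hD) where
  braiding X Y :=
    haveI : IsIso (braidHom hD R X Y) :=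
      isIso_crossHom (f := id) (X := X) (Y := Y) (fun _ _ _ => h.cross _ _ _) h.ne_zero
    asIso (braidHom hD R X Y)
  braiding_naturality_right X Y Z f :=
    crossHom_natural (f := id) (X := X) (Y := Y) (Y₁ := Z) (fun _ _ _ => h.cross _ _ _) (𝟙 X) f
  braiding_naturality_left {X Y} f Z :=
    crossHom_natural (f := id) (X := X) (X₁ := Y) (Y := Z) (fun _ _ _ => h.cross _ _ _) f (𝟙 Z)
  hexagon_forward X Y Z := by
    have e : D.tensorHom (D.tauHom D id (fun _ _ _ => 1) Y Z) (𝟙 X) = 𝟙 _ :=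
      (congrArg (fun a => D.tensorHom (X₁ := D.tensorObj Y Z) a (𝟙 X)) (tauHom_id Y Z)).trans
        (tensorHom_id _ _)
    have := h.hexagon_crossHom (g := ()) (X := X) (fun _ => rfl) Y Z
    refine Eq.trans ?_ this
    refine congrArg (D.assocHom X Y Z ≫ ·) (congrArg (D.crossHom id R X (D.tensorObj Y Z) ≫ ·) ?_)
    refine Eq.symm ((congrArg (· ≫ D.assocHom Y Z X) e).trans (Category.id_comp _))
  hexagon_reverse X Y Z := by
    rw [associator_inv hC, associator_inv hC, associator_inv hC]
    have e : D.tensorHom (compIso (1 : Unit →* Function.End I) () () Z).hom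
        (𝟙 (D.tensorObj X Y)) = 𝟙 _ := tensorHom_id _ _
    have := h.hexagon_inv_crossHom (g := ()) (k := ()) (X := X) (Y := Y) (fun _ => rfl)
      (fun _ => rfl) Z
    have e₁ : D.crossHom id R (D.tensorObj X Y) Z ≫ D.assocInv F' Z X Y =
        D.assocHom X Y Z ≫ D.tensorHom (𝟙 X) (D.crossHom id R Y Z) ≫ D.assocInv F' X Z Y ≫
          D.tensorHom (D.crossHom id R X Z) (𝟙 Y) := by
      refine Eq.trans ?_ this
      refine congrArg (D.crossHom id R (D.tensorObj X Y) Z ≫ ·) ?_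
      exact Eq.symm ((congrArg (· ≫ D.assocInv F' Z X Y) e).trans (Category.id_comp _))
    -- The usual reverse hexagon is the crossed second hexagon composed with an inverse associator
    -- on the left.
    refine (congrArg (D.assocInv F' X Y Z ≫ ·) e₁).trans ?_
    refine (Category.assoc _ _ _).symm.trans ?_
    exact (congrArg (· ≫ _) (hC.assoc_inv_hom X Y Z)).trans (Category.id_comp _)

end Braided

/-! ## Embeddings of the neutral component -/

section Embedding

variable {I J : Type u} {G : Type} [Group G] [Fintype I] [Fintype J]

/-- The functor given by a map of labels. -/
noncomputable def relabelCat {D : FusionDatum I} {E : FusionDatum J} (hD : D.IsTensor)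
    (hE : E.IsTensor) (f : I → J) : Cat hD ⥤ Cat hE := relabel f

/-- The map of labels `f` identifies `D` with the neutral component of `E`. -/
structure IsNeutralEmbedding (D : FusionDatum I) (E : FusionDatum J) (f : I → J)
    (ρ₀ : G →* Function.End I) (ρ : G →* Function.End J) (t₀ : G → I → I → I → ℂ)
    (t : G → J → J → J → ℂ) (gr : J → G) (R₀ : I → I → I → ℂ) (R : J → J → J → ℂ) : Prop where
  inj : Function.Injective f
  one : f D.one = E.one
  mem : ∀ i j s, s ∈ D.N i j ↔ f s ∈ E.N (f i) (f j)
  mem_range : ∀ i j w, w ∈ E.N (f i) (f j) → ∃ s, f s = w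
  assoc : ∀ i j k s r w, E.F (f i) (f j) (f k) (f s) (f r) (f w) = D.F i j k s r w
  act : ∀ g i, f (act ρ₀ g i) = FusionDatum.act ρ g (f i)
  tau : ∀ g i j s, t g (f i) (f j) (f s) = t₀ g i j s
  braid : ∀ i j s, R (f i) (f j) (f s) = R₀ i j s
  gr_eq : ∀ j, gr j = 1 ↔ ∃ i, f i = j
  mem_comm : ∀ i j s, s ∈ D.N i j → s ∈ D.N j i

variable {D : FusionDatum I} {E : FusionDatum J} {f : I → J}
  {ρ₀ : G →* Function.End I} {ρ : G →* Function.End J} {t₀ : G → I → I → I → ℂ}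
  {t : G → J → J → J → ℂ} {gr : J → G} {R₀ : I → I → I → ℂ} {R : J → J → J → ℂ}
  {F' : I → I → I → I → I → I → ℂ} {F'' : J → J → J → J → J → J → ℂ}

theorem inv_eq_inv_comp {C : Type*} [Category* C] {X Y Z : C} (a : X ≅ Z) (b : Y ≅ Z)
    (m : X ⟶ Y) (h : a.hom = m ≫ b.hom) : b.inv = a.inv ≫ m := by
  rw [Iso.eq_inv_comp, h, Category.assoc, Iso.hom_inv_id, Category.comp_id]

theorem full_relabel {I J : Type u} {f : I → J} (h : Function.Injective f) : (relabel f).Full where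
  map_surjective b :=
    ⟨⟨b.1, fun i j e => b.2 i j fun e₁ => e (h e₁)⟩, rfl⟩

theorem mem_essImage_relabel {I J : Type u} {f : I → J} {G : Type} [Group G] {gr : J → G}
    (h : ∀ j, gr j = 1 ↔ ∃ i, f i = j) (Y : GradedVect J) : (∀ i, gr (Y.deg i) = 1) ↔ (relabel f).essImage Y := by
  constructor
  · intro hY
    choose e he using fun i => (h _).1 (hY i)
    exact ⟨⟨Y.ι, e⟩, ⟨isoOfDeg Y he⟩⟩
  · rintro ⟨X, ⟨e⟩⟩ j
    obtain ⟨i, hi⟩ := exists_deg_eq_of_iso e j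
    exact (h _).2 ⟨X.deg i, hi⟩

namespace IsNeutralEmbedding

variable (h : IsNeutralEmbedding D E f ρ₀ ρ t₀ t gr R₀ R)
include h

theorem isIso_delta (X Y : GradedVect I) : IsIso (D.tauHom E f (fun _ _ _ => 1) X Y) :=
  isIso_tauHom h.inj h.mem h.mem_range (fun _ _ _ _ => one_ne_zero) X Y

theorem delta_natural {X X₁ Y Y₁ : GradedVect I} (a : X ⟶ X₁) (b : Y ⟶ Y₁) :
    D.tauHom E f (fun _ _ _ => 1) X Y ≫ E.tensorHom ((relabel f).map a) ((relabel f).map b) =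
      (relabel f).map (D.tensorHom a b) ≫ D.tauHom E f (fun _ _ _ => 1) X₁ Y₁ :=
  (tauHom_natural h.mem a b).symm

theorem delta_assoc (X Y Z : GradedVect I) :
    D.tauHom E f (fun _ _ _ => 1) (D.tensorObj X Y) Z ≫
      E.tensorHom (D.tauHom E f (fun _ _ _ => 1) X Y) (𝟙 ((relabel f).obj Z)) ≫ E.assocHom _ _ _ =
    (relabel f).map (D.assocHom X Y Z) ≫ D.tauHom E f (fun _ _ _ => 1) X (D.tensorObj Y Z) ≫
      E.tensorHom (𝟙 ((relabel f).obj X)) (D.tauHom E f (fun _ _ _ => 1) Y Z) :=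
  tauHom_assoc h.mem h.inj h.mem_range (fun i j k s r w _ _ _ _ => by
    rw [h.assoc]
    ring) X Y Z

/-- The embedding is an oplax monoidal functor. -/
noncomputable abbrev oplaxMonoidal (hC : D.IsCoherent F') (hE : E.IsCoherent F'')
    (hD : D.IsTensor) (hE' : E.IsTensor) : (relabelCat hD hE' f).OplaxMonoidal where
  η := D.tauOne E f
  δ X Y := D.tauHom E f (fun _ _ _ => 1) X Y
  δ_natural_left {X Y} a Z := by
    refine (congrArg (D.tauHom E f (fun _ _ _ => 1) X Z ≫ ·) ?_).trans
      (h.delta_natural (X := X) (X₁ := Y) a (𝟙 Z))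
    exact congrArg (E.tensorHom ((relabel f).map a)) ((relabel f).map_id Z).symm
  δ_natural_right {X Y} Z a := by
    refine (congrArg (D.tauHom E f (fun _ _ _ => 1) Z X ≫ ·) ?_).trans
      (h.delta_natural (X := Z) (Y := X) (Y₁ := Y) (𝟙 Z) a)
    exact congrArg (fun b => E.tensorHom b ((relabel f).map a)) ((relabel f).map_id Z).symm
  oplax_associativity X Y Z := h.delta_assoc X Y Z
  oplax_left_unitality X :=
    inv_eq_inv_comp ((relabelCat hD hE' f).mapIso (λ_ X)) (λ_ _) _
      ((tauHom_left hC hE h.one (t := fun _ _ _ => 1) (fun _ => rfl) X).trans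
        (Category.assoc _ _ _).symm)
  oplax_right_unitality X :=
    inv_eq_inv_comp ((relabelCat hD hE' f).mapIso (ρ_ X)) (ρ_ _) _
      ((tauHom_right hC hE h.one (t := fun _ _ _ => 1) (fun _ => rfl) X).trans
        (Category.assoc _ _ _).symm)

theorem delta_braid (X Y : GradedVect I) (hX : ∀ i, gr (((relabel f).obj X).deg i) = 1)
    (hR : IsCrossedCoherent E F'' ρ t gr R) :
    D.tauHom E f (fun _ _ _ => 1) X Y ≫
        E.crossHom (FusionDatum.act ρ 1) R ((relabel f).obj X) ((relabel f).obj Y) ≫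
        E.tensorHom (unitIso ρ ((relabel f).obj Y)).hom (𝟙 ((relabel f).obj X)) =
      (relabel f).map (D.crossHom id R₀ X Y) ≫ D.tauHom E f (fun _ _ _ => 1) Y X := by
  classical
  refine ext_push fun p γ => ?_
  obtain ⟨p, hp⟩ := exists_up f p
  obtain ⟨i, j, s, hs, rfl⟩ := exists_idx p
  subst hp
  have e₁ := mem_up ((h.mem _ _ _).1 hs)
  have e₂ := hR.mem_cross hX e₁
  have e₃ : s ∈ D.N (Y.deg j) (X.deg i) := h.mem_comm _ _ _ hs
  have e₄ := mem_up ((h.mem _ _ _).1 e₃)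
  have e₅ : push (D.crossHom id R₀ X Y) (D.idx i j s hs)
      (fun q => push (D.tauHom E f (fun _ _ _ => 1) Y X) (up f q) γ) =
      R₀ (X.deg i) (Y.deg j) s * push (D.tauHom E f (fun _ _ _ => 1) Y X)
        (up f (D.idx j i s e₃)) γ :=
    push_crossHom (f := id) i j s hs e₃ _
  refine Eq.trans ?_ ((push_comp (Y := (relabel f).obj (D.tensorObj Y X)) _ _ _ _).trans e₅).symm
  rw [push_comp, push_tauHom _ _ _ _ e₁, push_comp, push_crossHom _ _ _ _ e₂, push_tensorHom,
    push_unitIso_hom, push_id, dif_pos e₄, push_tauHom _ _ _ _ e₄,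
    deg_up, deg_up, h.braid, one_mul, one_mul]

/-- The comparison `f (g_* X) ≅ g_* (f X)`. -/
noncomputable def compare (g : G) (X : GradedVect I) :
    (relabel f).obj ((relabel (FusionDatum.act ρ₀ g)).obj X) ≅
      (relabel (FusionDatum.act ρ g)).obj ((relabel f).obj X) :=
  isoOfDeg ((relabel f).obj X) (f := fun i => f (FusionDatum.act ρ₀ g (X.deg i)))
    (f₁ := fun i => FusionDatum.act ρ g (f (X.deg i))) fun i => h.act g (X.deg i)

omit [Fintype I] [Fintype J] in
theorem push_compare (g : G) (X : GradedVect I) (i : X.ι) (γ) :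
    push (h.compare g X).hom (up f (up (FusionDatum.act ρ₀ g) i)) γ =
      γ (up (FusionDatum.act ρ g) (up f i)) :=
  push_isoOfDeg_hom ((relabel f).obj X) (fun i => h.act g (X.deg i)) i γ

omit [Fintype I] [Fintype J] in
theorem compare_natural (g : G) {X Y : GradedVect I} (a : X ⟶ Y) :
    (relabel f).map ((relabel (FusionDatum.act ρ₀ g)).map a) ≫ (h.compare g Y).hom =
      (h.compare g X).hom ≫ (relabel (FusionDatum.act ρ g)).map ((relabel f).map a) := by
  refine ext_push fun p γ => ?_
  obtain ⟨p, hp⟩ := exists_up _ p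
  obtain ⟨p, hp'⟩ := exists_up _ p
  rw [hp, hp']
  simp only [push_comp, push_relabel_up, push_compare]

omit [Fintype I] [Fintype J] in
theorem compare_unit (X : GradedVect I) :
    (relabel f).map (unitIso ρ₀ X).hom =
      (h.compare 1 X).hom ≫ (unitIso ρ ((relabel f).obj X)).hom := by
  refine ext_push fun p γ => ?_
  obtain ⟨p, hp⟩ := exists_up _ p
  obtain ⟨p, hp'⟩ := exists_up _ p
  rw [hp, hp']
  simp only [push_comp, push_relabel_up, push_compare, push_unitIso_hom]

omit [Fintype I] [Fintype J] in
theorem compare_comp (g k : G) (X : GradedVect I) :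
    (relabel f).map (compIso ρ₀ g k X).hom ≫
        (h.compare g ((relabel (FusionDatum.act ρ₀ k)).obj X)).hom ≫
        (relabel (FusionDatum.act ρ g)).map (h.compare k X).hom =
      (h.compare (g * k) X).hom ≫ (compIso ρ g k ((relabel f).obj X)).hom := by
  refine ext_push fun p γ => ?_
  obtain ⟨p, hp⟩ := exists_up _ p
  obtain ⟨p, hp'⟩ := exists_up _ p
  rw [hp, hp']
  simp only [push_comp, push_relabel_up, push_compare, push_compIso_hom]

theorem compare_tensor (hA₀ : IsActionCoherent D ρ₀ t₀) (hA : IsActionCoherent E ρ t)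
    (g : G) (X Y : GradedVect I) :
    (relabel f).map (D.tauHom D (FusionDatum.act ρ₀ g) (t₀ g) X Y) ≫
        D.tauHom E f (fun _ _ _ => 1) _ _ ≫
        E.tensorHom (h.compare g X).hom (h.compare g Y).hom =
      (h.compare g (D.tensorObj X Y)).hom ≫
        (relabel (FusionDatum.act ρ g)).map (D.tauHom E f (fun _ _ _ => 1) X Y) ≫
        E.tauHom E (FusionDatum.act ρ g) (t g) ((relabel f).obj X) ((relabel f).obj Y) := by
  classical
  refine ext_push fun p γ => ?_
  obtain ⟨p, hp⟩ := exists_up _ p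
  obtain ⟨p, hp'⟩ := exists_up _ p
  obtain ⟨i, j, s, hs, rfl⟩ := exists_idx p
  rw [hp, hp']
  have e₁ := mem_up ((hA₀.mem g _ _ _).1 hs)
  have e₂ := mem_up ((h.mem _ _ _).1 e₁)
  have e₃ := mem_up ((h.mem _ _ _).1 hs)
  have e₄ := mem_up ((hA.mem g _ _ _).1 e₃)
  have e₅ : f (FusionDatum.act ρ₀ g s) ∈
      E.N (((relabel (FusionDatum.act ρ g)).obj ((relabel f).obj X)).deg
        (up (FusionDatum.act ρ g) (up f i)))
      (((relabel (FusionDatum.act ρ g)).obj ((relabel f).obj Y)).deg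
        (up (FusionDatum.act ρ g) (up f j))) := by
    rw [h.act]
    exact e₄
  have e₆ : E.idx _ _ _ e₅ = E.idx _ _ _ e₄ := idx_inj.2 ⟨rfl, rfl, h.act g s⟩
  rw [push_comp, push_relabel_up, push_tauHom _ _ _ _ e₁, push_comp, push_tauHom _ _ _ _ e₂,
    push_tensorHom, push_compare, push_compare, dif_pos e₅, push_comp, push_compare, push_comp,
    push_relabel_up, push_tauHom _ _ _ _ e₃, push_tauHom _ _ _ _ e₄, e₆, deg_up, deg_up, h.tau,
    one_mul, one_mul]

/-- The comparison maps start at the image of a tensor product, so the embedding is first an oplax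
monoidal functor. They are invertible, which upgrades it to a monoidal functor with `μ` inverse to
`δ`; the braiding equation is verified for `δ` and then rewritten for `μ`. -/
theorem isExtension (hC : D.IsCoherent F') (hE : E.IsCoherent F'')
    (hA₀ : IsActionCoherent D ρ₀ t₀) (hR : IsCrossedCoherent E F'' ρ t gr R)
    (hD : D.IsTensor) (hE' : E.IsTensor) [BraidedCategory (Cat hD)]
    (hβ : ∀ X Y : Cat hD, (β_ X Y).hom = braidHom hD R₀ X Y) :
    (crossedData hE' ρ t gr R).IsExtension (actionData hD ρ₀ t₀) (relabelCat hD hE' f) := by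
  let _ := h.oplaxMonoidal hC hE hD hE'
  have : IsIso (Functor.OplaxMonoidal.η (relabelCat hD hE' f)) := isIso_tauOne h.one
  have : ∀ X Y, IsIso (Functor.OplaxMonoidal.δ (relabelCat hD hE' f) X Y) :=
    fun X Y => h.isIso_delta X Y
  refine ⟨full_relabel h.inj, ⟨fun {X Y} a b e =>
      Subtype.ext (congrArg (fun c : (relabel f).obj X ⟶ (relabel f).obj Y => c.1) e)⟩,
    relabel_additive f, relabel_linear f, mem_essImage_relabel h.gr_eq,
    Functor.Monoidal.ofOplaxMonoidal _, fun g X => h.compare g X, ?_,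
    fun g {X Y} a => h.compare_natural (X := X) (Y := Y) g a, fun X => h.compare_unit X,
    fun g k X => h.compare_comp g k X, fun g X Y => h.compare_tensor hA₀ hR.isActionCoherent g X Y⟩
  intro X Y hX
  have key : Functor.OplaxMonoidal.δ (relabelCat hD hE' f) X Y ≫
      (crossedData hE' ρ t gr R).braid hX ((relabelCat hD hE' f).obj Y) ≫
        (((crossedData hE' ρ t gr R).T₀ ((relabelCat hD hE' f).obj Y)).hom ▷ _) =
      (relabelCat hD hE' f).map (β_ X Y).hom ≫
        Functor.OplaxMonoidal.δ (relabelCat hD hE' f) Y X := by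
    rw [hβ]
    exact h.delta_braid X Y hX hR
  let M := Functor.Monoidal.ofOplaxMonoidal (relabelCat hD hE' f)
  have hμ : ∀ X Y, Functor.OplaxMonoidal.δ (relabelCat hD hE' f) X Y ≫
      M.toLaxMonoidal.μ X Y = 𝟙 _ := fun X Y => IsIso.hom_inv_id _
  have h₁ := congrArg (· ≫ M.toLaxMonoidal.μ Y X) key
  simp only [Category.assoc, hμ, Category.comp_id] at h₁
  exact (cancel_epi (Functor.OplaxMonoidal.δ (relabelCat hD hE' f) X Y)).1 (h₁.trans
    ((Category.id_comp _).symm.trans ((congrArg (· ≫ (relabelCat hD hE' f).map (β_ X Y).hom)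
      (hμ X Y).symm).trans (Category.assoc _ _ _))))

end IsNeutralEmbedding

end Embedding

end FusionDatum

/-! ### Elementary identities for special cocycles -/

section SpecialCocycle

variable {Γ : Type u} [AddCommGroup Γ]

namespace IsSpecialCocycle

variable {Q : Γ → ℂˣ} {σ : Γ → Γ → ℂˣ} {ω : Γ → Γ → Γ → ℂˣ} (h : IsSpecialCocycle Q σ ω)

include h

theorem sigma_add (a b c : Γ) : σ a (b + c) = σ a b * σ a c * ω a b c := by
  have h₁ := h.deviation a b c
  rw [mul_inv_eq_iff_eq_mul, mul_inv_eq_iff_eq_mul] at h₁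
  rw [h₁]
  ac_rfl

theorem sigma_add_left (a b c : Γ) : σ (b + c) a = σ b a * σ c a * ω a b c := by
  rw [h.symmetric, h.sigma_add, h.symmetric a b, h.symmetric a c]

/-- `ω(a, b, c)` is the deviation of `σ(a, ·)` from additivity at `b + c = c + b`, and that
deviation is symmetric. -/
theorem omega_swap (a b c : Γ) : ω a b c = ω a c b := by
  have h₁ := h.sigma_add a b c
  rw [add_comm, h.sigma_add, mul_comm (σ a c)] at h₁
  exact (mul_left_cancel h₁).symm

/-- In the first hexagon the factors `ω(b, a, c)` and `ω(b, c, a)` cancel by symmetry, which leaves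
`ω(a, b, c)⁻¹ = ω(a, b, c)`. -/
theorem omega_mul_self (a b c : Γ) : ω a b c * ω a b c = 1 := by
  have h₁ := h.hexagon₁ a b c
  rw [h.sigma_add, h.omega_swap b c a, mul_inv_rev, mul_inv_cancel_left,
    mul_comm (σ a b * σ a c), mul_inv_cancel_right] at h₁
  nth_rewrite 2 [← h₁]
  exact mul_inv_cancel _

theorem omega_inv (a b c : Γ) : (ω a b c)⁻¹ = ω a b c :=
  inv_eq_of_mul_eq_one_left (h.omega_mul_self a b c)

theorem omega_add_self (a b c : Γ) : ω (a + a) b c = 1 := by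
  rw [h.multiplicative, h.omega_mul_self]

theorem omega_zero_left (b c : Γ) : ω 0 b c = 1 := by
  rw [← add_zero (0 : Γ), h.omega_add_self]

theorem omega_zero_mid (a c : Γ) : ω a 0 c = 1 := by
  have h₁ := h.sigma_add a 0 c
  rw [zero_add, h.normalised_right, one_mul] at h₁
  exact (mul_eq_left.1 h₁.symm)

theorem omega_zero_right (a b : Γ) : ω a b 0 = 1 := by
  rw [h.omega_swap, h.omega_zero_mid]

theorem omega_neg (a b c : Γ) : ω (-a) b c = ω a b c := by
  have h₁ := h.multiplicative (-a) a b c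
  rw [neg_add_cancel, h.omega_zero_left] at h₁
  rw [eq_inv_of_mul_eq_one_left h₁.symm, h.omega_inv]

/-- Multiplicativity in the first argument splits `ω(a + b, c, d)`, and a common factor cancels from
the 3-cocycle identity: `ω(a, ·, ·)` is a 2-cocycle for every `a`. -/
theorem omega_cocycle (a b c d : Γ) : ω a (b + c) d * ω a b c = ω a c d * ω a b (c + d) := by
  have h₁ := h.cocycle a b c d
  rw [h.multiplicative, mul_assoc, mul_comm (ω a c d), mul_assoc (ω b c d)] at h₁
  exact mul_left_cancel h₁

/-- A homomorphism with values of order at most two is trivial on doubles. -/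
theorem omega_of_mem {m : Γ} (hm : m ∈ twoMul Γ) (b c : Γ) : ω m b c = 1 := by
  obtain ⟨a, rfl⟩ := hm
  show ω ((2 : ℤ) • a) b c = 1
  rw [two_zsmul, h.omega_add_self]

theorem omega_eq_of_coe_eq {a a' : Γ} (e : (a : Γ ⧸ twoMul Γ) = a') (b c : Γ) :
    ω a b c = ω a' b c := by
  have := h.omega_of_mem (QuotientAddGroup.eq.1 e) b c
  rw [h.multiplicative, h.omega_neg] at this
  rw [eq_inv_of_mul_eq_one_left this, h.omega_inv]

/-- The representative chosen by `Quotient.out` is immaterial, so all computations with classes can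
be carried out with arbitrary elements of `Γ`. -/
theorem omegaBar_coe (x b c : Γ) : omegaBar ω (x : Γ ⧸ twoMul Γ) b c = ω x b c :=
  congrArg _ (h.omega_eq_of_coe_eq (QuotientAddGroup.out_eq' _) b c)

end IsSpecialCocycle

end SpecialCocycle

/-! ### Actions by braided functors -/

namespace FusionDatum

open GradedVect

theorem sum_ite_eq_of_iff {K : Type*} [Fintype K] {P : K → Prop}
    {_ : ∀ x, Decidable (P x)} (a : K)
    (hP : ∀ x, P x ↔ x = a) (f : K → ℂ) : (∑ x, if P x then f x else 0) = f a := by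
  rw [Finset.sum_eq_single a, if_pos ((hP a).2 rfl)]
  · exact fun b _ hb => if_neg fun e => hb ((hP b).1 e)
  · exact fun e => absurd (Finset.mem_univ _) e

section BraidedAction

variable {I : Type u} {G : Type} [Group G] [Fintype I] {D : FusionDatum I}
  {ρ : G →* Function.End I} {t : G → I → I → I → ℂ} {F' : I → I → I → I → I → I → ℂ}
  {R : I → I → I → ℂ}

theorem tauHom_braid (hB : IsBraidCoherent D F' R) (hA : IsActionCoherent D ρ t)
    (h : ∀ g i j s, s ∈ D.N i j →
      R i j s * t g j i s = t g i j s * R (act ρ g i) (act ρ g j) (act ρ g s))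
    (g : G) (X Y : GradedVect I) :
    (relabel (act ρ g)).map (D.crossHom id R X Y) ≫ D.tauHom D (act ρ g) (t g) Y X =
      D.tauHom D (act ρ g) (t g) X Y ≫
        D.crossHom id R ((relabel (act ρ g)).obj X) ((relabel (act ρ g)).obj Y) := by
  refine ext_push fun p γ => ?_
  obtain ⟨p, hp⟩ := exists_up _ p
  obtain ⟨i, j, s, hs, rfl⟩ := exists_idx p
  subst hp
  have e₀ : s ∈ D.N (Y.deg j) (X.deg i) := (hB.cross _ _ _).1 hs
  have e₁ := mem_up ((hA.mem g _ _ _).1 hs)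
  have e₂ : s ∈ D.N (((relabel id).obj Y).deg (up id j)) (X.deg i) := e₀
  have e₃ := mem_up ((hA.mem g _ _ _).1 e₂)
  have e₄ : act ρ g s ∈ D.N (((relabel id).obj ((relabel (act ρ g)).obj Y)).deg
      (up id (up (act ρ g) j))) (((relabel (act ρ g)).obj X).deg (up (act ρ g) i)) := e₃
  -- `relabel id` of an object agrees with the object only by unfolding. The two sides are therefore
  -- evaluated separately, each in its own form, and identified at the end.
  have l : ∀ γ, push ((relabel (act ρ g)).map (D.crossHom id R X Y) ≫
      D.tauHom D (act ρ g) (t g) ((relabel id).obj Y) X) (up (act ρ g) (D.idx i j s hs)) γ =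
      R (X.deg i) (Y.deg j) s * (t g (Y.deg j) (X.deg i) s * γ (D.idx _ _ _ e₃)) := fun γ => by
    rw [push_comp, push_relabel_up, push_crossHom _ _ _ _ e₂, push_tauHom _ _ _ e₂ e₃]
    rfl
  have r : ∀ γ, push (D.tauHom D (act ρ g) (t g) X Y ≫
      D.crossHom id R ((relabel (act ρ g)).obj X) ((relabel (act ρ g)).obj Y))
      (up (act ρ g) (D.idx i j s hs)) γ = t g (X.deg i) (Y.deg j) s *
      (R (act ρ g (X.deg i)) (act ρ g (Y.deg j)) (act ρ g s) * γ (D.idx _ _ _ e₄)) := fun γ => by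
    rw [push_comp, push_tauHom _ _ _ _ e₁, push_crossHom _ _ _ _ e₄]
    rfl
  refine (l γ).trans (Eq.trans ?_ (r γ).symm)
  rw [← mul_assoc, ← mul_assoc, h g _ _ _ hs]
  rfl

theorem isBraidedAction (hB : IsBraidCoherent D F' R) (hA : IsActionCoherent D ρ t)
    (h : ∀ g i j s, s ∈ D.N i j →
      R i j s * t g j i s = t g i j s * R (act ρ g i) (act ρ g j) (act ρ g s))
    (hD : D.IsTensor) [BraidedCategory (Cat hD)]
    (hβ : ∀ X Y : Cat hD, (β_ X Y).hom = braidHom hD R X Y) :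
    (actionData hD ρ t).IsBraidedAction := by
  intro g X Y
  rw [hβ, hβ]
  exact tauHom_braid hB hA h g X Y

end BraidedAction

end FusionDatum

/-! ### The group of order two acting by an involution -/

theorem C₂.eq_one_or (g : C₂) : g = 1 ∨ g = Multiplicative.ofAdd 1 := by
  revert g
  decide

theorem C₂.ofAdd_one_ne : (Multiplicative.ofAdd 1 : C₂) ≠ 1 := by decide

theorem C₂.ofAdd_one_mul_self :
    (Multiplicative.ofAdd 1 : C₂) * Multiplicative.ofAdd 1 = 1 := by decide

theorem act_involutionAction {I : Type u} (n : I → I) (hn : ∀ i, n (n i) = i) (i : I) :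
    FusionDatum.act (involutionAction n hn) (Multiplicative.ofAdd 1) i = n i := by
  classical
  exact if_neg (α := I) (t := i) (e := n i) C₂.ofAdd_one_ne

section InvolutionAction

open FusionDatum

variable {I : Type u} {n : I → I} {hn : ∀ i, n (n i) = i} {D : FusionDatum I} {t : I → I → I → ℂ}

-- All equations for the neutral element are trivial. Strict composition contributes a condition
-- only for the product of the generator with itself, where it says that applying the tensor
-- structure twice gives `1`.
open Classical in
theorem isActionCoherent_involution (mem : ∀ i j s, s ∈ D.N i j ↔ n s ∈ D.N (n i) (n j))
    (one : n D.one = D.one) (ne_zero : ∀ i j s, s ∈ D.N i j → t i j s ≠ 0)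
    (assoc : ∀ i j k s r w, s ∈ D.N i j → w ∈ D.N s k → r ∈ D.N j k → w ∈ D.N i r →
      t s k w * t i j s * D.F (n i) (n j) (n k) (n s) (n r) (n w) =
        D.F i j k s r w * t i r w * t j k r)
    (left : ∀ i, t D.one i i = 1) (right : ∀ i, t i D.one i = 1)
    (mul : ∀ i j s, s ∈ D.N i j → 1 = t i j s * t (n i) (n j) (n s)) :
    IsActionCoherent D (involutionAction n hn) fun g i j s => if g = 1 then 1 else t i j s where
  mem g i j s := by
    rcases C₂.eq_one_or g with rfl | rfl
    · simp only [act_one]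
    · simpa only [act_involutionAction] using mem i j s
  one g := by
    rcases C₂.eq_one_or g with rfl | rfl
    · rw [act_one]
    · rw [act_involutionAction, one]
  ne_zero g i j s hs := by
    split_ifs
    · exact one_ne_zero
    · exact ne_zero i j s hs
  assoc g i j k s r w h₁ h₂ h₃ h₄ := by
    rcases C₂.eq_one_or g with rfl | rfl
    · simp only [act_one, if_true, one_mul, mul_one]
    · simpa only [act_involutionAction, if_neg C₂.ofAdd_one_ne] using assoc i j k s r w h₁ h₂ h₃ h₄
  left g i := by
    split_ifs
    · rfl
    · exact left i
  right g i := by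
    split_ifs
    · rfl
    · exact right i
  mul g k i j s hs := by
    rcases C₂.eq_one_or k with rfl | rfl
    · simp only [act_one, if_true, one_mul, mul_one]
    · rcases C₂.eq_one_or g with rfl | rfl
      · simp only [if_true, one_mul, mul_one]
      · simpa only [act_involutionAction, if_neg C₂.ofAdd_one_ne, C₂.ofAdd_one_mul_self, if_true]
          using mul i j s hs
  t_one i j s _ := if_pos rfl

end InvolutionAction

/-! ### The pointed braided category and its action -/

section Pointed

open FusionDatum

variable {Γ : Type u} [AddCommGroup Γ]
  {Q : Γ → ℂˣ} {σ : Γ → Γ → ℂˣ} {ω : Γ → Γ → Γ → ℂˣ} (h : IsSpecialCocycle Q σ ω)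

namespace IsSpecialCocycle

include h

/-- The 2-cocycles `ω(a, ·, ·)` and `ω(a, -·, -·)` differ by the coboundary of `b ↦ ω(a, b, -b)`. It
follows from the cocycle identity at `(b, c, -(b + c))` and at `(c, -c, -b)`, and it makes `ω(a, b,
-b)` a tensor structure. -/
theorem omega_neg_neg (a b c : Γ) :
    ω a b c * ω a (-b) (-c) * ω a b (-b) * ω a c (-c) = ω a (b + c) (-(b + c)) := by
  have e₁ := h.omega_cocycle a b c (-(b + c))
  have e₂ := h.omega_cocycle a c (-c) (-b)
  rw [show c + -(b + c) = -b by abel] at e₁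
  rw [add_neg_cancel, h.omega_zero_mid, one_mul, show -c + -b = -(b + c) by abel] at e₂
  have e₃ := h.omega_mul_self a c (-(b + c))
  have e₄ := h.omega_mul_self a b c
  have e₅ := h.omega_mul_self a (-b) (-c)
  rw [h.omega_swap a (-c)] at e₂
  -- Written additively, the goal is an integral linear consequence of the two cocycle relations and
  -- of the relations stating that values of `ω` have order two. The same device is used for nearly
  -- all scalar identities below.
  apply Additive.ofMul.injective
  replace e₁ := congrArg Additive.ofMul e₁
  replace e₂ := congrArg Additive.ofMul e₂
  replace e₃ := congrArg Additive.ofMul e₃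
  replace e₄ := congrArg Additive.ofMul e₄
  replace e₅ := congrArg Additive.ofMul e₅
  simp only [ofMul_mul, ofMul_one] at *
  grind

theorem sigma_neg (a : Γ) : σ a (-a) * σ a a = ω a a (-a) := by
  have := h.sigma_add a a (-a)
  rw [add_neg_cancel, h.normalised_right] at this
  rw [← h.omega_inv, eq_comm, inv_eq_iff_mul_eq_one, this]
  ac_rfl

/-- Both `σ(a, b)` and `σ(-a, -b)` are compared with `σ(a, -b)`, by expanding `σ(a, b - b) = 1` and
`σ(a - a, -b) = 1`. This identity makes the action braided. -/
theorem sigma_neg_neg (a b : Γ) : σ a b * ω b a (-a) = ω a b (-b) * σ (-a) (-b) := by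
  have e₁ := h.sigma_add a b (-b)
  have e₂ := h.sigma_add_left (-b) a (-a)
  rw [add_neg_cancel, h.normalised_right] at e₁
  rw [add_neg_cancel, h.normalised_left, h.omega_neg] at e₂
  have e₃ := h.omega_mul_self b a (-a)
  have e₄ := h.omega_mul_self a b (-b)
  apply Additive.ofMul.injective
  replace e₁ := congrArg Additive.ofMul e₁
  replace e₂ := congrArg Additive.ofMul e₂
  replace e₃ := congrArg Additive.ofMul e₃
  replace e₄ := congrArg Additive.ofMul e₄
  simp only [ofMul_mul, ofMul_one] at *
  grind

omit h in
theorem mem_pointed {a b s : Γ} : s ∈ (pointedDatum ω).N a b ↔ s = a + b := Iff.rfl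

/-- Since values of `ω` have square one, the inverse associator has the same coefficients as the
associator. -/
theorem pointed_isCoherent [Fintype Γ] :
    (pointedDatum ω).IsCoherent fun a b c _ _ _ => (ω a b c : ℂ) where
  one_left a s := by
    rw [mem_pointed]
    exact iff_of_eq (congrArg (s = ·) (zero_add a))
  one_right a s := by
    rw [mem_pointed]
    exact iff_of_eq (congrArg (s = ·) (add_zero a))
  inv_right := by
    rintro a b c _ _ _ rfl rfl rfl -
    rw [sum_ite_eq_of_iff (b + c), if_pos rfl]
    · show (ω a b c * ω a b c : ℂ) = 1
      rw [← Units.val_mul, h.omega_mul_self, Units.val_one]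
    · rintro r
      simp only [mem_pointed]
      exact ⟨fun e => e.1, fun e => ⟨e, by rw [e, add_assoc]⟩⟩
  inv_left := by
    rintro a b c _ _ _ rfl rfl rfl -
    rw [sum_ite_eq_of_iff (a + b), if_pos rfl]
    · show (ω a b c * ω a b c : ℂ) = 1
      rw [← Units.val_mul, h.omega_mul_self, Units.val_one]
    · rintro r
      simp only [mem_pointed]
      exact ⟨fun e => e.1, fun e => ⟨e, by rw [e, add_assoc]⟩⟩
  pentagon := by
    rintro a b c d _ _ _ _ _ rfl rfl rfl rfl rfl -
    rw [sum_ite_eq_of_iff (b + c), if_pos]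
    · show (ω a b c * (ω a (b + c) d * ω b c d) : ℂ) = ω (a + b) c d * ω a b (c + d)
      norm_cast
      rw [← h.cocycle]
      ac_rfl
    · simp only [mem_pointed]
      abel
    · rintro r
      simp only [mem_pointed]
      exact ⟨fun e => e.1.1, by rintro rfl; exact ⟨⟨rfl, by abel⟩, by abel⟩⟩
  triangle := by
    rintro a b _ -
    show (ω a 0 b : ℂ) = 1
    rw [h.omega_zero_mid, Units.val_one]

theorem pointed_isActionCoherent [Fintype Γ] : IsActionCoherent (pointedDatum ω)
    (involutionAction (fun a : Γ => -a) neg_neg)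
    fun g a b _ => if g = 1 then 1 else (ω a b (-b) : ℂ) := by
  convert isActionCoherent_involution (D := pointedDatum ω) (hn := neg_neg)
    (t := fun a b _ => (ω a b (-b) : ℂ)) ?_ ?_ ?_ ?_ ?_ ?_ ?_ using 1
  · intro a b s
    simp only [mem_pointed]
    rw [← neg_add, neg_inj]
  · exact neg_zero
  · exact fun _ _ _ _ => Units.ne_zero _
  · rintro a b c _ _ _ rfl rfl rfl -
    have e := h.omega_neg_neg a b c
    show (ω (a + b) c (-c) * ω a b (-b) * ω (-a) (-b) (-c) : ℂ) =
      ω a b c * ω a (b + c) (-(b + c)) * ω b c (-c)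
    norm_cast
    rw [← e, h.multiplicative, h.omega_neg]
    have e₄ := h.omega_mul_self a b c
    apply Additive.ofMul.injective
    replace e₄ := congrArg Additive.ofMul e₄
    simp only [ofMul_mul, ofMul_one] at *
    grind
  · intro a
    show (ω 0 a (-a) : ℂ) = 1
    rw [h.omega_zero_left, Units.val_one]
  · intro a
    show (ω a 0 (-0) : ℂ) = 1
    rw [h.omega_zero_mid, Units.val_one]
  · rintro a b s -
    norm_cast
    rw [h.omega_neg, neg_neg, h.omega_swap a (-b), h.omega_mul_self, Units.val_one]

theorem pointed_isBraidCoherent [Fintype Γ] :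
    IsBraidCoherent (pointedDatum ω) (fun a b c _ _ _ => (ω a b c : ℂ)) fun a b _ => (σ a b : ℂ) where
  isActionCoherent :=
    { mem := fun _ _ _ _ => Iff.rfl
      one := fun _ => rfl
      ne_zero := fun _ _ _ _ _ => one_ne_zero
      assoc := fun _ _ _ _ _ _ _ _ _ _ _ => by rw [one_mul, one_mul, mul_one, mul_one]; rfl
      left := fun _ _ => rfl
      right := fun _ _ => rfl
      mul := fun _ _ _ _ _ _ => (one_mul 1).symm
      t_one := fun _ _ _ _ => rfl }
  gr_mem _ _ _ _ := rfl
  gr_one := rfl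
  gr_act _ _ := rfl
  gr_surj g := ⟨0, rfl⟩
  cross a b s := iff_of_eq (congrArg (s = ·) (add_comm a b))
  ne_zero _ _ _ _ := Units.ne_zero _
  braid_act _ a b _ _ := by rw [one_mul, mul_one]; rfl
  hexagon := by
    rintro a b c _ _ _ rfl rfl rfl -
    rw [sum_ite_eq_of_iff (b + c)]
    · show (ω a b c * (σ a (b + c) * (1 * ω b c a)) : ℂ) = σ a b * (ω b a c * σ a c)
      rw [one_mul]
      norm_cast
      rw [h.sigma_add, h.omega_swap b c a]
      have e₄ := h.omega_mul_self a b c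
      apply Additive.ofMul.injective
      replace e₄ := congrArg Additive.ofMul e₄
      simp only [ofMul_mul, ofMul_one] at *
      grind
    · rintro r
      simp only [mem_pointed]
      exact ⟨fun e => e.1, by rintro rfl; exact ⟨rfl, by abel⟩⟩
  hexagon_inv := by
    rintro a b c _ _ _ rfl rfl rfl -
    rw [sum_ite_eq_of_iff (b + c)]
    · show (σ (a + b) c * ω c a b : ℂ) = ω a b c * (σ b c * (ω a c b * σ a c))
      norm_cast
      rw [h.sigma_add_left, h.omega_swap a c b]
      have e₄ := h.omega_mul_self a b c
      have e₅ := h.omega_mul_self c a b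
      apply Additive.ofMul.injective
      replace e₄ := congrArg Additive.ofMul e₄
      replace e₅ := congrArg Additive.ofMul e₅
      simp only [ofMul_mul, ofMul_one] at *
      grind
    · rintro r
      simp only [mem_pointed]
      exact ⟨fun e => e.1, by rintro rfl; exact ⟨rfl, by abel⟩⟩

theorem pointed_tau_braid (g : C₂) (a b s : Γ) (_ : s ∈ (pointedDatum ω).N a b) :
    (σ a b : ℂ) * (if g = 1 then 1 else (ω b a (-a) : ℂ)) = (if g = 1 then 1 else (ω a b (-b) : ℂ)) *
      σ (act (involutionAction (fun a : Γ => -a) neg_neg) g a)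
        (act (involutionAction (fun a : Γ => -a) neg_neg) g b) := by
  rcases C₂.eq_one_or g with rfl | rfl
  · simp only [act_one, if_true, one_mul, mul_one]
  · simp only [act_involutionAction, if_neg C₂.ofAdd_one_ne]
    exact_mod_cast h.sigma_neg_neg a b

end IsSpecialCocycle

end Pointed

/-! ### Sums over cosets of `2Γ` and orthogonality -/

section Sums

variable {Γ : Type u} [AddCommGroup Γ]

theorem mem_twoMul (a : Γ) : a + a ∈ twoMul Γ := ⟨a, two_zsmul a⟩

theorem quotient_add_self (x : Γ ⧸ twoMul Γ) : x + x = 0 := by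
  obtain ⟨x, rfl⟩ := QuotientAddGroup.mk_surjective x
  exact (QuotientAddGroup.eq_zero_iff _).2 (mem_twoMul x)

theorem sub_mem_of_coe_eq {a b : Γ} (e : (a : Γ ⧸ twoMul Γ) = b) : a - b ∈ twoMul Γ :=
  (QuotientAddGroup.eq_iff_sub_mem).1 e

theorem sqrtCard_mul_self [Finite Γ] : sqrtCard Γ * sqrtCard Γ = Nat.card (twoMul Γ) := by
  rw [sqrtCard, ← Complex.ofReal_mul, Real.mul_self_sqrt (Nat.cast_nonneg _), Complex.ofReal_natCast]

theorem card_twoMul_ne_zero [Finite Γ] : (Nat.card (twoMul Γ) : ℂ) ≠ 0 :=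
  Nat.cast_ne_zero.2 Nat.card_pos.ne'

theorem sqrtCard_ne_zero [Finite Γ] : sqrtCard Γ ≠ 0 := fun e =>
  card_twoMul_ne_zero (Γ := Γ) (by rw [← sqrtCard_mul_self, e, mul_zero])

theorem coe_sign_mul_self (ε : ℤˣ) : ((ε : ℤ) : ℂ) * ((ε : ℤ) : ℂ) = 1 := by
  rw [← Int.cast_mul, ← Units.val_mul, Int.units_mul_self, Units.val_one, Int.cast_one]

/-- Turns a sum over labels subject to a fusion rule into a sum over `2Γ`. The base point `m` of the
coset is left free, since different computations need different ones. -/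
theorem sum_coset {K : Type*} [Fintype K] [Fintype (twoMul Γ)] {P : K → Prop}
    {_ : ∀ x, Decidable (P x)} (g : Γ → K) (hg : Function.Injective g) (m : Γ)
    (hP : ∀ x, P x ↔ ∃ t : Γ, (t : Γ ⧸ twoMul Γ) = m ∧ x = g t) (f : K → ℂ) :
    (∑ x, if P x then f x else 0) = ∑ k : twoMul Γ, f (g (m + k)) := by
  rw [← Finset.sum_filter]
  symm
  refine Finset.sum_bij (fun k _ => g (m + k)) ?_ ?_ ?_ fun _ _ => rfl
  · intro k _
    rw [Finset.mem_filter]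
    exact ⟨Finset.mem_univ _, (hP _).2 ⟨_, QuotientAddGroup.mk_add_of_mem _ k.2, rfl⟩⟩
  · intro k _ l _ e
    exact Subtype.ext (add_left_cancel (hg e))
  · intro x hx
    obtain ⟨t, ht, rfl⟩ := (hP x).1 (Finset.mem_filter.1 hx).2
    exact ⟨⟨t - m, sub_mem_of_coe_eq ht⟩, Finset.mem_univ _, congrArg g (by simp)⟩

namespace IsSpecialCocycle

variable {Q : Γ → ℂˣ} {σ : Γ → Γ → ℂˣ} {ω : Γ → Γ → Γ → ℂˣ} (h : IsSpecialCocycle Q σ ω)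

include h

/-- The deviation from additivity in the other argument is `ω(n, ·, ·)`, which is trivial for `n` in
`2Γ`. -/
theorem sigma_add_of_mem {n : Γ} (hn : n ∈ twoMul Γ) (a b : Γ) :
    σ (a + b) n = σ a n * σ b n := by
  rw [h.sigma_add_left, h.omega_of_mem hn, mul_one]

/-- Expand `σ(a + b, a + b)` in both arguments. Each of `ω(a, a, b)` and `ω(b, a, b)` occurs twice
and drops out, and symmetry of `σ` leaves a square. -/
theorem assocForm_eq (a b : Γ) : assocForm Q a b = σ a b * σ a b := by
  have e₁ := h.sigma_add (a + b) a b
  have e₂ := h.sigma_add_left a a b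
  have e₃ := h.sigma_add_left b a b
  rw [h.multiplicative, h.symmetric b a, ] at *
  rw [assocForm, ← h.represents, ← h.represents, ← h.represents, e₁, e₂, e₃]
  have e₄ := h.omega_mul_self a a b
  have e₅ := h.omega_mul_self b a b
  apply Additive.ofMul.injective
  replace e₄ := congrArg Additive.ofMul e₄
  replace e₅ := congrArg Additive.ofMul e₅
  simp only [ofMul_mul, ofMul_inv, ofMul_one] at *
  grind

/-- For `n` in `2Γ`, `σ(b + b, n) = σ(b, n)²` is the bimultiplicative form of `Q` at `b` and `n`. So
nondegeneracy of `Q` is already visible to `σ` on `2Γ`. -/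
theorem exists_sigma_ne_one (hQ : IsDiscriminantForm Q) {n : Γ} (hn : n ∈ twoMul Γ) (h₀ : n ≠ 0) :
    ∃ k : twoMul Γ, σ k n ≠ 1 := by
  by_contra! hc
  refine h₀ (hQ.nondegenerate n fun b => ?_)
  have := hc ⟨b + b, mem_twoMul b⟩
  rw [h.sigma_add_of_mem hn] at this
  rw [h.assocForm_eq, h.symmetric, this]

-- For nonzero `n` the character `σ(·, n)` of `2Γ` is nontrivial, and translating by an element
-- where it is not `1` forces the sum to vanish.
open Classical in
theorem sum_sigma [Fintype (twoMul Γ)] (hQ : IsDiscriminantForm Q) {n : Γ} (hn : n ∈ twoMul Γ) :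
    ∑ k : twoMul Γ, (σ k n : ℂ) = if n = 0 then (Nat.card (twoMul Γ) : ℂ) else 0 := by
  split_ifs with e
  · subst e
    simp only [h.normalised_right, Units.val_one, Finset.sum_const, Finset.card_univ, nsmul_one,
      Nat.card_eq_fintype_card]
  · obtain ⟨k, hk⟩ := h.exists_sigma_ne_one hQ hn e
    have e₁ : (σ k n : ℂ) * ∑ l : twoMul Γ, (σ l n : ℂ) = ∑ l : twoMul Γ, (σ l n : ℂ) := by
      rw [Finset.mul_sum, ← Equiv.sum_comp (Equiv.addLeft k) fun l : twoMul Γ => (σ l n : ℂ)]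
      refine Finset.sum_congr rfl fun l _ => ?_
      rw [Equiv.coe_addLeft, AddSubgroup.coe_add, h.sigma_add_of_mem hn, Units.val_mul]
    exact (mul_left_eq_self₀.1 e₁).resolve_left fun e₂ => hk (Units.ext e₂)

open Classical in
/-- Orthogonality of the functions `σ(t, ·)` on a coset of `2Γ`. -/
theorem sum_sigma_coset [Fintype (twoMul Γ)] (hQ : IsDiscriminantForm Q) {t t₁ : Γ}
    (ht : (t : Γ ⧸ twoMul Γ) = t₁) (m : Γ) :
    ∑ k : twoMul Γ, ((σ t (m + k))⁻¹ * σ t₁ (m + k) : ℂ) =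
      if t = t₁ then (Nat.card (twoMul Γ) : ℂ) else 0 := by
  have hn := sub_mem_of_coe_eq ht.symm
  have e : ∀ k : twoMul Γ, ((σ t (m + k))⁻¹ * σ t₁ (m + k) : ℂ) =
      (σ t m)⁻¹ * σ t₁ m * σ k (t₁ - t) := fun k => by
    have e₁ : σ t₁ k = σ t k * σ (t₁ - t) k := by
      rw [← h.sigma_add_of_mem k.2, add_sub_cancel]
    -- `t` and `t₁` have the same class, so the factors `ω(t, m, k)` and `ω(t₁, m, k)` cancel in the
    -- quotient, and what depends on `k` is the character `σ(k, t₁ - t)`.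
    rw [h.sigma_add, h.sigma_add, e₁, h.omega_eq_of_coe_eq ht, h.symmetric k]
    push_cast
    have := Units.ne_zero (σ t m)
    have := Units.ne_zero (σ t k)
    have := Units.ne_zero (ω t₁ m k)
    field_simp
  rw [Finset.sum_congr rfl fun k _ => e k, ← Finset.mul_sum, h.sum_sigma hQ hn]
  by_cases he : t = t₁
  · subst he
    simp
  · rw [if_neg he, if_neg fun e => he (sub_eq_zero.1 e).symm, mul_zero]

end IsSpecialCocycle

end Sums

/-! ### Fusion rules of `Vect_Γ ⊕ Vect_{Γ/2Γ}` and invertible associators -/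

section GLM

open FusionDatum

variable {Γ : Type u} [AddCommGroup Γ]

theorem glmN_inl_inl {δ a b : Γ} {s : Label Γ} :
    s ∈ glmN δ (.inl a) (.inl b) ↔ s = .inl (a + b) := Iff.rfl

theorem glmN_inl_inr {δ a : Γ} {x : Γ ⧸ twoMul Γ} {s : Label Γ} :
    s ∈ glmN δ (.inl a) (.inr x) ↔ s = .inr (a + x) := Iff.rfl

theorem glmN_inr_inl {δ a : Γ} {x : Γ ⧸ twoMul Γ} {s : Label Γ} :
    s ∈ glmN δ (.inr x) (.inl a) ↔ s = .inr (x + a) := Iff.rfl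

theorem glmN_inr_inr {δ t : Γ} {x y : Γ ⧸ twoMul Γ} :
    .inl t ∈ glmN δ (.inr x) (.inr y) ↔ (t : Γ ⧸ twoMul Γ) = δ + x + y :=
  ⟨fun ⟨_, h, e⟩ => by cases e; exact h, fun h => ⟨t, h, rfl⟩⟩

theorem not_mem_glmN_inr_inr {δ : Γ} {x y z : Γ ⧸ twoMul Γ} :
    .inr z ∉ glmN δ (.inr x) (.inr y) := fun ⟨_, _, e⟩ => by cases e

/-- The inverse associators. -/
noncomputable def glmG (σ : Γ → Γ → ℂˣ) (ω : Γ → Γ → Γ → ℂˣ) (δ : Γ) (ε : ℤˣ) :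
    Label Γ → Label Γ → Label Γ → Label Γ → Label Γ → Label Γ → ℂ
  | .inr _, .inr _, .inr _, .inl t, .inl r, _ => ((ε : ℤ) : ℂ) * (sqrtCard Γ)⁻¹ * σ t r
  | i, j, k, s, r, w => (glmF σ ω δ ε i j k s r w)⁻¹

namespace IsSpecialCocycle

variable {Q : Γ → ℂˣ} {σ : Γ → Γ → ℂˣ} {ω : Γ → Γ → Γ → ℂˣ} (h : IsSpecialCocycle Q σ ω)
  (hQ : IsDiscriminantForm Q) {δ : Γ} {ε : ℤˣ}

set_option linter.unusedSimpArgs false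

omit h in
theorem sign_sqrtCard_mul_self [Finite Γ] :
    (((ε : ℤ) : ℂ) * (sqrtCard Γ)⁻¹) * (((ε : ℤ) : ℂ) * (sqrtCard Γ)⁻¹) =
      (Nat.card (twoMul Γ) : ℂ)⁻¹ := by
  rw [mul_mul_mul_comm, coe_sign_mul_self, one_mul, ← mul_inv, sqrtCard_mul_self]

include h hQ

/-- Whenever one of the three objects lies in `Vect_Γ`, the inner label is determined by the total
one and the associator is a nonzero scalar. Only three objects of type `X` give a genuine matrix. -/
theorem glm_inv_right [Finite Γ] [Fintype (Label Γ)] (i j k s s₁ w : Label Γ) :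
    s ∈ glmN δ i j → w ∈ glmN δ s k → s₁ ∈ glmN δ i j → w ∈ glmN δ s₁ k →
    ∀ (_ : ∀ r, Decidable (r ∈ glmN δ j k ∧ w ∈ glmN δ i r)) (_ : Decidable (s = s₁)),
    (∑ r, if r ∈ glmN δ j k ∧ w ∈ glmN δ i r then
        glmF σ ω δ ε i j k s r w * glmG σ ω δ ε i j k s₁ r w else 0) =
      if s = s₁ then 1 else 0 := by
  rcases i with a | x <;> rcases j with b | y <;> rcases k with c | z
  · rintro rfl rfl rfl - _ _
    rw [sum_ite_eq_of_iff (.inl (b + c)), if_pos rfl]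
    · exact mul_inv_cancel₀ (Units.ne_zero _)
    · rintro (m | m) <;> simp only [glmN_inl_inl, glmN_inl_inr, glmN_inr_inl,
        glmN_inr_inr, not_mem_glmN_inr_inr, reduceCtorEq, Sum.inl.injEq, Sum.inr.injEq, false_and,
        and_false, QuotientAddGroup.mk_add, QuotientAddGroup.mk_sub]
      have : ((b + c : Γ) : Γ ⧸ twoMul Γ) = b + c := rfl
      grind
  · rintro rfl rfl rfl - _ _
    rw [sum_ite_eq_of_iff (.inr (b + z)), if_pos rfl]
    · exact mul_inv_cancel₀ (Units.ne_zero _)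
    · rintro (m | m) <;> simp only [glmN_inl_inl, glmN_inl_inr, glmN_inr_inl,
        glmN_inr_inr, not_mem_glmN_inr_inr, reduceCtorEq, Sum.inl.injEq, Sum.inr.injEq, false_and,
        and_false, QuotientAddGroup.mk_add, QuotientAddGroup.mk_sub]
      grind
  · rintro rfl rfl rfl - _ _
    rw [sum_ite_eq_of_iff (.inr (y + c)), if_pos rfl]
    · exact mul_inv_cancel₀ (Units.ne_zero _)
    · rintro (m | m) <;> simp only [glmN_inl_inl, glmN_inl_inr, glmN_inr_inl,
        glmN_inr_inr, not_mem_glmN_inr_inr, reduceCtorEq, Sum.inl.injEq, Sum.inr.injEq, false_and,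
        and_false, QuotientAddGroup.mk_add, QuotientAddGroup.mk_sub]
      grind
  · rintro rfl ⟨t, ht, rfl⟩ rfl - _ _
    rw [sum_ite_eq_of_iff (.inl (t - a)), if_pos rfl]
    · exact mul_inv_cancel₀ (Units.ne_zero _)
    · rintro (m | m) <;> simp only [glmN_inl_inl, glmN_inl_inr, glmN_inr_inl,
        glmN_inr_inr, not_mem_glmN_inr_inr, reduceCtorEq, Sum.inl.injEq, Sum.inr.injEq, false_and,
        and_false, QuotientAddGroup.mk_add, QuotientAddGroup.mk_sub]
      have : ((t - a : Γ) : Γ ⧸ twoMul Γ) = t - a := rfl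
      grind
  · rintro rfl rfl rfl - _ _
    rw [sum_ite_eq_of_iff (.inl (b + c)), if_pos rfl]
    · exact mul_inv_cancel₀ (Units.ne_zero _)
    · rintro (m | m) <;> simp only [glmN_inl_inl, glmN_inl_inr, glmN_inr_inl,
        glmN_inr_inr, not_mem_glmN_inr_inr, reduceCtorEq, Sum.inl.injEq, Sum.inr.injEq, false_and,
        and_false, QuotientAddGroup.mk_add, QuotientAddGroup.mk_sub]
      have : ((b + c : Γ) : Γ ⧸ twoMul Γ) = b + c := rfl
      grind
  · rintro rfl ⟨t, ht, rfl⟩ rfl - _ _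
    rw [sum_ite_eq_of_iff (.inr (b + z)), if_pos rfl]
    · exact mul_inv_cancel₀ (Units.ne_zero _)
    · rintro (m | m) <;> simp only [glmN_inl_inl, glmN_inl_inr, glmN_inr_inl,
        glmN_inr_inr, not_mem_glmN_inr_inr, reduceCtorEq, Sum.inl.injEq, Sum.inr.injEq, false_and,
        and_false, QuotientAddGroup.mk_add, QuotientAddGroup.mk_sub]
      grind
  · rintro ⟨t, ht, rfl⟩ rfl ⟨t₁, ht₁, rfl⟩ e _ _
    obtain rfl : t = t₁ := add_right_cancel (Sum.inl.inj e)
    rw [sum_ite_eq_of_iff (.inr (y + c)), if_pos rfl]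
    · exact mul_inv_cancel₀ (Units.ne_zero _)
    · rintro (m | m) <;> simp only [glmN_inl_inl, glmN_inl_inr, glmN_inr_inl,
        glmN_inr_inr, not_mem_glmN_inr_inr, reduceCtorEq, Sum.inl.injEq, Sum.inr.injEq, false_and,
        and_false, QuotientAddGroup.mk_add, QuotientAddGroup.mk_sub]
      grind
  -- Three objects `X`: the entry is `|2Γ|⁻¹` times a sum over the coset `δ + y + z + 2Γ`, evaluated
  -- by orthogonality. The normalisation `|2Γ|^{-1/2}` of the associator is what makes the diagonal
  -- entries `1`.
  · rintro ⟨t, ht, rfl⟩ rfl ⟨t₁, ht₁, rfl⟩ - _ _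
    have _ := Fintype.ofFinite (twoMul Γ)
    obtain ⟨m, hm⟩ := QuotientAddGroup.mk_surjective (δ + y + z : Γ ⧸ twoMul Γ)
    rw [sum_coset (K := Label Γ) Sum.inl Sum.inl_injective m]
    · have e : ∀ k : twoMul Γ, glmF σ ω δ ε (.inr x) (.inr y) (.inr z) (.inl t) (.inl (m + k))
          (.inr (t + z)) * glmG σ ω δ ε (.inr x) (.inr y) (.inr z) (.inl t₁) (.inl (m + k))
          (.inr (t + z)) =
          (Nat.card (twoMul Γ) : ℂ)⁻¹ * ((σ t (m + k))⁻¹ * σ t₁ (m + k)) := fun k => by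
        rw [← sign_sqrtCard_mul_self (ε := ε), glmF, glmG, Units.val_inv_eq_inv_val]
        ring
      simp_rw [e]
      rw [← Finset.mul_sum, h.sum_sigma_coset hQ (ht.trans ht₁.symm)]
      by_cases e : t = t₁
      · rw [if_pos e, if_pos (congrArg _ e), inv_mul_cancel₀ card_twoMul_ne_zero]
      · rw [if_neg e, if_neg fun e₁ => e (Sum.inl.inj e₁), mul_zero]
    · rintro (r | r) <;> simp only [glmN_inl_inl, glmN_inl_inr, glmN_inr_inl,
        glmN_inr_inr, not_mem_glmN_inr_inr, reduceCtorEq, Sum.inl.injEq, Sum.inr.injEq, false_and,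
        and_false, QuotientAddGroup.mk_add, QuotientAddGroup.mk_sub]
      · have := quotient_add_self x
        have := quotient_add_self (δ : Γ ⧸ twoMul Γ)
        grind
      · simp

theorem glm_inv_left [Finite Γ] [Fintype (Label Γ)] (i j k r r₁ w : Label Γ) :
    r ∈ glmN δ j k → w ∈ glmN δ i r → r₁ ∈ glmN δ j k → w ∈ glmN δ i r₁ →
    ∀ (_ : ∀ s, Decidable (s ∈ glmN δ i j ∧ w ∈ glmN δ s k)) (_ : Decidable (r = r₁)),
    (∑ s, if s ∈ glmN δ i j ∧ w ∈ glmN δ s k then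
        glmG σ ω δ ε i j k s r w * glmF σ ω δ ε i j k s r₁ w else 0) =
      if r = r₁ then 1 else 0 := by
  rcases i with a | x <;> rcases j with b | y <;> rcases k with c | z
  · rintro rfl rfl rfl - _ _
    rw [sum_ite_eq_of_iff (.inl (a + b)), if_pos rfl]
    · exact inv_mul_cancel₀ (Units.ne_zero _)
    · rintro (m | m) <;> simp only [glmN_inl_inl, glmN_inl_inr, glmN_inr_inl,
        glmN_inr_inr, not_mem_glmN_inr_inr, reduceCtorEq, Sum.inl.injEq, Sum.inr.injEq, false_and,
        and_false, QuotientAddGroup.mk_add, QuotientAddGroup.mk_sub]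
      have : ((a + b : Γ) : Γ ⧸ twoMul Γ) = a + b := rfl
      grind
  · rintro rfl rfl rfl - _ _
    rw [sum_ite_eq_of_iff (.inl (a + b)), if_pos rfl]
    · exact inv_mul_cancel₀ (Units.ne_zero _)
    · rintro (m | m) <;> simp only [glmN_inl_inl, glmN_inl_inr, glmN_inr_inl,
        glmN_inr_inr, not_mem_glmN_inr_inr, reduceCtorEq, Sum.inl.injEq, Sum.inr.injEq, false_and,
        and_false, QuotientAddGroup.mk_add, QuotientAddGroup.mk_sub]
      have : ((a + b : Γ) : Γ ⧸ twoMul Γ) = a + b := rfl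
      grind
  · rintro rfl rfl rfl - _ _
    rw [sum_ite_eq_of_iff (.inr (a + y)), if_pos rfl]
    · exact inv_mul_cancel₀ (Units.ne_zero _)
    · rintro (m | m) <;> simp only [glmN_inl_inl, glmN_inl_inr, glmN_inr_inl,
        glmN_inr_inr, not_mem_glmN_inr_inr, reduceCtorEq, Sum.inl.injEq, Sum.inr.injEq, false_and,
        and_false, QuotientAddGroup.mk_add, QuotientAddGroup.mk_sub]
      grind
  · rintro ⟨t, ht, rfl⟩ rfl ⟨t₁, ht₁, rfl⟩ e _ _
    obtain rfl : t = t₁ := add_left_cancel (Sum.inl.inj e)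
    rw [sum_ite_eq_of_iff (.inr (a + y)), if_pos rfl]
    · exact inv_mul_cancel₀ (Units.ne_zero _)
    · rintro (m | m) <;> simp only [glmN_inl_inl, glmN_inl_inr, glmN_inr_inl,
        glmN_inr_inr, not_mem_glmN_inr_inr, reduceCtorEq, Sum.inl.injEq, Sum.inr.injEq, false_and,
        and_false, QuotientAddGroup.mk_add, QuotientAddGroup.mk_sub]
      grind
  · rintro rfl rfl rfl - _ _
    rw [sum_ite_eq_of_iff (.inr (x + b)), if_pos rfl]
    · exact inv_mul_cancel₀ (Units.ne_zero _)
    · rintro (m | m) <;> simp only [glmN_inl_inl, glmN_inl_inr, glmN_inr_inl,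
        glmN_inr_inr, not_mem_glmN_inr_inr, reduceCtorEq, Sum.inl.injEq, Sum.inr.injEq, false_and,
        and_false, QuotientAddGroup.mk_add, QuotientAddGroup.mk_sub]
      grind
  · rintro rfl ⟨t, ht, rfl⟩ rfl - _ _
    rw [sum_ite_eq_of_iff (.inr (x + b)), if_pos rfl]
    · exact inv_mul_cancel₀ (Units.ne_zero _)
    · rintro (m | m) <;> simp only [glmN_inl_inl, glmN_inl_inr, glmN_inr_inl,
        glmN_inr_inr, not_mem_glmN_inr_inr, reduceCtorEq, Sum.inl.injEq, Sum.inr.injEq, false_and,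
        and_false, QuotientAddGroup.mk_add, QuotientAddGroup.mk_sub]
      grind
  · rintro rfl ⟨t, ht, rfl⟩ rfl - _ _
    rw [sum_ite_eq_of_iff (.inl (t - c)), if_pos rfl]
    · exact inv_mul_cancel₀ (Units.ne_zero _)
    · rintro (m | m) <;> simp only [glmN_inl_inl, glmN_inl_inr, glmN_inr_inl,
        glmN_inr_inr, not_mem_glmN_inr_inr, reduceCtorEq, Sum.inl.injEq, Sum.inr.injEq, false_and,
        and_false, QuotientAddGroup.mk_add, QuotientAddGroup.mk_sub]
      have : ((t - c : Γ) : Γ ⧸ twoMul Γ) = t - c := rfl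
      grind
  · rintro ⟨t, ht, rfl⟩ rfl ⟨t₁, ht₁, rfl⟩ - _ _
    have _ := Fintype.ofFinite (twoMul Γ)
    obtain ⟨m, hm⟩ := QuotientAddGroup.mk_surjective (δ + x + y : Γ ⧸ twoMul Γ)
    rw [sum_coset (K := Label Γ) Sum.inl Sum.inl_injective m]
    · have e : ∀ k : twoMul Γ, glmG σ ω δ ε (.inr x) (.inr y) (.inr z) (.inl (m + k)) (.inl t)
          (.inr (x + t)) * glmF σ ω δ ε (.inr x) (.inr y) (.inr z) (.inl (m + k)) (.inl t₁)
          (.inr (x + t)) =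
          (Nat.card (twoMul Γ) : ℂ)⁻¹ * ((σ t₁ (m + k))⁻¹ * σ t (m + k)) := fun k => by
        rw [← sign_sqrtCard_mul_self (ε := ε), glmF, glmG, h.symmetric t, h.symmetric t₁]
        simp only [Units.val_inv_eq_inv_val]
        ring
      simp_rw [e]
      rw [← Finset.mul_sum, h.sum_sigma_coset hQ (ht₁.trans ht.symm)]
      by_cases e : t = t₁
      · rw [if_pos e.symm, if_pos (congrArg _ e), inv_mul_cancel₀ card_twoMul_ne_zero]
      · rw [if_neg (Ne.symm e), if_neg fun e₁ => e (Sum.inl.inj e₁), mul_zero]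
    · rintro (r | r) <;> simp only [glmN_inl_inl, glmN_inl_inr, glmN_inr_inl,
        glmN_inr_inr, not_mem_glmN_inr_inr, reduceCtorEq, Sum.inl.injEq, Sum.inr.injEq, false_and,
        and_false, QuotientAddGroup.mk_add, QuotientAddGroup.mk_sub]
      · have := quotient_add_self z
        have := quotient_add_self (δ : Γ ⧸ twoMul Γ)
        grind
      · simp

end IsSpecialCocycle

end GLM

/-! ### The pentagon with at most three factors `X` -/

section GLM

open FusionDatum

variable {Γ : Type u} [AddCommGroup Γ]

namespace IsSpecialCocycle

variable {Q : Γ → ℂˣ} {σ : Γ → Γ → ℂˣ} {ω : Γ → Γ → Γ → ℂˣ} (h : IsSpecialCocycle Q σ ω)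
  (hQ : IsDiscriminantForm Q) {δ : Γ} {ε : ℤˣ}

include h

/-- A constituent `t` of a product of two `X` is known only through its class `δ + x + y`; this
suffices to expand `ω(t, ·, ·)`. -/
theorem omega_coset {t a b c : Γ} (e : (t : Γ ⧸ twoMul Γ) = a + b + c) (p q : Γ) :
    ω t p q = ω a p q * ω b p q * ω c p q := by
  rw [h.omega_eq_of_coe_eq (a' := a + b + c) e, h.multiplicative, h.multiplicative]

theorem ofMul_omega_coset {t a b c : Γ} (e : (t : Γ ⧸ twoMul Γ) = a + b + c) (p q : Γ) :
    Additive.ofMul (ω t p q) = .ofMul (ω a p q) + .ofMul (ω b p q) + .ofMul (ω c p q) :=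
  congrArg Additive.ofMul (h.omega_coset e p q)

theorem ofMul_omega_add_self (a b c : Γ) :
    Additive.ofMul (ω a b c) + .ofMul (ω a b c) = 0 :=
  congrArg Additive.ofMul (h.omega_mul_self a b c)

/-- The terms are 2-torsion, and signs do not balance over the integers without that information. It
is bundled with the relation so that goals become integral linear consequences of the hypotheses. -/
theorem ofMul_omega_cocycle (a b c d : Γ) :
    Additive.ofMul (ω a (b + c) d) + .ofMul (ω a b c) =
      .ofMul (ω a c d) + .ofMul (ω a b (c + d)) ∧
    Additive.ofMul (ω a b c) + .ofMul (ω a b c) = 0 ∧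
    Additive.ofMul (ω a c d) + .ofMul (ω a c d) = 0 ∧
    Additive.ofMul (ω a (b + c) d) + .ofMul (ω a (b + c) d) = 0 ∧
    Additive.ofMul (ω a b (c + d)) + .ofMul (ω a b (c + d)) = 0 :=
  ⟨congrArg Additive.ofMul (h.omega_cocycle a b c d), h.ofMul_omega_add_self _ _ _,
    h.ofMul_omega_add_self _ _ _, h.ofMul_omega_add_self _ _ _, h.ofMul_omega_add_self _ _ _⟩

theorem ofMul_sigma_add (a b c : Γ) :
    Additive.ofMul (σ a (b + c)) = .ofMul (σ a b) + .ofMul (σ a c) + .ofMul (ω a b c) ∧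
    Additive.ofMul (ω a b c) + .ofMul (ω a b c) = 0 :=
  ⟨congrArg Additive.ofMul (h.sigma_add a b c), h.ofMul_omega_add_self _ _ _⟩

theorem ofMul_sigma_add_left (a b c : Γ) :
    Additive.ofMul (σ (b + c) a) = .ofMul (σ b a) + .ofMul (σ c a) + .ofMul (ω a b c) ∧
    Additive.ofMul (ω a b c) + .ofMul (ω a b c) = 0 :=
  ⟨congrArg Additive.ofMul (h.sigma_add_left a b c), h.ofMul_omega_add_self _ _ _⟩

set_option linter.unusedSimpArgs false

/-- The pentagon equation for four given simple objects. -/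
def PentagonAt [Fintype (Label Γ)] (_ : IsSpecialCocycle Q σ ω) (δ : Γ) (ε : ℤˣ)
    (i j k l : Label Γ) : Prop :=
  ∀ s w u r v, s ∈ glmN δ i j → w ∈ glmN δ s k → u ∈ glmN δ w l → r ∈ glmN δ k l →
    v ∈ glmN δ j r → u ∈ glmN δ i v →
    ∀ (_ : ∀ m, Decidable ((m ∈ glmN δ j k ∧ w ∈ glmN δ i m) ∧ v ∈ glmN δ m l))
      (_ : Decidable (u ∈ glmN δ s r)),
    (∑ m, if (m ∈ glmN δ j k ∧ w ∈ glmN δ i m) ∧ v ∈ glmN δ m l then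
      glmF σ ω δ ε i j k s m w * (glmF σ ω δ ε i m l w v u * glmF σ ω δ ε j k l m r v) else 0) =
      if u ∈ glmN δ s r then glmF σ ω δ ε s k l w r u * glmF σ ω δ ε i j r s v u else 0

variable [Fintype (Label Γ)]

theorem pentagon_llll (a b c d : Γ) :
    h.PentagonAt δ ε (.inl a) (.inl b) (.inl c) (.inl d) := by
  intro s w u r v
  rintro rfl rfl rfl rfl rfl - _ _
  rw [sum_ite_eq_of_iff (.inl (b + c)), if_pos]
  · have := h.cocycle a b c d
    simp only [glmF]
    norm_cast
    rw [← this]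
    ac_rfl
  · simp only [glmN_inl_inl, glmN_inl_inr, glmN_inr_inl,
      glmN_inr_inr, not_mem_glmN_inr_inr, reduceCtorEq, Sum.inl.injEq, Sum.inr.injEq, false_and,
      and_false, QuotientAddGroup.mk_add, QuotientAddGroup.mk_sub]
    grind
  · rintro (m' | m') <;> simp only [glmN_inl_inl, glmN_inl_inr, glmN_inr_inl,
      glmN_inr_inr, not_mem_glmN_inr_inr, reduceCtorEq, Sum.inl.injEq, Sum.inr.injEq, false_and,
      and_false, QuotientAddGroup.mk_add, QuotientAddGroup.mk_sub]
    have : ((b + c : Γ) : Γ ⧸ twoMul Γ) = b + c := rfl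
    grind

theorem pentagon_lllr (a b c p : Γ) :
    h.PentagonAt δ ε (.inl a) (.inl b) (.inl c) (.inr (p : Γ ⧸ twoMul Γ)) := by
  intro s w u r v
  rintro rfl rfl rfl rfl rfl - _ _
  rw [sum_ite_eq_of_iff (.inl (b + c)), if_pos]
  · simp only [glmF, ← QuotientAddGroup.mk_add, h.omegaBar_coe]
    norm_cast
    apply Additive.ofMul.injective
    have := h.ofMul_omega_cocycle a a b c
    have := h.ofMul_omega_cocycle b a b c
    have := h.ofMul_omega_cocycle c a b c
    have := h.ofMul_omega_cocycle p a b c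
    simp only [ofMul_mul, ofMul_inv, h.multiplicative] at *
    grind
  · simp only [glmN_inl_inl, glmN_inl_inr, glmN_inr_inl,
      glmN_inr_inr, not_mem_glmN_inr_inr, reduceCtorEq, Sum.inl.injEq, Sum.inr.injEq, false_and,
      and_false, QuotientAddGroup.mk_add, QuotientAddGroup.mk_sub]
    grind
  · rintro (m' | m') <;> simp only [glmN_inl_inl, glmN_inl_inr, glmN_inr_inl,
      glmN_inr_inr, not_mem_glmN_inr_inr, reduceCtorEq, Sum.inl.injEq, Sum.inr.injEq, false_and,
      and_false, QuotientAddGroup.mk_add, QuotientAddGroup.mk_sub]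
    have : ((b + c : Γ) : Γ ⧸ twoMul Γ) = b + c := rfl
    grind

theorem pentagon_llrl (a b z d : Γ) :
    h.PentagonAt δ ε (.inl a) (.inl b) (.inr (z : Γ ⧸ twoMul Γ)) (.inl d) := by
  intro s w u r v
  rintro rfl rfl rfl rfl rfl - _ _
  rw [sum_ite_eq_of_iff (.inr (b + z)), if_pos]
  · simp only [glmF, ← QuotientAddGroup.mk_add, h.omegaBar_coe]
    norm_cast
    apply Additive.ofMul.injective
    have := h.ofMul_sigma_add_left d a b
    simp only [ofMul_mul, ofMul_inv, h.multiplicative] at *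
    grind
  · simp only [glmN_inl_inl, glmN_inl_inr, glmN_inr_inl,
      glmN_inr_inr, not_mem_glmN_inr_inr, reduceCtorEq, Sum.inl.injEq, Sum.inr.injEq, false_and,
      and_false, QuotientAddGroup.mk_add, QuotientAddGroup.mk_sub]
    grind
  · rintro (m' | m') <;> simp only [glmN_inl_inl, glmN_inl_inr, glmN_inr_inl,
      glmN_inr_inr, not_mem_glmN_inr_inr, reduceCtorEq, Sum.inl.injEq, Sum.inr.injEq, false_and,
      and_false, QuotientAddGroup.mk_add, QuotientAddGroup.mk_sub]
    grind

theorem pentagon_llrr (a b z p : Γ) :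
    h.PentagonAt δ ε (.inl a) (.inl b) (.inr (z : Γ ⧸ twoMul Γ)) (.inr (p : Γ ⧸ twoMul Γ)) := by
  intro s w u r v
  rintro rfl rfl ⟨t, ht, rfl⟩ ⟨t₂, ht₂, rfl⟩ rfl e _ _
  obtain rfl : t = a + (b + t₂) := Sum.inl.inj e
  rw [sum_ite_eq_of_iff (.inr (b + z)), if_pos]
  · simp only [glmF, ← QuotientAddGroup.mk_add, h.omegaBar_coe]
    norm_cast
    apply Additive.ofMul.injective
    have := h.ofMul_omega_cocycle a a b t₂
    have := h.ofMul_omega_cocycle b a b t₂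
    have := h.ofMul_omega_cocycle z a b t₂
    simp only [ofMul_mul, ofMul_inv, h.multiplicative] at *
    grind
  · simp only [glmN_inl_inl, glmN_inl_inr, glmN_inr_inl,
      glmN_inr_inr, not_mem_glmN_inr_inr, reduceCtorEq, Sum.inl.injEq, Sum.inr.injEq, false_and,
      and_false, QuotientAddGroup.mk_add, QuotientAddGroup.mk_sub]
    grind
  · rintro (m' | m') <;> simp only [glmN_inl_inl, glmN_inl_inr, glmN_inr_inl,
      glmN_inr_inr, not_mem_glmN_inr_inr, reduceCtorEq, Sum.inl.injEq, Sum.inr.injEq, false_and,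
      and_false, QuotientAddGroup.mk_add, QuotientAddGroup.mk_sub]
    grind

theorem pentagon_lrll (a y c d : Γ) :
    h.PentagonAt δ ε (.inl a) (.inr (y : Γ ⧸ twoMul Γ)) (.inl c) (.inl d) := by
  intro s w u r v
  rintro rfl rfl rfl rfl rfl - _ _
  rw [sum_ite_eq_of_iff (.inr (y + c)), if_pos]
  · simp only [glmF, ← QuotientAddGroup.mk_add, h.omegaBar_coe]
    norm_cast
    apply Additive.ofMul.injective
    have := h.ofMul_sigma_add a c d
    simp only [ofMul_mul, ofMul_inv, h.multiplicative] at *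
    grind
  · simp only [glmN_inl_inl, glmN_inl_inr, glmN_inr_inl,
      glmN_inr_inr, not_mem_glmN_inr_inr, reduceCtorEq, Sum.inl.injEq, Sum.inr.injEq, false_and,
      and_false, QuotientAddGroup.mk_add, QuotientAddGroup.mk_sub]
    grind
  · rintro (m' | m') <;> simp only [glmN_inl_inl, glmN_inl_inr, glmN_inr_inl,
      glmN_inr_inr, not_mem_glmN_inr_inr, reduceCtorEq, Sum.inl.injEq, Sum.inr.injEq, false_and,
      and_false, QuotientAddGroup.mk_add, QuotientAddGroup.mk_sub]
    grind

theorem pentagon_lrrl (a y z d : Γ) :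
    h.PentagonAt δ ε (.inl a) (.inr (y : Γ ⧸ twoMul Γ)) (.inr (z : Γ ⧸ twoMul Γ)) (.inl d) := by
  intro s w u r v
  rintro rfl ⟨t, ht, rfl⟩ rfl rfl ⟨t₂, ht₂, rfl⟩ e _ _
  obtain ⟨m, rfl⟩ : ∃ m, t = a + m := ⟨t - a, (add_sub_cancel _ _).symm⟩
  obtain rfl : m + d = t₂ := add_left_cancel ((add_assoc a m d).symm.trans (Sum.inl.inj e))
  rw [QuotientAddGroup.mk_add] at ht ht₂
  rw [sum_ite_eq_of_iff (.inl m), if_pos]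
  · simp only [glmF, ← QuotientAddGroup.mk_add, h.omegaBar_coe]
    norm_cast
    apply Additive.ofMul.injective
    have := h.ofMul_omega_cocycle a a m d
    have := h.ofMul_omega_cocycle y a m d
    simp only [ofMul_mul, ofMul_inv, h.multiplicative] at *
    grind
  · simp only [glmN_inl_inl, glmN_inl_inr, glmN_inr_inl,
      glmN_inr_inr, not_mem_glmN_inr_inr, reduceCtorEq, Sum.inl.injEq, Sum.inr.injEq, false_and,
      and_false, QuotientAddGroup.mk_add, QuotientAddGroup.mk_sub]
    grind
  · rintro (m' | m') <;> simp only [glmN_inl_inl, glmN_inl_inr, glmN_inr_inl,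
      glmN_inr_inr, not_mem_glmN_inr_inr, reduceCtorEq, Sum.inl.injEq, Sum.inr.injEq, false_and,
      and_false, QuotientAddGroup.mk_add, QuotientAddGroup.mk_sub]
    grind

theorem pentagon_lrlr (a y c p : Γ) :
    h.PentagonAt δ ε (.inl a) (.inr (y : Γ ⧸ twoMul Γ)) (.inl c) (.inr (p : Γ ⧸ twoMul Γ)) := by
  intro s w u r v
  rintro rfl rfl ⟨t, ht, rfl⟩ rfl ⟨t₂, ht₂, rfl⟩ e _ _
  obtain rfl : t = a + t₂ := Sum.inl.inj e
  rw [sum_ite_eq_of_iff (.inr (y + c)), if_pos]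
  · simp only [glmF, ← QuotientAddGroup.mk_add, h.omegaBar_coe]
    norm_cast
    apply Additive.ofMul.injective
    have := h.ofMul_sigma_add c a t₂
    have := congrArg Additive.ofMul (h.symmetric a c)
    simp only [ofMul_mul, ofMul_inv, h.multiplicative] at *
    grind
  · simp only [glmN_inl_inl, glmN_inl_inr, glmN_inr_inl,
      glmN_inr_inr, not_mem_glmN_inr_inr, reduceCtorEq, Sum.inl.injEq, Sum.inr.injEq, false_and,
      and_false, QuotientAddGroup.mk_add, QuotientAddGroup.mk_sub]
    grind
  · rintro (m' | m') <;> simp only [glmN_inl_inl, glmN_inl_inr, glmN_inr_inl,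
      glmN_inr_inr, not_mem_glmN_inr_inr, reduceCtorEq, Sum.inl.injEq, Sum.inr.injEq, false_and,
      and_false, QuotientAddGroup.mk_add, QuotientAddGroup.mk_sub]
    grind

/-- With three `X` each side contains exactly one factor `ε|2Γ|^{-1/2}`. It is split off, and the
remaining identity `key` between units rests on the deviation formula for `σ`, with `ω(t₂, ·, ·)`
and `ω(m, ·, ·)` expanded through the classes of `t₂` and `m`. -/
theorem pentagon_lrrr (a y z p : Γ) :
    h.PentagonAt δ ε (.inl a) (.inr (y : Γ ⧸ twoMul Γ)) (.inr (z : Γ ⧸ twoMul Γ)) (.inr (p : Γ ⧸ twoMul Γ)) := by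
  intro s w u r v
  rintro rfl ⟨t, ht, rfl⟩ rfl ⟨t₂, ht₂, rfl⟩ rfl e _ _
  obtain ⟨m, rfl⟩ : ∃ m, t = a + m := ⟨t - a, (add_sub_cancel _ _).symm⟩
  rw [QuotientAddGroup.mk_add] at ht
  have hm : (m : Γ ⧸ twoMul Γ) = δ + y + z := by grind
  rw [sum_ite_eq_of_iff (.inl m), if_pos]
  · have key : ω (a + y) a m * (ω (a + m + p) a m * (σ m t₂)⁻¹) = (σ (a + m) t₂)⁻¹ * σ a t₂ := by
      apply Additive.ofMul.injective
      have e1 := h.ofMul_sigma_add_left t₂ a m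
      have e2 := h.ofMul_omega_coset ht₂ a m
      have e3 := h.ofMul_omega_coset hm a m
      have e4 := h.ofMul_omega_add_self a a m
      have e5 := h.ofMul_omega_add_self δ a m
      have e6 := h.ofMul_omega_add_self y a m
      have e7 := h.ofMul_omega_add_self z a m
      have e8 := h.ofMul_omega_add_self p a m
      simp only [ofMul_mul, ofMul_inv, h.multiplicative] at *
      linear_combination (norm := abel) e1.1 + e2 + e3 + e4 + e5 + e6 + e7 + e8
    simp only [glmF, ← QuotientAddGroup.mk_add, h.omegaBar_coe]
    replace key := congrArg Units.val key
    push_cast at key ⊢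
    linear_combination (((ε : ℤ) : ℂ) * (sqrtCard Γ)⁻¹) * key
  · simp only [glmN_inl_inl, glmN_inl_inr, glmN_inr_inl,
      glmN_inr_inr, not_mem_glmN_inr_inr, reduceCtorEq, Sum.inl.injEq, Sum.inr.injEq, false_and,
      and_false, QuotientAddGroup.mk_add, QuotientAddGroup.mk_sub]
    grind
  · rintro (m' | m') <;> simp only [glmN_inl_inl, glmN_inl_inr, glmN_inr_inl,
      glmN_inr_inr, not_mem_glmN_inr_inr, reduceCtorEq, Sum.inl.injEq, Sum.inr.injEq, false_and,
      and_false, QuotientAddGroup.mk_add, QuotientAddGroup.mk_sub]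
    grind

theorem pentagon_rlll (x b c d : Γ) :
    h.PentagonAt δ ε (.inr (x : Γ ⧸ twoMul Γ)) (.inl b) (.inl c) (.inl d) := by
  intro s w u r v
  rintro rfl rfl rfl rfl rfl - _ _
  rw [sum_ite_eq_of_iff (.inl (b + c)), if_pos]
  · simp only [glmF, ← QuotientAddGroup.mk_add, h.omegaBar_coe]
    norm_cast
    apply Additive.ofMul.injective
    have := h.ofMul_omega_cocycle x b c d
    have := h.ofMul_omega_cocycle δ b c d
    have := h.ofMul_omega_cocycle b b c d
    simp only [ofMul_mul, ofMul_inv, h.multiplicative] at *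
    grind
  · simp only [glmN_inl_inl, glmN_inl_inr, glmN_inr_inl,
      glmN_inr_inr, not_mem_glmN_inr_inr, reduceCtorEq, Sum.inl.injEq, Sum.inr.injEq, false_and,
      and_false, QuotientAddGroup.mk_add, QuotientAddGroup.mk_sub]
    grind
  · rintro (m' | m') <;> simp only [glmN_inl_inl, glmN_inl_inr, glmN_inr_inl,
      glmN_inr_inr, not_mem_glmN_inr_inr, reduceCtorEq, Sum.inl.injEq, Sum.inr.injEq, false_and,
      and_false, QuotientAddGroup.mk_add, QuotientAddGroup.mk_sub]
    have : ((b + c : Γ) : Γ ⧸ twoMul Γ) = b + c := rfl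
    grind

theorem pentagon_rllr (x b c p : Γ) :
    h.PentagonAt δ ε (.inr (x : Γ ⧸ twoMul Γ)) (.inl b) (.inl c) (.inr (p : Γ ⧸ twoMul Γ)) := by
  intro s w u r v
  rintro rfl rfl ⟨t, ht, rfl⟩ rfl rfl - _ _
  -- The class of `t` is regrouped into three summands so that `ofMul_omega_coset` applies.
  have ht' : (t : Γ ⧸ twoMul Γ) = ((δ + x : Γ) : Γ ⧸ twoMul Γ) + ((b + c : Γ) : Γ ⧸ twoMul Γ) + p :=
    ht.trans (by simp only [QuotientAddGroup.mk_add]; abel)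
  rw [sum_ite_eq_of_iff (.inl (b + c)), if_pos]
  · simp only [glmF, ← QuotientAddGroup.mk_add, h.omegaBar_coe]
    norm_cast
    apply Additive.ofMul.injective
    have := h.ofMul_sigma_add_left t b c
    have := h.ofMul_omega_coset ht' b c
    have := h.ofMul_omega_add_self δ b c
    have := h.ofMul_omega_add_self x b c
    have := h.ofMul_omega_add_self b b c
    have := h.ofMul_omega_add_self c b c
    have := h.ofMul_omega_add_self p b c
    simp only [ofMul_mul, ofMul_inv, h.multiplicative] at *
    grind
  · simp only [glmN_inl_inl, glmN_inl_inr, glmN_inr_inl,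
      glmN_inr_inr, not_mem_glmN_inr_inr, reduceCtorEq, Sum.inl.injEq, Sum.inr.injEq, false_and,
      and_false, QuotientAddGroup.mk_add, QuotientAddGroup.mk_sub]
    clear ht'
    grind
  · rintro (m' | m') <;> simp only [glmN_inl_inl, glmN_inl_inr, glmN_inr_inl,
      glmN_inr_inr, not_mem_glmN_inr_inr, reduceCtorEq, Sum.inl.injEq, Sum.inr.injEq, false_and,
      and_false, QuotientAddGroup.mk_add, QuotientAddGroup.mk_sub]
    have : ((b + c : Γ) : Γ ⧸ twoMul Γ) = b + c := rfl
    clear ht'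
    grind

theorem pentagon_rlrl (x b z d : Γ) :
    h.PentagonAt δ ε (.inr (x : Γ ⧸ twoMul Γ)) (.inl b) (.inr (z : Γ ⧸ twoMul Γ)) (.inl d) := by
  intro s w u r v
  rintro rfl ⟨t, ht, rfl⟩ rfl rfl rfl - _ _
  rw [sum_ite_eq_of_iff (.inr (b + z)), if_pos]
  · simp only [glmF, ← QuotientAddGroup.mk_add, h.omegaBar_coe]
    norm_cast
    apply Additive.ofMul.injective
    have := h.ofMul_sigma_add b t d
    simp only [ofMul_mul, ofMul_inv, h.multiplicative] at *
    grind
  · simp only [glmN_inl_inl, glmN_inl_inr, glmN_inr_inl,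
      glmN_inr_inr, not_mem_glmN_inr_inr, reduceCtorEq, Sum.inl.injEq, Sum.inr.injEq, false_and,
      and_false, QuotientAddGroup.mk_add, QuotientAddGroup.mk_sub]
    grind
  · rintro (m' | m') <;> simp only [glmN_inl_inl, glmN_inl_inr, glmN_inr_inl,
      glmN_inr_inr, not_mem_glmN_inr_inr, reduceCtorEq, Sum.inl.injEq, Sum.inr.injEq, false_and,
      and_false, QuotientAddGroup.mk_add, QuotientAddGroup.mk_sub]
    grind

theorem pentagon_rlrr (x b z p : Γ) :
    h.PentagonAt δ ε (.inr (x : Γ ⧸ twoMul Γ)) (.inl b) (.inr (z : Γ ⧸ twoMul Γ)) (.inr (p : Γ ⧸ twoMul Γ)) := by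
  intro s w u r v
  rintro rfl ⟨t, ht, rfl⟩ rfl ⟨t₂, ht₂, rfl⟩ rfl - _ _
  have ht' : (t : Γ ⧸ twoMul Γ) = ((δ + x : Γ) : Γ ⧸ twoMul Γ) + b + z :=
    ht.trans (by simp only [QuotientAddGroup.mk_add]; abel)
  rw [sum_ite_eq_of_iff (.inr (b + z)), if_pos]
  · have key : σ b t * ((σ t (b + t₂))⁻¹ * ω (b + z) b t₂) = (σ t t₂)⁻¹ * ω (x + δ) b t₂ := by
      apply Additive.ofMul.injective
      have e1 := h.ofMul_sigma_add t b t₂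
      have e2 := h.ofMul_omega_coset ht' b t₂
      have e3 := congrArg Additive.ofMul (h.symmetric t b)
      have e4 := h.ofMul_omega_add_self δ b t₂
      have e5 := h.ofMul_omega_add_self x b t₂
      have e6 := h.ofMul_omega_add_self b b t₂
      have e7 := h.ofMul_omega_add_self z b t₂
      simp only [ofMul_mul, ofMul_inv, h.multiplicative] at *
      linear_combination (norm := abel) -e1.1 - e3 - e2 - e4 - e5
    simp only [glmF, ← QuotientAddGroup.mk_add, h.omegaBar_coe]
    replace key := congrArg Units.val key
    push_cast at key ⊢
    linear_combination (((ε : ℤ) : ℂ) * (sqrtCard Γ)⁻¹) * key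
  · simp only [glmN_inl_inl, glmN_inl_inr, glmN_inr_inl,
      glmN_inr_inr, not_mem_glmN_inr_inr, reduceCtorEq, Sum.inl.injEq, Sum.inr.injEq, false_and,
      and_false, QuotientAddGroup.mk_add, QuotientAddGroup.mk_sub]
    clear ht'
    grind
  · rintro (m' | m') <;> simp only [glmN_inl_inl, glmN_inl_inr, glmN_inr_inl,
      glmN_inr_inr, not_mem_glmN_inr_inr, reduceCtorEq, Sum.inl.injEq, Sum.inr.injEq, false_and,
      and_false, QuotientAddGroup.mk_add, QuotientAddGroup.mk_sub]
    clear ht'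
    grind

theorem pentagon_rrll (x y c d : Γ) :
    h.PentagonAt δ ε (.inr (x : Γ ⧸ twoMul Γ)) (.inr (y : Γ ⧸ twoMul Γ)) (.inl c) (.inl d) := by
  intro s w u r v
  rintro ⟨t, ht, rfl⟩ rfl rfl rfl rfl - _ _
  rw [sum_ite_eq_of_iff (.inr (y + c)), if_pos]
  · simp only [glmF, ← QuotientAddGroup.mk_add, h.omegaBar_coe]
    norm_cast
    apply Additive.ofMul.injective
    have := h.ofMul_omega_cocycle x t c d
    have := h.ofMul_omega_coset ht c d
    have := h.ofMul_omega_add_self δ c d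
    have := h.ofMul_omega_add_self y c d
    simp only [ofMul_mul, ofMul_inv, h.multiplicative] at *
    grind
  · simp only [glmN_inl_inl, glmN_inl_inr, glmN_inr_inl,
      glmN_inr_inr, not_mem_glmN_inr_inr, reduceCtorEq, Sum.inl.injEq, Sum.inr.injEq, false_and,
      and_false, QuotientAddGroup.mk_add, QuotientAddGroup.mk_sub]
    grind
  · rintro (m' | m') <;> simp only [glmN_inl_inl, glmN_inl_inr, glmN_inr_inl,
      glmN_inr_inr, not_mem_glmN_inr_inr, reduceCtorEq, Sum.inl.injEq, Sum.inr.injEq, false_and,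
      and_false, QuotientAddGroup.mk_add, QuotientAddGroup.mk_sub]
    grind

theorem pentagon_rrlr (x y c p : Γ) :
    h.PentagonAt δ ε (.inr (x : Γ ⧸ twoMul Γ)) (.inr (y : Γ ⧸ twoMul Γ)) (.inl c) (.inr (p : Γ ⧸ twoMul Γ)) := by
  intro s w u r v
  rintro ⟨t, ht, rfl⟩ rfl rfl rfl ⟨t₂, ht₂, rfl⟩ - _ _
  have ht' : (t₂ : Γ ⧸ twoMul Γ) = ((δ + y : Γ) : Γ ⧸ twoMul Γ) + c + p :=
    ht₂.trans (by simp only [QuotientAddGroup.mk_add]; abel)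
  rw [sum_ite_eq_of_iff (.inr (y + c)), if_pos]
  · have key : ω x t c * ((σ (t + c) t₂)⁻¹ * σ c t₂) = ω (t + c + p) t c * (σ t t₂)⁻¹ := by
      apply Additive.ofMul.injective
      have e1 := h.ofMul_sigma_add_left t₂ t c
      have e2 := h.ofMul_omega_coset ht t c
      have e3 := h.ofMul_omega_coset ht' t c
      have e4 := h.ofMul_omega_add_self δ t c
      have e5 := h.ofMul_omega_add_self x t c
      have e6 := h.ofMul_omega_add_self y t c
      have e7 := h.ofMul_omega_add_self c t c
      have e8 := h.ofMul_omega_add_self p t c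
      simp only [ofMul_mul, ofMul_inv, h.multiplicative] at *
      linear_combination (norm := abel) -e1.1 - e3 - e2 - e4 - e6 - e7 - e8
    simp only [glmF, ← QuotientAddGroup.mk_add, h.omegaBar_coe]
    replace key := congrArg Units.val key
    push_cast at key ⊢
    linear_combination (((ε : ℤ) : ℂ) * (sqrtCard Γ)⁻¹) * key
  · simp only [glmN_inl_inl, glmN_inl_inr, glmN_inr_inl,
      glmN_inr_inr, not_mem_glmN_inr_inr, reduceCtorEq, Sum.inl.injEq, Sum.inr.injEq, false_and,
      and_false, QuotientAddGroup.mk_add, QuotientAddGroup.mk_sub]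
    clear ht'
    grind
  · rintro (m' | m') <;> simp only [glmN_inl_inl, glmN_inl_inr, glmN_inr_inl,
      glmN_inr_inr, not_mem_glmN_inr_inr, reduceCtorEq, Sum.inl.injEq, Sum.inr.injEq, false_and,
      and_false, QuotientAddGroup.mk_add, QuotientAddGroup.mk_sub]
    clear ht'
    grind

theorem pentagon_rrrl (x y z d : Γ) :
    h.PentagonAt δ ε (.inr (x : Γ ⧸ twoMul Γ)) (.inr (y : Γ ⧸ twoMul Γ)) (.inr (z : Γ ⧸ twoMul Γ)) (.inl d) := by
  intro s w u r v
  rintro ⟨t, ht, rfl⟩ rfl rfl rfl ⟨t₂, ht₂, rfl⟩ - _ _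
  obtain ⟨m, rfl⟩ : ∃ m, t₂ = m + d := ⟨t₂ - d, (sub_add_cancel _ _).symm⟩
  rw [QuotientAddGroup.mk_add] at ht₂
  rw [sum_ite_eq_of_iff (.inl m), if_pos]
  · have key : (σ t m)⁻¹ * (ω (x + δ) m d * ω y m d) = σ t d * (σ t (m + d))⁻¹ := by
      apply Additive.ofMul.injective
      have e1 := h.ofMul_sigma_add t m d
      have e2 := h.ofMul_omega_coset ht m d
      have e3 := h.ofMul_omega_add_self δ m d
      have e4 := h.ofMul_omega_add_self x m d
      have e5 := h.ofMul_omega_add_self y m d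
      simp only [ofMul_mul, ofMul_inv, h.multiplicative] at *
      linear_combination (norm := abel) e1.1 + e2 + e3 + e4 + e5
    simp only [glmF, ← QuotientAddGroup.mk_add, h.omegaBar_coe]
    replace key := congrArg Units.val key
    push_cast at key ⊢
    linear_combination (((ε : ℤ) : ℂ) * (sqrtCard Γ)⁻¹) * key
  · simp only [glmN_inl_inl, glmN_inl_inr, glmN_inr_inl,
      glmN_inr_inr, not_mem_glmN_inr_inr, reduceCtorEq, Sum.inl.injEq, Sum.inr.injEq, false_and,
      and_false, QuotientAddGroup.mk_add, QuotientAddGroup.mk_sub]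
    grind
  · rintro (m' | m') <;> simp only [glmN_inl_inl, glmN_inl_inr, glmN_inr_inl,
      glmN_inr_inr, not_mem_glmN_inr_inr, reduceCtorEq, Sum.inl.injEq, Sum.inr.injEq, false_and,
      and_false, QuotientAddGroup.mk_add, QuotientAddGroup.mk_sub]
    grind

end IsSpecialCocycle

end GLM

/-! ### The pentagon for four factors `X` -/

section GLM

open FusionDatum

variable {Γ : Type u} [AddCommGroup Γ]

namespace IsSpecialCocycle

variable {Q : Γ → ℂˣ} {σ : Γ → Γ → ℂˣ} {ω : Γ → Γ → Γ → ℂˣ} (h : IsSpecialCocycle Q σ ω)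
  (hQ : IsDiscriminantForm Q) {δ : Γ} {ε : ℤˣ}

include h

set_option linter.unusedSimpArgs false

/-- The intermediate label `m` runs over a coset of `2Γ`, and the summand is `σ(u, m)` divided by
`σ(t, m)σ(r, m)`. The denominator equals `σ(t + r, m)` up to `ω(m, t, r)`, which is constant on the
coset, so orthogonality evaluates the sum. -/
theorem pentagon_rrrr [Finite Γ] [Fintype (Label Γ)] (hQ : IsDiscriminantForm Q) (x y z p : Γ) :
    h.PentagonAt δ ε (.inr (x : Γ ⧸ twoMul Γ)) (.inr (y : Γ ⧸ twoMul Γ))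
      (.inr (z : Γ ⧸ twoMul Γ)) (.inr (p : Γ ⧸ twoMul Γ)) := by
  intro s w u r v
  rintro ⟨t, ht, rfl⟩ rfl ⟨u, hu, rfl⟩ ⟨r, hr, rfl⟩ rfl - _ _
  have _ := Fintype.ofFinite (twoMul Γ)
  have hm : ((δ + y + z : Γ) : Γ ⧸ twoMul Γ) = δ + y + z := rfl
  have hz := quotient_add_self (z : Γ ⧸ twoMul Γ)
  have hδ := quotient_add_self (δ : Γ ⧸ twoMul Γ)
  rw [sum_coset (K := Label Γ) Sum.inl Sum.inl_injective (δ + y + z)]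
  · have e : ∀ k : twoMul Γ, glmF σ ω δ ε (.inr x) (.inr y) (.inr z) (.inl t)
        (.inl (δ + y + z + k)) (.inr (t + z)) *
        (glmF σ ω δ ε (.inr x) (.inl (δ + y + z + k)) (.inr p) (.inr (t + z)) (.inr (y + r))
          (.inl u) *
        glmF σ ω δ ε (.inr y) (.inr z) (.inr p) (.inl (δ + y + z + k)) (.inl r) (.inr (y + r))) =
        (Nat.card (twoMul Γ) : ℂ)⁻¹ * ω (δ + y + z) t r *
          ((σ (t + r) (δ + y + z + k))⁻¹ * σ u (δ + y + z + k)) := fun k => by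
      have e₁ := h.sigma_add_left (δ + y + z + k) t r
      rw [h.omega_eq_of_coe_eq (QuotientAddGroup.mk_add_of_mem (δ + y + z) k.2)] at e₁
      simp only [glmF]
      rw [← sign_sqrtCard_mul_self (ε := ε), e₁, h.symmetric u, h.symmetric r]
      push_cast
      field_simp
    rw [Finset.sum_congr rfl fun k _ => e k, ← Finset.mul_sum, h.sum_sigma_coset hQ]
    -- Orthogonality yields the Kronecker delta of `t + r = u`, which is exactly the fusion
    -- condition on the other side of the pentagon.
    · by_cases e : t + r = u
      · have e₁ := h.ofMul_omega_coset ht t r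
        have e₂ := h.ofMul_omega_add_self x t r
        rw [if_pos e, if_pos (glmN_inl_inl.2 (congrArg Sum.inl e.symm))]
        simp only [glmF, ← QuotientAddGroup.mk_add, h.omegaBar_coe]
        rw [mul_right_comm, inv_mul_cancel₀ card_twoMul_ne_zero, one_mul]
        norm_cast
        apply Additive.ofMul.injective
        simp only [ofMul_mul, h.multiplicative]
        linear_combination (norm := abel) - e₁ - e₂
      · rw [if_neg e, if_neg fun e₁ => e (Sum.inl.inj (glmN_inl_inl.1 e₁)).symm, mul_zero]
    · rw [hu, QuotientAddGroup.mk_add, ht, hr]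
      grind
  · rintro (m | m) <;> simp only [glmN_inl_inl, glmN_inl_inr, glmN_inr_inl,
        glmN_inr_inr, not_mem_glmN_inr_inr, reduceCtorEq, Sum.inl.injEq, Sum.inr.injEq, false_and,
        and_false, QuotientAddGroup.mk_add, QuotientAddGroup.mk_sub]
    · have hx := quotient_add_self (x : Γ ⧸ twoMul Γ)
      grind
    · simp

theorem pentagonAt [Finite Γ] [Fintype (Label Γ)] (hQ : IsDiscriminantForm Q) (i j k l : Label Γ) :
    h.PentagonAt δ ε i j k l := by
  have key : ∀ i : Label Γ, (∃ a, i = .inl a) ∨ ∃ x : Γ, i = .inr (x : Γ ⧸ twoMul Γ) := by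
    rintro (a | x)
    · exact .inl ⟨a, rfl⟩
    · obtain ⟨x, rfl⟩ := QuotientAddGroup.mk_surjective x
      exact .inr ⟨x, rfl⟩
  rcases key i with ⟨a, rfl⟩ | ⟨a, rfl⟩ <;> rcases key j with ⟨b, rfl⟩ | ⟨b, rfl⟩ <;>
    rcases key k with ⟨c, rfl⟩ | ⟨c, rfl⟩ <;> rcases key l with ⟨d, rfl⟩ | ⟨d, rfl⟩
  · exact h.pentagon_llll a b c d
  · exact h.pentagon_lllr a b c d
  · exact h.pentagon_llrl a b c d
  · exact h.pentagon_llrr a b c d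
  · exact h.pentagon_lrll a b c d
  · exact h.pentagon_lrlr a b c d
  · exact h.pentagon_lrrl a b c d
  · exact h.pentagon_lrrr a b c d
  · exact h.pentagon_rlll a b c d
  · exact h.pentagon_rllr a b c d
  · exact h.pentagon_rlrl a b c d
  · exact h.pentagon_rlrr a b c d
  · exact h.pentagon_rrll a b c d
  · exact h.pentagon_rrlr a b c d
  · exact h.pentagon_rrrl a b c d
  · exact h.pentagon_rrrr hQ a b c d

theorem glm_isCoherent [Finite Γ] [Fintype (Label Γ)] (hQ : IsDiscriminantForm Q) :
    (glmDatum σ ω δ ε).IsCoherent (glmG σ ω δ ε) where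
  one_left := by
    rintro (a | x) s
    · exact iff_of_eq (congrArg (s = ·) (congrArg Sum.inl (zero_add a)))
    · exact iff_of_eq (congrArg (s = ·) (congrArg Sum.inr (zero_add x)))
  one_right := by
    rintro (a | x) s
    · exact iff_of_eq (congrArg (s = ·) (congrArg Sum.inl (add_zero a)))
    · exact iff_of_eq (congrArg (s = ·) (congrArg Sum.inr (add_zero x)))
  inv_right i j k s s₁ w h₁ h₂ h₃ h₄ := h.glm_inv_right hQ i j k s s₁ w h₁ h₂ h₃ h₄ _ _
  inv_left i j k r r₁ w h₁ h₂ h₃ h₄ := h.glm_inv_left hQ i j k r r₁ w h₁ h₂ h₃ h₄ _ _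
  pentagon i j k l s w u r v h₁ h₂ h₃ h₄ h₅ h₆ :=
    h.pentagonAt hQ i j k l s w u r v h₁ h₂ h₃ h₄ h₅ h₆ _ _
  triangle := by
    rintro (a | x) (b | y) w hw
    · exact congrArg Units.val (h.omega_zero_mid a b)
    · exact congrArg Units.val (h.omega_zero_right _ a)
    · exact congrArg Units.val (h.omega_zero_mid _ _)
    · obtain ⟨t, ht, rfl⟩ := hw
      exact congrArg Units.val (h.normalised_left t)

end IsSpecialCocycle

end GLM

/-! ### Compatibility of the action with the associators -/

section GLM

open FusionDatum

variable {Γ : Type u} [AddCommGroup Γ]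

namespace IsSpecialCocycle

variable {Q : Γ → ℂˣ} {σ : Γ → Γ → ℂˣ} {ω : Γ → Γ → Γ → ℂˣ} (h : IsSpecialCocycle Q σ ω)
  {δ : Γ} {ε : ℤˣ}

include h

set_option linter.unusedSimpArgs false

theorem ofMul_omega_neg_neg (a b c : Γ) :
    Additive.ofMul (ω a b c) + .ofMul (ω a (-b) (-c)) + .ofMul (ω a b (-b)) +
      .ofMul (ω a c (-c)) = .ofMul (ω a (b + c) (-(b + c))) ∧
    Additive.ofMul (ω a b c) + .ofMul (ω a b c) = 0 ∧
    Additive.ofMul (ω a (-b) (-c)) + .ofMul (ω a (-b) (-c)) = 0 ∧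
    Additive.ofMul (ω a b (-b)) + .ofMul (ω a b (-b)) = 0 ∧
    Additive.ofMul (ω a c (-c)) + .ofMul (ω a c (-c)) = 0 :=
  ⟨congrArg Additive.ofMul (h.omega_neg_neg a b c), h.ofMul_omega_add_self _ _ _,
    h.ofMul_omega_add_self _ _ _, h.ofMul_omega_add_self _ _ _, h.ofMul_omega_add_self _ _ _⟩

theorem ofMul_sigma_neg_neg (a b : Γ) :
    Additive.ofMul (σ a b) + .ofMul (ω b a (-a)) = .ofMul (ω a b (-b)) + .ofMul (σ (-a) (-b)) ∧
    Additive.ofMul (ω b a (-a)) + .ofMul (ω b a (-a)) = 0 ∧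
    Additive.ofMul (ω a b (-b)) + .ofMul (ω a b (-b)) = 0 :=
  ⟨congrArg Additive.ofMul (h.sigma_neg_neg a b), h.ofMul_omega_add_self _ _ _,
    h.ofMul_omega_add_self _ _ _⟩

/-- Compatibility of the tensor structure of the action with the associator. -/
def TauAssocAt (_ : IsSpecialCocycle Q σ ω) (δ : Γ) (ε : ℤˣ) (i j k : Label Γ) : Prop :=
  ∀ s r w, s ∈ glmN δ i j → w ∈ glmN δ s k → r ∈ glmN δ j k → w ∈ glmN δ i r →
    glmTau ω δ s k w * glmTau ω δ i j s *
        glmF σ ω δ ε (glmNeg i) (glmNeg j) (glmNeg k) (glmNeg s) (glmNeg r) (glmNeg w) =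
      glmF σ ω δ ε i j k s r w * glmTau ω δ i r w * glmTau ω δ j k r

theorem tau_assoc_lll (a b c : Γ) :
    h.TauAssocAt δ ε (.inl a) (.inl b) (.inl c) := by
  intro s r w
  rintro rfl rfl rfl -
  simp only [glmF, glmTau, glmNeg, ← QuotientAddGroup.mk_add, h.omegaBar_coe]
  norm_cast
  apply Additive.ofMul.injective
  have e1 := h.ofMul_omega_neg_neg a b c
  have e2 := h.ofMul_omega_neg_neg b b c
  have e3 := h.ofMul_omega_add_self a c (-c)
  have e4 := h.ofMul_omega_add_self b c (-c)
  simp only [ofMul_mul, ofMul_inv, h.multiplicative, h.omega_neg, neg_neg] at *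
  grind

theorem tau_assoc_llr (a b z : Γ) :
    h.TauAssocAt δ ε (.inl a) (.inl b) (.inr (z : Γ ⧸ twoMul Γ)) := by
  intro s r w
  rintro rfl rfl rfl -
  simp only [glmF, glmTau, glmNeg, ← QuotientAddGroup.mk_add, h.omegaBar_coe]
  norm_cast
  apply Additive.ofMul.injective
  have e1 := h.ofMul_omega_neg_neg a a b
  have e2 := h.ofMul_omega_neg_neg b a b
  have e3 := h.ofMul_omega_neg_neg z a b
  have e4 := h.ofMul_omega_add_self a b (-b)
  simp only [ofMul_mul, ofMul_inv, h.multiplicative, h.omega_neg, neg_neg] at *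
  linear_combination (norm := abel) -e1.1 + e1.2.2.1 + e1.2.2.2.2 - e2.1 + e2.2.2.1 - e3.1 + e3.2.2.1

theorem tau_assoc_lrl (a y c : Γ) :
    h.TauAssocAt δ ε (.inl a) (.inr (y : Γ ⧸ twoMul Γ)) (.inl c) := by
  intro s r w
  rintro rfl rfl rfl -
  simp only [glmF, glmTau, glmNeg, ← QuotientAddGroup.mk_add, h.omegaBar_coe]
  norm_cast
  apply Additive.ofMul.injective
  have e1 := h.ofMul_sigma_neg_neg a c
  have e2 := h.ofMul_omega_add_self a a (-a)
  have e3 := h.ofMul_omega_add_self y a (-a)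
  simp only [ofMul_mul, ofMul_inv, h.multiplicative, h.omega_neg, neg_neg] at *
  grind

theorem tau_assoc_lrr (a y z : Γ) :
    h.TauAssocAt δ ε (.inl a) (.inr (y : Γ ⧸ twoMul Γ)) (.inr (z : Γ ⧸ twoMul Γ)) := by
  intro s r w
  rintro rfl ⟨t, ht, rfl⟩ ⟨m, hm, rfl⟩ e
  obtain rfl : t = a + m := Sum.inl.inj e
  simp only [glmF, glmTau, glmNeg, ← QuotientAddGroup.mk_add, h.omegaBar_coe]
  norm_cast
  apply Additive.ofMul.injective
  have e1 := h.ofMul_omega_neg_neg a a m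
  have e2 := h.ofMul_omega_neg_neg y a m
  simp only [ofMul_mul, ofMul_inv, h.multiplicative, h.omega_neg, neg_neg] at *
  linear_combination (norm := abel) -e1.1 + e1.2.2.1 + e1.2.2.2.1 - e2.1 + e2.2.2.1 + e2.2.2.2.1

theorem tau_assoc_rll (x b c : Γ) :
    h.TauAssocAt δ ε (.inr (x : Γ ⧸ twoMul Γ)) (.inl b) (.inl c) := by
  intro s r w
  rintro rfl rfl rfl -
  simp only [glmF, glmTau, glmNeg, ← QuotientAddGroup.mk_add, h.omegaBar_coe]
  norm_cast
  apply Additive.ofMul.injective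
  have e1 := h.ofMul_omega_neg_neg x b c
  have e2 := h.ofMul_omega_neg_neg δ b c
  have e3 := h.ofMul_omega_add_self b c (-c)
  simp only [ofMul_mul, ofMul_inv, h.multiplicative, h.omega_neg, neg_neg] at *
  linear_combination (norm := abel) e1.1 - e1.2.1 + e2.1 - e2.2.1

theorem tau_assoc_rlr (x b z : Γ) :
    h.TauAssocAt δ ε (.inr (x : Γ ⧸ twoMul Γ)) (.inl b) (.inr (z : Γ ⧸ twoMul Γ)) := by
  intro s r w
  rintro rfl ⟨t, ht, rfl⟩ rfl -
  have ht' : (t : Γ ⧸ twoMul Γ) = ((δ + x : Γ) : Γ ⧸ twoMul Γ) + b + z := ht.trans (by simp only [QuotientAddGroup.mk_add]; abel)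
  simp only [glmF, glmTau, glmNeg, ← QuotientAddGroup.mk_add, h.omegaBar_coe]
  norm_cast
  apply Additive.ofMul.injective
  have e1 := h.ofMul_sigma_neg_neg b t
  have e2 := h.ofMul_omega_coset ht' b (-b)
  have e3 := h.ofMul_omega_add_self b t (-t)
  have e4 := h.ofMul_omega_add_self x t (-t)
  have e5 := h.ofMul_omega_add_self x b (-b)
  have e6 := h.ofMul_omega_add_self δ b (-b)
  simp only [ofMul_mul, ofMul_inv, h.multiplicative, h.omega_neg, neg_neg] at *
  grind

theorem tau_assoc_rrl (x y c : Γ) :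
    h.TauAssocAt δ ε (.inr (x : Γ ⧸ twoMul Γ)) (.inr (y : Γ ⧸ twoMul Γ)) (.inl c) := by
  intro s r w
  rintro ⟨t, ht, rfl⟩ rfl rfl -
  simp only [glmF, glmTau, glmNeg, ← QuotientAddGroup.mk_add, h.omegaBar_coe]
  norm_cast
  apply Additive.ofMul.injective
  have e1 := h.ofMul_omega_neg_neg x t c
  have e2 := h.ofMul_omega_coset ht c (-c)
  have e3 := h.ofMul_omega_add_self x c (-c)
  have e4 := h.ofMul_omega_add_self y c (-c)
  have e5 := h.ofMul_omega_add_self δ c (-c)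
  simp only [ofMul_mul, ofMul_inv, h.multiplicative, h.omega_neg, neg_neg] at *
  grind

/-- By `sigma_neg_neg`, `σ(t, m)` and `σ(-t, -m)` differ by `ω(m, t, -t)` and `ω(t, m, -m)`. Since
the classes of `t` and `m` are `δ + x + y` and `δ + y + z`, these are the factors contributed by the
tensor structures. -/
theorem tau_assoc_rrr (x y z : Γ) :
    h.TauAssocAt δ ε (.inr (x : Γ ⧸ twoMul Γ)) (.inr (y : Γ ⧸ twoMul Γ)) (.inr (z : Γ ⧸ twoMul Γ)) := by
  intro s r w
  rintro ⟨t, ht, rfl⟩ rfl ⟨m, hm, rfl⟩ -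
  have key : ω (t + z) t (-t) * ω x t (-t) * (σ (-t) (-m))⁻¹ = (σ t m)⁻¹ * ω (x + δ) m (-m) * ω y m (-m) := by
    apply Additive.ofMul.injective
    have e1 := h.ofMul_sigma_neg_neg t m
    have e2 := h.ofMul_omega_coset ht t (-t)
    have e3 := h.ofMul_omega_coset ht m (-m)
    have e4 := h.ofMul_omega_coset hm t (-t)
    have e5 := h.ofMul_omega_coset hm m (-m)
    have e6 := h.ofMul_omega_add_self δ t (-t)
    have e7 := h.ofMul_omega_add_self δ m (-m)
    have e8 := h.ofMul_omega_add_self x t (-t)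
    have e9 := h.ofMul_omega_add_self x m (-m)
    have e10 := h.ofMul_omega_add_self y t (-t)
    have e11 := h.ofMul_omega_add_self y m (-m)
    have e12 := h.ofMul_omega_add_self z t (-t)
    have e13 := h.ofMul_omega_add_self z m (-m)
    simp only [ofMul_mul, ofMul_inv, h.multiplicative, h.omega_neg, neg_neg] at *
    linear_combination (norm := abel) e1.1 + e2 + e3 - e4 + e8
  simp only [glmF, glmTau, glmNeg, ← QuotientAddGroup.mk_add, h.omegaBar_coe]
  replace key := congrArg Units.val key
  push_cast at key ⊢
  linear_combination (((ε : ℤ) : ℂ) * (sqrtCard Γ)⁻¹) * key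

end IsSpecialCocycle

end GLM

/-! ### The function `q` and equivariance of the braiding -/

section GLM

open FusionDatum

variable {Γ : Type u} [AddCommGroup Γ]

theorem Label.exists_rep (i : Label Γ) :
    (∃ a, i = .inl a) ∨ ∃ x : Γ, i = .inr (x : Γ ⧸ twoMul Γ) := by
  rcases i with a | x
  · exact .inl ⟨a, rfl⟩
  · obtain ⟨x, rfl⟩ := QuotientAddGroup.mk_surjective x
    exact .inr ⟨x, rfl⟩

theorem coe_neg_twoMul (a : Γ) : ((-a : Γ) : Γ ⧸ twoMul Γ) = a := by
  rw [QuotientAddGroup.mk_neg, neg_eq_iff_add_eq_zero, quotient_add_self]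

theorem glmNeg_mem {δ : Γ} {i j s : Label Γ} (h : s ∈ glmN δ i j) :
    glmNeg s ∈ glmN δ (glmNeg i) (glmNeg j) := by
  rcases i with a | x <;> rcases j with b | y
  · obtain rfl := h
    exact congrArg Sum.inl (neg_add a b)
  · obtain rfl := h
    refine congrArg Sum.inr ?_
    rw [coe_neg_twoMul]
  · obtain rfl := h
    refine congrArg Sum.inr ?_
    rw [coe_neg_twoMul]
  · obtain ⟨t, ht, rfl⟩ := h
    exact ⟨-t, (coe_neg_twoMul t).trans ht, rfl⟩

namespace IsSpecialCocycle

variable {Q : Γ → ℂˣ} {σ : Γ → Γ → ℂˣ} {ω : Γ → Γ → Γ → ℂˣ} (h : IsSpecialCocycle Q σ ω)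
  {δ : Γ} {ε : ℤˣ}

include h

set_option linter.unusedSimpArgs false

theorem tauAssocAt (i j k : Label Γ) : h.TauAssocAt δ ε i j k := by
  rcases i.exists_rep with ⟨a, rfl⟩ | ⟨a, rfl⟩ <;> rcases j.exists_rep with ⟨b, rfl⟩ | ⟨b, rfl⟩ <;>
    rcases k.exists_rep with ⟨c, rfl⟩ | ⟨c, rfl⟩
  · exact h.tau_assoc_lll a b c
  · exact h.tau_assoc_llr a b c
  · exact h.tau_assoc_lrl a b c
  · exact h.tau_assoc_lrr a b c
  · exact h.tau_assoc_rll a b c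
  · exact h.tau_assoc_rlr a b c
  · exact h.tau_assoc_rrl a b c
  · exact h.tau_assoc_rrr a b c

theorem glmTau_mul {i j s : Label Γ} (hs : s ∈ glmN δ i j) :
    1 = glmTau ω δ i j s * glmTau ω δ (glmNeg i) (glmNeg j) (glmNeg s) := by
  rcases i.exists_rep with ⟨a, rfl⟩ | ⟨x, rfl⟩ <;>
    rcases j.exists_rep with ⟨b, rfl⟩ | ⟨y, rfl⟩
  · simp only [glmTau, glmNeg]
    norm_cast
    rw [h.omega_neg, neg_neg, h.omega_swap a (-b), h.omega_mul_self, Units.val_one]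
  · simp only [glmTau, glmNeg, coe_neg_twoMul, ← QuotientAddGroup.mk_add, h.omegaBar_coe]
    norm_cast
    rw [neg_neg, h.omega_swap _ (-a), h.omega_mul_self, Units.val_one]
  · simp only [glmTau, glmNeg, ← QuotientAddGroup.mk_add, h.omegaBar_coe]
    norm_cast
    rw [neg_neg, h.omega_swap _ (-b), h.omega_mul_self, Units.val_one]
  · obtain ⟨t, ht, rfl⟩ := hs
    simp only [glmTau, glmNeg, h.omegaBar_coe]
    norm_cast
    rw [neg_neg, h.omega_swap _ (-t), h.omega_mul_self, Units.val_one]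

open Classical in
theorem glm_isActionCoherent : IsActionCoherent (glmDatum σ ω δ ε)
    (involutionAction glmNeg glmNeg_glmNeg)
    fun g i j s => if g = 1 then 1 else glmTau ω δ i j s := by
  refine isActionCoherent_involution (t := glmTau ω δ) ?_ ?_ ?_ ?_ ?_ ?_ ?_
  · refine fun i j s => ⟨glmNeg_mem, fun hs => ?_⟩
    have := glmNeg_mem hs
    rwa [glmNeg_glmNeg, glmNeg_glmNeg, glmNeg_glmNeg] at this
  · exact congrArg Sum.inl neg_zero
  · rintro (a | x) (b | y) s hs
    · exact Units.ne_zero _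
    · exact Units.ne_zero _
    · exact Units.ne_zero _
    · obtain ⟨t, ht, rfl⟩ := hs
      exact Units.ne_zero _
  · exact fun i j k s r w => h.tauAssocAt i j k s r w
  · rintro (a | x)
    · exact congrArg Units.val (h.omega_zero_left _ _)
    · exact congrArg Units.val (h.omega_zero_mid _ _)
  · rintro (a | x)
    · exact congrArg Units.val (h.omega_zero_mid _ _)
    · exact congrArg Units.val (h.omega_zero_mid _ _)
  · exact fun i j s hs => h.glmTau_mul hs

variable {q : Γ → ℂˣ} (hq : ∀ a, q a ^ 2 = Q a)
  (hqadd : ∀ a b, q (a + b) * (q a)⁻¹ * (q b)⁻¹ = σ a b * ω (a + b) a b * ω δ a b)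

omit h in
include hqadd in
theorem q_add (a b : Γ) : q (a + b) = q a * q b * σ a b * ω (a + b) a b * ω δ a b := by
  have := hqadd a b
  rw [mul_inv_eq_iff_eq_mul, mul_inv_eq_iff_eq_mul] at this
  rw [this]
  ac_rfl

include hqadd in
theorem q_zero : q 0 = 1 := by
  have := q_add hqadd 0 0
  rw [h.omega_zero_mid, h.omega_zero_mid, h.normalised_left, add_zero, mul_one, mul_one,
    mul_one] at this
  exact (mul_eq_left.1 this.symm)

include hq in
theorem ofMul_q_self (a : Γ) : Additive.ofMul (q a) + .ofMul (q a) = .ofMul (σ a a) :=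
  congrArg Additive.ofMul ((sq (q a)).symm.trans ((hq a).trans (h.represents a).symm))

include hqadd in
theorem ofMul_q_add (a b : Γ) :
    Additive.ofMul (q (a + b)) = .ofMul (q a) + .ofMul (q b) + .ofMul (σ a b) +
      .ofMul (ω a a b) + .ofMul (ω b a b) + .ofMul (ω δ a b) ∧
    Additive.ofMul (ω a a b) + .ofMul (ω a a b) = 0 ∧
    Additive.ofMul (ω b a b) + .ofMul (ω b a b) = 0 ∧
    Additive.ofMul (ω δ a b) + .ofMul (ω δ a b) = 0 := by
  refine ⟨?_, h.ofMul_omega_add_self _ _ _, h.ofMul_omega_add_self _ _ _,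
    h.ofMul_omega_add_self _ _ _⟩
  have := q_add hqadd a b
  rw [h.multiplicative, ← mul_assoc] at this
  exact congrArg Additive.ofMul this

-- The addition law at `a + (-a) = 0` relates `q(a) q(-a)` to `σ(a, -a)`; the latter is `ω(a, a,
-- -a)` divided by `σ(a, a)`, and `σ(a, a) = q(a)²`. This comparison of `q` at `a` and `-a` is what
-- equivariance of the braiding needs.
include hq hqadd in
theorem ofMul_q_neg (a : Γ) :
    Additive.ofMul (q a) = .ofMul (q (-a)) + .ofMul (ω a a (-a)) + .ofMul (ω δ a (-a)) ∧
    Additive.ofMul (ω a a (-a)) + .ofMul (ω a a (-a)) = 0 ∧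
    Additive.ofMul (ω δ a (-a)) + .ofMul (ω δ a (-a)) = 0 := by
  refine ⟨?_, h.ofMul_omega_add_self _ _ _, h.ofMul_omega_add_self _ _ _⟩
  obtain ⟨e₁, e₂, e₃, e₄⟩ := h.ofMul_q_add hqadd a (-a)
  have e₅ := h.ofMul_q_self hq a
  have e₆ := congrArg Additive.ofMul (h.sigma_neg a)
  rw [add_neg_cancel, h.q_zero hqadd, h.omega_neg] at e₁
  simp only [ofMul_mul, ofMul_one] at e₁ e₆
  linear_combination (norm := abel) e₅ + e₁ + e₆ + e₂

variable {α : ℂ}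

include hq hqadd in
open Classical in
theorem glm_braid_act (g : C₂) (i j s : Label Γ) (hs : s ∈ glmN δ i j) :
    glmR σ ω q α i j s *
        (if g = 1 then 1 else glmTau ω δ
          (act (involutionAction glmNeg glmNeg_glmNeg) (glmDegree i) j) i s) =
      (if g = 1 then 1 else glmTau ω δ i j s) *
        glmR σ ω q α (act (involutionAction glmNeg glmNeg_glmNeg) g i)
          (act (involutionAction glmNeg glmNeg_glmNeg) g j)
          (act (involutionAction glmNeg glmNeg_glmNeg) g s) := by
  rcases C₂.eq_one_or g with rfl | rfl
  · simp only [act_one, if_true, one_mul, mul_one]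
  rw [if_neg C₂.ofAdd_one_ne, if_neg C₂.ofAdd_one_ne]
  simp only [act_involutionAction]
  rcases i.exists_rep with ⟨a, rfl⟩ | ⟨x, rfl⟩ <;>
    rcases j.exists_rep with ⟨b, rfl⟩ | ⟨y, rfl⟩ <;>
    simp only [glmDegree, act_one, act_involutionAction]
  · simp only [glmR, glmTau, glmNeg]
    exact_mod_cast h.sigma_neg_neg a b
  · have e1 := h.ofMul_q_neg hq hqadd a
    have e2 := h.ofMul_omega_add_self y a (-a)
    simp only [glmR, glmTau, glmNeg, ← QuotientAddGroup.mk_add, h.omegaBar_coe]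
    norm_cast
    apply Additive.ofMul.injective
    simp only [ofMul_mul, ofMul_inv, h.multiplicative, h.omega_neg, neg_neg] at *
    linear_combination (norm := abel) -e1.1 - e1.2.1
  · have e1 := h.ofMul_q_neg hq hqadd b
    have e2 := h.ofMul_omega_add_self x b (-b)
    have e3 := congrArg Additive.ofMul (h.omega_swap x b (-b))
    have e4 := congrArg Additive.ofMul (h.omega_swap b b (-b))
    simp only [glmR, glmTau, glmNeg, ← QuotientAddGroup.mk_add, h.omegaBar_coe]
    norm_cast
    apply Additive.ofMul.injective
    simp only [ofMul_mul, ofMul_inv, h.multiplicative, h.omega_neg, neg_neg] at *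
    linear_combination (norm := abel) -e1.1 - e1.2.2
  · obtain ⟨t, ht, rfl⟩ := hs
    have key : q t * ω y t (-t) = ω x t (-t) * q (-t) := by
      apply Additive.ofMul.injective
      have e1 := h.ofMul_q_neg hq hqadd t
      have e2 := h.ofMul_omega_coset ht t (-t)
      have e3 := h.ofMul_omega_add_self x t (-t)
      have e4 := h.ofMul_omega_add_self y t (-t)
      simp only [ofMul_mul, ofMul_inv, h.multiplicative, h.omega_neg, neg_neg] at *
      grind
    simp only [glmR, glmTau, glmNeg, h.omegaBar_coe]
    replace key := congrArg Units.val key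
    push_cast at key ⊢
    linear_combination α * key

end IsSpecialCocycle

end GLM

/-! ### The first hexagon with at most two factors `X` -/

section GLM

open FusionDatum

variable {Γ : Type u} [AddCommGroup Γ]

/-- The action of the degree of `i` on the simple objects. -/
def glmShift : Label Γ → Label Γ → Label Γ
  | .inl _, j => j
  | .inr _, j => glmNeg j

/-- The tensor structure of the action of the degree of `i`. -/
noncomputable def glmShiftTau (ω : Γ → Γ → Γ → ℂˣ) (δ : Γ) :
    Label Γ → Label Γ → Label Γ → Label Γ → ℂ
  | .inl _, _, _, _ => 1
  | .inr _, i, j, s => glmTau ω δ i j s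

namespace IsSpecialCocycle

variable {Q : Γ → ℂˣ} {σ : Γ → Γ → ℂˣ} {ω : Γ → Γ → Γ → ℂˣ} (h : IsSpecialCocycle Q σ ω)
  {δ : Γ} {ε : ℤˣ} {q : Γ → ℂˣ} {α : ℂ}

set_option linter.unusedSimpArgs false
set_option linter.unusedVariables false
set_option linter.unusedSectionVars false

/-- The first hexagon equation for three given simple objects. -/
def HexagonAt [Fintype (Label Γ)] (_ : IsSpecialCocycle Q σ ω) (δ : Γ) (ε : ℤˣ) (q : Γ → ℂˣ)
    (α : ℂ) (i j k : Label Γ) : Prop :=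
  ∀ s w v, s ∈ glmN δ i j → w ∈ glmN δ s k → v ∈ glmN δ i k → w ∈ glmN δ (glmShift i j) v →
    ∀ (_ : ∀ r, Decidable (r ∈ glmN δ j k ∧ w ∈ glmN δ i r)),
    (∑ r, if r ∈ glmN δ j k ∧ w ∈ glmN δ i r then
      glmF σ ω δ ε i j k s r w * (glmR σ ω q α i r w * (glmShiftTau ω δ i j k r *
        glmF σ ω δ ε (glmShift i j) (glmShift i k) i (glmShift i r) v w)) else 0) =
      glmR σ ω q α i j s * (glmF σ ω δ ε (glmShift i j) i k s v w * glmR σ ω q α i k v)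

/-- The second hexagon equation for three given simple objects. -/
def HexagonInvAt [Fintype (Label Γ)] (_ : IsSpecialCocycle Q σ ω) (δ : Γ) (ε : ℤˣ) (q : Γ → ℂˣ)
    (α : ℂ) (i j k : Label Γ) : Prop :=
  ∀ s w v, s ∈ glmN δ i j → w ∈ glmN δ s k → v ∈ glmN δ i (glmShift j k) → w ∈ glmN δ v j →
    ∀ (_ : ∀ r, Decidable (r ∈ glmN δ j k ∧ w ∈ glmN δ i r)),
    glmR σ ω q α s k w * glmG σ ω δ ε (glmShift i (glmShift j k)) i j v s w =
      ∑ r, if r ∈ glmN δ j k ∧ w ∈ glmN δ i r then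
        glmF σ ω δ ε i j k s r w * (glmR σ ω q α j k r *
          (glmG σ ω δ ε i (glmShift j k) j v r w * glmR σ ω q α i (glmShift j k) v)) else 0

variable [Fintype (Label Γ)] (hq : ∀ a, q a ^ 2 = Q a)
  (hqadd : ∀ a b, q (a + b) * (q a)⁻¹ * (q b)⁻¹ = σ a b * ω (a + b) a b * ω δ a b)

include h

omit [Fintype (Label Γ)] in
theorem omega_sub_cocycle (A t b : Γ) :
    Additive.ofMul (ω A (t + b) (-b)) + .ofMul (ω A t b) = .ofMul (ω A b (-b)) := by
  have := h.omega_cocycle A t b (-b)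
  rw [add_neg_cancel, h.omega_zero_right, mul_one] at this
  exact congrArg Additive.ofMul this

omit [Fintype (Label Γ)] in
theorem ofMul_sigma_neg_left (a b : Γ) :
    Additive.ofMul (σ (-a) b) + .ofMul (σ a b) = .ofMul (ω b a (-a)) ∧
      Additive.ofMul (ω b a (-a)) + .ofMul (ω b a (-a)) = 0 := by
  obtain ⟨e₁, e₂⟩ := h.ofMul_sigma_add_left b a (-a)
  rw [add_neg_cancel, h.normalised_left, ofMul_one] at e₁
  exact ⟨by linear_combination (norm := abel) -e₁ - e₂, e₂⟩

omit [Fintype (Label Γ)] in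
theorem ofMul_sigma_neg_right (a b : Γ) :
    Additive.ofMul (σ b (-a)) + .ofMul (σ b a) = .ofMul (ω b a (-a)) := by
  rw [h.symmetric b, h.symmetric b]
  exact (h.ofMul_sigma_neg_left a b).1

include hq hqadd

theorem hexagon_lll (a b c : Γ) :
    h.HexagonAt δ ε q α (.inl a) (.inl b) (.inl c) := by
  intro s w v
  rintro rfl rfl rfl - _
  rw [sum_ite_eq_of_iff (.inl (b + c))]
  · simp only [glmF, glmR, glmG, glmShift, glmShiftTau, glmTau, glmNeg, one_mul, ← QuotientAddGroup.mk_add, h.omegaBar_coe]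
    norm_cast
    apply Additive.ofMul.injective
    have e1 := h.ofMul_sigma_add a b c
    have e2 := congrArg Additive.ofMul (h.omega_swap b c a)
    have e3 := h.ofMul_omega_add_self b a c
    simp only [ofMul_mul, ofMul_inv, h.multiplicative, h.omega_neg, neg_neg] at *
    grind
  · rintro (m' | m') <;> simp only [glmN_inl_inl, glmN_inl_inr, glmN_inr_inl,
        glmN_inr_inr, not_mem_glmN_inr_inr, reduceCtorEq, Sum.inl.injEq, Sum.inr.injEq, false_and,
        and_false, QuotientAddGroup.mk_add, QuotientAddGroup.mk_sub]
    have : ((b + c : Γ) : Γ ⧸ twoMul Γ) = b + c := rfl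
    grind

theorem hexagon_llr (a b z : Γ) :
    h.HexagonAt δ ε q α (.inl a) (.inl b) (.inr (z : Γ ⧸ twoMul Γ)) := by
  intro s w v
  rintro rfl rfl rfl - _
  rw [sum_ite_eq_of_iff (.inr (b + z))]
  · simp only [glmF, glmR, glmG, glmShift, glmShiftTau, glmTau, glmNeg, one_mul, ← QuotientAddGroup.mk_add, h.omegaBar_coe]
    norm_cast
    apply Additive.ofMul.injective
    have e1 := congrArg Additive.ofMul (h.omega_swap a b a)
    have e2 := congrArg Additive.ofMul (h.omega_swap b b a)
    have e3 := congrArg Additive.ofMul (h.omega_swap z b a)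
    have e4 := congrArg Additive.ofMul (h.symmetric b a)
    have e5 := h.ofMul_omega_add_self a a b
    simp only [ofMul_mul, ofMul_inv, h.multiplicative, h.omega_neg, neg_neg] at *
    grind
  · rintro (m' | m') <;> simp only [glmN_inl_inl, glmN_inl_inr, glmN_inr_inl,
        glmN_inr_inr, not_mem_glmN_inr_inr, reduceCtorEq, Sum.inl.injEq, Sum.inr.injEq, false_and,
        and_false, QuotientAddGroup.mk_add, QuotientAddGroup.mk_sub]
    grind

theorem hexagon_lrl (a y c : Γ) :
    h.HexagonAt δ ε q α (.inl a) (.inr (y : Γ ⧸ twoMul Γ)) (.inl c) := by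
  intro s w v
  rintro rfl rfl rfl - _
  rw [sum_ite_eq_of_iff (.inr (y + c))]
  · simp only [glmF, glmR, glmG, glmShift, glmShiftTau, glmTau, glmNeg, one_mul, ← QuotientAddGroup.mk_add, h.omegaBar_coe]
    norm_cast
    apply Additive.ofMul.injective
    have e1 := congrArg Additive.ofMul (h.omega_swap y c a)
    have e2 := congrArg Additive.ofMul (h.omega_swap δ c a)
    simp only [ofMul_mul, ofMul_inv, h.multiplicative, h.omega_neg, neg_neg] at *
    grind
  · rintro (m' | m') <;> simp only [glmN_inl_inl, glmN_inl_inr, glmN_inr_inl,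
        glmN_inr_inr, not_mem_glmN_inr_inr, reduceCtorEq, Sum.inl.injEq, Sum.inr.injEq, false_and,
        and_false, QuotientAddGroup.mk_add, QuotientAddGroup.mk_sub]
    grind

/-- Moving `ℂ_a` past two `X` in turn produces `q(a)⁻²`, while moving it past the summand `ℂ_m` of
their product produces `σ(a, m)`. The associator `σ(a, a + m)` contains the missing factor `σ(a, a)
= q(a)²`. -/
theorem hexagon_lrr (a y z : Γ) :
    h.HexagonAt δ ε q α (.inl a) (.inr (y : Γ ⧸ twoMul Γ)) (.inr (z : Γ ⧸ twoMul Γ)) := by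
  intro s w v
  rintro rfl ⟨t, ht, rfl⟩ rfl - _
  obtain ⟨m, rfl⟩ : ∃ m, t = a + m := ⟨t - a, (add_sub_cancel _ _).symm⟩
  rw [QuotientAddGroup.mk_add] at ht
  rw [sum_ite_eq_of_iff (.inl m)]
  · simp only [glmF, glmR, glmG, glmShift, glmShiftTau, glmTau, glmNeg, one_mul, ← QuotientAddGroup.mk_add, h.omegaBar_coe]
    norm_cast
    apply Additive.ofMul.injective
    have e1 := h.ofMul_sigma_add a a m
    have e2 := h.ofMul_q_self hq a
    have e3 := congrArg Additive.ofMul (h.omega_swap y m a)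
    have e4 := h.ofMul_omega_add_self y a m
    simp only [ofMul_mul, ofMul_inv, h.multiplicative, h.omega_neg, neg_neg] at *
    linear_combination (norm := abel) -e1.1 + e2 + e3 + e4
  · rintro (m' | m') <;> simp only [glmN_inl_inl, glmN_inl_inr, glmN_inr_inl,
        glmN_inr_inr, not_mem_glmN_inr_inr, reduceCtorEq, Sum.inl.injEq, Sum.inr.injEq, false_and,
        and_false, QuotientAddGroup.mk_add, QuotientAddGroup.mk_sub]
    grind

/-- The factors `ω(·, b, -b)` in the braiding compensate, through `omega_neg_neg`, for the passage
from `ω(·, b, c)` to `ω(·, -b, -c)` caused by the action. What remains is the addition law of `q`.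
-/
theorem hexagon_rll (x b c : Γ) :
    h.HexagonAt δ ε q α (.inr (x : Γ ⧸ twoMul Γ)) (.inl b) (.inl c) := by
  intro s w v
  rintro rfl rfl rfl - _
  rw [sum_ite_eq_of_iff (.inl (b + c))]
  · simp only [glmF, glmR, glmG, glmShift, glmShiftTau, glmTau, glmNeg, one_mul, ← QuotientAddGroup.mk_add, h.omegaBar_coe]
    norm_cast
    apply Additive.ofMul.injective
    have e1 := h.ofMul_omega_neg_neg x b c
    have e2 := h.ofMul_omega_neg_neg b b c
    have e3 := h.ofMul_omega_neg_neg c b c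
    have e4 := h.ofMul_omega_neg_neg δ b c
    have e5 := h.ofMul_q_add hqadd b c
    have e6 := h.ofMul_sigma_neg_left b c
    have e7 := h.ofMul_omega_add_self x b (-b)
    have e8 := h.ofMul_omega_add_self b b (-b)
    have e9 := h.ofMul_omega_add_self c b (-b)
    have e10 := h.ofMul_omega_add_self x c (-c)
    have e11 := h.ofMul_omega_add_self b c (-c)
    have e12 := h.ofMul_omega_add_self c c (-c)
    have e13 := h.ofMul_omega_add_self x b c
    simp only [ofMul_mul, ofMul_inv, h.multiplicative, h.omega_neg, neg_neg] at *
    linear_combination (norm := abel) -e1.1 + e1.2.1 + e1.2.2.1 - e2.1 + e2.2.2.1 + e2.2.2.2.2 - e3.1 + e3.2.2.1 - e5.1 - e6.1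
  · rintro (m' | m') <;> simp only [glmN_inl_inl, glmN_inl_inr, glmN_inr_inl,
        glmN_inr_inr, not_mem_glmN_inr_inr, reduceCtorEq, Sum.inl.injEq, Sum.inr.injEq, false_and,
        and_false, QuotientAddGroup.mk_add, QuotientAddGroup.mk_sub]
    have : ((b + c : Γ) : Γ ⧸ twoMul Γ) = b + c := rfl
    grind

theorem hexagon_rlr (x b z : Γ) :
    h.HexagonAt δ ε q α (.inr (x : Γ ⧸ twoMul Γ)) (.inl b) (.inr (z : Γ ⧸ twoMul Γ)) := by
  intro s w v
  rintro rfl ⟨t, ht, rfl⟩ ⟨m, hm, rfl⟩ e _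
  obtain rfl : m = t + b := by
    have := Sum.inl.inj (glmN_inl_inl.1 e)
    rw [this]
    abel
  rw [sum_ite_eq_of_iff (.inr (b + z))]
  · have key : σ b t * (q t * (ω (b + z) b (-b) * ω (-b + z) (-b) (t + b))) = (q b)⁻¹ * ω (x + b) b (-b) * (ω (-b + x) (-b) (t + b) * q (t + b)) := by
      apply Additive.ofMul.injective
      have e1 := h.ofMul_q_add hqadd t b
      have e2 := h.omega_sub_cocycle x t b
      have e3 := h.omega_sub_cocycle z t b
      have e4 := h.omega_sub_cocycle b t b
      have e5 := congrArg Additive.ofMul (h.omega_swap x (-b) (t + b))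
      have e6 := congrArg Additive.ofMul (h.omega_swap z (-b) (t + b))
      have e7 := congrArg Additive.ofMul (h.omega_swap b (-b) (t + b))
      have e8 := congrArg Additive.ofMul (h.symmetric t b)
      have e9 := h.ofMul_omega_coset ht t b
      have e10 := h.ofMul_omega_add_self x t b
      have e11 := h.ofMul_omega_add_self x b (-b)
      have e12 := h.ofMul_omega_add_self x (-b) (t + b)
      have e13 := h.ofMul_omega_add_self z t b
      have e14 := h.ofMul_omega_add_self z b (-b)
      have e15 := h.ofMul_omega_add_self z (-b) (t + b)
      have e16 := h.ofMul_omega_add_self b t b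
      have e17 := h.ofMul_omega_add_self b b (-b)
      have e18 := h.ofMul_omega_add_self b (-b) (t + b)
      have e19 := h.ofMul_omega_add_self δ t b
      have e20 := h.ofMul_omega_add_self δ b (-b)
      have e21 := h.ofMul_omega_add_self δ (-b) (t + b)
      simp only [ofMul_mul, ofMul_inv, h.multiplicative, h.omega_neg, neg_neg] at *
      linear_combination (norm := abel) -e1.1 - e1.2.1 + e2 + e3 + e5 + e6 - e8 - e12 + e14 + e9
    simp only [glmF, glmR, glmG, glmShift, glmShiftTau, glmTau, glmNeg, one_mul, Units.val_inv_eq_inv_val, ← QuotientAddGroup.mk_add, h.omegaBar_coe]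
    replace key := congrArg Units.val key
    push_cast at key ⊢
    linear_combination α * key
  · rintro (m' | m') <;> simp only [glmN_inl_inl, glmN_inl_inr, glmN_inr_inl,
        glmN_inr_inr, not_mem_glmN_inr_inr, reduceCtorEq, Sum.inl.injEq, Sum.inr.injEq, false_and,
        and_false, QuotientAddGroup.mk_add, QuotientAddGroup.mk_sub]
    grind

theorem hexagon_rrl (x y c : Γ) :
    h.HexagonAt δ ε q α (.inr (x : Γ ⧸ twoMul Γ)) (.inr (y : Γ ⧸ twoMul Γ)) (.inl c) := by
  intro s w v
  rintro ⟨t, ht, rfl⟩ rfl rfl - _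
  rw [sum_ite_eq_of_iff (.inr (y + c))]
  · have key : ω x t c * (q (t + c) * (ω (y + δ) c (-c) * σ (-c) (t + c))) = q t * (ω y t c * ((q c)⁻¹ * ω (x + c) c (-c))) := by
      apply Additive.ofMul.injective
      have e1 := h.ofMul_q_add hqadd t c
      have e2 := h.ofMul_sigma_add c t c
      have e3 := h.ofMul_sigma_neg_left c (t + c)
      have e4 := h.ofMul_q_self hq c
      have e5 := congrArg Additive.ofMul (h.symmetric t c)
      have e6 := h.ofMul_omega_coset ht t c
      have e7 := h.ofMul_omega_coset ht c (-c)
      have e8 := h.ofMul_omega_add_self x t c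
      have e9 := h.ofMul_omega_add_self x c (-c)
      have e10 := h.ofMul_omega_add_self y t c
      have e11 := h.ofMul_omega_add_self y c (-c)
      have e12 := h.ofMul_omega_add_self c t c
      have e13 := h.ofMul_omega_add_self c c (-c)
      have e14 := h.ofMul_omega_add_self δ t c
      have e15 := h.ofMul_omega_add_self δ c (-c)
      simp only [ofMul_mul, ofMul_inv, h.multiplicative, h.omega_neg, neg_neg] at *
      linear_combination (norm := abel) e1.1 + e1.2.2.2 - e2.1 + e4 + e5 + e6 + e7 + e8 + e11 + e15 + e3.1
    simp only [glmF, glmR, glmG, glmShift, glmShiftTau, glmTau, glmNeg, one_mul, Units.val_inv_eq_inv_val, ← QuotientAddGroup.mk_add, h.omegaBar_coe]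
    replace key := congrArg Units.val key
    push_cast at key ⊢
    linear_combination α * key
  · rintro (m' | m') <;> simp only [glmN_inl_inl, glmN_inl_inr, glmN_inr_inl,
        glmN_inr_inr, not_mem_glmN_inr_inr, reduceCtorEq, Sum.inl.injEq, Sum.inr.injEq, false_and,
        and_false, QuotientAddGroup.mk_add, QuotientAddGroup.mk_sub]
    grind

end IsSpecialCocycle

end GLM

/-! ### The second hexagon with at most two factors `X` -/

section GLM

open FusionDatum

variable {Γ : Type u} [AddCommGroup Γ]

namespace IsSpecialCocycle

variable {Q : Γ → ℂˣ} {σ : Γ → Γ → ℂˣ} {ω : Γ → Γ → Γ → ℂˣ} (h : IsSpecialCocycle Q σ ω)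
  {δ : Γ} {ε : ℤˣ} {q : Γ → ℂˣ} {α : ℂ}

set_option linter.unusedSimpArgs false
set_option linter.unusedVariables false
set_option linter.unusedSectionVars false

variable [Fintype (Label Γ)] (hq : ∀ a, q a ^ 2 = Q a)
  (hqadd : ∀ a b, q (a + b) * (q a)⁻¹ * (q b)⁻¹ = σ a b * ω (a + b) a b * ω δ a b)

include h hq hqadd

theorem hexagon_inv_lll (a b c : Γ) :
    h.HexagonInvAt δ ε q α (.inl a) (.inl b) (.inl c) := by
  intro s w v
  rintro rfl rfl rfl - _
  rw [sum_ite_eq_of_iff (.inl (b + c))]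
  · simp only [glmF, glmR, glmG, glmShift, glmShiftTau, glmTau, glmNeg, one_mul, ← QuotientAddGroup.mk_add, h.omegaBar_coe]
    norm_cast
    apply Additive.ofMul.injective
    have e1 := h.ofMul_sigma_add_left c a b
    have e2 := congrArg Additive.ofMul (h.omega_swap a c b)
    have e3 := h.ofMul_omega_add_self c a b
    have e4 := h.ofMul_omega_add_self a b c
    simp only [ofMul_mul, ofMul_inv, h.multiplicative, h.omega_neg, neg_neg] at *
    linear_combination (norm := abel) e1.1 + e2
  · rintro (m' | m') <;> simp only [glmN_inl_inl, glmN_inl_inr, glmN_inr_inl,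
        glmN_inr_inr, not_mem_glmN_inr_inr, reduceCtorEq, Sum.inl.injEq, Sum.inr.injEq, false_and,
        and_false, QuotientAddGroup.mk_add, QuotientAddGroup.mk_sub]
    have : ((b + c : Γ) : Γ ⧸ twoMul Γ) = b + c := rfl
    grind

/-- This equation is equivalent to the addition law of `q`: the associator of two elements with `X`
on the right contributes `ω(a + b + z, a, b)`, the one with `X` on the left contributes `ω(z + δ, a,
b)`, and the class `z` cancels. -/
theorem hexagon_inv_llr (a b z : Γ) :
    h.HexagonInvAt δ ε q α (.inl a) (.inl b) (.inr (z : Γ ⧸ twoMul Γ)) := by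
  intro s w v
  rintro rfl rfl rfl - _
  rw [sum_ite_eq_of_iff (.inr (b + z))]
  · simp only [glmF, glmR, glmG, glmShift, glmShiftTau, glmTau, glmNeg, one_mul, ← QuotientAddGroup.mk_add, h.omegaBar_coe]
    norm_cast
    apply Additive.ofMul.injective
    have e1 := h.ofMul_q_add hqadd a b
    have e2 := h.ofMul_omega_add_self z a b
    have e3 := h.ofMul_omega_add_self a a b
    have e4 := h.ofMul_omega_add_self b a b
    have e5 := h.ofMul_omega_add_self δ a b
    simp only [ofMul_mul, ofMul_inv, h.multiplicative, h.omega_neg, neg_neg] at *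
    linear_combination (norm := abel) -e1.1 - e1.2.1 - e1.2.2.1 - e1.2.2.2 - e2
  · rintro (m' | m') <;> simp only [glmN_inl_inl, glmN_inl_inr, glmN_inr_inl,
        glmN_inr_inr, not_mem_glmN_inr_inr, reduceCtorEq, Sum.inl.injEq, Sum.inr.injEq, false_and,
        and_false, QuotientAddGroup.mk_add, QuotientAddGroup.mk_sub]
    grind

theorem hexagon_inv_lrl (a y c : Γ) :
    h.HexagonInvAt δ ε q α (.inl a) (.inr (y : Γ ⧸ twoMul Γ)) (.inl c) := by
  intro s w v
  rintro rfl rfl rfl - _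
  rw [sum_ite_eq_of_iff (.inr (y + c))]
  · simp only [glmF, glmR, glmG, glmShift, glmShiftTau, glmTau, glmNeg, one_mul, ← QuotientAddGroup.mk_add, h.omegaBar_coe]
    norm_cast
    apply Additive.ofMul.injective
    have e1 := h.ofMul_sigma_neg_right c a
    have e2 := congrArg Additive.ofMul (h.omega_swap a c (-c))
    have e3 := congrArg Additive.ofMul (h.omega_swap c (-c) a)
    have e4 := congrArg Additive.ofMul (h.omega_swap a (-c) a)
    have e5 := congrArg Additive.ofMul (h.omega_swap y (-c) a)
    have e6 := h.ofMul_omega_add_self a c (-c)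
    have e7 := h.ofMul_omega_add_self c a (-c)
    have e8 := h.ofMul_omega_add_self a a (-c)
    have e9 := h.ofMul_omega_add_self y a (-c)
    simp only [ofMul_mul, ofMul_inv, h.multiplicative, h.omega_neg, neg_neg] at *
    grind
  · rintro (m' | m') <;> simp only [glmN_inl_inl, glmN_inl_inr, glmN_inr_inl,
        glmN_inr_inr, not_mem_glmN_inr_inr, reduceCtorEq, Sum.inl.injEq, Sum.inr.injEq, false_and,
        and_false, QuotientAddGroup.mk_add, QuotientAddGroup.mk_sub]
    grind

theorem hexagon_inv_lrr (a y z : Γ) :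
    h.HexagonInvAt δ ε q α (.inl a) (.inr (y : Γ ⧸ twoMul Γ)) (.inr (z : Γ ⧸ twoMul Γ)) := by
  intro s w v
  rintro rfl ⟨t, ht, rfl⟩ rfl - _
  obtain ⟨m, rfl⟩ : ∃ m, t = a + m := ⟨t - a, (add_sub_cancel _ _).symm⟩
  rw [QuotientAddGroup.mk_add] at ht
  have hm : (m : Γ ⧸ twoMul Γ) = δ + y + z := by grind
  rw [sum_ite_eq_of_iff (.inl m)]
  · have key : q (a + m) * (σ a (a + m))⁻¹ = ω (a + y) a m * (q m * ((ω (a + z) a m)⁻¹ * (q a)⁻¹)) := by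
      apply Additive.ofMul.injective
      have e1 := h.ofMul_sigma_add a a m
      have e2 := h.ofMul_q_add hqadd a m
      have e3 := h.ofMul_q_self hq a
      have e4 := h.ofMul_omega_coset hm a m
      have e5 := h.ofMul_omega_add_self y a m
      have e6 := h.ofMul_omega_add_self z a m
      have e7 := h.ofMul_omega_add_self a a m
      have e8 := h.ofMul_omega_add_self δ a m
      simp only [ofMul_mul, ofMul_inv, h.multiplicative, h.omega_neg, neg_neg] at *
      linear_combination (norm := abel) -e1.1 + e2.1 + e2.2.2.1 + e3 - e4 - e5
    simp only [glmF, glmR, glmG, glmShift, glmShiftTau, glmTau, glmNeg, one_mul, Units.val_inv_eq_inv_val, ← QuotientAddGroup.mk_add, h.omegaBar_coe]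
    replace key := congrArg Units.val key
    push_cast at key ⊢
    linear_combination α * key
  · rintro (m' | m') <;> simp only [glmN_inl_inl, glmN_inl_inr, glmN_inr_inl,
        glmN_inr_inr, not_mem_glmN_inr_inr, reduceCtorEq, Sum.inl.injEq, Sum.inr.injEq, false_and,
        and_false, QuotientAddGroup.mk_add, QuotientAddGroup.mk_sub]
    grind

theorem hexagon_inv_rll (x b c : Γ) :
    h.HexagonInvAt δ ε q α (.inr (x : Γ ⧸ twoMul Γ)) (.inl b) (.inl c) := by
  intro s w v
  rintro rfl rfl rfl - _
  rw [sum_ite_eq_of_iff (.inl (b + c))]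
  · simp only [glmF, glmR, glmG, glmShift, glmShiftTau, glmTau, glmNeg, one_mul, ← QuotientAddGroup.mk_add, h.omegaBar_coe]
    norm_cast
    apply Additive.ofMul.injective
    have e1 := h.ofMul_sigma_neg_left c b
    have e2 := congrArg Additive.ofMul (h.omega_swap x c b)
    have e3 := congrArg Additive.ofMul (h.omega_swap δ c b)
    have e4 := congrArg Additive.ofMul (h.symmetric c b)
    have e5 := h.ofMul_omega_add_self x b c
    have e6 := h.ofMul_omega_add_self δ b c
    have e7 := h.ofMul_omega_add_self b c (-c)
    simp only [ofMul_mul, ofMul_inv, h.multiplicative, h.omega_neg, neg_neg] at *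
    linear_combination (norm := abel) -e1.1 + e2 + e3 + e4
  · rintro (m' | m') <;> simp only [glmN_inl_inl, glmN_inl_inr, glmN_inr_inl,
        glmN_inr_inr, not_mem_glmN_inr_inr, reduceCtorEq, Sum.inl.injEq, Sum.inr.injEq, false_and,
        and_false, QuotientAddGroup.mk_add, QuotientAddGroup.mk_sub]
    have : ((b + c : Γ) : Γ ⧸ twoMul Γ) = b + c := rfl
    grind

theorem hexagon_inv_rlr (x b z : Γ) :
    h.HexagonInvAt δ ε q α (.inr (x : Γ ⧸ twoMul Γ)) (.inl b) (.inr (z : Γ ⧸ twoMul Γ)) := by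
  intro s w v
  rintro rfl ⟨t, ht, rfl⟩ ⟨m, hm, rfl⟩ e _
  obtain rfl : t = m + b := Sum.inl.inj e
  rw [sum_ite_eq_of_iff (.inr (b + z))]
  · have key : q (m + b) * (ω z m b)⁻¹ = σ b (m + b) * ((q b)⁻¹ * ((ω x m b)⁻¹ * q m)) := by
      apply Additive.ofMul.injective
      have e1 := h.ofMul_q_add hqadd m b
      have e2 := h.ofMul_q_self hq b
      have e3 := h.ofMul_sigma_add b m b
      have e4 := congrArg Additive.ofMul (h.symmetric m b)
      have e5 := h.ofMul_omega_coset hm m b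
      have e6 := h.ofMul_omega_add_self x m b
      have e7 := h.ofMul_omega_add_self z m b
      have e8 := h.ofMul_omega_add_self b m b
      have e9 := h.ofMul_omega_add_self δ m b
      simp only [ofMul_mul, ofMul_inv, h.multiplicative, h.omega_neg, neg_neg] at *
      linear_combination (norm := abel) e1.1 + e1.2.2.2 + e2 - e3.1 + e4 + e5 + e6
    simp only [glmF, glmR, glmG, glmShift, glmShiftTau, glmTau, glmNeg, one_mul, Units.val_inv_eq_inv_val, ← QuotientAddGroup.mk_add, h.omegaBar_coe]
    replace key := congrArg Units.val key
    push_cast at key ⊢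
    linear_combination α * key
  · rintro (m' | m') <;> simp only [glmN_inl_inl, glmN_inl_inr, glmN_inr_inl,
        glmN_inr_inr, not_mem_glmN_inr_inr, reduceCtorEq, Sum.inl.injEq, Sum.inr.injEq, false_and,
        and_false, QuotientAddGroup.mk_add, QuotientAddGroup.mk_sub]
    grind

theorem hexagon_inv_rrl (x y c : Γ) :
    h.HexagonInvAt δ ε q α (.inr (x : Γ ⧸ twoMul Γ)) (.inr (y : Γ ⧸ twoMul Γ)) (.inl c) := by
  intro s w v
  rintro ⟨t, ht, rfl⟩ rfl rfl - _
  rw [sum_ite_eq_of_iff (.inr (y + c))]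
  · simp only [glmF, glmR, glmG, glmShift, glmShiftTau, glmTau, glmNeg, one_mul, ← QuotientAddGroup.mk_add, h.omegaBar_coe]
    norm_cast
    apply Additive.ofMul.injective
    have e1 := h.ofMul_sigma_neg_left c (t + c)
    have e2 := h.ofMul_sigma_add c t c
    have e3 := congrArg Additive.ofMul (h.symmetric t c)
    have e4 := h.ofMul_q_self hq c
    have e5 := h.ofMul_q_neg hq hqadd c
    have e6 := congrArg Additive.ofMul (h.omega_swap c c t)
    have e7 := congrArg Additive.ofMul (h.omega_swap x c t)
    have e8 := congrArg Additive.ofMul (h.omega_swap x (-c) c)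
    have e9 := congrArg Additive.ofMul (h.omega_swap c (-c) c)
    have e10 := congrArg Additive.ofMul (h.omega_swap δ (-c) c)
    have e11 := h.ofMul_omega_coset ht c (-c)
    have e12 := h.ofMul_omega_add_self x t c
    have e13 := h.ofMul_omega_add_self x c (-c)
    have e14 := h.ofMul_omega_add_self x c t
    have e15 := h.ofMul_omega_add_self y t c
    have e16 := h.ofMul_omega_add_self y c (-c)
    have e17 := h.ofMul_omega_add_self y c t
    have e18 := h.ofMul_omega_add_self c t c
    have e19 := h.ofMul_omega_add_self c c (-c)
    have e20 := h.ofMul_omega_add_self c c t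
    have e21 := h.ofMul_omega_add_self δ t c
    have e22 := h.ofMul_omega_add_self δ c (-c)
    have e23 := h.ofMul_omega_add_self δ c t
    simp only [ofMul_mul, ofMul_inv, h.multiplicative, h.omega_neg, neg_neg] at *
    linear_combination (norm := abel) -e2.1 - e2.2 + e3 + e4 - e5.1 - e5.2.1 - e6 - e7 - e8 - e9 + e11 - e12 + e1.1
  · rintro (m' | m') <;> simp only [glmN_inl_inl, glmN_inl_inr, glmN_inr_inl,
        glmN_inr_inr, not_mem_glmN_inr_inr, reduceCtorEq, Sum.inl.injEq, Sum.inr.injEq, false_and,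
        and_false, QuotientAddGroup.mk_add, QuotientAddGroup.mk_sub]
    grind

end IsSpecialCocycle

end GLM

/-! ### Gauss sums and the hexagons for three factors `X` -/

section GLM

open FusionDatum

variable {Γ : Type u} [AddCommGroup Γ]

namespace IsSpecialCocycle

variable {Q : Γ → ℂˣ} {σ : Γ → Γ → ℂˣ} {ω : Γ → Γ → Γ → ℂˣ} (h : IsSpecialCocycle Q σ ω)
  {δ : Γ} {ε : ℤˣ} {q : Γ → ℂˣ} {α : ℂ}

variable (hq : ∀ a, q a ^ 2 = Q a)
  (hqadd : ∀ a b, q (a + b) * (q a)⁻¹ * (q b)⁻¹ = σ a b * ω (a + b) a b * ω δ a b)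

include h

include hq hqadd in
/-- Completing the square. -/
theorem q_mul_sigma {r t u v : Γ} (e : r + t = u + v) (hu : (u : Γ ⧸ twoMul Γ) = δ) :
    q u * σ r v * σ t v = q r * q t * q v * σ r t := by
  apply Additive.ofMul.injective
  -- Expanding `q` at `r + t` and at `u + v` leaves values of `ω` at first arguments `r`, `u`;
  -- knowing their classes makes everything cancel.
  have hr : (r : Γ ⧸ twoMul Γ) = δ + v + t := by
    have e₁ := congrArg (fun a : Γ => (a : Γ ⧸ twoMul Γ)) (eq_sub_of_add_eq e)
    have e₂ := quotient_add_self (t : Γ ⧸ twoMul Γ)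
    simp only [QuotientAddGroup.mk_add, QuotientAddGroup.mk_sub] at e₁
    grind
  have e1 := h.ofMul_q_add hqadd r t
  have e2 := h.ofMul_q_add hqadd u v
  have e3 := h.ofMul_sigma_add_left v r t
  have e4 := h.ofMul_sigma_add_left v u v
  have e5 := h.ofMul_q_self hq v
  have e6 := h.ofMul_omega_coset hr r t
  have e7 := congrArg Additive.ofMul (h.omega_eq_of_coe_eq hu u v)
  rw [e] at e1 e3
  simp only [ofMul_mul]
  linear_combination (norm := abel) e1.1 + e1.2.2.1 + e1.2.2.2 - e2.1 - e2.2.1 - e3.1 + e4.1 - e5 + e6 + e7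

/-- The sum of `q` over the class of `δ` modulo `2Γ`, times the sum of `q⁻¹`. -/
theorem gauss_mul_gauss [Fintype (twoMul Γ)] (hQ : IsDiscriminantForm Q)
    (hqadd : ∀ a b, q (a + b) * (q a)⁻¹ * (q b)⁻¹ = σ a b * ω (a + b) a b * ω δ a b) :
    (∑ k : twoMul Γ, (q (δ + k) : ℂ)⁻¹) * ∑ k : twoMul Γ, (q (δ + k) : ℂ) =
      Nat.card (twoMul Γ) := by
  classical
  -- The two values of `ω` in the addition law combine into one at `2δ + k + n`, which lies in `2Γ`,
  -- so they disappear. The quotient depends on `k` only through the character `σ(k, n)`.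
  have e : ∀ k n : twoMul Γ, (q (δ + k) : ℂ)⁻¹ * q (δ + (k + n : twoMul Γ)) =
      q n * σ δ n * σ k n := fun k n => by
    have e₁ := q_add hqadd (δ + k) n
    have e₂ := h.omega_of_mem (add_mem (add_mem (mem_twoMul δ) k.2) n.2) (δ + k) n
    rw [show δ + δ + (k : Γ) + n = δ + k + n + δ by abel, h.multiplicative] at e₂
    rw [mul_assoc, e₂, mul_one, h.sigma_add_of_mem n.2] at e₁
    rw [AddSubgroup.coe_add, ← add_assoc, e₁, mul_assoc, Units.val_mul,
      inv_mul_cancel_left₀ (Units.ne_zero _)]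
    push_cast
    ring
  calc _ = ∑ k : twoMul Γ, ∑ n : twoMul Γ, (q (δ + k) : ℂ)⁻¹ * q (δ + (k + n : twoMul Γ)) := by
        rw [Finset.sum_mul]
        refine Finset.sum_congr rfl fun k _ => ?_
        rw [← Finset.mul_sum, ← Equiv.sum_comp (Equiv.addLeft k) fun l : twoMul Γ => (q (δ + l) : ℂ)]
        rfl
    _ = ∑ n : twoMul Γ, (q n * σ δ n : ℂ) * ∑ k : twoMul Γ, (σ k n : ℂ) := by
        rw [Finset.sum_comm]
        refine Finset.sum_congr rfl fun n _ => ?_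
        rw [Finset.mul_sum]
        exact Finset.sum_congr rfl fun k _ => e k n
    _ = _ := by
        -- Summing over `k` first kills all `n` except `0`, where `q(0) σ(δ, 0) = 1` and the inner
        -- sum is `|2Γ|`.
        rw [Finset.sum_eq_single 0]
        · rw [AddSubgroup.coe_zero, h.sum_sigma hQ (zero_mem _), if_pos rfl, h.q_zero hqadd,
            h.normalised_right, Units.val_one, one_mul, one_mul]
        · intro n _ hn
          rw [h.sum_sigma hQ n.2, if_neg fun e₁ : (n : Γ) = 0 => hn (Subtype.ext e₁), mul_zero]
        · exact fun e₁ => absurd (Finset.mem_univ _) e₁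

variable (hα : α ^ 2 = ((ε : ℤ) : ℂ) * partialGaussSum q δ)

omit h in
include hα in
theorem alpha_mul_self [Fintype (twoMul Γ)] :
    α * α = ((ε : ℤ) : ℂ) * (sqrtCard Γ)⁻¹ * ∑ k : twoMul Γ, (q (δ + k) : ℂ)⁻¹ := by
  rw [← sq, hα, partialGaussSum, finsum_eq_sum_of_fintype, mul_assoc]
  simp only [Units.val_inv_eq_inv_val]

-- Insert the definition of `α²`: the two normalising factors give `|2Γ|⁻¹`, and the product of the
-- two Gauss sums is `|2Γ|`. In particular `α` cannot vanish, as invertibility of the braiding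
-- requires.
include hα hqadd in
theorem alpha_mul_gauss [Finite Γ] [Fintype (twoMul Γ)] (hQ : IsDiscriminantForm Q) :
    ((ε : ℤ) : ℂ) * (sqrtCard Γ)⁻¹ * (α * α) * ∑ k : twoMul Γ, (q (δ + k) : ℂ) = 1 := by
  rw [alpha_mul_self hα, ← mul_assoc, sign_sqrtCard_mul_self, mul_assoc,
    h.gauss_mul_gauss hQ hqadd, inv_mul_cancel₀ card_twoMul_ne_zero]

include hα hqadd in
theorem alpha_ne_zero [Finite Γ] (hQ : IsDiscriminantForm Q) : α ≠ 0 := by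
  have _ := Fintype.ofFinite (twoMul Γ)
  rintro rfl
  have := h.alpha_mul_gauss hqadd hα hQ
  rw [mul_zero, mul_zero, zero_mul] at this
  exact zero_ne_one this

set_option linter.unusedSimpArgs false

variable [Finite Γ] [Fintype (Label Γ)]

-- Completing the square turns the sum over the inner label into `q(t) q(v) σ(t, v)⁻¹` times the sum
-- of `q⁻¹` over `δ + 2Γ`. The two braidings on the other side contribute `α²`, so the equation is
-- the definition of `α²`.
include hq hqadd hα in
theorem hexagon_rrr (x y z : Γ) :
    h.HexagonAt δ ε q α (.inr (x : Γ ⧸ twoMul Γ)) (.inr (y : Γ ⧸ twoMul Γ))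
      (.inr (z : Γ ⧸ twoMul Γ)) := by
  intro s w v
  rintro ⟨t, ht, rfl⟩ rfl ⟨v, hv, rfl⟩ - _
  have _ := Fintype.ofFinite (twoMul Γ)
  have hx := quotient_add_self (x : Γ ⧸ twoMul Γ)
  have hy := quotient_add_self (y : Γ ⧸ twoMul Γ)
  -- The base point is chosen so that the summation label `r` satisfies `r + t = (δ + k) + v`, the
  -- relation required by `q_mul_sigma`.
  rw [sum_coset (K := Label Γ) Sum.inl Sum.inl_injective (δ + v - t)]
  · have e : ∀ k : twoMul Γ, glmF σ ω δ ε (.inr x) (.inr y) (.inr z) (.inl t)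
        (.inl (δ + v - t + k)) (.inr (t + z)) * (glmR σ ω q α (.inr x) (.inl (δ + v - t + k))
          (.inr (t + z)) * (glmShiftTau ω δ (.inr x) (.inr y) (.inr z) (.inl (δ + v - t + k)) *
        glmF σ ω δ ε (glmShift (.inr x) (.inr y)) (glmShift (.inr x) (.inr z)) (.inr x)
          (glmShift (.inr x) (.inl (δ + v - t + k))) (.inl v) (.inr (t + z)))) =
        ((ε : ℤ) : ℂ) * (sqrtCard Γ)⁻¹ * (((ε : ℤ) : ℂ) * (sqrtCard Γ)⁻¹) *
          (q t * q v * (σ t v : ℂ)⁻¹) * (q (δ + k) : ℂ)⁻¹ := fun k => by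
      have key : ∀ r, r + t = δ + k + v → (σ t r)⁻¹ * ((q r)⁻¹ * ω (x + r) r (-r) * (ω y r (-r) *
          (σ (-r) v)⁻¹)) = q t * q v * (σ t v)⁻¹ * (q (δ + k))⁻¹ := fun r hr => by
        have hk : ((δ + k : Γ) : Γ ⧸ twoMul Γ) = δ := QuotientAddGroup.mk_add_of_mem δ k.2
        have e1 := congrArg Additive.ofMul (h.q_mul_sigma hq hqadd hr hk)
        have e2 := h.ofMul_sigma_neg_left r v
        have e3 := congrArg Additive.ofMul (h.symmetric t r)
        -- With this class of `r`, the values of `ω` at `(r, -r)` from the braiding, from the action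
        -- and from `σ(-r, v)` multiply to `1`.
        have hrr : (r : Γ ⧸ twoMul Γ) = v + x + y := by
          have e₁ := congrArg (fun a : Γ => (a : Γ ⧸ twoMul Γ)) (eq_sub_of_add_eq hr)
          simp only [QuotientAddGroup.mk_add, QuotientAddGroup.mk_sub] at e₁ hk
          linear_combination (norm := abel) e₁ + hk - ht - hx - hy
        have e4 := h.ofMul_omega_coset hrr r (-r)
        have e5 := h.ofMul_omega_add_self x r (-r)
        have e6 := h.ofMul_omega_add_self y r (-r)
        apply Additive.ofMul.injective
        simp only [ofMul_mul, ofMul_inv, h.multiplicative] at *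
        linear_combination (norm := abel) e1 - e2.1 - e3 + e4 + e5 + e6
      replace key := congrArg Units.val (key (δ + v - t + k) (by abel))
      simp only [glmF, glmR, glmShift, glmShiftTau, glmTau, glmNeg, ← QuotientAddGroup.mk_add,
        h.omegaBar_coe]
      push_cast at key ⊢
      linear_combination (((ε : ℤ) : ℂ) * (sqrtCard Γ)⁻¹ * (((ε : ℤ) : ℂ) * (sqrtCard Γ)⁻¹)) * key
    rw [Finset.sum_congr rfl fun k _ => e k, ← Finset.mul_sum]
    simp only [glmF, glmR, glmShift, glmNeg, Units.val_inv_eq_inv_val]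
    have := alpha_mul_self hα
    linear_combination (-((ε : ℤ) : ℂ) * (sqrtCard Γ)⁻¹ * (q t * q v * (σ t v : ℂ)⁻¹)) * this
  · have e₁ : ((δ + v - t : Γ) : Γ ⧸ twoMul Γ) = δ + v - t := rfl
    rintro (r | r) <;> simp only [glmN_inr_inl, glmN_inr_inr, not_mem_glmN_inr_inr, reduceCtorEq,
      Sum.inl.injEq, Sum.inr.injEq, false_and, and_false]
    · refine ⟨fun e₂ => ⟨r, ?_, rfl⟩, ?_⟩
      · linear_combination (norm := abel) e₂.1 - e₁ - hv + ht + hy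
      · rintro ⟨_, e₂, rfl⟩
        refine ⟨?_, ?_⟩
        · linear_combination (norm := abel) e₂ + e₁ + hv - ht - hy
        · linear_combination (norm := abel) -e₂ - e₁ - hv + (2 : ℤ) • ht + hy
    · simp

-- Here the braidings occur on the side of the sum, which after completing the square is `α²` times
-- the sum of `q` itself; `alpha_mul_gauss` evaluates it.
include hq hqadd hα in
theorem hexagon_inv_rrr (hQ : IsDiscriminantForm Q) (x y z : Γ) :
    h.HexagonInvAt δ ε q α (.inr (x : Γ ⧸ twoMul Γ)) (.inr (y : Γ ⧸ twoMul Γ))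
      (.inr (z : Γ ⧸ twoMul Γ)) := by
  intro s w v
  rintro ⟨t, ht, rfl⟩ rfl ⟨v, hv, rfl⟩ - _
  have _ := Fintype.ofFinite (twoMul Γ)
  have hx := quotient_add_self (x : Γ ⧸ twoMul Γ)
  have hz := quotient_add_self (z : Γ ⧸ twoMul Γ)
  -- Compared with the first hexagon, `t` and `v` exchange roles: the summation label satisfies `r +
  -- v = (δ + k) + t`.
  rw [sum_coset (K := Label Γ) Sum.inl Sum.inl_injective (δ + t - v)]
  · have e : ∀ k : twoMul Γ, glmF σ ω δ ε (.inr x) (.inr y) (.inr z) (.inl t)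
        (.inl (δ + t - v + k)) (.inr (t + z)) * (glmR σ ω q α (.inr y) (.inr z)
          (.inl (δ + t - v + k)) * (glmG σ ω δ ε (.inr x) (glmShift (.inr y) (.inr z)) (.inr y)
          (.inl v) (.inl (δ + t - v + k)) (.inr (t + z)) *
        glmR σ ω q α (.inr x) (glmShift (.inr y) (.inr z)) (.inl v))) =
        ((ε : ℤ) : ℂ) * (sqrtCard Γ)⁻¹ * (((ε : ℤ) : ℂ) * (sqrtCard Γ)⁻¹) * (α * α) *
          ((q t : ℂ)⁻¹ * σ v t) * q (δ + k) := fun k => by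
      have key : ∀ r, r + v = δ + k + t → (σ t r)⁻¹ * (q r * (σ v r * q v)) =
          (q t)⁻¹ * σ v t * q (δ + k) := fun r hr => by
        have hk : ((δ + k : Γ) : Γ ⧸ twoMul Γ) = δ := QuotientAddGroup.mk_add_of_mem δ k.2
        have e1 := congrArg Additive.ofMul (h.q_mul_sigma hq hqadd hr hk)
        have e2 := congrArg Additive.ofMul (h.symmetric t r)
        have e3 := congrArg Additive.ofMul (h.symmetric v r)
        apply Additive.ofMul.injective
        simp only [ofMul_mul, ofMul_inv, h.multiplicative] at *
        grind
      replace key := congrArg Units.val (key (δ + t - v + k) (by abel))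
      simp only [glmF, glmR, glmG, glmShift, glmNeg]
      push_cast at key ⊢
      linear_combination (((ε : ℤ) : ℂ) * (sqrtCard Γ)⁻¹ * (((ε : ℤ) : ℂ) * (sqrtCard Γ)⁻¹) *
        (α * α)) * key
    rw [Finset.sum_congr rfl fun k _ => e k, ← Finset.mul_sum]
    simp only [glmG, glmR, glmShift, glmNeg, Units.val_inv_eq_inv_val]
    have := h.alpha_mul_gauss hqadd hα hQ
    linear_combination (-((ε : ℤ) : ℂ) * (sqrtCard Γ)⁻¹ * ((q t : ℂ)⁻¹ * σ v t)) * this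
  · have e₁ : ((δ + t - v : Γ) : Γ ⧸ twoMul Γ) = δ + t - v := rfl
    rintro (r | r) <;> simp only [glmN_inr_inl, glmN_inr_inr, not_mem_glmN_inr_inr, reduceCtorEq,
      Sum.inl.injEq, Sum.inr.injEq, false_and, and_false]
    · refine ⟨fun e₂ => ⟨r, ?_, rfl⟩, ?_⟩
      · linear_combination (norm := abel) e₂.1 - e₁ - ht + hv + hz
      · rintro ⟨_, e₂, rfl⟩
        refine ⟨?_, ?_⟩
        · linear_combination (norm := abel) e₂ + e₁ + ht - hv - hz
        · linear_combination (norm := abel) -e₂ - e₁ + hv + hz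
    · simp

end IsSpecialCocycle

end GLM

/-! ### All crossed coherence equations together -/

section GLM

open FusionDatum

variable {Γ : Type u} [AddCommGroup Γ]

theorem act_glmDegree (i j : Label Γ) :
    act (involutionAction glmNeg glmNeg_glmNeg) (glmDegree i) j = glmShift i j := by
  cases i with
  | inl a => exact act_one _ j
  | inr x => exact act_involutionAction _ _ j

open Classical in
theorem glmDegree_tau (ω : Γ → Γ → Γ → ℂˣ) (δ : Γ) (i j k s : Label Γ) :
    (if glmDegree i = 1 then 1 else glmTau ω δ j k s) = glmShiftTau ω δ i j k s := by
  cases i with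
  | inl a => exact if_pos rfl
  | inr x => exact if_neg C₂.ofAdd_one_ne

theorem glmDegree_glmNeg (i : Label Γ) : glmDegree (glmNeg i) = glmDegree i := by
  cases i <;> rfl

namespace IsSpecialCocycle

variable {Q : Γ → ℂˣ} {σ : Γ → Γ → ℂˣ} {ω : Γ → Γ → Γ → ℂˣ} (h : IsSpecialCocycle Q σ ω)
  (hQ : IsDiscriminantForm Q) {δ : Γ} {ε : ℤˣ} {q : Γ → ℂˣ} {α : ℂ} (hq : ∀ a, q a ^ 2 = Q a)
  (hqadd : ∀ a b, q (a + b) * (q a)⁻¹ * (q b)⁻¹ = σ a b * ω (a + b) a b * ω δ a b)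
  (hα : α ^ 2 = ((ε : ℤ) : ℂ) * partialGaussSum q δ)
  [Finite Γ] [Fintype (Label Γ)]

include h hq hqadd hα

theorem hexagonAt (i j k : Label Γ) : h.HexagonAt δ ε q α i j k := by
  rcases i.exists_rep with ⟨a, rfl⟩ | ⟨a, rfl⟩ <;>
    rcases j.exists_rep with ⟨b, rfl⟩ | ⟨b, rfl⟩ <;>
    rcases k.exists_rep with ⟨c, rfl⟩ | ⟨c, rfl⟩
  · exact h.hexagon_lll hq hqadd a b c
  · exact h.hexagon_llr hq hqadd a b c
  · exact h.hexagon_lrl hq hqadd a b c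
  · exact h.hexagon_lrr hq hqadd a b c
  · exact h.hexagon_rll hq hqadd a b c
  · exact h.hexagon_rlr hq hqadd a b c
  · exact h.hexagon_rrl hq hqadd a b c
  · exact h.hexagon_rrr hq hqadd hα a b c

include hQ in
theorem hexagonInvAt (i j k : Label Γ) : h.HexagonInvAt δ ε q α i j k := by
  rcases i.exists_rep with ⟨a, rfl⟩ | ⟨a, rfl⟩ <;>
    rcases j.exists_rep with ⟨b, rfl⟩ | ⟨b, rfl⟩ <;>
    rcases k.exists_rep with ⟨c, rfl⟩ | ⟨c, rfl⟩
  · exact h.hexagon_inv_lll hq hqadd a b c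
  · exact h.hexagon_inv_llr hq hqadd a b c
  · exact h.hexagon_inv_lrl hq hqadd a b c
  · exact h.hexagon_inv_lrr hq hqadd a b c
  · exact h.hexagon_inv_rll hq hqadd a b c
  · exact h.hexagon_inv_rlr hq hqadd a b c
  · exact h.hexagon_inv_rrl hq hqadd a b c
  · exact h.hexagon_inv_rrr hq hqadd hα hQ a b c

include hQ in
open Classical in
theorem glm_isCrossedCoherent : IsCrossedCoherent (glmDatum σ ω δ ε) (glmG σ ω δ ε)
    (involutionAction glmNeg glmNeg_glmNeg) (fun g i j s => if g = 1 then 1 else glmTau ω δ i j s)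
    glmDegree (glmR σ ω q α) where
  isActionCoherent := h.glm_isActionCoherent
  gr_mem := by
    rintro (a | x) (b | y) s hs
    · obtain rfl := hs; exact (mul_one _).symm
    · obtain rfl := hs; exact (one_mul _).symm
    · obtain rfl := hs; exact (mul_one _).symm
    · obtain ⟨t, -, rfl⟩ := hs; exact C₂.ofAdd_one_mul_self.symm
  gr_one := rfl
  gr_act g i := by
    -- The group is commutative, so conjugation is trivial and the degree only has to be invariant
    -- under the involution.
    rw [mul_comm g, mul_inv_cancel_right]
    rcases C₂.eq_one_or g with rfl | rfl
    · rw [act_one]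
    · rw [act_involutionAction, glmDegree_glmNeg]
  gr_surj g := by
    rcases C₂.eq_one_or g with rfl | rfl
    · exact ⟨.inl 0, rfl⟩
    · exact ⟨.inr 0, rfl⟩
  cross i j s := by
    rw [act_glmDegree]
    rcases i with a | x <;> rcases j with b | y
    · exact iff_of_eq (congrArg (fun t => s = Sum.inl t) (add_comm a b))
    · exact iff_of_eq (congrArg (fun t => s = Sum.inr t) (add_comm (a : Γ ⧸ twoMul Γ) y))
    · refine iff_of_eq (congrArg (fun t => s = Sum.inr t) ?_)
      rw [coe_neg_twoMul, add_comm]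
    · refine iff_of_eq (congrArg (fun t => ∃ r : Γ, (r : Γ ⧸ twoMul Γ) = t ∧ s = Sum.inl r) ?_)
      exact add_right_comm _ _ _
  ne_zero := by
    rintro (a | x) (b | y) s hs
    · exact Units.ne_zero _
    · exact Units.ne_zero _
    · exact mul_ne_zero (Units.ne_zero _) (Units.ne_zero _)
    · obtain ⟨t, -, rfl⟩ := hs
      exact mul_ne_zero (h.alpha_ne_zero hqadd hα hQ) (Units.ne_zero _)
  braid_act g i j s hs := h.glm_braid_act hq hqadd g i j s hs
  hexagon i j k s w v h₁ h₂ h₃ h₄ := by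
    simp only [act_glmDegree, glmDegree_tau] at h₄ ⊢
    exact h.hexagonAt hq hqadd hα i j k s w v h₁ h₂ h₃ h₄ _
  hexagon_inv i j k s w v h₁ h₂ h₃ h₄ := by
    simp only [act_glmDegree] at h₃ ⊢
    exact h.hexagonInvAt hQ hq hqadd hα i j k s w v h₁ h₂ h₃ h₄ _

end IsSpecialCocycle

end GLM

/-! ### Duals and the twist -/

section GLM

open FusionDatum

variable {Γ : Type u} [AddCommGroup Γ]

/-- The label of the dual simple object. -/
def glmDual (δ : Γ) : Label Γ → Label Γ
  | .inl a => .inl (-a)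
  | .inr x => .inr (-x - δ)

/-- The scalar of the evaluation. -/
noncomputable def glmEvScalar (ω : Γ → Γ → Γ → ℂˣ) (ε : ℤˣ) : Label Γ → ℂ
  | .inl a => (ω a (-a) a)⁻¹
  | .inr _ => ((ε : ℤ) : ℂ) * sqrtCard Γ

/-- Each simple object has only one dual label, so conditions over all labels whose product contains
the unit need to be checked only there. -/
theorem glm_one_mem_glmDual {δ : Γ} {i j : Label Γ} (hi : .inl 0 ∈ glmN δ i j) :
    j = glmDual δ i := by
  rcases i with a | x <;> rcases j with b | y
  · rw [glmN_inl_inl, Sum.inl.injEq] at hi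
    exact congrArg Sum.inl (neg_eq_of_add_eq_zero_right hi.symm).symm
  · rw [glmN_inl_inr] at hi; cases hi
  · rw [glmN_inr_inl] at hi; cases hi
  · rw [glmN_inr_inr] at hi
    refine congrArg Sum.inr ?_
    rw [QuotientAddGroup.mk_zero] at hi
    linear_combination (norm := abel) -hi

theorem glmDual_mem (δ : Γ) (i : Label Γ) : .inl 0 ∈ glmN δ i (glmDual δ i) := by
  rcases i with a | x
  · exact congrArg Sum.inl (add_neg_cancel a).symm
  · refine glmN_inr_inr.2 ?_
    rw [QuotientAddGroup.mk_zero]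
    abel

namespace IsSpecialCocycle

variable {Q : Γ → ℂˣ} {σ : Γ → Γ → ℂˣ} {ω : Γ → Γ → Γ → ℂˣ} (h : IsSpecialCocycle Q σ ω)
  (hQ : IsDiscriminantForm Q) {δ : Γ} {ε : ℤˣ} {q : Γ → ℂˣ} {α β : ℂ} (hq : ∀ a, q a ^ 2 = Q a)
  (hqadd : ∀ a b, q (a + b) * (q a)⁻¹ * (q b)⁻¹ = σ a b * ω (a + b) a b * ω δ a b)

include h

theorem glm_isDual [Finite Γ] [Fintype (Label Γ)] :
    IsDual (glmDatum σ ω δ ε) (glmG σ ω δ ε) (glmDual δ) (glmEvScalar ω ε) where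
  invol := by
    rintro (a | x)
    · exact congrArg Sum.inl (neg_neg a)
    · refine congrArg Sum.inr ?_
      abel
  mem i := glmDual_mem δ i
  zigzag := by
    rintro (a | x)
    · exact mul_inv_cancel₀ (Units.ne_zero (ω a (-a) a))
    · change ((ε : ℤ) : ℂ) * (sqrtCard Γ)⁻¹ * ((σ 0 0)⁻¹ : ℂˣ) * (((ε : ℤ) : ℂ) * sqrtCard Γ) = 1
      rw [h.normalised_left, inv_one, Units.val_one, mul_one, mul_mul_mul_comm, coe_sign_mul_self,
        inv_mul_cancel₀ sqrtCard_ne_zero, one_mul]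
  zigzag' := by
    rintro (a | x)
    · change (ω (-a) a (-a) : ℂ)⁻¹ * (ω a (-a) a : ℂ)⁻¹ = 1
      rw [← mul_inv, ← Units.val_mul, h.omega_neg, h.omega_swap a a (-a), h.omega_mul_self,
        Units.val_one, inv_one]
    · change ((ε : ℤ) : ℂ) * (sqrtCard Γ)⁻¹ * σ 0 0 * (((ε : ℤ) : ℂ) * sqrtCard Γ) = 1
      rw [h.normalised_left, Units.val_one, mul_one, mul_mul_mul_comm, coe_sign_mul_self,
        inv_mul_cancel₀ sqrtCard_ne_zero, one_mul]

include hQ in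
theorem sigma_neg_self (a : Γ) : σ (-a) (-a) = σ a a := by
  have := hQ.zsmul (-1) a
  rwa [neg_one_zsmul, neg_one_sq, zpow_one, ← h.represents, ← h.represents] at this

-- For `ℂ_a` and `X`, two half-braidings give `q(a)⁻²`, which cancels the twist `σ(a, a)`; in the
-- opposite order `q(b) q(-b)` occurs instead and `ofMul_q_neg` supplies the tensor structure. For
-- two `X` the equation says `σ(t, t) = α²β² q(t)²`.
include hQ hq hqadd in
open Classical in
theorem glm_isTwistCoherent (hα₀ : α ≠ 0) (hβ : β = α⁻¹ ∨ β = -α⁻¹) :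
    IsTwistCoherent (glmDatum σ ω δ ε) (involutionAction glmNeg glmNeg_glmNeg)
      (fun g i j s => if g = 1 then 1 else glmTau ω δ i j s) glmDegree (glmR σ ω q α)
      (glmTheta σ β) where
  act_self i := by
    rw [act_glmDegree]
    cases i <;> rfl
  ne_zero := by
    rintro (a | x)
    · exact Units.ne_zero _
    · rcases hβ with rfl | rfl
      · exact inv_ne_zero hα₀
      · exact neg_ne_zero.2 (inv_ne_zero hα₀)
  one := congrArg Units.val (h.normalised_left 0)
  tensor i j s hs := by
    rw [act_glmDegree]
    rcases i.exists_rep with ⟨a, rfl⟩ | ⟨x, rfl⟩ <;>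
      rcases j.exists_rep with ⟨b, rfl⟩ | ⟨y, rfl⟩
    · obtain rfl := hs
      simp only [glmDegree, mul_one, if_true, glmTheta, glmR, glmShift]
      norm_cast
      apply Additive.ofMul.injective
      have e1 := h.ofMul_sigma_add a a b
      have e2 := h.ofMul_sigma_add b a b
      have e3 := h.ofMul_sigma_add_left (a + b) a b
      have e4 := congrArg Additive.ofMul (h.symmetric a b)
      have e5 := h.ofMul_omega_add_self a a b
      have e6 := h.ofMul_omega_add_self b a b
      simp only [ofMul_mul, h.multiplicative] at *
      grind
    · obtain rfl := hs
      have key : ω (a + y) a (-a) = (q a)⁻¹ * ((q a)⁻¹ * ω (y + a) a (-a) * σ a a) := by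
        apply Additive.ofMul.injective
        have e1 := h.ofMul_q_self hq a
        simp only [ofMul_mul, ofMul_inv, h.multiplicative] at *
        grind
      simp only [glmDegree, one_mul, if_neg C₂.ofAdd_one_ne, glmTheta, glmR, glmShift, glmTau, ← QuotientAddGroup.mk_add, h.omegaBar_coe]
      replace key := congrArg Units.val key
      push_cast at key ⊢
      linear_combination β * key
    · obtain rfl := hs
      have key : ω (x + δ) b (-b) = (q b)⁻¹ * ω (x + b) b (-b) * ((q (-b))⁻¹ * σ b b) := by
        apply Additive.ofMul.injective
        have e1 := h.ofMul_q_self hq b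
        have e2 := h.ofMul_q_neg hq hqadd b
        simp only [ofMul_mul, ofMul_inv, h.multiplicative] at *
        linear_combination (norm := abel) e1 - e2.1 - e2.2.1
      simp only [glmDegree, mul_one, if_neg C₂.ofAdd_one_ne, glmTheta, glmR, glmShift, glmTau, glmNeg, ← QuotientAddGroup.mk_add,
        h.omegaBar_coe]
      replace key := congrArg Units.val key
      push_cast at key ⊢
      linear_combination β * key
    · obtain ⟨t, -, rfl⟩ := hs
      simp only [glmDegree, C₂.ofAdd_one_mul_self, if_true, glmTheta, glmR, glmShift, glmNeg]
      -- Only the square of `β` matters here, so both signs in `β = ±α⁻¹` are admissible.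
      have e₁ : α * α * (β * β) = 1 := by
        rcases hβ with rfl | rfl <;> field_simp
      have e₂ := congrArg Units.val ((h.represents t).trans (hq t).symm)
      push_cast at e₂
      linear_combination e₂ - q t ^ 2 * e₁
  invariant g i := by
    rcases C₂.eq_one_or g with rfl | rfl
    · rw [act_one]
    · rw [act_involutionAction]
      rcases i with a | x
      · exact congrArg Units.val (h.sigma_neg_self hQ a)
      · rfl
  dual i j hij := by
    obtain rfl := glm_one_mem_glmDual hij
    rcases i.exists_rep with ⟨a, rfl⟩ | ⟨x, rfl⟩
    · simp only [glmDegree, inv_one, if_true, mul_one]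
      exact congrArg Units.val (h.sigma_neg_self hQ a).symm
    · simp only [glmDegree]
      change β * (omegaBar ω x 0 (-0)) = β
      rw [h.omegaBar_coe, h.omega_zero_mid, Units.val_one, mul_one]

end IsSpecialCocycle

end GLM

/-! ### The neutral component and the quantum dimensions -/

section GLM

open FusionDatum

variable {Γ : Type u} [AddCommGroup Γ]

namespace IsSpecialCocycle

variable {Q : Γ → ℂˣ} {σ : Γ → Γ → ℂˣ} {ω : Γ → Γ → Γ → ℂˣ} (h : IsSpecialCocycle Q σ ω)
  {δ : Γ} {ε : ℤˣ} {q : Γ → ℂˣ} {α β : ℂ}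

open Classical in
theorem glm_isNeutralEmbedding :
    IsNeutralEmbedding (pointedDatum ω) (glmDatum σ ω δ ε) Sum.inl
      (involutionAction (fun a : Γ => -a) neg_neg) (involutionAction glmNeg glmNeg_glmNeg)
      (fun g a b _ => if g = 1 then 1 else (ω a b (-b) : ℂ))
      (fun g i j s => if g = 1 then 1 else glmTau ω δ i j s) glmDegree
      (fun a b _ => (σ a b : ℂ)) (glmR σ ω q α) where
  inj := Sum.inl_injective
  one := rfl
  mem a b s := (Sum.inl_injective.eq_iff (a := s) (b := a + b)).symm
  mem_range a b w hw := ⟨a + b, hw.symm⟩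
  assoc _ _ _ _ _ _ := rfl
  act g a := by
    rcases C₂.eq_one_or g with rfl | rfl
    · rw [act_one, act_one]
    · rw [act_involutionAction, act_involutionAction]
      rfl
  tau _ _ _ _ := rfl
  braid _ _ _ := rfl
  gr_eq := by
    rintro (a | x)
    · exact iff_of_true rfl ⟨a, rfl⟩
    · exact iff_of_false C₂.ofAdd_one_ne (by simp)
  mem_comm a b s hs := Eq.trans hs (add_comm a b)

/-- The quantum dimensions of the simple objects. -/
noncomputable def glmDim (Γ : Type u) [AddCommGroup Γ] (ε : ℤˣ) (α β : ℂ) : Label Γ → ℂ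
  | .inl _ => 1
  | .inr _ => α * β * ((ε : ℤ) : ℂ) * sqrtCard Γ

-- For `ℂ_a` the identity is the expansion of `σ(a, -a + a) = 1`. For `X` all values of `ω`, `σ` and
-- `q` are taken at `0`, so what remains is `αβ` against the associator scalar `ε|2Γ|^{-1/2}`.
include h in
open Classical in
theorem glm_dim_eq [Finite Γ]
    (hqadd : ∀ a b, q (a + b) * (q a)⁻¹ * (q b)⁻¹ = σ a b * ω (a + b) a b * ω δ a b)
    (i k : Label Γ) (hk : .inl 0 ∈ glmN δ i k) :
    glmR σ ω q α i k (.inl 0) * glmTheta σ β i =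
      glmDim Γ ε α β i * ((if glmDegree i = 1 then 1 else glmTau ω δ k i (.inl 0)) *
        glmF σ ω δ ε i k i (.inl 0) (.inl 0) i) := by
  obtain rfl := glm_one_mem_glmDual hk
  rw [glmDegree_tau]
  rcases i.exists_rep with ⟨a, rfl⟩ | ⟨x, rfl⟩
  · change (σ a (-a) : ℂ) * σ a a = 1 * (1 * ω a (-a) a)
    rw [one_mul, one_mul]
    have e₁ := h.deviation a (-a) a
    rw [neg_add_cancel, h.normalised_right, one_mul, ← mul_inv] at e₁
    rw [← h.omega_inv, ← e₁, inv_inv]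
    push_cast
    rfl
  · change α * q 0 * β = α * β * ((ε : ℤ) : ℂ) * sqrtCard Γ *
      (omegaBar ω (-x - δ : Γ) 0 (-0) * (((ε : ℤ) : ℂ) * (sqrtCard Γ)⁻¹ * ((σ 0 0)⁻¹ : ℂˣ)))
    rw [h.omegaBar_coe, h.omega_zero_mid, h.normalised_left, h.q_zero hqadd, inv_one, Units.val_one]
    have e₁ := coe_sign_mul_self (ε := ε)
    have e₂ := mul_inv_cancel₀ (sqrtCard_ne_zero (Γ := Γ))
    linear_combination -α * β * e₂ - α * β * sqrtCard Γ * (sqrtCard Γ)⁻¹ * e₁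

end IsSpecialCocycle

end GLM

/-! ### Exact pairings of simple objects, positivity and the main theorem -/

section GLM

open FusionDatum

variable {Γ : Type u} [AddCommGroup Γ] [Finite Γ] {Q : Γ → ℂˣ} {σ : Γ → Γ → ℂˣ}
  {ω : Γ → Γ → Γ → ℂˣ} {δ : Γ} {ε : ℤˣ} {q : Γ → ℂˣ} {α β : ℂ}

theorem IsSpecialCocycle.glm_exists_exactPairing (hσω : IsSpecialCocycle Q σ ω)
    (hQ : IsDiscriminantForm Q) (h : (glmDatum σ ω δ ε).IsTensor) (i : Label Γ) :
    ∃ P : ExactPairing (simple h i) (simple h (glmDual δ i)),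
      P.coevaluation' = glmCoev h i (glmDual δ i) ∧
      P.evaluation' = glmEv h (glmEvScalar ω ε i) (glmDual δ i) i := by
  classical
  have _ := Fintype.ofFinite (Label Γ)
  have hd : IsDual (glmDatum σ ω δ ε) (glmG σ ω δ ε) (glmDual δ) (glmEvScalar ω ε) :=
    hσω.glm_isDual
  refine ⟨exactPairing (hσω.glm_isCoherent hQ) h (X := simple h i) (Y := simple h (glmDual δ i))
    (Equiv.refl PUnit) (fun _ => glmEvScalar ω ε i) (fun _ => hd.mem i) (fun _ => hd.mem' i)
    (fun _ => hd.zigzag i) (fun _ => hd.zigzag' i), ?_, ?_⟩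
  · exact congrArg GradedVect.ofMat (funext fun _ => funext fun _ => if_pos rfl)
  · exact congrArg GradedVect.ofMat (funext fun _ => funext fun _ => if_pos rfl)

theorem smul_id_unit_injective {I : Type u} [Finite I] {D : FusionDatum I} (h : D.IsTensor)
    {c d : ℂ} (e : c • 𝟙 (𝟙_ (Cat h)) = d • 𝟙 (𝟙_ (Cat h))) : c = d := by
  have : Simple (𝟙_ (Cat h)) := GradedVect.simple_single D.one
  exact smul_left_injective ℂ (id_nonzero _) e

/-- The dual `Y` need not be one of the explicit ones; the object `X` only has to have a single
basis vector, which every simple object has. -/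
theorem IsSpecialCocycle.glm_quantumDim (hσω : IsSpecialCocycle Q σ ω)
    (hQ : IsDiscriminantForm Q) (hq : ∀ a, q a ^ 2 = Q a)
    (hqadd : ∀ a b, q (a + b) * (q a)⁻¹ * (q b)⁻¹ = σ a b * ω (a + b) a b * ω δ a b)
    (hα : α ^ 2 = ((ε : ℤ) : ℂ) * partialGaussSum q δ) (hβ : β = α⁻¹ ∨ β = -α⁻¹)
    (h : (glmDatum σ ω δ ε).IsTensor) (hD : (glmCrossed q α h).IsBraidedCrossed) {g : C₂}
    {X : Cat h} (hX : (glmCrossed q α h).comp g X) (Y : Cat h) [ExactPairing X Y]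
    (i : GradedVect.ι X) (hi : ∀ k, k = i) :
    (glmCrossed q α h).quantumDim hD (glmTwist q α β h) hX Y =
      glmDim Γ ε α β (GradedVect.deg X i) • 𝟙 _ := by
  classical
  have _ := Fintype.ofFinite (Label Γ)
  obtain rfl : glmDegree (GradedVect.deg X i) = g := hX i
  have hα₀ := hσω.alpha_ne_zero hqadd hα hQ
  refine quantumDim_eq (hσω.glm_isCoherent hQ) (hσω.glm_isCrossedCoherent hQ hq hqadd hα)
    (hσω.glm_isTwistCoherent hQ hq hqadd hα₀ hβ) h hD hX Y hi (fun k hk => ?_)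
    fun k hk => hσω.glm_dim_eq hqadd _ k hk
  have hd : IsDual (glmDatum σ ω δ ε) (glmG σ ω δ ε) (glmDual δ) (glmEvScalar ω ε) :=
    hσω.glm_isDual
  rw [glm_one_mem_glmDual hk]
  exact hd.mem' _

/-- Objects `ℂ_a` have dimension `1` and impose nothing. For `X` the dimension is `±|2Γ|^{1/2}` with
sign `αβε`, and this sign is `1` exactly when `αβ = ε`. -/
theorem IsSpecialCocycle.glm_hasPositiveDims_iff (hσω : IsSpecialCocycle Q σ ω)
    (hQ : IsDiscriminantForm Q) (hq : ∀ a, q a ^ 2 = Q a)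
    (hqadd : ∀ a b, q (a + b) * (q a)⁻¹ * (q b)⁻¹ = σ a b * ω (a + b) a b * ω δ a b)
    (hα : α ^ 2 = ((ε : ℤ) : ℂ) * partialGaussSum q δ) (hβ : β = α⁻¹ ∨ β = -α⁻¹)
    (h : (glmDatum σ ω δ ε).IsTensor) (hD : (glmCrossed q α h).IsBraidedCrossed) :
    (glmCrossed q α h).HasPositiveDims hD (glmTwist q α β h) ↔ α * β = ((ε : ℤ) : ℂ) := by
  have hα₀ := hσω.alpha_ne_zero hqadd hα hQ
  have hpos : 0 < Real.sqrt (Nat.card (twoMul Γ)) := Real.sqrt_pos.2 (Nat.cast_pos.2 Nat.card_pos)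
  have hdim {g : C₂} {X : Cat h} (hX) (Y) [ExactPairing X Y] :=
    hσω.glm_quantumDim hQ hq hqadd hα hβ h hD (g := g) (X := X) hX Y
  constructor
  · intro H
    obtain ⟨P, -⟩ := hσω.glm_exists_exactPairing hQ h (.inr 0)
    have hX : (glmCrossed q α h).comp (Multiplicative.ofAdd 1) (simple h (.inr 0)) := fun _ => rfl
    obtain ⟨d, hd, e⟩ := H hX (simple h (glmDual δ (.inr 0)))
      (GradedVect.simple_single (Sum.inr 0 : Label Γ))
    have e₁ : α * β * ((ε : ℤ) : ℂ) * (Real.sqrt (Nat.card (twoMul Γ)) : ℂ) = (d : ℂ) :=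
      smul_id_unit_injective h ((hdim hX _ PUnit.unit fun _ => rfl).symm.trans e)
    -- Only positivity of the square root is used, and hiding it keeps the sign cases from rewriting
    -- it.
    generalize Real.sqrt (Nat.card (twoMul Γ)) = s at hpos e₁
    have h₁ : α * β = 1 ∨ α * β = -1 := by
      rcases hβ with rfl | rfl
      · exact .inl (mul_inv_cancel₀ hα₀)
      · exact .inr (by rw [mul_neg, mul_inv_cancel₀ hα₀])
    rcases h₁ with h₁ | h₁ <;> rcases Int.units_eq_one_or ε with rfl | rfl <;> rw [h₁] at e₁ ⊢ <;>
      norm_num at e₁ ⊢ <;> norm_cast at e₁ <;> linarith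
  · intro H g X hX Y _ hS
    obtain ⟨i, hi⟩ := @GradedVect.exists_basis_of_simple (Label Γ) X hS
    have e := hdim hX Y i hi
    rcases hs : GradedVect.deg X i with a | x
    · rw [hs] at e
      exact ⟨1, one_pos, e.trans (by rw [glmDim, Complex.ofReal_one])⟩
    · rw [hs] at e
      refine ⟨Real.sqrt (Nat.card (twoMul Γ)), hpos, e.trans ?_⟩
      rw [glmDim, H, coe_sign_mul_self, one_mul]
      rfl

end GLM
theorem mainTheorem1 {Γ : Type u} [AddCommGroup Γ] [Finite Γ]
    (Q : Γ → ℂˣ) (hQ : IsDiscriminantForm Q)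
    (σ : Γ → Γ → ℂˣ) (ω : Γ → Γ → Γ → ℂˣ) (hσω : IsSpecialCocycle Q σ ω)
    (δ : Γ) (hδ : (2 : ℤ) • δ = 0)
    (q : Γ → ℂˣ) (hq : ∀ a, q a ^ 2 = Q a)
    (hqadd : ∀ a b, q (a + b) * (q a)⁻¹ * (q b)⁻¹ = σ a b * ω (a + b) a b * ω δ a b)
    (ε : ℤˣ) (α β : ℂ) (hα : α ^ 2 = ((ε : ℤ) : ℂ) * partialGaussSum q δ)
    (hβ : β = α⁻¹ ∨ β = -α⁻¹) :
    ∃ (h₀ : (pointedDatum ω).IsTensor) (h : (glmDatum σ ω δ ε).IsTensor)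
      (_ : BraidedCategory (FusionDatum.Cat h₀))
      (hD : (glmCrossed q α h).IsBraidedCrossed),
      -- `Vect_Γ` carries the braiding `σ`, and the group of order two acts on it
      (∀ X Y : FusionDatum.Cat h₀,
        (β_ X Y).hom = FusionDatum.braidHom h₀ (fun a b _ => (σ a b : ℂ)) X Y) ∧
      (pointedAction h₀).IsAction ∧ (pointedAction h₀).IsBraidedAction ∧
      -- `Vect_Γ ⊕ Vect_{Γ/2Γ}` is a braided crossed ribbon fusion category
      IsFusion (FusionDatum.Cat h) ∧
      (glmCrossed q α h).IsRibbon hD (glmTwist q α β h) ∧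
      -- the duals
      (∀ a : Γ, ∃ P : ExactPairing (FusionDatum.simple h (.inl a)) (FusionDatum.simple h (.inl (-a))),
        P.coevaluation' = glmCoev h (.inl a) (.inl (-a))) ∧
      (∀ x : Γ ⧸ twoMul Γ,
        ∃ P : ExactPairing (FusionDatum.simple h (.inr x)) (FusionDatum.simple h (.inr (-x - δ))),
          P.coevaluation' = glmCoev h (.inr x) (.inr (-x - δ)) ∧
          P.evaluation' = glmEv h (((ε : ℤ) : ℂ) * sqrtCard Γ) (.inr (-x - δ)) (.inr x)) ∧
      -- it extends `Vect_Γ` with its braiding and action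
      (glmCrossed q α h).IsExtension (pointedAction h₀) (glmIncl h h₀) ∧
      -- positivity of the quantum dimensions
      ((glmCrossed q α h).HasPositiveDims hD (glmTwist q α β h) ↔ α * β = ((ε : ℤ) : ℂ)) := by
  classical
  have _ := Fintype.ofFinite Γ
  have _ := Fintype.ofFinite (Label Γ)
  have hC₀ := hσω.pointed_isCoherent
  have hB₀ := hσω.pointed_isBraidCoherent
  have hA₀ := hσω.pointed_isActionCoherent
  have h₀ := hC₀.isTensor
  have hC : (glmDatum σ ω δ ε).IsCoherent (glmG σ ω δ ε) := hσω.glm_isCoherent hQ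
  have hR := hσω.glm_isCrossedCoherent (ε := ε) hQ hq hqadd hα
  have hα₀ := hσω.alpha_ne_zero hqadd hα hQ
  have hθ := hσω.glm_isTwistCoherent (ε := ε) hQ hq hqadd hα₀ hβ
  have hd := hσω.glm_isDual (δ := δ) (ε := ε)
  have h := hC.isTensor
  have hD : (glmCrossed q α h).IsBraidedCrossed := hR.isBraidedCrossed hC h
  let _ := hB₀.braidedCategory hC₀ h₀
  have hβ₀ : ∀ X Y : FusionDatum.Cat h₀,
      (β_ X Y).hom = FusionDatum.braidHom h₀ (fun a b _ => (σ a b : ℂ)) X Y := fun _ _ => rfl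
  refine ⟨h₀, h, inferInstance, hD, hβ₀, hA₀.isAction hC₀ h₀,
    FusionDatum.isBraidedAction hB₀ hA₀ hσω.pointed_tau_braid h₀ hβ₀, hd.isFusion hC h,
    hθ.isRibbon hR h hD, fun a => ?_, fun x => hσω.glm_exists_exactPairing hQ h (.inr x),
    IsSpecialCocycle.glm_isNeutralEmbedding.isExtension hC₀ hC hA₀ hR h₀ h hβ₀,
    hσω.glm_hasPositiveDims_iff hQ hq hqadd hα hβ h hD⟩
  obtain ⟨P, hP, -⟩ := hσω.glm_exists_exactPairing hQ h (.inl a)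
  exact ⟨P, hP⟩
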